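/- \textbf{Setting.} Let $U\subset\mathbb{R}^3$ be an open coordinate patch of the spatial manifold, $\kappa\in\mathbb{R}\setminus\{0\}$, and $\lambda\in\mathbb{C}\setminus\{0\}$ (in particular $\lambda=1$ or $\lambda=i$). The phase space of selfdual gravity consists of pairs of smooth complex fields $(A^i_a,\tilde E^a_i)$ on $U$ with $\det\tilde E\neq 0$, with internal indices moved by $\delta_{ij}$ and with holomorphic Poisson bracket $$\{F,G\}_\lambda=\frac{i\kappa}{2\lambda}\int_U\Big(\frac{\delta F}{\delta A^i_a}\frac{\delta G}{\delta\tilde E^a_i}-\frac{\delta F}{\delta\tilde E^a_i}\frac{\delta G}{\delta A^i_a}\Big)d^3x .$$ Let $s_E=\det\tilde E/\sqrt{(\det\tilde E)^2}$ and $s_e=\det e/\sqrt{(\det e)^2}$ (for a complex tetrad $e^I_\alpha$ along $U$) be the orientation signs for continuous branches of the square roots; they take values $\pm1$ and are held fixed under variations. The spatial metric $q_{ab}$ has determinant $q=s_E\det\tilde E$ and satisfies $q\,q^{ab}=\delta^{ij}\tilde E^a_i\tilde E^b_j$; $R$ is its Ricci scalar (positive on round spheres) and $\mathcal D_a$ its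 Levi-Civita derivative. Let $\Gamma^i_a$ be the spin connection, determined by $\partial_a\tilde E^b_j+\Gamma^b_{ac}\tilde E^c_j-\Gamma^c_{ca}\tilde E^b_j+\epsilon_{ji}{}^k\Gamma^i_a\tilde E^b_k=0$, and put $K=(A-\Gamma)/i$, so $A=\Gamma+iK$. With $F^k_{ab}=\partial_aA^k_b-\partial_bA^k_a+\epsilon_{mn}{}^kA^m_aA^n_b$ the selfdual constraints are $$G_i=\frac{2\lambda}{i\kappa}\big(\partial_a\tilde E^a_i+\epsilon_{ij}{}^kA^j_a\tilde E^a_k\big),\qquad C_a=\frac{2\lambda}{i\kappa}\tilde E^b_iF^i_{ab},\qquad C=-\frac{\lambda s_e}{\sqrt q\,\kappa\,s_E}\,\epsilon_k{}^{ij}\tilde E^a_i\tilde E^b_jF^k_{ab},$$ and the ADM constraints in the variables $(K,\tilde E)$ are $$G_i^{\rm ADM}=\frac2\kappa\epsilon_{ij}{}^kK^j_a\tilde E^a_k,\qquad C^{\rm ADM}_a=-\frac2\kappa\mathcal D_b\big(K^i_a\tilde E^b_i-\delta^b_aK^i_c\tilde E^c_i\big),$$ $$C^{\rm ADM}=\frac1{\kappa\sqrt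 q}\big(qR+(K^m_a\tilde E^a_m)(K^n_b\tilde E^b_n)-K^n_a\tilde E^b_nK^m_b\tilde E^a_m\big).$$ \textbf{Claims.} (1) At every point of the phase space $\{K^i_a(x),\tilde E^b_j(y)\}_\lambda=\frac{\kappa}{2\lambda}\,\delta^i_j\,\delta^b_a\,\delta(x,y)$, i.e. for all complex test functions $f,g\in C_c^\infty(U)$ the bracket of $\int fK^i_a$ and $\int g\tilde E^b_j$ exists and equals $\frac{\kappa}{2\lambda}\delta^i_j\delta^b_a\int_Ufg\,d^3x$. (2) If $G_i=0$ on $U$, then on $U$ $$C_a=\lambda\,C_a^{\rm ADM}(K,\tilde E),\qquad C=\lambda\,\frac{s_e}{s_E}\,C^{\rm ADM}(K,\tilde E).$$ (3) Let $I\subset\mathbb R$ be open and let $(A_t,\tilde E_t)_{t\in I}$ be a smooth solution on $U$ of Hamilton's equations of $\int(NC+N^aC_a+\Lambda^iG_i)$ for $\{\cdot,\cdot\}_\lambda$, with smooth real lapse $N_t$ without zeros, smooth real shift $N^a_t$ and smooth complex multiplier $\Lambda^i_t$, lying on the Gauss surface $G_i=0$, with signs $s_e,s_E$ that do not depend on $t$.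 (All functional derivatives are taken with respect to variations with compact support in $U$.) Suppose that the reality conditions hold: $q_{ab}$ is real and positive definite, and $\dot q_{ab}$ is real. Then there are a smooth $\mathrm{SO}(3,\mathbb C)$-valued gauge rotation $R_t(x)$ and smooth real fields $(K'_t,\tilde E'_t)$ and a smooth real multiplier $\Omega^i_t$ such that $\tilde E_t$ and $K_t$ are the rotations by $R_t$ of $\tilde E'_t$ and $K'_t$; $s_E\det\tilde E'_t>0$; $G_i^{\rm ADM}(K',\tilde E')=0$; $C_a=\lambda C_a^{\rm ADM}(K',\tilde E')$ and $C=\lambda\frac{s_e}{s_E}C^{\rm ADM}(K',\tilde E')$; and $(K'_t,\tilde E'_t)$ solves Hamilton's equations of real ADM gravity, i.e. those of $\int\big(\frac{s_e}{s_E}N\,C^{\rm ADM}+N^aC_a^{\rm ADM}+\Omega^iG_i^{\rm ADM}\big)$ for the real bracket $\{K^i_a(x),\tilde E^b_j(y)\}=\frac\kappa2\delta^i_j\delta^b_a\delta(x,y)$. (4) Conversely, let $(K_t,\tilde E_t)_{t\in I}$ be a smooth real solution of these ADM equations, with smooth real $N$, $N^a$, $\Omega^i$, with $G_i^{\rm ADM}=0$,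 $s_E\det\tilde E_t>0$, and $s_e$ the ($t$-independent) orientation sign of a complex tetrad. Then there is a smooth complex multiplier $\Lambda^i_t$ such that $(A_t,\tilde E_t)$, with $A_t=\Gamma_t+iK_t$ on $U$, satisfies $G_i=0$ and the reality conditions and solves the selfdual Hamilton equations in (3) with lapse $N$, shift $N^a$ and multiplier $\Lambda^i$. -/

import Mathlib

open MeasureTheory Set
open scoped ContDiff

noncomputable section

namespace SelfdualGravity

/-- Points of a coordinate patch of the three dimensional spatial manifold. -/
abbrev Pt : Type := Fin 3 → ℝ

/-- A field with one spatial index (written first) and one internal index (written second).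
`E x a i` stands for `Ẽ^a_i(x)`, and `A x a i`, `Γ x a i`, `K x a i` stand for `A^i_a(x)`,
`Γ^i_a(x)`, `K^i_a(x)`.  Internal indices are moved with the Euclidean metric `δ_ij`. -/
abbrev TField (𝕜 : Type) : Type := Pt → Fin 3 → Fin 3 → 𝕜

/-- The coordinate derivative `∂_a f`. -/
def pd {𝕜 : Type} [RCLike 𝕜] (a : Fin 3) (f : Pt → 𝕜) (x : Pt) : 𝕜 :=
  fderiv ℝ f x (Pi.single a 1)

/-- The Levi-Civita symbol with `eps 0 1 2 = 1`. -/
def eps (𝕜 : Type) [RCLike 𝕜] (i j k : Fin 3) : 𝕜 :=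
  (((j : ℕ) : 𝕜) - ((i : ℕ) : 𝕜)) * (((k : ℕ) : 𝕜) - ((j : ℕ) : 𝕜)) *
    (((k : ℕ) : 𝕜) - ((i : ℕ) : 𝕜)) / 2

/-- The Kronecker symbol. -/
def kron (i j : Fin 3) : ℂ := if i = j then 1 else 0

/-! ### Orientation signs -/

/-- `s` is the sign `d / √(d²)` of the nowhere vanishing function `d`, where `√(d²)` is a
continuous branch of the square root on `U`. -/
def IsOrientationSign {𝕜 : Type} [RCLike 𝕜] (U : Set Pt) (d : Pt → 𝕜) (s : Pt → ℝ) : Prop :=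
  ContinuousOn d U ∧ (∀ x ∈ U, d x ≠ 0) ∧
    ∃ r : Pt → 𝕜, ContinuousOn r U ∧
      ∀ x ∈ U, r x ^ 2 = d x ^ 2 ∧ ((s x : ℝ) : 𝕜) = d x / r x

/-- The determinant `det(Ẽ)`. -/
def detE {𝕜 : Type} [RCLike 𝕜] (E : TField 𝕜) (x : Pt) : 𝕜 := (Matrix.of (E x)).det

/-- The determinant `det(e^I_α)` of a tetrad. -/
def detTetrad (e : Pt → Fin 4 → Fin 4 → ℂ) (x : Pt) : ℂ := (Matrix.of (e x)).det

/-! ### Spatial geometry of a densitised triad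

`sE` is the orientation sign of `det(Ẽ)`. -/

section Geometry

variable {𝕜 : Type} [RCLike 𝕜] (sE : Pt → ℝ) (E : TField 𝕜)

/-- The inverse `(Ẽ⁻¹)^i_a` of the densitised triad. -/
def invE (x : Pt) (i a : Fin 3) : 𝕜 := (Matrix.of (E x))⁻¹ i a

/-- The determinant `q = √(det(Ẽ)²) = s_E det(Ẽ)` of the spatial metric. -/
def detq (x : Pt) : 𝕜 := ((sE x : ℝ) : 𝕜) * detE E x

/-- The spatial metric `q_ab = q δ_ij (Ẽ⁻¹)^i_a (Ẽ⁻¹)^j_b`. -/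
def metric (x : Pt) (a b : Fin 3) : 𝕜 :=
  detq sE E x * ∑ i, invE E x i a * invE E x i b

/-- The inverse spatial metric, `q q^{ab} = δ^{ij} Ẽ^a_i Ẽ^b_j`. -/
def invMetric (x : Pt) (a b : Fin 3) : 𝕜 :=
  (detq sE E x)⁻¹ * ∑ i, E x a i * E x b i

/-- The Christoffel symbols `Γ^c_{ab}` of the spatial metric. -/
def christoffel (x : Pt) (c a b : Fin 3) : 𝕜 :=
  1 / 2 * ∑ d, invMetric sE E x c d *
    (pd a (fun y => metric sE E y d b) x + pd b (fun y => metric sE E y d a) x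
      - pd d (fun y => metric sE E y a b) x)

/-- The Ricci tensor `R_{bd} = R^a_{bad}` of the spatial metric. -/
def ricci (x : Pt) (b d : Fin 3) : 𝕜 :=
  ∑ a, (pd a (fun y => christoffel sE E y a b d) x - pd d (fun y => christoffel sE E y a b a) x
    + ∑ c, (christoffel sE E x a a c * christoffel sE E x c b d
      - christoffel sE E x a d c * christoffel sE E x c b a))

/-- The Ricci scalar `R = q^{bd} R_{bd}` of the spatial metric (positive on round spheres). -/
def scalarCurvature (x : Pt) : 𝕜 := ∑ b, ∑ d, invMetric sE E x b d * ricci sE E x b d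

/-- The spin connection `Γ^k_a`, i.e. the solution of `𝒟_a Ẽ^b_j = ∂_a Ẽ^b_j + Γ^b_{ac} Ẽ^c_j
- Γ^c_{ca} Ẽ^b_j + ε_{ji}^k Γ^i_a Ẽ^b_k = 0`:
`Γ^k_a = (1/2) ε^{kj}_m (Ẽ⁻¹)^m_b (∂_a Ẽ^b_j + Γ^b_{ac} Ẽ^c_j)`. -/
def spinConnection : TField 𝕜 := fun x a k =>
  1 / 2 * ∑ j, ∑ m, eps 𝕜 k j m * ∑ b, invE E x m b *
    (pd a (fun y => E y b j) x + ∑ c, christoffel sE E x b a c * E x c j)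

/-- The Levi-Civita derivative `𝒟_c T^b_a` of a `(1,1)` tensor density `T x b a = T^b_a(x)` of
weight one. -/
def covDerivDensity (T : TField 𝕜) (x : Pt) (c b a : Fin 3) : 𝕜 :=
  pd c (fun y => T y b a) x
    + ∑ d, (christoffel sE E x b c d * T x d a - christoffel sE E x d c a * T x b d
      - christoffel sE E x d d c * T x b a)

end Geometry

/-! ### ADM gravity in the variables `(K^i_a, Ẽ^a_i)` -/

section ADM

variable {𝕜 : Type} [RCLike 𝕜] (κ : ℝ) (sE : Pt → ℝ) (K E : TField 𝕜)

/-- The tensor density `K^i_a Ẽ^b_i`. -/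
def KE (x : Pt) (b a : Fin 3) : 𝕜 := ∑ i, K x a i * E x b i

/-- The trace `K^i_c Ẽ^c_i`. -/
def trKE (x : Pt) : 𝕜 := ∑ c, KE K E x c c

/-- The ADM rotation (Gauss) constraint `(2/κ) ε_{ij}^k K^j_a Ẽ^a_k`. -/
def admGauss (x : Pt) (i : Fin 3) : 𝕜 :=
  ((2 / κ : ℝ) : 𝕜) * ∑ j, ∑ k, eps 𝕜 i j k * ∑ a, K x a j * E x a k

/-- The ADM diffeomorphism constraint `-(2/κ) 𝒟_b (K^i_a Ẽ^b_i - δ^b_a K^i_c Ẽ^c_i)`. -/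
def admDiffeo (x : Pt) (a : Fin 3) : 𝕜 :=
  -((2 / κ : ℝ) : 𝕜) * ∑ b, covDerivDensity sE E
    (fun y b' a' => KE K E y b' a' - if b' = a' then trKE K E y else 0) x b b a

/-- The ADM Hamilton constraint
`(1/(κ √q)) (q R + (K^m_a Ẽ^a_m)(K^n_b Ẽ^b_n) - K^n_a Ẽ^b_n K^m_b Ẽ^a_m)`. -/
def admHamilton (x : Pt) : 𝕜 :=
  ((κ : 𝕜) * RCLike.sqrt (detq sE E x))⁻¹ *
    (detq sE E x * scalarCurvature sE E x + trKE K E x * trKE K E x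
      - ∑ a, ∑ b, KE K E x b a * KE K E x a b)

/-- The density of the total ADM Hamiltonian with lapse `N`, shift `Nv` and multiplier `Ω` of the
Gauss constraint. -/
def admTotal (N : Pt → 𝕜) (Nv Ω : Pt → Fin 3 → 𝕜) (x : Pt) : 𝕜 :=
  N x * admHamilton κ sE K E x + ∑ a, Nv x a * admDiffeo κ sE K E x a
    + ∑ i, Ω x i * admGauss κ K E x i

end ADM

/-! ### Selfdual gravity in the variables `(A^i_a, Ẽ^a_i)` -/

section Selfdual

variable (κ : ℝ) (lam : ℂ) (se sE : Pt → ℝ) (A E : TField ℂ)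

/-- The curvature `F^k_{ab} = 2 ∂_[a A^k_b] + ε_{mn}^k A^m_a A^n_b`. -/
def curvature (x : Pt) (a b k : Fin 3) : ℂ :=
  pd a (fun y => A y b k) x - pd b (fun y => A y a k) x
    + ∑ m, ∑ n, eps ℂ m n k * A x a m * A x b n

/-- The complex extrinsic curvature `K = (A - Γ)/i`, so that `A = Γ + iK`. -/
def extrinsicK : TField ℂ := fun x a i => (A x a i - spinConnection sE E x a i) / Complex.I

/-- The Gauss constraint `G_i = (2λ/(iκ)) D_a Ẽ^a_i`, with
`D_a Ẽ^a_i = ∂_a Ẽ^a_i + ε_{ij}^k A^j_a Ẽ^a_k`. -/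
def gauss (x : Pt) (i : Fin 3) : ℂ :=
  2 * lam / (Complex.I * κ) * ∑ a, (pd a (fun y => E y a i) x
    + ∑ j, ∑ k, eps ℂ i j k * A x a j * E x a k)

/-- The diffeomorphism constraint `C_a = (2λ/(iκ)) Ẽ^b_i F^i_{ab}`. -/
def diffeo (x : Pt) (a : Fin 3) : ℂ :=
  2 * lam / (Complex.I * κ) * ∑ b, ∑ i, E x b i * curvature A x a b i

/-- The Hamilton constraint `C = -(λ s_e / (√q κ s_E)) ε_k^{ij} Ẽ^a_i Ẽ^b_j F^k_{ab}`. -/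
def hamilton (x : Pt) : ℂ :=
  -(lam * (se x : ℂ) / (RCLike.sqrt (detq sE E x) * κ * (sE x : ℂ))) *
    ∑ i, ∑ j, ∑ k, ∑ a, ∑ b, eps ℂ k i j * E x a i * E x b j * curvature A x a b k

/-- The density `N C + N^a C_a + Λ^i G_i` of the total selfdual Hamiltonian. -/
def selfdualTotal (N : Pt → ℂ) (Nv Λ : Pt → Fin 3 → ℂ) (x : Pt) : ℂ :=
  N x * hamilton κ lam se sE A E x + ∑ a, Nv x a * diffeo κ lam A E x a
    + ∑ i, Λ x i * gauss κ lam A E x i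

end Selfdual

/-! ### Functional derivatives, Poisson brackets, Hamilton's equations

For `𝕜 = ℂ` all functional derivatives are holomorphic ones. -/

section Canonical

variable {𝕜 : Type} [RCLike 𝕜]

/-- Smooth functions with compact support in `U`. -/
def IsTest (U : Set Pt) (f : Pt → 𝕜) : Prop :=
  ContDiff ℝ ∞ f ∧ HasCompactSupport f ∧ tsupport f ⊆ U

/-- Pairing `∫_U W φ` of fields. -/
def pairing (U : Set Pt) (W φ : TField 𝕜) : 𝕜 := ∫ x in U, ∑ a, ∑ i, W x a i * φ x a i

/-- `W` is the functional derivative `δF/δu` at the field `u`, with respect to variations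
that are compactly supported in `U`. -/
def HasFunctionalDeriv (U : Set Pt) (F : TField 𝕜 → 𝕜) (u W : TField 𝕜) : Prop :=
  ContinuousOn W U ∧ ∀ φ : TField 𝕜, (∀ a i, IsTest U (fun x => φ x a i)) →
    HasDerivAt (fun s : 𝕜 => F (u + s • φ)) (pairing U W φ) 0

/-- The Poisson bracket `{F, G} = c ∫_U (δF/δQ δG/δP - δF/δP δG/δQ)` exists at `(Q, P)` and has the
value `v`.  Formally, `{Q^i_a(x), P^b_j(y)} = c δ^b_a δ^i_j δ(x, y)`. -/
def HasPoissonBracket (c : 𝕜) (U : Set Pt) (F G : TField 𝕜 → TField 𝕜 → 𝕜) (Q P : TField 𝕜)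
    (v : 𝕜) : Prop :=
  ∃ FQ FP GQ GP : TField 𝕜,
    HasFunctionalDeriv U (fun Q' => F Q' P) Q FQ ∧ HasFunctionalDeriv U (fun P' => F Q P') P FP ∧
    HasFunctionalDeriv U (fun Q' => G Q' P) Q GQ ∧ HasFunctionalDeriv U (fun P' => G Q P') P GP ∧
    v = c * (pairing U FQ GP - pairing U FP GQ)

/-- The curve `(Q_t, P_t)`, `t ∈ I`, solves Hamilton's equations `∂_t Q = {Q, H} = c δH/δP`,
`∂_t P = {P, H} = -c δH/δQ` on `U`, where `H` has the density `h t Q P`.  As the lapse, shift and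
multiplier need not have compact support, the functional that is varied is the difference of `H`
and of its value at `(Q_t, P_t)`. -/
def SolvesHamiltonEqs (c : 𝕜) (U : Set Pt) (I : Set ℝ)
    (h : ℝ → TField 𝕜 → TField 𝕜 → Pt → 𝕜) (Q P : ℝ → TField 𝕜) : Prop :=
  ∀ t ∈ I, ∃ WQ WP : TField 𝕜,
    HasFunctionalDeriv U (fun Q' => ∫ x in U, (h t Q' (P t) x - h t (Q t) (P t) x)) (Q t) WQ ∧
    HasFunctionalDeriv U (fun P' => ∫ x in U, (h t (Q t) P' x - h t (Q t) (P t) x)) (P t) WP ∧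
    ∀ x ∈ U, ∀ a i,
      HasDerivAt (fun τ => Q τ x a i) (c * WP x a i) t ∧
      HasDerivAt (fun τ => P τ x a i) (-c * WQ x a i) t

/-- Joint smoothness on `I × U` of a time dependent object on the spatial patch. -/
def SmoothFamily {V : Type} [NormedAddCommGroup V] [NormedSpace ℝ V] (I : Set ℝ) (U : Set Pt)
    (f : ℝ → Pt → V) : Prop :=
  ContDiffOn ℝ ∞ (fun p : ℝ × Pt => f p.1 p.2) (I ×ˢ U)

end Canonical

/-- The reality conditions along a curve of densitised triads: the spatial metric is real
(a Riemannian metric), and so is its time derivative. -/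
def RealityConditions (U : Set Pt) (I : Set ℝ) (sE : Pt → ℝ) (E : ℝ → TField ℂ) : Prop :=
  ∀ t ∈ I, ∀ x ∈ U,
    (∃ m : Matrix (Fin 3) (Fin 3) ℝ, m.PosDef ∧ ∀ a b, metric sE (E t) x a b = (m a b : ℂ)) ∧
    ∀ a b, (deriv (fun τ => metric sE (E τ) x a b) t).im = 0

/-- The complex field `u` is the gauge rotation of the real field `v` by `R`. -/
def IsRotatedBy (u : TField ℂ) (v : TField ℝ) (R : Pt → Fin 3 → Fin 3 → ℂ) (x : Pt) : Prop :=
  ∀ a i, u x a i = ∑ j, (v x a j : ℂ) * R x j i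

/-- The complexification of a real field. -/
def complexify (v : TField ℝ) : TField ℂ := fun x a i => (v x a i : ℂ)

end SelfdualGravity

end

open SelfdualGravity

/-!
# Selfdual gravity and its real ADM form

Everything rests on one fact: the spin connection `Γ(Ẽ)` is a gradient. Its linearisation `linSpin`
is symmetric up to the divergence of an explicit current (`Triad.spin_symm`), so that it is symmetric
for the pairing of fields with variations of compact support (`pairing_linSpin`). Hence the passage
from `A = Γ + iK` to `K` is canonical up to a constant factor. The Poisson relation between `K` and
`Ẽ` (`hasPoissonBracket_extrinsicK`) is one instance; the equivalence of the equations of motion is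
another. The linearisation itself is computed from a closed formula for `Γ` in frame components
(`Triad.frame_spinConnection`), which also shows that the triad is covariantly constant
(`Triad.pd_E`).

For the constraints, `F(Γ + iK) = F(Γ) + i D K - K ∧ K`. The Ricci identity for the covariantly
constant triad (`Triad.riemann_E`) turns `F(Γ)` into the Riemann tensor. Its contraction in the
diffeomorphism constraint vanishes by the first Bianchi identity, and its contraction in the Hamilton
constraint is the scalar curvature. The terms linear in `K` are the divergence of the trace-reversed
momentum and a divergence of the Gauss vector `ε_{ij}^k K^j_a Ẽ^a_k`. So the selfdual constraints are
multiples of the ADM constraints plus terms in the Gauss vector (`Triad.gauss_eq`,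
`Triad.diffeo_eq`, `Triad.hamilton_eq`), which vanish on the Gauss surface.

These extra terms do contribute to the equations of motion, but harmlessly. To first order at the
Gauss surface, they amount to a shift of the multiplier of the Gauss constraint by `gaugeShift`, up
to a divergence (`sdLin_eq_admVar`). Functional derivatives are governed by first variations of
densities (`hasFunctionalDeriv_iff`), for which divergences are irrelevant. Together with the symmetry
of `linSpin` this identifies gradients of the selfdual Hamiltonian with gradients of the complexified
ADM Hamiltonian (`isAdmGradient_of_selfdual`, `hasFunctionalDeriv_selfdual_of_adm`).

A real ADM solution is therefore a selfdual solution, with multiplier `Ω - gaugeShift`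
(`selfdual_of_adm`); the only additional point is that a complex variation is a complex combination
of two real ones.

For a selfdual solution with real positive metric, the Cholesky factor of the Gram matrix `Ẽ Ẽᵀ` is a
smooth real triad `Ẽ'`, and `Ẽ` is obtained from it by a rotation in `SO(3, ℂ)`
(`exists_real_triad`). In the rotating frame the solution still solves the complexified ADM
equations, since the angular velocity of the frame is absorbed by the multiplier
(`adm_equations_rotate`). Now the velocity of `Ẽ'` is real, and it is an explicit function
(`admGradK`) of `K'` and of the multiplier. As the lapse has no zeros, the imaginary part of this
relation is a homogeneous system with injective matrix: `k ↦ (tr k) δ - k` is injective on the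
symmetric matrices, to which the Gauss law confines `K'`, and the multiplier enters through the
antisymmetric part (`eq_zero_of_velocity`). So `K'` and the multiplier are real, and the solution is
one of real ADM gravity (`adm_of_selfdual`).
-/


noncomputable section

namespace SelfdualGravity

/-! ### Families of fields depending smoothly on a parameter -/

section Families

variable {P V : Type*} [NormedAddCommGroup P] [NormedSpace ℝ P] [NormedAddCommGroup V]
  [NormedSpace ℝ V] {O : Set (P × Pt)}

/-- Joint smoothness of a family of fields in the parameter and the point, on a set `O` of pairs.
The parameter is a time, the (real or complex) parameter of a variation, or a dummy. -/
def JointSmooth (O : Set (P × Pt)) (f : P → Pt → V) : Prop :=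
  ContDiffOn ℝ ∞ (fun p : P × Pt => f p.1 p.2) O

theorem JointSmooth.hasFDerivAt (hO : IsOpen O) {f : P → Pt → V} (hf : JointSmooth O f)
    {s : P} {x : Pt} (h : (s, x) ∈ O) :
    HasFDerivAt (fun p : P × Pt => f p.1 p.2) (fderiv ℝ (fun p : P × Pt => f p.1 p.2) (s, x))
      (s, x) :=
  ((hf.contDiffAt (hO.mem_nhds h)).differentiableAt (by simp)).hasFDerivAt

theorem JointSmooth.hasFDerivAt_right (hO : IsOpen O) {f : P → Pt → V} (hf : JointSmooth O f)
    {s : P} {x : Pt} (h : (s, x) ∈ O) :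
    HasFDerivAt (f s) ((fderiv ℝ (fun p : P × Pt => f p.1 p.2) (s, x)).comp
      (ContinuousLinearMap.inr ℝ P Pt)) x :=
  HasFDerivAt.comp (f := fun y : Pt => (s, y)) (g := fun p : P × Pt => f p.1 p.2) x
    (hf.hasFDerivAt hO h) (hasFDerivAt_prodMk_right s x)

theorem JointSmooth.hasFDerivAt_left (hO : IsOpen O) {f : P → Pt → V} (hf : JointSmooth O f)
    {s : P} {x : Pt} (h : (s, x) ∈ O) :
    HasFDerivAt (fun r => f r x) ((fderiv ℝ (fun p : P × Pt => f p.1 p.2) (s, x)).comp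
      (ContinuousLinearMap.inl ℝ P Pt)) s :=
  HasFDerivAt.comp (f := fun r : P => (r, x)) (g := fun p : P × Pt => f p.1 p.2) s
    (hf.hasFDerivAt hO h) (hasFDerivAt_prodMk_left s x)

theorem JointSmooth.fderiv_apply (hO : IsOpen O) {f : P → Pt → V} (hf : JointSmooth O f)
    (v : P × Pt) :
    JointSmooth O (fun s x => fderiv ℝ (fun p : P × Pt => f p.1 p.2) (s, x) v) := by
  have h : ContDiffOn ℝ ∞ (fderiv ℝ (fun p : P × Pt => f p.1 p.2)) O :=
    hf.fderiv_of_isOpen hO (by simp)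
  exact h.clm_apply contDiffOn_const

theorem JointSmooth.congr {f g : P → Pt → V} (hf : JointSmooth O f)
    (h : ∀ s x, (s, x) ∈ O → g s x = f s x) : JointSmooth O g :=
  ContDiffOn.congr hf (fun p hp => h p.1 p.2 hp)

theorem JointSmooth.mono {O' : Set (P × Pt)} {f : P → Pt → V} (hf : JointSmooth O f)
    (h : O' ⊆ O) : JointSmooth O' f := ContDiffOn.mono hf h

theorem pd_eq_of_jointSmooth {𝕜 : Type} [RCLike 𝕜] (hO : IsOpen O) {f : P → Pt → 𝕜}
    (hf : JointSmooth O f) {s : P} {x : Pt} (h : (s, x) ∈ O) (a : Fin 3) :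
    pd a (f s) x = fderiv ℝ (fun p : P × Pt => f p.1 p.2) (s, x) (0, Pi.single a 1) := by
  rw [pd, (hf.hasFDerivAt_right hO h).fderiv]
  simp

theorem JointSmooth.pd {𝕜 : Type} [RCLike 𝕜] (hO : IsOpen O) {f : P → Pt → 𝕜}
    (hf : JointSmooth O f) (a : Fin 3) : JointSmooth O (fun s x => pd a (f s) x) :=
  (hf.fderiv_apply hO (0, Pi.single a 1)).congr
    (fun _ _ h => pd_eq_of_jointSmooth hO hf h a)

/-- A field on space, regarded as a family that does not depend on the parameter. -/
theorem jointSmooth_const {U : Set Pt} {f : Pt → V} (hf : ContDiffOn ℝ ∞ f U) (S : Set P) :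
    JointSmooth (S ×ˢ U) (fun _ : P => f) :=
  ContDiffOn.comp hf contDiff_snd.contDiffOn (fun _ hp => hp.2)

theorem JointSmooth.slice {f : P → Pt → V} (hf : JointSmooth O f) {U : Set Pt} {s : P}
    (h : ∀ x ∈ U, (s, x) ∈ O) : ContDiffOn ℝ ∞ (f s) U :=
  ContDiffOn.comp (f := fun y : Pt => (s, y)) (g := fun p : P × Pt => f p.1 p.2) hf
    (contDiff_const.prodMk contDiff_id).contDiffOn h

/-- The family is smooth along the space directions if each of its components is. -/
theorem jointSmooth_pi {f : P → Pt → Fin 3 → Fin 3 → V} :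
    JointSmooth O f ↔ ∀ a i, JointSmooth O (fun s x => f s x a i) := by
  constructor
  · intro h a i
    exact contDiffOn_pi.1 (contDiffOn_pi.1 h a) i
  · intro h
    exact contDiffOn_pi.2 fun a => contDiffOn_pi.2 fun i => h a i

end Families

section TimeDerivative

variable {V : Type*} [NormedAddCommGroup V] [NormedSpace ℝ V] {O : Set (ℝ × Pt)}

theorem deriv_eq_of_jointSmooth (hO : IsOpen O) {f : ℝ → Pt → V} (hf : JointSmooth O f)
    {s : ℝ} {x : Pt} (h : (s, x) ∈ O) :
    deriv (fun r => f r x) s = fderiv ℝ (fun p : ℝ × Pt => f p.1 p.2) (s, x) (1, 0) := by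
  rw [(hf.hasFDerivAt_left hO h).hasDerivAt.deriv]
  simp

theorem JointSmooth.hasDerivAt (hO : IsOpen O) {f : ℝ → Pt → V} (hf : JointSmooth O f)
    {s : ℝ} {x : Pt} (h : (s, x) ∈ O) :
    HasDerivAt (fun r => f r x) (deriv (fun r => f r x) s) s :=
  (hf.hasFDerivAt_left hO h).differentiableAt.hasDerivAt

theorem JointSmooth.deriv (hO : IsOpen O) {f : ℝ → Pt → V} (hf : JointSmooth O f) :
    JointSmooth O (fun s x => deriv (fun r => f r x) s) :=
  (hf.fderiv_apply hO (1, 0)).congr (fun _ _ h => deriv_eq_of_jointSmooth hO hf h)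

/-- Derivatives along the parameter and along space commute. -/
theorem JointSmooth.deriv_pd {𝕜 : Type} [RCLike 𝕜] (hO : IsOpen O) {f : ℝ → Pt → 𝕜}
    (hf : JointSmooth O f) {s : ℝ} {x : Pt} (h : (s, x) ∈ O) (a : Fin 3) :
    _root_.deriv (fun r => SelfdualGravity.pd a (f r) x) s
      = SelfdualGravity.pd a (fun y => _root_.deriv (fun r => f r y) s) x := by
  rw [deriv_eq_of_jointSmooth hO (hf.pd hO a) h,
    pd_eq_of_jointSmooth hO (hf.deriv hO) h]
  set F := fun p : ℝ × Pt => f p.1 p.2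
  have hF : ContDiffAt ℝ ∞ F (s, x) := hf.contDiffAt (hO.mem_nhds h)
  have hF' : DifferentiableAt ℝ (fderiv ℝ F) (s, x) :=
    (hF.fderiv_right (m := 1) (by norm_cast)).differentiableAt (by norm_num)
  have e1 : (fun p : ℝ × Pt => SelfdualGravity.pd a (f p.1) p.2)
      =ᶠ[nhds (s, x)] fun p => fderiv ℝ F p (0, Pi.single a 1) := by
    filter_upwards [hO.mem_nhds h] with p hp
    exact pd_eq_of_jointSmooth hO hf hp a
  have e2 : (fun p : ℝ × Pt => _root_.deriv (fun r => f r p.2) p.1)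
      =ᶠ[nhds (s, x)] fun p => fderiv ℝ F p (1, 0) := by
    filter_upwards [hO.mem_nhds h] with p hp
    exact deriv_eq_of_jointSmooth hO hf hp
  rw [e1.fderiv_eq, e2.fderiv_eq]
  have d : ∀ v : ℝ × Pt, fderiv ℝ (fun p => fderiv ℝ F p v) (s, x)
      = (fderiv ℝ (fderiv ℝ F) (s, x)).flip v := by
    intro v
    have := hF'.hasFDerivAt.clm_apply (hasFDerivAt_const v (s, x))
    rw [this.fderiv]
    ext <;> simp
  rw [d, d]
  have hsym : IsSymmSndFDerivAt ℝ F (s, x) :=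
    hF.isSymmSndFDerivAt (by simp; norm_cast)
  exact hsym _ _

theorem JointSmooth.hasDerivAt_pd {𝕜 : Type} [RCLike 𝕜] (hO : IsOpen O) {f : ℝ → Pt → 𝕜}
    (hf : JointSmooth O f) {s : ℝ} {x : Pt} (h : (s, x) ∈ O) (a : Fin 3) :
    HasDerivAt (fun r => SelfdualGravity.pd a (f r) x)
      (SelfdualGravity.pd a (fun y => _root_.deriv (fun r => f r y) s) x) s := by
  rw [← hf.deriv_pd hO h a]
  exact (hf.pd hO a).hasDerivAt hO h

end TimeDerivative

/-! ### Rules for coordinate derivatives -/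

section Rules

variable {𝕜 : Type} [RCLike 𝕜] {f g : Pt → 𝕜} {x : Pt} (a : Fin 3)

theorem pd_congr {U : Set Pt} (hU : IsOpen U) (h : ∀ y ∈ U, f y = g y) (hx : x ∈ U) :
    pd a f x = pd a g x := by
  have : f =ᶠ[nhds x] g := by
    filter_upwards [hU.mem_nhds hx] with y hy using h y hy
  rw [pd, pd, this.fderiv_eq]

theorem pd_add (hf : DifferentiableAt ℝ f x) (hg : DifferentiableAt ℝ g x) :
    pd a (fun y => f y + g y) x = pd a f x + pd a g x := by
  simp [pd, fderiv_fun_add hf hg]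

theorem pd_sub (hf : DifferentiableAt ℝ f x) (hg : DifferentiableAt ℝ g x) :
    pd a (fun y => f y - g y) x = pd a f x - pd a g x := by
  simp [pd, fderiv_fun_sub hf hg]

theorem pd_neg : pd a (fun y => -f y) x = -pd a f x := by
  simp [pd, fderiv_fun_neg]

theorem pd_mul (hf : DifferentiableAt ℝ f x) (hg : DifferentiableAt ℝ g x) :
    pd a (fun y => f y * g y) x = pd a f x * g x + f x * pd a g x := by
  simp [pd, fderiv_fun_mul hf hg]
  ring

theorem pd_const (c : 𝕜) : pd a (fun _ => c) x = 0 := by simp [pd]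

theorem pd_const_mul (c : 𝕜) (hf : DifferentiableAt ℝ f x) :
    pd a (fun y => c * f y) x = c * pd a f x := by
  rw [pd_mul a (by fun_prop) hf, pd_const]; ring

theorem pd_sum {ι : Type*} {s : Finset ι} {F : ι → Pt → 𝕜}
    (h : ∀ i ∈ s, DifferentiableAt ℝ (F i) x) :
    pd a (fun y => ∑ i ∈ s, F i y) x = ∑ i ∈ s, pd a (F i) x := by
  simp [pd, fderiv_fun_sum h]

theorem pd_comm {U : Set Pt} (hU : IsOpen U) (hf : ContDiffOn ℝ ∞ f U) (hx : x ∈ U)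
    (b : Fin 3) : pd a (fun y => pd b f y) x = pd b (fun y => pd a f y) x := by
  have hF : ContDiffAt ℝ ∞ f x := hf.contDiffAt (hU.mem_nhds hx)
  have hF' : DifferentiableAt ℝ (fderiv ℝ f) x :=
    (hF.fderiv_right (m := 1) (by norm_cast)).differentiableAt (by norm_num)
  have d : ∀ v : Pt, fderiv ℝ (fun p => fderiv ℝ f p v) x
      = (fderiv ℝ (fderiv ℝ f) x).flip v := by
    intro v
    have := hF'.hasFDerivAt.clm_apply (hasFDerivAt_const v x)
    rw [this.fderiv]
    ext; simp
  simp only [pd]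
  rw [d, d]
  have hsym : IsSymmSndFDerivAt ℝ f x := hF.isSymmSndFDerivAt (by simp; norm_cast)
  exact hsym _ _

theorem contDiffOn_pd {U : Set Pt} (hU : IsOpen U) (hf : ContDiffOn ℝ ∞ f U) :
    ContDiffOn ℝ ∞ (fun x => pd a f x) U := by
  have h : JointSmooth (univ ×ˢ U) (fun _ : ℝ => f) := jointSmooth_const hf univ
  exact (h.pd (isOpen_univ.prod hU) a).slice (s := 0) (fun x hx => ⟨trivial, hx⟩)

theorem pd_ofReal (f : Pt → ℝ) (x : Pt) : pd a (fun y => (f y : ℂ)) x = ((pd a f x : ℝ) : ℂ) := by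
  by_cases hf : DifferentiableAt ℝ f x
  · have := (Complex.ofRealCLM.hasFDerivAt).comp x hf.hasFDerivAt
    have e : HasFDerivAt (fun y => (f y : ℂ)) (Complex.ofRealCLM.comp (fderiv ℝ f x)) x := this
    rw [pd, e.fderiv]; simp [pd]
  · have hf' : ¬ DifferentiableAt ℝ (fun y => (f y : ℂ)) x := by
      intro h
      exact hf ((Complex.reCLM.differentiableAt).comp x h)
    rw [pd, pd, fderiv_zero_of_not_differentiableAt hf, fderiv_zero_of_not_differentiableAt hf']
    simp

end Rules

/-! ### Test functions -/

section Test

variable {𝕜 : Type} [RCLike 𝕜] {U : Set Pt} {f g : Pt → 𝕜}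

theorem IsTest.add (hf : IsTest U f) (hg : IsTest U g) : IsTest U (fun x => f x + g x) :=
  ⟨hf.1.add hg.1, hf.2.1.add hg.2.1,
    (tsupport_add f g).trans (union_subset hf.2.2 hg.2.2)⟩

theorem isTest_zero : IsTest U (fun _ => (0 : 𝕜)) :=
  ⟨contDiff_const, HasCompactSupport.zero (α := Pt) (β := 𝕜), by
    have : tsupport (fun _ : Pt => (0 : 𝕜)) = ∅ := tsupport_eq_empty_iff.2 rfl
    simp [this]⟩

theorem IsTest.sum {ι : Type*} {s : Finset ι} {F : ι → Pt → 𝕜} (h : ∀ i ∈ s, IsTest U (F i)) :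
    IsTest U (fun x => ∑ i ∈ s, F i x) := by
  classical
  induction s using Finset.induction_on with
  | empty => simpa using isTest_zero
  | insert i s hi ih =>
    simp only [Finset.sum_insert hi]
    exact (h i (by simp)).add (ih fun j hj => h j (by simp [hj]))

/-- A function that is smooth on `U` and vanishes outside a compact subset of `U` is a test
function. -/
theorem isTest_of_smoothOn (hU : IsOpen U) {Kc : Set Pt} (hK : IsCompact Kc) (hKU : Kc ⊆ U)
    (hg : ContDiffOn ℝ ∞ g U) (h : ∀ x, x ∉ Kc → g x = 0) : IsTest U g := by
  have hs : tsupport g ⊆ Kc :=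
    closure_minimal (fun x hx => by_contra fun h' => hx (h x h')) hK.isClosed
  refine ⟨?_, hK.of_isClosed_subset (isClosed_tsupport g) hs, hs.trans hKU⟩
  rw [contDiff_iff_contDiffAt]
  intro x
  by_cases hx : x ∈ Kc
  · exact hg.contDiffAt (hU.mem_nhds (hKU hx))
  · have : g =ᶠ[nhds x] fun _ => 0 := by
      filter_upwards [hK.isClosed.isOpen_compl.mem_nhds hx] with y hy using h y hy
    exact contDiffAt_const.congr_of_eventuallyEq this

theorem IsTest.of_smoothOn (hU : IsOpen U) (hf : IsTest U f) (hg : ContDiffOn ℝ ∞ g U)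
    (h : ∀ x, x ∉ tsupport f → g x = 0) : IsTest U g :=
  isTest_of_smoothOn hU hf.2.1 hf.2.2 hg h

theorem IsTest.mul_smoothOn (hU : IsOpen U) (hf : IsTest U f) (hg : ContDiffOn ℝ ∞ g U) :
    IsTest U (fun x => f x * g x) :=
  hf.of_smoothOn hU (hf.1.contDiffOn.mul hg)
    (fun x hx => by simp [image_eq_zero_of_notMem_tsupport hx])

theorem pd_eq_zero_of_notMem_tsupport {x : Pt} (h : x ∉ tsupport f) (a : Fin 3) :
    pd a f x = 0 := by
  have : f =ᶠ[nhds x] fun _ => 0 := by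
    filter_upwards [(isClosed_tsupport f).isOpen_compl.mem_nhds h] with y hy
      using image_eq_zero_of_notMem_tsupport hy
  rw [pd, this.fderiv_eq]; simp

theorem IsTest.coordDeriv (hU : IsOpen U) (hf : IsTest U f) (a : Fin 3) :
    IsTest U (fun x => pd a f x) :=
  hf.of_smoothOn hU (contDiffOn_pd a hU hf.1.contDiffOn)
    (fun _ hx => pd_eq_zero_of_notMem_tsupport hx a)

theorem IsTest.integrableOn (hf : IsTest U f) : IntegrableOn f U :=
  (hf.1.continuous.integrable_of_hasCompactSupport hf.2.1).integrableOn

theorem IsTest.integral_pd (hU : IsOpen U) (hf : IsTest U f) (a : Fin 3) :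
    ∫ x in U, pd a f x = 0 := by
  have hi : Integrable f := hf.1.continuous.integrable_of_hasCompactSupport hf.2.1
  have hi' : Integrable (fun x => pd a f x) :=
    (hf.coordDeriv hU a).1.continuous.integrable_of_hasCompactSupport (hf.coordDeriv hU a).2.1
  rw [setIntegral_eq_integral_of_forall_compl_eq_zero
    (fun x hx => pd_eq_zero_of_notMem_tsupport (fun h => hx (hf.2.2 h)) a)]
  have := integral_mul_fderiv_eq_neg_fderiv_mul_of_integrable (μ := (volume : Measure Pt))
    (f := fun _ : Pt => (1 : 𝕜)) (g := f) (v := Pi.single a 1)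
    (by simp) (by simpa [pd] using hi') (by simpa using hi)
    (by fun_prop) (fun x _ => hf.1.differentiable (by simp) x)
  simpa [pd] using this

theorem IsTest.integral_div (hU : IsOpen U) {w : Pt → Fin 3 → 𝕜}
    (hw : ∀ a, IsTest U (fun x => w x a)) :
    ∫ x in U, ∑ a, pd a (fun y => w y a) x = 0 := by
  rw [integral_finsetSum _ (fun a _ => ((hw a).coordDeriv hU a).integrableOn)]
  exact Finset.sum_eq_zero fun a _ => (hw a).integral_pd hU a

/-- A variation: a field whose components are test functions. -/
def TestField (U : Set Pt) (φ : TField 𝕜) : Prop := ∀ a i, IsTest U (fun x => φ x a i)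

/-- The union of the supports of the components of a field. -/
def fieldSupport (φ : TField 𝕜) : Set Pt := ⋃ a, ⋃ i, tsupport (fun x => φ x a i)

theorem TestField.isCompact {φ : TField 𝕜} (h : TestField U φ) : IsCompact (fieldSupport φ) :=
  isCompact_iUnion fun a => isCompact_iUnion fun i => (h a i).2.1

theorem TestField.subset {φ : TField 𝕜} (h : TestField U φ) : fieldSupport φ ⊆ U :=
  iUnion_subset fun a => iUnion_subset fun i => (h a i).2.2

theorem notMem_fieldSupport {φ : TField 𝕜} {x : Pt} :
    x ∉ fieldSupport φ ↔ ∀ a i, x ∉ tsupport (fun x => φ x a i) := by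
  simp [fieldSupport]

theorem eq_zero_of_notMem_fieldSupport {φ : TField 𝕜} {x : Pt} (h : x ∉ fieldSupport φ)
    (a i : Fin 3) : φ x a i = 0 :=
  image_eq_zero_of_notMem_tsupport (f := fun x => φ x a i) (notMem_fieldSupport.1 h a i)

theorem TestField.smul {φ : TField 𝕜} (h : TestField U φ) (c : 𝕜) : TestField U (c • φ) := by
  intro a i
  have e : (fun x => (c • φ) x a i) = fun x => c * φ x a i := rfl
  rw [e]
  refine ⟨contDiff_const.mul (h a i).1, (h a i).2.1.mul_left, ?_⟩
  exact (closure_mono (Function.support_mul_subset_right _ _)).trans (h a i).2.2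

end Test

/-! ### Pairings -/

section Pairing

variable {𝕜 : Type} [RCLike 𝕜] {U : Set Pt}

theorem IsTest.integrableOn_mul (hU : IsOpen U) {f W : Pt → 𝕜} (hf : IsTest U f)
    (hW : ContinuousOn W U) : IntegrableOn (fun x => W x * f x) U := by
  have h : IntegrableOn (fun x => W x * f x) (tsupport f) :=
    ((hW.mono hf.2.2).mul hf.1.continuous.continuousOn).integrableOn_compact hf.2.1
  exact h.of_forall_sdiff_eq_zero hU.measurableSet
    (fun x hx => by simp [image_eq_zero_of_notMem_tsupport hx.2])

theorem continuousOn_component {W : TField 𝕜} (hW : ContinuousOn W U) (a i : Fin 3) :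
    ContinuousOn (fun x => W x a i) U :=
  continuousOn_pi.1 (continuousOn_pi.1 hW a) i

theorem integrableOn_pairing (hU : IsOpen U) {W φ : TField 𝕜} (hW : ContinuousOn W U)
    (hφ : TestField U φ) : IntegrableOn (fun x => ∑ a, ∑ i, W x a i * φ x a i) U :=
  integrable_finsetSum _ fun a _ => integrable_finsetSum _ fun i _ =>
    (hφ a i).integrableOn_mul hU (continuousOn_component hW a i)

theorem pairing_smul_right (W φ : TField 𝕜) (c : 𝕜) :
    pairing U W (c • φ) = c * pairing U W φ := by
  rw [pairing, pairing, ← integral_const_mul]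
  congr 1; ext x
  simp only [Finset.mul_sum, Pi.smul_apply, smul_eq_mul]
  refine Finset.sum_congr rfl fun a _ => Finset.sum_congr rfl fun i _ => by ring

/-- The fundamental lemma of the calculus of variations. -/
theorem eq_of_pairing_eq (hU : IsOpen U) {W W' : TField ℂ} (hW : ContinuousOn W U)
    (hW' : ContinuousOn W' U)
    (h : ∀ φ, TestField U φ → pairing U W φ = pairing U W' φ) :
    ∀ x ∈ U, ∀ a i, W x a i = W' x a i := by
  intro x hx a i
  have hc := continuousOn_component hW a i
  have hc' := continuousOn_component hW' a i
  have key : ∀ᵐ y ∂volume, y ∈ U → (W y a i - W' y a i) = 0 := by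
    refine hU.ae_eq_zero_of_integral_contDiff_smul_eq_zero
      ((hc.sub hc').locallyIntegrableOn hU.measurableSet) ?_
    intro g hg hgc hgs
    have ht : IsTest U (fun y => (g y : ℂ)) := by
      refine ⟨Complex.ofRealCLM.contDiff.comp hg, hgc.comp_left (g := fun r : ℝ => (r : ℂ)) (by simp),
        (closure_mono ?_).trans hgs⟩
      intro y hy; simpa using hy
    set φ : TField ℂ := fun y b j => if b = a ∧ j = i then (g y : ℂ) else 0
    have hφ : TestField U φ := by
      intro b j
      by_cases hb : b = a ∧ j = i
      · simpa only [φ, hb, and_self, if_true] using ht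
      · simpa only [φ, hb, if_false] using isTest_zero
    have e : ∀ Z : TField ℂ, pairing U Z φ = ∫ y in U, Z y a i * g y := by
      intro Z
      rw [pairing]; congr 1; ext y
      rw [Finset.sum_eq_single a, Finset.sum_eq_single i]
      · simp [φ]
      · intro j _ hj; simp [φ, hj]
      · simp
      · intro b _ hb; simp [φ, hb]
      · simp
    have := h φ hφ
    rw [e, e, ← sub_eq_zero, ← integral_sub (ht.integrableOn_mul hU hc)
      (ht.integrableOn_mul hU hc')] at this
    rw [← setIntegral_eq_integral_of_forall_compl_eq_zero (s := U), ← this]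
    · congr 1; ext y; simp; ring
    · intro y hy
      have : g y = 0 := image_eq_zero_of_notMem_tsupport (fun h' => hy (hgs h'))
      simp [this]
  have : EqOn (fun y => W y a i) (fun y => W' y a i) U := by
    refine Measure.eqOn_open_of_ae_eq (μ := volume) ?_ hU hc hc'
    rw [Filter.EventuallyEq, ae_restrict_iff' hU.measurableSet]
    filter_upwards [key] with y hy hyU using sub_eq_zero.1 (hy hyU)
  exact this hx

end Pairing

/-! ### First variations and functional derivatives -/

section FirstVariation

/-- Differentiation under the integral sign for a jointly smooth family of functions supported in
a fixed compact subset of `U`. -/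
theorem exists_hasFDerivAt_integral {P V : Type*} [NormedAddCommGroup P] [NormedSpace ℝ P]
    [NormedAddCommGroup V] [NormedSpace ℝ V] {U Kc : Set Pt} (hU : IsOpen U)
    (hK : IsCompact Kc) (hKU : Kc ⊆ U) {O : Set (P × Pt)} (hO : IsOpen O)
    (hO0 : ∀ x ∈ U, ((0 : P), x) ∈ O) {f : P → Pt → V} (hf : JointSmooth O f)
    (hz : ∀ s, ∀ x ∈ U, x ∉ Kc → f s x = 0) :
    ∃ L : P →L[ℝ] V, HasFDerivAt (fun s => ∫ x in U, f s x) L 0 ∧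
      ∀ σ, IntegrableOn (fun x => deriv (fun r : ℝ => f (r • σ) x) 0) U ∧
        L σ = ∫ x in U, deriv (fun r : ℝ => f (r • σ) x) 0 := by
  have hO0' : ∀ x ∈ Kc, ((0 : P), x) ∈ O := fun x hx => hO0 x (hKU hx)
  set D : P × Pt → (P × Pt →L[ℝ] V) := fderiv ℝ (fun p : P × Pt => f p.1 p.2)
  have hD : ContinuousOn D O := (hf.fderiv_of_isOpen hO (m := 0) (by simp)).continuousOn
  set F' : P → Pt → (P →L[ℝ] V) := fun s x => (D (s, x)).comp (ContinuousLinearMap.inl ℝ P Pt)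
  have hF'c : ContinuousOn (F' 0) Kc := by
    have : ContinuousOn (fun x => D ((0 : P), x)) Kc :=
      hD.comp (by fun_prop) hO0'
    exact this.clm_comp continuousOn_const
  obtain ⟨C, hC⟩ : ∃ C, ∀ x ∈ Kc, ‖D ((0 : P), x)‖ ≤ C := by
    have : ContinuousOn (fun x => D ((0 : P), x)) Kc := hD.comp (by fun_prop) hO0'
    exact hK.exists_bound_of_continuousOn this
  set O' : Set (P × Pt) := O ∩ {p | ‖D p‖ < C + 1}
  have hO' : IsOpen O' := by
    have : IsOpen (O ∩ D ⁻¹' {T | ‖T‖ < C + 1}) :=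
      hD.isOpen_inter_preimage hO (isOpen_lt continuous_norm continuous_const)
    exact this
  obtain ⟨S, T, hS, hT, hS0, hKT, hST⟩ := generalized_tube_lemma (s := {(0 : P)})
    isCompact_singleton hK hO' (by
      rintro ⟨s, x⟩ ⟨hs, hx⟩
      obtain rfl : s = 0 := hs
      exact ⟨hO0' x hx, (hC x hx).trans_lt (lt_add_one C)⟩)
  have hS' : S ∈ nhds (0 : P) := hS.mem_nhds (hS0 rfl)
  have hsub : ∀ s ∈ S, ∀ x ∈ Kc, (s, x) ∈ O' := fun s hs x hx => hST ⟨hs, hKT hx⟩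
  obtain ⟨ε, hε, hεS⟩ := Metric.mem_nhds_iff.1 hS'
  have hcont : ∀ s ∈ S, ContinuousOn (f s) Kc := fun s hs =>
    ContinuousOn.comp (f := fun y : Pt => (s, y)) (g := fun p : P × Pt => f p.1 p.2)
      hf.continuousOn (by fun_prop) fun x hx => (hsub s hs x hx).1
  have hUK : ∀ s, ∫ x in U, f s x = ∫ x in Kc, f s x := fun s =>
    setIntegral_eq_of_subset_of_forall_sdiff_eq_zero hU.measurableSet hKU
      (fun x hx => hz s x hx.1 hx.2)
  have hmain : HasFDerivAt (fun s => ∫ x in Kc, f s x) (∫ x in Kc, F' 0 x) 0 := by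
    refine hasFDerivAt_integral_of_dominated_of_fderiv_le (𝕜 := ℝ) (F := f) (F' := F')
      (bound := fun _ => C + 1) (Metric.ball_mem_nhds 0 hε) ?_ ?_ ?_ ?_ ?_ ?_
    · filter_upwards [hS'] with s hs
      exact (hcont s hs).aestronglyMeasurable_of_isCompact hK hK.measurableSet
    · exact (hcont 0 (hS0 rfl)).integrableOn_compact hK
    · exact hF'c.aestronglyMeasurable_of_isCompact hK hK.measurableSet
    · refine (ae_restrict_iff' hK.measurableSet).2 (Filter.Eventually.of_forall fun x hx s hs => ?_)
      have h1 := (hsub s (hεS hs) x hx).2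
      have h2 : ‖ContinuousLinearMap.inl ℝ P Pt‖ ≤ 1 := by
        refine ContinuousLinearMap.opNorm_le_bound _ zero_le_one fun v => ?_
        simp [Prod.norm_def]
      calc ‖F' s x‖ ≤ ‖D (s, x)‖ * ‖ContinuousLinearMap.inl ℝ P Pt‖ :=
            ContinuousLinearMap.opNorm_comp_le _ _
        _ ≤ ‖D (s, x)‖ * 1 := by gcongr
        _ ≤ C + 1 := by rw [mul_one]; exact le_of_lt h1
    · exact continuousOn_const.integrableOn_compact hK
    · refine (ae_restrict_iff' hK.measurableSet).2 (Filter.Eventually.of_forall fun x hx s hs => ?_)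
      exact hf.hasFDerivAt_left hO (hsub s (hεS hs) x hx).1
  have hFint : IntegrableOn (F' 0) Kc := hF'c.integrableOn_compact hK
  have hder : ∀ σ, ∀ x ∈ Kc, deriv (fun r : ℝ => f (r • σ) x) 0 = F' 0 x σ := by
    intro σ x hx
    have h1 : HasDerivAt (fun r : ℝ => r • σ) σ 0 := by
      simpa using (hasDerivAt_id (0 : ℝ)).smul_const σ
    have h2 := hf.hasFDerivAt_left hO (hO0' x hx)
    have h3 : HasFDerivAt (fun r => f r x) (F' 0 x) ((0 : ℝ) • σ) := by simpa using h2
    exact (h3.comp_hasDerivAt (0 : ℝ) h1).deriv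
  have hder0 : ∀ σ, ∀ x ∈ U \ Kc, deriv (fun r : ℝ => f (r • σ) x) 0 = 0 := by
    intro σ x hx
    have : (fun r : ℝ => f (r • σ) x) = fun _ => 0 := funext fun r => hz _ x hx.1 hx.2
    simp [this]
  refine ⟨∫ x in Kc, F' 0 x, ?_, fun σ => ⟨?_, ?_⟩⟩
  · simpa only [hUK] using hmain
  · have : IntegrableOn (fun x => deriv (fun r : ℝ => f (r • σ) x) 0) Kc :=
      IntegrableOn.congr_fun (hFint.apply_continuousLinearMap σ)
        (fun x hx => (hder σ x hx).symm) hK.measurableSet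
    exact this.of_forall_sdiff_eq_zero hU.measurableSet (hder0 σ)
  · rw [setIntegral_eq_of_subset_of_forall_sdiff_eq_zero hU.measurableSet hKU (hder0 σ),
      ContinuousLinearMap.integral_apply hFint]
    exact setIntegral_congr_fun hK.measurableSet fun x hx => (hder σ x hx).symm

variable {𝕜 : Type} [RCLike 𝕜] {U : Set Pt}

/-- A density `h` can be varied at the field `u`: it is a smooth function of the parameter of a
variation and of the point, near the parameter zero, and it is local. -/
structure Variable (U : Set Pt) (h : TField 𝕜 → Pt → 𝕜) (u : TField 𝕜) : Prop where
  smooth : ∀ φ, TestField U φ → ∃ O : Set (𝕜 × Pt), IsOpen O ∧ (∀ x ∈ U, ((0 : 𝕜), x) ∈ O) ∧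
    JointSmooth O (fun s x => h (u + s • φ) x)
  isLocal : ∀ φ, TestField U φ → ∀ s : 𝕜, ∀ x ∈ U, x ∉ fieldSupport φ → h (u + s • φ) x = h u x

/-- The first variation of a density along `φ`. -/
def firstVar (h : TField 𝕜 → Pt → 𝕜) (u φ : TField 𝕜) (x : Pt) : 𝕜 :=
  deriv (fun r : ℝ => h (u + (r : 𝕜) • φ) x) 0

theorem Variable.exists_hasFDerivAt (hU : IsOpen U) {h : TField 𝕜 → Pt → 𝕜} {u : TField 𝕜}
    (hh : Variable U h u) {φ : TField 𝕜} (hφ : TestField U φ) :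
    ∃ L : 𝕜 →L[ℝ] 𝕜, HasFDerivAt (fun s : 𝕜 => ∫ x in U, (h (u + s • φ) x - h u x)) L 0 ∧
      ∀ σ, IntegrableOn (firstVar h u (σ • φ)) U ∧ L σ = ∫ x in U, firstVar h u (σ • φ) x := by
  obtain ⟨O, hO, hO0, hsm⟩ := hh.smooth φ hφ
  have h0 : ContDiffOn ℝ ∞ (h u) U := by
    have := hsm.slice (s := 0) hO0
    simpa using this
  set O' : Set (𝕜 × Pt) := O ∩ (univ ×ˢ U)
  have hO' : IsOpen O' := hO.inter (isOpen_univ.prod hU)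
  have hsm' : JointSmooth O' (fun s x => h (u + s • φ) x - h u x) :=
    ContDiffOn.sub (hsm.mono inter_subset_left)
      ((jointSmooth_const h0 univ).mono inter_subset_right)
  obtain ⟨L, hL, hL'⟩ := exists_hasFDerivAt_integral hU hφ.isCompact hφ.subset hO'
    (fun x hx => ⟨hO0 x hx, trivial, hx⟩) hsm'
    (fun s x hx hxK => by rw [hh.isLocal φ hφ s x hx hxK, sub_self])
  have e : ∀ (σ : 𝕜) x, deriv (fun r : ℝ => h (u + (r • σ) • φ) x - h u x) 0
      = firstVar h u (σ • φ) x := by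
    intro σ x
    rw [deriv_sub_const, firstVar]
    simp only [smul_smul, RCLike.real_smul_eq_coe_mul]
  simp only [e] at hL'
  exact ⟨L, hL, hL'⟩

theorem Variable.integrableOn (hU : IsOpen U) {h : TField 𝕜 → Pt → 𝕜} {u : TField 𝕜}
    (hh : Variable U h u) {φ : TField 𝕜} (hφ : TestField U φ) :
    IntegrableOn (firstVar h u φ) U := by
  obtain ⟨L, -, hL⟩ := hh.exists_hasFDerivAt hU hφ
  simpa using (hL 1).1

/-- The functional derivative is determined by the first variation of the density, along real
values of the parameter. The holomorphic derivative exists because the first variation pairs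
complex linearly with the variation. -/
theorem hasFunctionalDeriv_iff (hU : IsOpen U) {h : TField 𝕜 → Pt → 𝕜} {u W : TField 𝕜}
    (hh : Variable U h u) :
    HasFunctionalDeriv U (fun u' => ∫ x in U, (h u' x - h u x)) u W ↔
      ContinuousOn W U ∧
        ∀ φ, TestField U φ → ∫ x in U, firstVar h u φ x = pairing U W φ := by
  refine and_congr_right fun hW => ⟨fun H φ hφ => ?_, fun H φ hφ => ?_⟩
  · obtain ⟨L, hL, hL'⟩ := hh.exists_hasFDerivAt hU hφ
    have h1 := (H φ hφ).hasFDerivAt.restrictScalars ℝ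
    have h2 := congrArg (fun T : 𝕜 →L[ℝ] 𝕜 => T 1) (hL.unique h1)
    have h3 := (hL' 1).2
    rw [one_smul] at h3
    rw [← h3, h2]
    simp
  · obtain ⟨L, hL, hL'⟩ := hh.exists_hasFDerivAt hU hφ
    refine hasDerivAt_iff_hasFDerivAt.2 (hasFDerivAt_of_restrictScalars ℝ hL ?_)
    ext σ
    rw [(hL' σ).2, H _ (TestField.smul hφ σ), pairing_smul_right]
    simp

/-- The functional derivative of a functional whose density is supported in a fixed compact
set. -/
theorem hasFunctionalDeriv_of_compact (hU : IsOpen U) {h : TField 𝕜 → Pt → 𝕜} {u W : TField 𝕜}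
    {Kc : Set Pt} (hK : IsCompact Kc) (hKU : Kc ⊆ U)
    (hsm : ∀ φ, TestField U φ → ∃ O : Set (𝕜 × Pt), IsOpen O ∧ (∀ x ∈ U, ((0 : 𝕜), x) ∈ O) ∧
      JointSmooth O (fun s x => h (u + s • φ) x))
    (hz : ∀ u', ∀ x ∈ U, x ∉ Kc → h u' x = 0) (hW : ContinuousOn W U)
    (H : ∀ φ, TestField U φ → ∫ x in U, firstVar h u φ x = pairing U W φ) :
    HasFunctionalDeriv U (fun u' => ∫ x in U, h u' x) u W := by
  refine ⟨hW, fun φ hφ => ?_⟩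
  obtain ⟨O, hO, hO0, hs⟩ := hsm φ hφ
  obtain ⟨L, hL, hL'⟩ := exists_hasFDerivAt_integral hU hK hKU hO hO0 hs
    (fun s x hx hxK => hz _ x hx hxK)
  refine hasDerivAt_iff_hasFDerivAt.2 (hasFDerivAt_of_restrictScalars ℝ hL ?_)
  ext σ
  have e : ∀ x, deriv (fun r : ℝ => h (u + (r • σ) • φ) x) 0 = firstVar h u (σ • φ) x := by
    intro x
    rw [firstVar]
    simp only [smul_smul, RCLike.real_smul_eq_coe_mul]
  have h2 := (hL' σ).2
  simp only [e] at h2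
  rw [h2, H _ (TestField.smul hφ σ), pairing_smul_right]
  simp

end FirstVariation

/-! ### Smoothness of the geometry of a family of triads -/

section SmoothAlgebra

variable {P : Type*} [NormedAddCommGroup P] [NormedSpace ℝ P] {O : Set (P × Pt)}
  {f g : P → Pt → ℂ}

theorem JointSmooth.add (hf : JointSmooth O f) (hg : JointSmooth O g) :
    JointSmooth O (fun s x => f s x + g s x) := ContDiffOn.add hf hg

theorem JointSmooth.sub (hf : JointSmooth O f) (hg : JointSmooth O g) :
    JointSmooth O (fun s x => f s x - g s x) := ContDiffOn.sub hf hg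

theorem JointSmooth.neg (hf : JointSmooth O f) :
    JointSmooth O (fun s x => -f s x) := ContDiffOn.neg hf

theorem JointSmooth.mul (hf : JointSmooth O f) (hg : JointSmooth O g) :
    JointSmooth O (fun s x => f s x * g s x) := ContDiffOn.mul hf hg

theorem jointSmooth_of_const (c : ℂ) : JointSmooth O (fun _ _ => c) := contDiffOn_const

theorem JointSmooth.sum {ι : Type*} {s : Finset ι} {F : ι → P → Pt → ℂ}
    (h : ∀ i, JointSmooth O (F i)) : JointSmooth O (fun r x => ∑ i ∈ s, F i r x) :=
  ContDiffOn.sum fun i _ => h i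

theorem JointSmooth.inv (hf : JointSmooth O f) (h : ∀ s x, (s, x) ∈ O → f s x ≠ 0) :
    JointSmooth O (fun s x => (f s x)⁻¹) := ContDiffOn.inv hf (fun p hp => h p.1 p.2 hp)

theorem JointSmooth.const_mul (c : ℂ) (hf : JointSmooth O f) :
    JointSmooth O (fun s x => c * f s x) := (jointSmooth_of_const c).mul hf

/-- A smooth family of nondegenerate densitised triads, together with a locally constant sign. -/
structure TriadFamily (O : Set (P × Pt)) (sE : Pt → ℝ) (E : P → TField ℂ) : Prop where
  isOpen : IsOpen O
  smooth : ∀ a i, JointSmooth O (fun s x => E s x a i)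
  det_ne : ∀ s x, (s, x) ∈ O → detE (E s) x ≠ 0
  sign : ∀ s x, (s, x) ∈ O → (sE x = 1 ∨ sE x = -1) ∧ ∀ᶠ y in nhds x, sE y = sE x

theorem detE_eq (E : TField ℂ) (x : Pt) : detE E x =
    E x 0 0 * E x 1 1 * E x 2 2 - E x 0 0 * E x 1 2 * E x 2 1
      - E x 0 1 * E x 1 0 * E x 2 2 + E x 0 1 * E x 1 2 * E x 2 0
      + E x 0 2 * E x 1 0 * E x 2 1 - E x 0 2 * E x 1 1 * E x 2 0 := by
  simp [detE, Matrix.det_fin_three]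

theorem invE_eq (E : TField ℂ) (x : Pt) (i a : Fin 3) :
    invE E x i a = (detE E x)⁻¹ * (Matrix.of (E x)).adjugate i a := by
  simp [invE, detE, Matrix.inv_def]

variable {sE : Pt → ℝ} {E : P → TField ℂ} (h : TriadFamily O sE E)
include h

theorem TriadFamily.detE : JointSmooth O (fun s x => detE (E s) x) := by
  have := h.smooth
  simp only [detE_eq]
  have h3 : ∀ a b c i j k : Fin 3, JointSmooth O (fun s x => E s x a i * E s x b j * E s x c k) :=
    fun a b c i j k => ((this a i).mul (this b j)).mul (this c k)
  exact (((((h3 _ _ _ _ _ _).sub (h3 _ _ _ _ _ _)).sub (h3 _ _ _ _ _ _)).add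
    (h3 _ _ _ _ _ _)).add (h3 _ _ _ _ _ _)).sub (h3 _ _ _ _ _ _)

theorem TriadFamily.invE (i a : Fin 3) : JointSmooth O (fun s x => invE (E s) x i a) := by
  have := h.smooth
  have h2 : ∀ a b i j : Fin 3, JointSmooth O (fun s x => E s x a i * E s x b j) :=
    fun a b i j => (this a i).mul (this b j)
  simp only [invE_eq]
  refine (h.detE.inv h.det_ne).mul ?_
  have h3 : ∀ a b c d i j k l : Fin 3,
      JointSmooth O (fun s x => E s x a i * E s x b j - E s x c k * E s x d l) :=
    fun a b c d i j k l => (h2 a b i j).sub (h2 c d k l)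
  have h4 : ∀ a b c d i j k l : Fin 3,
      JointSmooth O (fun s x => -(E s x a i * E s x b j) + E s x c k * E s x d l) :=
    fun a b c d i j k l => (h2 a b i j).neg.add (h2 c d k l)
  fin_cases i <;> fin_cases a <;>
    simp [Matrix.adjugate_fin_three] <;> first | apply h3 | apply h4

theorem TriadFamily.smooth_sign : JointSmooth O (fun _ x => ((sE x : ℝ) : ℂ)) := by
  intro p hp
  refine ContDiffAt.contDiffWithinAt ?_
  have e : (fun q : P × Pt => ((sE q.2 : ℝ) : ℂ)) =ᶠ[nhds p] fun _ => ((sE p.2 : ℝ) : ℂ) := by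
    filter_upwards [continuous_snd.continuousAt.eventually (h.sign p.1 p.2 hp).2] with q hq
    rw [hq]
  exact contDiffAt_const.congr_of_eventuallyEq e

theorem TriadFamily.sign_ne {s : P} {x : Pt} (hx : (s, x) ∈ O) : sE x ≠ 0 := by
  rcases (h.sign s x hx).1 with h | h <;> simp [h]

theorem TriadFamily.detq : JointSmooth O (fun s x => detq sE (E s) x) :=
  h.smooth_sign.mul h.detE

theorem TriadFamily.detq_ne {s : P} {x : Pt} (hx : (s, x) ∈ O) :
    SelfdualGravity.detq sE (E s) x ≠ 0 :=
  mul_ne_zero (by simpa using h.sign_ne hx) (h.det_ne s x hx)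

theorem TriadFamily.metric (a b : Fin 3) : JointSmooth O (fun s x => metric sE (E s) x a b) :=
  h.detq.mul (JointSmooth.sum fun _ => (h.invE _ _).mul (h.invE _ _))

theorem TriadFamily.invMetric (a b : Fin 3) :
    JointSmooth O (fun s x => invMetric sE (E s) x a b) :=
  (h.detq.inv fun _ _ hx => h.detq_ne hx).mul
    (JointSmooth.sum fun _ => (h.smooth _ _).mul (h.smooth _ _))

theorem TriadFamily.christoffel (c a b : Fin 3) :
    JointSmooth O (fun s x => christoffel sE (E s) x c a b) :=
  JointSmooth.const_mul _ <| JointSmooth.sum fun _ => (h.invMetric _ _).mul <|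
    (((h.metric _ _).pd h.isOpen _).add ((h.metric _ _).pd h.isOpen _)).sub
      ((h.metric _ _).pd h.isOpen _)

theorem TriadFamily.ricci (b d : Fin 3) : JointSmooth O (fun s x => ricci sE (E s) x b d) :=
  JointSmooth.sum fun _ => (((h.christoffel _ _ _).pd h.isOpen _).sub
    ((h.christoffel _ _ _).pd h.isOpen _)).add <| JointSmooth.sum fun _ =>
      ((h.christoffel _ _ _).mul (h.christoffel _ _ _)).sub
        ((h.christoffel _ _ _).mul (h.christoffel _ _ _))

theorem TriadFamily.scalarCurvature :
    JointSmooth O (fun s x => scalarCurvature sE (E s) x) :=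
  JointSmooth.sum fun _ => JointSmooth.sum fun _ => (h.invMetric _ _).mul (h.ricci _ _)

theorem TriadFamily.spinConnection (a k : Fin 3) :
    JointSmooth O (fun s x => spinConnection sE (E s) x a k) :=
  JointSmooth.const_mul _ <| JointSmooth.sum fun _ => JointSmooth.sum fun _ =>
    JointSmooth.const_mul _ <| JointSmooth.sum fun _ => (h.invE _ _).mul <|
      ((h.smooth _ _).pd h.isOpen _).add <| JointSmooth.sum fun _ =>
        (h.christoffel _ _ _).mul (h.smooth _ _)

end SmoothAlgebra

/-! ### A densitised triad on an open set -/

/-- A locally constant sign on `U`. -/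
def LocSign (U : Set Pt) (s : Pt → ℝ) : Prop :=
  ∀ x ∈ U, (s x = 1 ∨ s x = -1) ∧ ∀ᶠ y in nhds x, s y = s x

theorem LocSign.contDiffOn {U : Set Pt} {s : Pt → ℝ} (h : LocSign U s) :
    ContDiffOn ℝ ∞ s U := fun x hx =>
  (contDiffAt_const.congr_of_eventuallyEq (h x hx).2).contDiffWithinAt

theorem LocSign.contDiffOn_complex {U : Set Pt} {s : Pt → ℝ} (h : LocSign U s) :
    ContDiffOn ℝ ∞ (fun x => ((s x : ℝ) : ℂ)) U :=
  Complex.ofRealCLM.contDiff.comp_contDiffOn h.contDiffOn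

theorem LocSign.ne_zero {U : Set Pt} {s : Pt → ℝ} (h : LocSign U s) {x : Pt} (hx : x ∈ U) :
    s x ≠ 0 := by
  rcases (h x hx).1 with h | h <;> simp [h]

theorem LocSign.div {U : Set Pt} {s t : Pt → ℝ} (hs : LocSign U s) (ht : LocSign U t) :
    LocSign U (fun x => s x / t x) := by
  intro x hx
  refine ⟨?_, ?_⟩
  · rcases (hs x hx).1 with h | h <;> rcases (ht x hx).1 with h' | h' <;> simp [h, h']
  · filter_upwards [(hs x hx).2, (ht x hx).2] with y h h' using by rw [h, h']

/-- An orientation sign takes the values `±1`, and is continuous, hence locally constant. -/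
theorem IsOrientationSign.locSign {𝕜 : Type} [RCLike 𝕜] {U : Set Pt} (hU : IsOpen U)
    {d : Pt → 𝕜} {s : Pt → ℝ} (h : IsOrientationSign U d s) : LocSign U s := by
  obtain ⟨hd, hd0, r, hr, hrs⟩ := h
  have hr0 : ∀ x ∈ U, r x ≠ 0 := fun x hx h0 => by
    have := (hrs x hx).1
    rw [h0] at this
    exact hd0 x hx (by simpa using this.symm)
  have hpm : ∀ x ∈ U, s x = 1 ∨ s x = -1 := fun x hx => by
    have h1 : ((s x : ℝ) : 𝕜) ^ 2 = 1 := by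
      rw [(hrs x hx).2, div_pow, (hrs x hx).1]
      exact div_self (pow_ne_zero 2 (hd0 x hx))
    have h2 : s x ^ 2 = 1 := by exact_mod_cast h1
    exact sq_eq_one_iff.1 h2
  have hc : ContinuousOn s U := by
    have h1 : ContinuousOn (fun x => RCLike.re (d x / r x)) U :=
      RCLike.continuous_re.comp_continuousOn (hd.div hr hr0)
    refine h1.congr fun x hx => ?_
    simp only [← (hrs x hx).2, RCLike.ofReal_re]
  intro x hx
  refine ⟨hpm x hx, ?_⟩
  have h1 := (hc.continuousAt (hU.mem_nhds hx)).eventually (Metric.ball_mem_nhds (s x) one_pos)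
  filter_upwards [h1, hU.mem_nhds hx] with y hy hyU
  have hy' : |s y - s x| < 1 := hy
  rcases hpm x hx with h | h <;> rcases hpm y hyU with h' | h' <;> rw [h, h'] at hy' ⊢ <;>
    norm_num at hy'

/-- A smooth nondegenerate densitised triad on an open set, together with a sign. -/
structure Triad (U : Set Pt) (sE : Pt → ℝ) (E : TField ℂ) : Prop where
  isOpen : IsOpen U
  smooth : ContDiffOn ℝ ∞ E U
  det_ne : ∀ x ∈ U, detE E x ≠ 0
  sign : LocSign U sE

namespace Triad

variable {U : Set Pt} {sE : Pt → ℝ} {E : TField ℂ} (h : Triad U sE E)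
include h

theorem comp (a i : Fin 3) : ContDiffOn ℝ ∞ (fun x => E x a i) U :=
  contDiffOn_pi.1 (contDiffOn_pi.1 h.smooth a) i

/-- The constant family. -/
theorem family : TriadFamily (univ ×ˢ U) sE (fun _ : ℝ => E) where
  isOpen := isOpen_univ.prod h.isOpen
  smooth a i := jointSmooth_const (h.comp a i) univ
  det_ne _ x hx := h.det_ne x hx.2
  sign _ x hx := h.sign x hx.2

omit h in
theorem slice_const {f : Pt → ℂ} (hf : JointSmooth (univ ×ˢ U) (fun _ : ℝ => f)) :
    ContDiffOn ℝ ∞ f U := hf.slice (s := 0) fun _ hx => ⟨trivial, hx⟩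

theorem detE : ContDiffOn ℝ ∞ (detE E) U := slice_const h.family.detE
theorem invE (i a : Fin 3) : ContDiffOn ℝ ∞ (fun x => invE E x i a) U :=
  slice_const (h.family.invE i a)
theorem detq : ContDiffOn ℝ ∞ (detq sE E) U := slice_const h.family.detq
theorem christoffel (c a b : Fin 3) : ContDiffOn ℝ ∞ (fun x => christoffel sE E x c a b) U :=
  slice_const (h.family.christoffel c a b)
theorem spinConnection (a k : Fin 3) :
    ContDiffOn ℝ ∞ (fun x => spinConnection sE E x a k) U :=
  slice_const (h.family.spinConnection a k)
theorem detq_ne {x : Pt} (hx : x ∈ U) : SelfdualGravity.detq sE E x ≠ 0 :=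
  h.family.detq_ne (s := 0) ⟨trivial, hx⟩

end Triad

/-- Each member of a family is a triad. -/
theorem TriadFamily.triad {P : Type*} [NormedAddCommGroup P] [NormedSpace ℝ P] {O : Set (P × Pt)}
    {sE : Pt → ℝ} {E : P → TField ℂ} (h : TriadFamily O sE E) (s : P) :
    Triad {x | (s, x) ∈ O} sE (E s) where
  isOpen := h.isOpen.preimage (by fun_prop)
  smooth := contDiffOn_pi.2 fun a => contDiffOn_pi.2 fun i => (h.smooth a i).slice fun _ hx => hx
  det_ne _ hx := h.det_ne s _ hx
  sign _ hx := h.sign s _ hx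

theorem differentiableAt_of_contDiffOn {U : Set Pt} (hU : IsOpen U) {f : Pt → ℂ} (hf : ContDiffOn ℝ ∞ f U)
    {x : Pt} (hx : x ∈ U) : DifferentiableAt ℝ f x :=
  (hf.contDiffAt (hU.mem_nhds hx)).differentiableAt (by simp)

/-! ### Frame components -/

theorem fin3_cases (j : Fin 3) : j = 0 ∨ j = 1 ∨ j = 2 := by omega

/-- The nonzero values of `ε_{ijk}`, and its vanishing on repeated indices. -/
theorem eps_table : (eps ℂ 0 1 2 = 1 ∧ eps ℂ 1 2 0 = 1 ∧ eps ℂ 2 0 1 = 1 ∧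
    eps ℂ 0 2 1 = -1 ∧ eps ℂ 2 1 0 = -1 ∧ eps ℂ 1 0 2 = -1) ∧
    (∀ i k, eps ℂ i i k = 0) ∧ (∀ i k, eps ℂ i k i = 0) ∧ ∀ i k, eps ℂ k i i = 0 := by
  refine ⟨⟨?_, ?_, ?_, ?_, ?_, ?_⟩, ?_, ?_, ?_⟩ <;> first | (simp [eps]; done) | (simp [eps]; norm_num)

section Algebra

variable {E : TField ℂ} {x : Pt} (h : detE E x ≠ 0)
include h

theorem sum_invE_mul_E (i j : Fin 3) : ∑ a, invE E x i a * E x a j = if i = j then 1 else 0 := by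
  have hu : IsUnit (Matrix.of (E x)).det := isUnit_iff_ne_zero.2 h
  have := congrFun (congrFun (Matrix.nonsing_inv_mul _ hu) i) j
  simpa [Matrix.mul_apply, Matrix.one_apply, invE] using this

theorem sum_E_mul_invE (a b : Fin 3) : ∑ i, E x a i * invE E x i b = if a = b then 1 else 0 := by
  have hu : IsUnit (Matrix.of (E x)).det := isUnit_iff_ne_zero.2 h
  have := congrFun (congrFun (Matrix.mul_nonsing_inv _ hu) a) b
  simpa [Matrix.mul_apply, Matrix.one_apply, invE] using this

/-- A spatial vector is determined by its frame components. -/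
theorem eq_sum_E (v : Fin 3 → ℂ) (b : Fin 3) :
    v b = ∑ m, E x b m * ∑ c, invE E x m c * v c := by
  have e : ∑ m, E x b m * ∑ c, invE E x m c * v c
      = ∑ c, (∑ m, E x b m * invE E x m c) * v c := by
    simp only [Finset.mul_sum, Finset.sum_mul]
    rw [Finset.sum_comm]
    simp only [mul_assoc]
  rw [e]
  simp [sum_E_mul_invE h]

/-- A covector is determined by its frame components. -/
theorem eq_sum_invE (v : Fin 3 → ℂ) (a : Fin 3) :
    v a = ∑ l, invE E x l a * ∑ c, E x c l * v c := by
  have e : ∑ l, invE E x l a * ∑ c, E x c l * v c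
      = ∑ c, (∑ l, E x c l * invE E x l a) * v c := by
    simp only [Finset.mul_sum, Finset.sum_mul]
    rw [Finset.sum_comm]
    refine Finset.sum_congr rfl fun c _ => Finset.sum_congr rfl fun l _ => by ring
  rw [e]
  simp [sum_E_mul_invE h]

/-- A mixed tensor vanishes if its frame components do. -/
theorem eq_zero_of_frame {T : Fin 3 → Fin 3 → ℂ}
    (hT : ∀ l m, ∑ a, ∑ b, E x a l * invE E x m b * T a b = 0) (a b : Fin 3) : T a b = 0 := by
  rw [eq_sum_E h (T a) b]
  refine Finset.sum_eq_zero fun m _ => ?_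
  have e := eq_sum_invE h (fun a => ∑ c, invE E x m c * T a c) a
  have e' : ∀ l, ∑ c, E x c l * ∑ d, invE E x m d * T c d = 0 := fun l => by
    rw [← hT l m]
    simp only [Finset.mul_sum, mul_assoc]
  simp only [e', mul_zero, Finset.sum_const_zero] at e
  rw [e, mul_zero]

end Algebra

/-- The frame components `E^a_l ω^m_b ∂_a φ^b_j` of the derivative of a field, for `ω = E⁻¹`. -/
def frameD (E φ : TField ℂ) (x : Pt) (l m j : Fin 3) : ℂ :=
  ∑ a, ∑ b, E x a l * invE E x m b * pd a (fun y => φ y b j) x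

/-- The spin connection in frame components, as a function of the frame components `C` of the
derivative of the triad. -/
def frameSpin (C : Fin 3 → Fin 3 → Fin 3 → ℂ) (l k : Fin 3) : ℂ :=
  1 / 2 * ∑ j, ∑ m, eps ℂ k j m * (C l m j + C m j l + C m l j)
    + 1 / 2 * ∑ j, ∑ n, eps ℂ k j l * C j n n


/-- The covariant constancy of the triad in frame components. -/
theorem frame_compat (C : Fin 3 → Fin 3 → Fin 3 → ℂ) (l m j : Fin 3) :
    C l m j + 1 / 2 * ((if m = j then ∑ k, C l k k else 0)
        + (if m = l then ∑ k, C j k k else 0) - (if l = j then ∑ k, C m k k else 0)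
        - C l j m - C l m j - C j l m - C j m l + C m l j + C m j l)
      - 1 / 2 * (∑ k, C l k k) * (if m = j then 1 else 0)
      + ∑ k, ∑ i, eps ℂ j i k * frameSpin C l i * (if m = k then 1 else 0) = 0 := by
  have e : ∑ k, ∑ i, eps ℂ j i k * frameSpin C l i * (if m = k then 1 else 0)
      = ∑ i, eps ℂ j i m * frameSpin C l i := by
    simp
  rw [e]
  rcases fin3_cases l with rfl | rfl | rfl <;> rcases fin3_cases m with rfl | rfl | rfl <;>
  rcases fin3_cases j with rfl | rfl | rfl <;>
    simp only [Fin.sum_univ_three, eps_table, frameSpin, Fin.reduceEq, if_true, if_false, zero_mul, zero_add, add_zero, one_mul] <;> ring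

namespace Triad

variable {U : Set Pt} {sE : Pt → ℝ} {E : TField ℂ} (h : Triad U sE E) {x : Pt} (hx : x ∈ U)
include h hx

theorem diffAt {f : Pt → ℂ} (hf : ContDiffOn ℝ ∞ f U) : DifferentiableAt ℝ f x :=
  differentiableAt_of_contDiffOn h.isOpen hf hx

/-- The derivative of `ω E = 1`, for the coframe `ω = E⁻¹`. -/
theorem pd_invE (a i m : Fin 3) :
    ∑ b, E x b m * pd a (fun y => SelfdualGravity.invE E y i b) x
      = -∑ b, SelfdualGravity.invE E x i b * pd a (fun y => E y b m) x := by
  have d1 : ∀ b, DifferentiableAt ℝ (fun y => SelfdualGravity.invE E y i b) x :=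
    fun b => h.diffAt hx (h.invE i b)
  have d2 : ∀ b, DifferentiableAt ℝ (fun y => E y b m) x := fun b => h.diffAt hx (h.comp b m)
  have e : pd a (fun y => ∑ b, SelfdualGravity.invE E y i b * E y b m) x
      = pd a (fun _ => if i = m then (1 : ℂ) else 0) x :=
    pd_congr a h.isOpen (fun y hy => sum_invE_mul_E (h.det_ne y hy) i m) hx
  rw [pd_const, pd_sum a (fun b _ => (d1 b).fun_mul (d2 b))] at e
  simp only [pd_mul a (d1 _) (d2 _), Finset.sum_add_distrib] at e
  rw [eq_neg_iff_add_eq_zero, ← e]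
  congr 1
  exact Finset.sum_congr rfl fun b _ => mul_comm _ _

/-- Jacobi's formula for the determinant of the triad. -/
theorem pd_detE (a : Fin 3) : pd a (SelfdualGravity.detE E) x
    = SelfdualGravity.detE E x
      * ∑ b, ∑ j, SelfdualGravity.invE E x j b * pd a (fun y => E y b j) x := by
  have d : ∀ b j, DifferentiableAt ℝ (fun y => E y b j) x := fun b j => h.diffAt hx (h.comp b j)
  have hd := h.det_ne x hx
  have e : ∑ b, ∑ j, SelfdualGravity.invE E x j b * pd a (fun y => E y b j) x
      = (SelfdualGravity.detE E x)⁻¹ *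
        ∑ b, ∑ j, (Matrix.of (E x)).adjugate j b * pd a (fun y => E y b j) x := by
    simp only [invE_eq, Finset.mul_sum, mul_assoc]
  rw [e, mul_inv_cancel_left₀ hd]
  have e2 : pd a (SelfdualGravity.detE E) x = pd a (fun x => E x 0 0 * E x 1 1 * E x 2 2
      - E x 0 0 * E x 1 2 * E x 2 1
      - E x 0 1 * E x 1 0 * E x 2 2 + E x 0 1 * E x 1 2 * E x 2 0
      + E x 0 2 * E x 1 0 * E x 2 1 - E x 0 2 * E x 1 1 * E x 2 0) x := by
    congr 1; ext y; exact detE_eq E y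
  rw [e2]
  simp (disch := fun_prop) only [pd_sub, pd_add, pd_mul]
  simp [Fin.sum_univ_three, Matrix.adjugate_fin_three]
  ring

theorem pd_detq (a : Fin 3) : pd a (SelfdualGravity.detq sE E) x
    = SelfdualGravity.detq sE E x
      * ∑ b, ∑ j, SelfdualGravity.invE E x j b * pd a (fun y => E y b j) x := by
  have e : pd a (SelfdualGravity.detq sE E) x
      = pd a (fun y => ((sE x : ℝ) : ℂ) * SelfdualGravity.detE E y) x := by
    have : SelfdualGravity.detq sE E =ᶠ[nhds x]
        (fun y => ((sE x : ℝ) : ℂ) * SelfdualGravity.detE E y) := by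
      filter_upwards [(h.sign x hx).2] with y hy
      simp [SelfdualGravity.detq, hy]
    rw [pd, pd, this.fderiv_eq]
  rw [e, pd_const_mul a _ (h.diffAt hx h.detE), h.pd_detE hx, ← mul_assoc]
  rfl

/-- The frame components of the derivative of the metric. -/
theorem frame_pd_metric (l m n : Fin 3) :
    ∑ a, ∑ b, ∑ c, E x a l * E x b m * E x c n * pd a (fun y => SelfdualGravity.metric sE E y b c) x
      = SelfdualGravity.detq sE E x * ((if m = n then ∑ k, frameD E E x l k k else 0)
        - frameD E E x l n m - frameD E E x l m n) := by
  have dq := h.diffAt hx h.detq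
  have dw : ∀ i b, DifferentiableAt ℝ (fun y => SelfdualGravity.invE E y i b) x :=
    fun i b => h.diffAt hx (h.invE i b)
  have e : ∀ a b c, pd a (fun y => SelfdualGravity.metric sE E y b c) x
      = pd a (SelfdualGravity.detq sE E) x *
          ∑ i, SelfdualGravity.invE E x i b * SelfdualGravity.invE E x i c
        + SelfdualGravity.detq sE E x *
          ∑ i, (pd a (fun y => SelfdualGravity.invE E y i b) x * SelfdualGravity.invE E x i c
            + SelfdualGravity.invE E x i b * pd a (fun y => SelfdualGravity.invE E y i c) x) := by
    intro a b c
    simp only [SelfdualGravity.metric]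
    simp (disch := fun_prop) only [pd_mul, pd_sum]
  simp only [e, h.pd_detq hx]
  have alg : ∀ (M W : Fin 3 → Fin 3 → ℂ) (q : ℂ) (X : Fin 3 → ℂ) (Y : Fin 3 → Fin 3 → Fin 3 → ℂ),
      ∑ a, ∑ b, ∑ c, M a l * M b m * M c n * (q * X a * ∑ i, W i b * W i c
        + q * ∑ i, (Y a i b * W i c + W i b * Y a i c))
      = q * (∑ a, M a l * X a) * (∑ i, (∑ b, W i b * M b m) * (∑ c, W i c * M c n))
        + q * ∑ a, M a l * ∑ i, ((∑ b, M b m * Y a i b) * (∑ c, W i c * M c n)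
          + (∑ c, W i c * M c m) * (∑ b, M b n * Y a i b)) := by
    intro M W q X Y
    simp only [Fin.sum_univ_three]; ring
  rw [alg]
  simp only [sum_invE_mul_E (h.det_ne x hx), h.pd_invE hx]
  simp only [mul_ite, ite_mul, mul_one, one_mul, mul_zero, zero_mul, Finset.sum_add_distrib,
    Finset.sum_ite_eq', Finset.mem_univ, if_true, frameD]
  by_cases hmn : m = n
  · subst hmn
    simp only [if_true, Fin.sum_univ_three]; ring
  · simp only [hmn, Ne.symm hmn, if_false, Fin.sum_univ_three]; ring

/-- The frame components of the Christoffel symbols. -/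
theorem frame_christoffel (m l n : Fin 3) :
    ∑ c, ∑ a, ∑ b, SelfdualGravity.invE E x m c * E x a l * E x b n
        * SelfdualGravity.christoffel sE E x c a b
      = 1 / 2 * ((if m = n then ∑ k, frameD E E x l k k else 0)
        + (if m = l then ∑ k, frameD E E x n k k else 0)
        - (if l = n then ∑ k, frameD E E x m k k else 0)
        - frameD E E x l n m - frameD E E x l m n - frameD E E x n l m - frameD E E x n m l
        + frameD E E x m l n + frameD E E x m n l) := by
  have hq := h.detq_ne hx
  have e1 := h.frame_pd_metric hx
  have e2 := sum_invE_mul_E (h.det_ne x hx)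
  have alg : ∀ (M W : Fin 3 → Fin 3 → ℂ) (q : ℂ) (X : Fin 3 → Fin 3 → Fin 3 → ℂ),
      ∑ c, ∑ a, ∑ b, W m c * M a l * M b n * (1 / 2 * ∑ d, (q * ∑ i, M c i * M d i)
        * (X a d b + X b d a - X d a b))
      = 1 / 2 * q * ∑ i, (∑ c, W m c * M c i) * (
          ∑ a, ∑ b, ∑ c, M a l * M b i * M c n * X a b c
          + ∑ a, ∑ b, ∑ c, M a n * M b i * M c l * X a b c
          - ∑ a, ∑ b, ∑ c, M a i * M b l * M c n * X a b c) := by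
    intro M W q X
    simp only [Fin.sum_univ_three]; ring
  simp only [SelfdualGravity.christoffel, SelfdualGravity.invMetric]
  rw [alg]
  simp only [e1, e2, ite_mul, one_mul, zero_mul, Finset.sum_ite_eq, Finset.mem_univ, if_true]
  field_simp
  ring

/-- The frame components of the spin connection. -/
theorem frame_spinConnection (l k : Fin 3) :
    ∑ a, E x a l * SelfdualGravity.spinConnection sE E x a k
      = frameSpin (frameD E E x) l k := by
  have e1 := h.frame_christoffel hx
  have alg : ∀ (M W : Fin 3 → Fin 3 → ℂ) (X Y : Fin 3 → Fin 3 → Fin 3 → ℂ)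
      (e : Fin 3 → Fin 3 → ℂ),
      ∑ a, M a l * (1 / 2 * ∑ j, ∑ m, e j m * ∑ b, W m b * (X a b j + ∑ c, Y b a c * M c j))
      = 1 / 2 * ∑ j, ∑ m, e j m * ((∑ a, ∑ b, M a l * W m b * X a b j)
          + ∑ c, ∑ a, ∑ b, W m c * M a l * M b j * Y c a b) := by
    intro M W X Y e
    simp only [Fin.sum_univ_three]; ring
  simp only [SelfdualGravity.spinConnection]
  rw [alg (E x) (SelfdualGravity.invE E x) (fun a b j => pd a (fun y => E y b j) x)]
  simp only [e1]
  change 1 / 2 * ∑ j, ∑ m, eps ℂ k j m * (frameD E E x l m j + _) = _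
  generalize frameD E E x = C
  rcases fin3_cases l with rfl | rfl | rfl <;> rcases fin3_cases k with rfl | rfl | rfl <;>
    simp only [Fin.sum_univ_three, eps_table, frameSpin, Fin.reduceEq, if_true, if_false] <;> ring

/-- The trace `Γ^c_{ca}` is half the logarithmic derivative of the determinant. -/
theorem christoffel_trace (a : Fin 3) :
    ∑ c, SelfdualGravity.christoffel sE E x c c a
      = 1 / 2 * ∑ b, ∑ j, SelfdualGravity.invE E x j b * pd a (fun y => E y b j) x := by
  have e1 := h.frame_christoffel hx
  have e2 := sum_E_mul_invE (h.det_ne x hx)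
  have key : ∀ l, ∑ a, E x a l * ∑ c, SelfdualGravity.christoffel sE E x c c a
      = ∑ a, E x a l * (1 / 2 * ∑ b, ∑ j, SelfdualGravity.invE E x j b * pd a (fun y => E y b j) x)
      := by
    intro l
    have alg : ∀ (M W : Fin 3 → Fin 3 → ℂ) (Y : Fin 3 → Fin 3 → Fin 3 → ℂ),
        ∑ n, ∑ c, ∑ a, ∑ b, W n c * M a n * M b l * Y c a b
        = ∑ b, M b l * ∑ c, ∑ a, (∑ n, M a n * W n c) * Y c a b := by
      intro M W Y
      simp only [Fin.sum_univ_three]; ring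
    have := alg (E x) (SelfdualGravity.invE E x) (SelfdualGravity.christoffel sE E x)
    simp only [e1, e2, ite_mul, one_mul, zero_mul, Finset.sum_ite_eq', Finset.mem_univ,
      if_true] at this
    rw [← this]
    have e3 : ∑ a, E x a l * (1 / 2 * ∑ b, ∑ j, SelfdualGravity.invE E x j b
        * pd a (fun y => E y b j) x) = 1 / 2 * ∑ k, frameD E E x l k k := by
      simp only [frameD, Fin.sum_univ_three]; ring
    rw [e3]
    generalize frameD E E x = C
    rcases fin3_cases l with rfl | rfl | rfl <;>
      simp only [Fin.sum_univ_three, Fin.reduceEq, if_true, if_false] <;> ring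
  rw [eq_sum_invE (h.det_ne x hx) (fun a => ∑ c, SelfdualGravity.christoffel sE E x c c a) a]
  simp only [key]
  rw [← eq_sum_invE (h.det_ne x hx) (fun a => 1 / 2 * ∑ b, ∑ j, SelfdualGravity.invE E x j b
    * pd a (fun y => E y b j) x) a]

/-- The triad is covariantly constant. -/
theorem pd_E (a b j : Fin 3) : pd a (fun y => E y b j) x
    = -(∑ c, SelfdualGravity.christoffel sE E x b a c * E x c j)
      + (∑ c, SelfdualGravity.christoffel sE E x c c a) * E x b j
      - ∑ i, ∑ k, eps ℂ j i k * SelfdualGravity.spinConnection sE E x a i * E x b k := by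
  have e1 := h.frame_christoffel hx
  have e2 := h.frame_spinConnection hx
  have e3 := sum_invE_mul_E (h.det_ne x hx)
  have key := eq_zero_of_frame (h.det_ne x hx) (T := fun a b => pd a (fun y => E y b j) x
    + (∑ c, SelfdualGravity.christoffel sE E x b a c * E x c j)
      - (∑ c, SelfdualGravity.christoffel sE E x c c a) * E x b j
      + ∑ i, ∑ k, eps ℂ j i k * SelfdualGravity.spinConnection sE E x a i * E x b k) ?_ a b
  · linear_combination key
  intro l m
  simp only [h.christoffel_trace hx]
  have alg : ∀ (M W : Fin 3 → Fin 3 → ℂ) (X Y : Fin 3 → Fin 3 → Fin 3 → ℂ) (e S : Fin 3 → Fin 3 → ℂ)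
      (p : Fin 3 → ℂ),
      ∑ a, ∑ b, M a l * W m b * (X a b j + (∑ c, Y b a c * M c j) - p a * M b j
        + ∑ i, ∑ k, e i k * S a i * M b k)
      = ∑ a, ∑ b, M a l * W m b * X a b j + (∑ c, ∑ a, ∑ b, W m c * M a l * M b j * Y c a b)
        - (∑ a, M a l * p a) * (∑ b, W m b * M b j)
        + ∑ k, ∑ i, e i k * (∑ a, M a l * S a i) * (∑ b, W m b * M b k) := by
    intro M W X Y e S p
    simp only [Fin.sum_univ_three]; ring
  rw [alg (E x) (SelfdualGravity.invE E x) (fun a b j => pd a (fun y => E y b j) x)]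
  have e4 : ∑ a, E x a l * (1 / 2 * ∑ b, ∑ j, SelfdualGravity.invE E x j b
        * pd a (fun y => E y b j) x) = 1 / 2 * ∑ k, frameD E E x l k k := by
    simp only [frameD, Fin.sum_univ_three]; ring
  rw [e4]
  simp only [e1, e2, e3]
  exact frame_compat (frameD E E x) l m j
end Triad

/-! ### Curvature of the spin connection -/

/-- The Riemann tensor `R^c_{dab}` of the spatial metric. -/
def riemann (sE : Pt → ℝ) (E : TField ℂ) (x : Pt) (c d a b : Fin 3) : ℂ :=
  pd a (fun y => christoffel sE E y c b d) x - pd b (fun y => christoffel sE E y c a d) x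
    + ∑ e, (christoffel sE E x c a e * christoffel sE E x e b d
      - christoffel sE E x c b e * christoffel sE E x e a d)

theorem metric_symm (sE : Pt → ℝ) (E : TField ℂ) (x : Pt) (a b : Fin 3) :
    metric sE E x a b = metric sE E x b a := by
  simp only [metric, mul_comm]

theorem christoffel_symm (sE : Pt → ℝ) (E : TField ℂ) (x : Pt) (c a b : Fin 3) :
    christoffel sE E x c a b = christoffel sE E x c b a := by
  have e : (fun y => metric sE E y a b) = fun y => metric sE E y b a :=
    funext fun y => metric_symm sE E y a b
  simp only [christoffel, e]
  refine congrArg _ (Finset.sum_congr rfl fun d _ => ?_)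
  ring

/-- The first Bianchi identity. -/
theorem riemann_cyclic (sE : Pt → ℝ) (E : TField ℂ) (x : Pt) (c d a b : Fin 3) :
    riemann sE E x c d a b + riemann sE E x c a b d + riemann sE E x c b d a = 0 := by
  have e : ∀ a b, (fun y => christoffel sE E y c a b) = fun y => christoffel sE E y c b a :=
    fun a b => funext fun y => christoffel_symm sE E y c a b
  simp only [riemann, christoffel_symm sE E x _ b a, christoffel_symm sE E x _ d a,
    christoffel_symm sE E x _ d b, e b a, e d a, e d b, Fin.sum_univ_three]
  ring

theorem ricci_eq_riemann (sE : Pt → ℝ) (E : TField ℂ) (x : Pt) (b d : Fin 3) :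
    ricci sE E x b d = ∑ a, riemann sE E x a b a d := by
  have e : ∀ c a b, (fun y => christoffel sE E y c a b) = fun y => christoffel sE E y c b a :=
    fun c a b => funext fun y => christoffel_symm sE E y c a b
  simp only [ricci, riemann]
  refine Finset.sum_congr rfl fun a _ => ?_
  rw [e a d b, e a a b]
  simp only [christoffel_symm sE E x _ d b, christoffel_symm sE E x _ a b]

theorem curvature_antisymm (A : TField ℂ) (x : Pt) (a b k : Fin 3) :
    curvature A x a b k = -curvature A x b a k := by
  simp only [curvature]
  rcases fin3_cases k with rfl | rfl | rfl <;> simp only [Fin.sum_univ_three, eps_table] <;> ring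

/-- The algebra of the equality of mixed second derivatives of a covariantly constant triad. At a
point, `Ga`, `Gb` are the matrices of the Christoffel symbols, `pa`, `pb` their traces, `Sa`, `Sb` the
spin connection, and `DaE`, `DbE` the derivatives of the triad in the directions `a` and `b`; the
remaining arguments are second order data. The terms in the derivatives of the traces cancel, as
the trace of the Christoffel symbols is a gradient. -/
theorem commutator_algebra (E : Fin 3 → Fin 3 → ℂ) (Ga Gb Rab : Fin 3 → Fin 3 → ℂ)
    (dGa dGb : Fin 3 → Fin 3 → ℂ) (pa pb dp : ℂ) (Sa Sb dSa dSb F : Fin 3 → ℂ) (c j : Fin 3)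
    (DaE DbE : Fin 3 → Fin 3 → ℂ)
    (hDa : ∀ d j, DaE d j = -(∑ e, Ga d e * E e j) + pa * E d j
      - ∑ i, ∑ k, eps ℂ j i k * Sa i * E d k)
    (hDb : ∀ d j, DbE d j = -(∑ e, Gb d e * E e j) + pb * E d j
      - ∑ i, ∑ k, eps ℂ j i k * Sb i * E d k)
    (hR : ∀ d, Rab c d = dGb c d - dGa c d + ∑ e, (Ga c e * Gb e d - Gb c e * Ga e d))
    (hF : ∀ i, F i = dSb i - dSa i + ∑ m, ∑ n, eps ℂ m n i * Sa m * Sb n)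
    (hcomm : -(∑ d, (dGa c d * E d j + Ga c d * DbE d j)) + (dp * E c j + pa * DbE c j)
        - ∑ i, ∑ k, eps ℂ j i k * (dSa i * E c k + Sa i * DbE c k)
      = -(∑ d, (dGb c d * E d j + Gb c d * DaE d j)) + (dp * E c j + pb * DaE c j)
        - ∑ i, ∑ k, eps ℂ j i k * (dSb i * E c k + Sb i * DaE c k)) :
    ∑ d, Rab c d * E d j = -∑ i, ∑ k, eps ℂ j i k * F i * E c k := by
  simp only [hR, hF]
  simp only [hDa, hDb] at hcomm
  rcases fin3_cases j with rfl | rfl | rfl <;>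
    simp only [Fin.sum_univ_three, eps_table, zero_mul, zero_add, add_zero, one_mul] at hcomm ⊢ <;>
    linear_combination hcomm

namespace Triad

variable {U : Set Pt} {sE : Pt → ℝ} {E : TField ℂ} (h : Triad U sE E) {x : Pt} (hx : x ∈ U)
include h hx

/-- The trace of the Christoffel symbols is a closed form, being the differential of
`1/2 log det E`. -/
theorem pd_christoffel_trace (a b : Fin 3) :
    pd b (fun y => ∑ c, SelfdualGravity.christoffel sE E y c c a) x
      = pd a (fun y => ∑ c, SelfdualGravity.christoffel sE E y c c b) x := by
  have e : ∀ a, ∀ y ∈ U, ∑ c, SelfdualGravity.christoffel sE E y c c a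
      = 1 / 2 * ((SelfdualGravity.detE E y)⁻¹ * pd a (SelfdualGravity.detE E) y) := by
    intro a y hy
    rw [h.christoffel_trace hy, h.pd_detE hy, inv_mul_cancel_left₀ (h.det_ne y hy)]
  have hd := h.det_ne x hx
  have d1 := h.diffAt hx h.detE
  have d2 : ∀ a, DifferentiableAt ℝ (fun y => pd a (SelfdualGravity.detE E) y) x :=
    fun a => h.diffAt hx (contDiffOn_pd a h.isOpen h.detE)
  have d3 : DifferentiableAt ℝ (fun y => (SelfdualGravity.detE E y)⁻¹) x := d1.inv hd
  have e2 : ∀ a, pd a (fun y => (SelfdualGravity.detE E y)⁻¹) x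
      = -(SelfdualGravity.detE E x ^ 2)⁻¹ * pd a (SelfdualGravity.detE E) x := by
    intro a
    have e3 : pd a (fun y => SelfdualGravity.detE E y * (SelfdualGravity.detE E y)⁻¹) x = 0 := by
      rw [pd_congr a h.isOpen (fun y hy => mul_inv_cancel₀ (h.det_ne y hy)) hx, pd_const]
    rw [pd_mul a d1 d3] at e3
    change pd a (SelfdualGravity.detE E) x * _ + _ = 0 at e3
    field_simp at e3 ⊢
    linear_combination e3
  rw [pd_congr b h.isOpen (e a) hx, pd_congr a h.isOpen (e b) hx]
  simp (disch := fun_prop) only [pd_const_mul, pd_mul, e2]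
  rw [pd_comm b h.isOpen h.detE hx a]
  ring

/-- The Ricci identity for the covariantly constant triad: on it, the Riemann tensor acts on the
spatial index as the curvature of the spin connection acts on the internal one. -/
theorem riemann_E (c a b j : Fin 3) :
    ∑ d, riemann sE E x c d a b * E x d j
      = -∑ i, ∑ k, eps ℂ j i k * curvature (SelfdualGravity.spinConnection sE E) x a b i
          * E x c k := by
  have dG : ∀ c a b, DifferentiableAt ℝ (fun y => SelfdualGravity.christoffel sE E y c a b) x :=
    fun c a b => h.diffAt hx (h.christoffel c a b)
  have dS : ∀ a i, DifferentiableAt ℝ (fun y => SelfdualGravity.spinConnection sE E y a i) x :=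
    fun a i => h.diffAt hx (h.spinConnection a i)
  have dE : ∀ b j, DifferentiableAt ℝ (fun y => E y b j) x := fun b j => h.diffAt hx (h.comp b j)
  have dp : ∀ a, DifferentiableAt ℝ (fun y => ∑ c, SelfdualGravity.christoffel sE E y c c a) x :=
    fun a => DifferentiableAt.fun_sum fun c _ => dG c c a
  have second : ∀ a b, pd b (fun y => pd a (fun z => E z c j) y) x
      = -(∑ d, (pd b (fun y => SelfdualGravity.christoffel sE E y c a d) x * E x d j
          + SelfdualGravity.christoffel sE E x c a d * pd b (fun y => E y d j) x))
        + (pd b (fun y => ∑ c, SelfdualGravity.christoffel sE E y c c a) x * E x c j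
          + (∑ c, SelfdualGravity.christoffel sE E x c c a) * pd b (fun y => E y c j) x)
        - ∑ i, ∑ k, eps ℂ j i k * (pd b (fun y => SelfdualGravity.spinConnection sE E y a i) x
          * E x c k + SelfdualGravity.spinConnection sE E x a i * pd b (fun y => E y c k) x) := by
    intro a b
    rw [pd_congr b h.isOpen (fun y hy => h.pd_E hy a c j) hx]
    have reg : (fun y => -(∑ d, SelfdualGravity.christoffel sE E y c a d * E y d j)
        + (∑ c, SelfdualGravity.christoffel sE E y c c a) * E y c j
        - ∑ i, ∑ k, eps ℂ j i k * SelfdualGravity.spinConnection sE E y a i * E y c k)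
        = fun y => -(∑ d, SelfdualGravity.christoffel sE E y c a d * E y d j)
        + (fun z => ∑ c, SelfdualGravity.christoffel sE E z c c a) y * E y c j
        - ∑ i, ∑ k, eps ℂ j i k * (SelfdualGravity.spinConnection sE E y a i * E y c k) := by
      simp only [mul_assoc]
    rw [reg]
    generalize hp : (fun z => ∑ c, SelfdualGravity.christoffel sE E z c c a) = p
    have dp' : DifferentiableAt ℝ p x := hp ▸ dp a
    have hpx : p x = ∑ c, SelfdualGravity.christoffel sE E x c c a := by rw [← hp]
    simp (disch := fun_prop) only [pd_sub, pd_add, pd_neg, pd_sum, pd_mul,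
      pd_const, zero_mul, zero_add]
    rw [hpx]
  refine commutator_algebra (E x) (fun c d => SelfdualGravity.christoffel sE E x c a d)
    (fun c d => SelfdualGravity.christoffel sE E x c b d)
    (fun c d => riemann sE E x c d a b)
    (fun c d => pd b (fun y => SelfdualGravity.christoffel sE E y c a d) x)
    (fun c d => pd a (fun y => SelfdualGravity.christoffel sE E y c b d) x)
    (∑ c, SelfdualGravity.christoffel sE E x c c a)
    (∑ c, SelfdualGravity.christoffel sE E x c c b)
    (pd b (fun y => ∑ c, SelfdualGravity.christoffel sE E y c c a) x)
    (SelfdualGravity.spinConnection sE E x a) (SelfdualGravity.spinConnection sE E x b)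
    (fun i => pd b (fun y => SelfdualGravity.spinConnection sE E y a i) x)
    (fun i => pd a (fun y => SelfdualGravity.spinConnection sE E y b i) x)
    _ c j (fun d j => pd a (fun y => E y d j) x) (fun d j => pd b (fun y => E y d j) x)
    (fun d j => h.pd_E hx a d j) (fun d j => h.pd_E hx b d j) (fun d => rfl) (fun i => rfl) ?_
  have := second b a
  rw [← pd_comm b h.isOpen (h.comp c j) hx, second a b, h.pd_christoffel_trace hx b a] at this
  exact this

end Triad

/-! ### The selfdual constraints in terms of `K` -/

/-- The vector `ε_{ij}^k K^j_a Ẽ^a_k`, which vanishes on the Gauss surface. -/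
def gaussVec (K E : TField ℂ) (x : Pt) (i : Fin 3) : ℂ :=
  ∑ j, ∑ k, eps ℂ i j k * ∑ a, K x a j * E x a k

/-- The antisymmetrised covariant derivative `2 D_[a K_b]^k` of a connection perturbation. -/
def extDeriv (Γ K : TField ℂ) (x : Pt) (a b k : Fin 3) : ℂ :=
  pd a (fun y => K y b k) x - pd b (fun y => K y a k) x
    + ∑ m, ∑ n, eps ℂ m n k * (Γ x a m * K x b n + K x a m * Γ x b n)

/-- The curvature of `Γ + iK`. -/
theorem curvature_add_I_mul {U : Set Pt} (hU : IsOpen U) {A Γ K : TField ℂ}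
    (hΓ : ∀ a i, ContDiffOn ℝ ∞ (fun x => Γ x a i) U)
    (hK : ∀ a i, ContDiffOn ℝ ∞ (fun x => K x a i) U)
    (hA : ∀ x ∈ U, ∀ a i, A x a i = Γ x a i + Complex.I * K x a i) {x : Pt} (hx : x ∈ U)
    (a b k : Fin 3) :
    curvature A x a b k = curvature Γ x a b k + Complex.I * extDeriv Γ K x a b k
      - ∑ m, ∑ n, eps ℂ m n k * K x a m * K x b n := by
  have dΓ : ∀ a i, DifferentiableAt ℝ (fun x => Γ x a i) x :=
    fun a i => differentiableAt_of_contDiffOn hU (hΓ a i) hx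
  have dK : ∀ a i, DifferentiableAt ℝ (fun x => K x a i) x :=
    fun a i => differentiableAt_of_contDiffOn hU (hK a i) hx
  have e : ∀ a b k, pd a (fun y => A y b k) x
      = pd a (fun y => Γ y b k) x + Complex.I * pd a (fun y => K y b k) x := by
    intro a b k
    rw [pd_congr a hU (fun y hy => hA y hy b k) hx]
    simp (disch := fun_prop) only [pd_add, pd_const_mul]
  simp only [curvature, extDeriv, e, hA x hx]
  rcases fin3_cases k with rfl | rfl | rfl <;> simp only [Fin.sum_univ_three, eps_table]
  · linear_combination (K x a 1 * K x b 2 - K x a 2 * K x b 1) * Complex.I_sq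
  · linear_combination (K x a 2 * K x b 0 - K x a 0 * K x b 2) * Complex.I_sq
  · linear_combination (K x a 0 * K x b 1 - K x a 1 * K x b 0) * Complex.I_sq

namespace Triad

variable {U : Set Pt} {sE : Pt → ℝ} {E : TField ℂ} (h : Triad U sE E) {x : Pt} (hx : x ∈ U)
include h hx

/-- The contracted first Bianchi identity for the curvature of the spin connection. -/
theorem E_mul_curvature_spin (a : Fin 3) :
    ∑ b, ∑ i, E x b i * curvature (SelfdualGravity.spinConnection sE E) x a b i = 0 := by
  have hE := sum_invE_mul_E (h.det_ne x hx)
  set F : Fin 3 → Fin 3 → Fin 3 → ℂ := fun l m i => ∑ a, ∑ b, E x a l * E x b m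
    * curvature (SelfdualGravity.spinConnection sE E) x a b i with hF
  have anti : ∀ l m i, F l m i = -F m l i := by
    intro l m i
    have e : F l m i = ∑ a, ∑ b, E x a l * E x b m
        * -curvature (SelfdualGravity.spinConnection sE E) x b a i := by
      simp only [hF, ← curvature_antisymm]
    rw [e]
    simp only [hF, Fin.sum_univ_three]; ring
  have key : ∀ n j l m, ∑ c, ∑ a, ∑ b, ∑ d, SelfdualGravity.invE E x n c * E x a l * E x b m
      * E x d j * riemann sE E x c d a b = -∑ i, eps ℂ j i n * F l m i := by
    intro n j l m
    have e1 : ∑ c, ∑ a, ∑ b, ∑ d, SelfdualGravity.invE E x n c * E x a l * E x b m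
      * E x d j * riemann sE E x c d a b
        = ∑ c, ∑ a, ∑ b, SelfdualGravity.invE E x n c * E x a l * E x b m
          * ∑ d, riemann sE E x c d a b * E x d j := by
      simp only [Fin.sum_univ_three]; ring
    have e2 : ∀ (M W : Fin 3 → Fin 3 → ℂ) (F : Fin 3 → Fin 3 → Fin 3 → ℂ) (e : Fin 3 → Fin 3 → ℂ),
        ∑ c, ∑ a, ∑ b, W n c * M a l * M b m * -∑ i, ∑ k, e i k * F a b i * M c k
        = -∑ i, ∑ k, e i k * (∑ c, W n c * M c k) * ∑ a, ∑ b, M a l * M b m * F a b i := by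
      intro M W F e
      simp only [Fin.sum_univ_three]; ring
    rw [e1]
    simp only [h.riemann_E hx]
    rw [e2]
    simp only [hE, mul_ite, ite_mul, mul_one, mul_zero, zero_mul, Finset.sum_ite_eq,
      Finset.mem_univ, if_true, hF]
  have cyc : ∀ n j l m, ∑ i, eps ℂ j i n * F l m i + ∑ i, eps ℂ l i n * F m j i
      + ∑ i, eps ℂ m i n * F j l i = 0 := by
    intro n j l m
    have e : ∀ (M W : Fin 3 → Fin 3 → ℂ) (R : Fin 3 → Fin 3 → Fin 3 → Fin 3 → ℂ),
        ∑ c, ∑ a, ∑ b, ∑ d, W n c * M a l * M b m * M d j * R c d a b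
        + ∑ c, ∑ a, ∑ b, ∑ d, W n c * M a m * M b j * M d l * R c d a b
        + ∑ c, ∑ a, ∑ b, ∑ d, W n c * M a j * M b l * M d m * R c d a b
        = ∑ c, ∑ a, ∑ b, ∑ d, W n c * M a l * M b m * M d j
          * (R c d a b + R c a b d + R c b d a) := by
      intro M W R
      simp only [Fin.sum_univ_three]; ring
    have := e (E x) (SelfdualGravity.invE E x) (riemann sE E x)
    simp only [key, riemann_cyclic, mul_zero, Finset.sum_const_zero] at this
    linear_combination -this
  rw [eq_sum_invE (h.det_ne x hx) (fun a => ∑ b, ∑ i, E x b i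
    * curvature (SelfdualGravity.spinConnection sE E) x a b i) a]
  refine Finset.sum_eq_zero fun l _ => ?_
  have e : ∑ a, E x a l * ∑ b, ∑ i, E x b i
      * curvature (SelfdualGravity.spinConnection sE E) x a b i = ∑ i, F l i i := by
    simp only [hF, Fin.sum_univ_three]; ring
  rw [e]
  suffices hs : ∑ i, F l i i = 0 by rw [hs, mul_zero]
  have c0 := cyc 0 0 1 2
  have c1 := cyc 1 0 1 2
  have c2 := cyc 2 0 1 2
  have a4 := anti 0 1
  have a5 := anti 0 2
  have a6 := anti 1 2
  clear_value F
  simp only [Fin.sum_univ_three, eps_table] at c0 c1 c2 ⊢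
  simp only [a4, a6] at c0 c1 c2
  have b : ∀ l i, F l l i = 0 := fun l i => by linear_combination 1 / 2 * anti l l i
  rcases fin3_cases l with rfl | rfl | rfl <;> simp only [b, a4, a5, a6]
  · linear_combination -c0
  · linear_combination -c1
  · linear_combination -c2

/-- The scalar curvature in terms of the curvature of the spin connection. -/
theorem scalarCurvature_eq :
    ∑ i, ∑ j, ∑ k, ∑ a, ∑ b, eps ℂ k i j * E x a i * E x b j
      * curvature (SelfdualGravity.spinConnection sE E) x a b k
      = -(SelfdualGravity.detq sE E x * SelfdualGravity.scalarCurvature sE E x) := by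
  have hq := h.detq_ne hx
  simp only [SelfdualGravity.scalarCurvature, ricci_eq_riemann, SelfdualGravity.invMetric]
  have e1 : ∀ (M : Fin 3 → Fin 3 → ℂ) (q : ℂ) (R : Fin 3 → Fin 3 → Fin 3 → Fin 3 → ℂ), q ≠ 0 →
      q * ∑ b, ∑ d, q⁻¹ * (∑ i, M b i * M d i) * ∑ a, R a b a d
      = ∑ d, ∑ j, M d j * ∑ a, ∑ b, R a b a d * M b j := by
    intro M q R hq
    simp only [Fin.sum_univ_three]; field_simp; ring
  rw [e1 _ _ _ hq]
  simp only [h.riemann_E hx]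
  generalize curvature (SelfdualGravity.spinConnection sE E) x = F
  simp only [Fin.sum_univ_three, eps_table]; ring


/-- The Gauss law of the spin connection. -/
theorem div_E (i : Fin 3) : ∑ a, (pd a (fun y => E y a i) x
    + ∑ j, ∑ k, eps ℂ i j k * SelfdualGravity.spinConnection sE E x a j * E x a k) = 0 := by
  simp only [h.pd_E hx]
  generalize SelfdualGravity.spinConnection sE E x = S
  generalize SelfdualGravity.christoffel sE E x = G
  simp only [Fin.sum_univ_three]; ring

variable {K : TField ℂ} (hK : ∀ a i, ContDiffOn ℝ ∞ (fun x => K x a i) U)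
include hK

/-- The part of the diffeomorphism constraint that is linear in `K` is the covariant divergence of
the trace-reversed momentum. -/
theorem diffeo_algebra (a : Fin 3) :
    ∑ b, ∑ i, E x b i * extDeriv (SelfdualGravity.spinConnection sE E) K x a b i
      = -∑ b, covDerivDensity sE E
    (fun y b' a' => KE K E y b' a' - if b' = a' then trKE K E y else 0) x b b a := by
  have dK : ∀ a i, DifferentiableAt ℝ (fun x => K x a i) x := fun a i => h.diffAt hx (hK a i)
  have dE : ∀ a i, DifferentiableAt ℝ (fun x => E x a i) x := fun a i => h.diffAt hx (h.comp a i)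
  have e1 : ∀ c b a, pd c (fun y => KE K E y b a - if b = a then trKE K E y else 0) x
      = ∑ i, (pd c (fun y => K y a i) x * E x b i + K x a i * pd c (fun y => E y b i) x)
        - if b = a then ∑ d, ∑ i, (pd c (fun y => K y d i) x * E x d i
          + K x d i * pd c (fun y => E y d i) x) else 0 := by
    intro c b a
    simp only [KE, trKE]
    by_cases hba : b = a
    · simp only [hba, if_true]
      simp (disch := fun_prop) only [pd_sub, pd_sum, pd_mul]
    · simp only [hba, if_false, sub_zero]
      simp (disch := fun_prop) only [pd_sum, pd_mul]
  simp only [covDerivDensity, e1]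
  simp only [extDeriv, KE, trKE, h.pd_E hx]
  have hs : ∀ c a b, SelfdualGravity.christoffel sE E x c a b
      = SelfdualGravity.christoffel sE E x c b a := christoffel_symm sE E x
  generalize SelfdualGravity.spinConnection sE E x = S
  generalize SelfdualGravity.christoffel sE E x = G at hs ⊢
  generalize E x = M
  have g1 := fun c => hs c 1 0
  have g2 := fun c => hs c 2 0
  have g3 := fun c => hs c 2 1
  generalize hdK : (fun c a i => pd c (fun y => K y a i) x) = D
  have hD : ∀ c a i, pd c (fun y => K y a i) x = D c a i := fun c a i => by rw [← hdK]
  generalize K x = L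
  simp only [hD]
  rcases fin3_cases a with rfl | rfl | rfl <;>
    simp only [Fin.sum_univ_three, eps_table, g1, g2, g3, Fin.reduceEq, if_true, if_false] <;> ring

/-- The part of the Hamilton constraint that is linear in `K` is a covariant divergence of the Gauss
vector. -/
theorem hamilton_algebra :
    ∑ i, ∑ j, ∑ k, ∑ a, ∑ b, eps ℂ k i j * E x a i * E x b j
        * extDeriv (SelfdualGravity.spinConnection sE E) K x a b k
      = -2 * ∑ a, (pd a (fun y => ∑ i, E y a i * gaussVec K E y i) x
        - (∑ c, SelfdualGravity.christoffel sE E x c c a) * ∑ i, E x a i * gaussVec K E x i) := by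
  have dK : ∀ a i, DifferentiableAt ℝ (fun x => K x a i) x := fun a i => h.diffAt hx (hK a i)
  have dE : ∀ a i, DifferentiableAt ℝ (fun x => E x a i) x := fun a i => h.diffAt hx (h.comp a i)
  simp only [gaussVec]
  simp (disch := fun_prop) only [pd_sum, pd_mul, pd_const, zero_mul, zero_add]
  simp only [extDeriv, h.pd_E hx]
  have hs : ∀ c a b, SelfdualGravity.christoffel sE E x c a b
      = SelfdualGravity.christoffel sE E x c b a := christoffel_symm sE E x
  generalize SelfdualGravity.spinConnection sE E x = S
  generalize SelfdualGravity.christoffel sE E x = G at hs ⊢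
  generalize E x = M
  have g1 := fun c => hs c 1 0
  have g2 := fun c => hs c 2 0
  have g3 := fun c => hs c 2 1
  generalize hdK : (fun c a i => pd c (fun y => K y a i) x) = D
  have hD : ∀ c a i, pd c (fun y => K y a i) x = D c a i := fun c a i => by rw [← hdK]
  generalize K x = L
  simp only [hD]
  simp only [Fin.sum_univ_three, eps_table, g1, g2, g3]
  ring

end Triad

theorem admGauss_eq (κ : ℝ) (K E : TField ℂ) (x : Pt) (i : Fin 3) :
    admGauss κ K E x i = 2 / κ * gaussVec K E x i := by
  simp [admGauss, gaussVec]

theorem extrinsicK_spec (sE : Pt → ℝ) (A E : TField ℂ) (x : Pt) (a i : Fin 3) :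
    A x a i = spinConnection sE E x a i + Complex.I * extrinsicK sE A E x a i := by
  simp only [extrinsicK]
  field_simp
  ring

namespace Triad

variable {U : Set Pt} {sE : Pt → ℝ} {E : TField ℂ} (h : Triad U sE E) {x : Pt} (hx : x ∈ U)
  {κ : ℝ} (hκ : κ ≠ 0) (lam : ℂ) (se : Pt → ℝ) {A K : TField ℂ}
  (hK : ∀ a i, ContDiffOn ℝ ∞ (fun x => K x a i) U)
  (hA : ∀ x ∈ U, ∀ a i, A x a i = SelfdualGravity.spinConnection sE E x a i + Complex.I * K x a i)
include h hx hκ hA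

/-- The selfdual Gauss constraint is `λ` times that of ADM gravity, on and off the constraint
surface. -/
theorem gauss_eq (i : Fin 3) : gauss κ lam A E x i = lam * admGauss κ K E x i := by
  have hκ' : (κ : ℂ) ≠ 0 := by exact_mod_cast hκ
  rw [gauss, admGauss_eq]
  have e : ∑ a, (pd a (fun y => E y a i) x + ∑ j, ∑ k, eps ℂ i j k * A x a j * E x a k)
      = Complex.I * gaussVec K E x i := by
    rw [← zero_add (Complex.I * _), ← h.div_E hx i]
    simp only [hA x hx, gaussVec]
    generalize SelfdualGravity.spinConnection sE E x = S
    simp only [Fin.sum_univ_three]; ring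
  rw [e]
  field_simp

include hK

/-- The selfdual and the ADM diffeomorphism constraint differ by a term that is linear in the Gauss
vector. -/
theorem diffeo_eq (a : Fin 3) : diffeo κ lam A E x a
    = lam * (admDiffeo κ sE K E x a
      + 2 * Complex.I / κ * ∑ m, K x a m * gaussVec K E x m) := by
  have hκ' : (κ : ℂ) ≠ 0 := by exact_mod_cast hκ
  have e := fun b i => curvature_add_I_mul h.isOpen h.spinConnection hK hA hx a b i
  have e2 : ∑ b, ∑ i, E x b i * ∑ m, ∑ n, eps ℂ m n i * K x a m * K x b n
      = ∑ m, K x a m * gaussVec K E x m := by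
    simp only [gaussVec, Fin.sum_univ_three, eps_table]; ring
  have e3 : ∑ b, ∑ i, E x b i * curvature A x a b i
      = Complex.I * -∑ b, covDerivDensity sE E
        (fun y b' a' => KE K E y b' a' - if b' = a' then trKE K E y else 0) x b b a
        - ∑ m, K x a m * gaussVec K E x m := by
    rw [← e2, ← h.diffeo_algebra hx hK, ← zero_add (Complex.I * _), ← h.E_mul_curvature_spin hx a]
    simp only [e]
    simp only [Fin.sum_univ_three]; ring
  rw [diffeo, e3, admDiffeo]
  simp only [Complex.coe_algebraMap, Complex.ofReal_div, Complex.ofReal_ofNat]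
  field_simp
  linear_combination -(∑ m, K x a m * gaussVec K E x m) * lam * Complex.I_sq

omit hκ in
/-- The selfdual and the ADM Hamilton constraint differ by a divergence of the Gauss vector. -/
theorem hamilton_eq : hamilton κ lam se sE A E x
    = lam * ((se x / sE x : ℝ) : ℂ) * (admHamilton κ sE K E x
      + 2 * Complex.I / κ * ((RCLike.sqrt (SelfdualGravity.detq sE E x))⁻¹
        * ∑ a, (pd a (fun y => ∑ i, E y a i * gaussVec K E y i) x
        - (∑ c, SelfdualGravity.christoffel sE E x c c a) * ∑ i, E x a i * gaussVec K E x i))) := by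
  have e := fun a b i => curvature_add_I_mul h.isOpen h.spinConnection hK hA hx a b i
  have e2 : ∑ i, ∑ j, ∑ k, ∑ a, ∑ b, eps ℂ k i j * E x a i * E x b j
      * ∑ m, ∑ n, eps ℂ m n k * K x a m * K x b n
      = trKE K E x * trKE K E x - ∑ a, ∑ b, KE K E x b a * KE K E x a b := by
    simp only [KE, trKE, Fin.sum_univ_three, eps_table]; ring
  have e3 : ∑ i, ∑ j, ∑ k, ∑ a, ∑ b, eps ℂ k i j * E x a i * E x b j * curvature A x a b k
      = -(SelfdualGravity.detq sE E x * SelfdualGravity.scalarCurvature sE E x)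
      + Complex.I * (-2 * ∑ a, (pd a (fun y => ∑ i, E y a i * gaussVec K E y i) x
        - (∑ c, SelfdualGravity.christoffel sE E x c c a) * ∑ i, E x a i * gaussVec K E x i))
      - (trKE K E x * trKE K E x - ∑ a, ∑ b, KE K E x b a * KE K E x a b) := by
    rw [← e2, ← h.hamilton_algebra hx hK, ← h.scalarCurvature_eq hx]
    simp only [e]
    simp only [Fin.sum_univ_three, eps_table]; ring
  rw [hamilton, e3, admHamilton]
  simp only [Complex.coe_algebraMap, div_eq_mul_inv, mul_inv, Complex.ofReal_mul,
    Complex.ofReal_inv]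
  ring

end Triad

/-- On the Gauss surface the selfdual constraints are, up to constant factors, those of ADM gravity
in the variables `(K, Ẽ)`. -/
theorem constraints_of_gauss {U : Set Pt} {sE : Pt → ℝ} {E : TField ℂ} (h : Triad U sE E)
    {κ : ℝ} (hκ : κ ≠ 0) {lam : ℂ} (hlam : lam ≠ 0) (se : Pt → ℝ) {A : TField ℂ}
    (hA : ContDiffOn ℝ ∞ A U) (hG : ∀ x ∈ U, ∀ i, gauss κ lam A E x i = 0) :
    (∀ x ∈ U, ∀ i, gaussVec (extrinsicK sE A E) E x i = 0) ∧
    ∀ x ∈ U, (∀ a, diffeo κ lam A E x a = lam * admDiffeo κ sE (extrinsicK sE A E) E x a) ∧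
      hamilton κ lam se sE A E x =
        lam * ((se x / sE x : ℝ) : ℂ) * admHamilton κ sE (extrinsicK sE A E) E x := by
  have hκ' : (κ : ℂ) ≠ 0 := by exact_mod_cast hκ
  have hK : ∀ a i, ContDiffOn ℝ ∞ (fun x => extrinsicK sE A E x a i) U := fun a i =>
    ((contDiffOn_pi.1 (contDiffOn_pi.1 hA a) i).sub (h.spinConnection a i)).div_const _
  have hs : ∀ x ∈ U, ∀ a i, A x a i = spinConnection sE E x a i
      + Complex.I * extrinsicK sE A E x a i := fun x _ a i => extrinsicK_spec sE A E x a i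
  have hg : ∀ x ∈ U, ∀ i, gaussVec (extrinsicK sE A E) E x i = 0 := by
    intro x hx i
    have := hG x hx i
    rw [h.gauss_eq hx hκ lam hs, admGauss_eq] at this
    simpa [hlam, hκ'] using this
  refine ⟨hg, fun x hx => ⟨fun a => ?_, ?_⟩⟩
  · rw [h.diffeo_eq hx hκ lam hK hs]
    simp [hg x hx]
  · have e : ∀ a, pd a (fun y => ∑ i, E y a i * gaussVec (extrinsicK sE A E) E y i) x = 0 := by
      intro a
      rw [pd_congr a h.isOpen (g := fun _ => 0) (fun y hy => by simp [hg y hy]) hx, pd_const]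
    rw [h.hamilton_eq hx lam se hK hs]
    simp [hg x hx, e]

/-! ### Linearisation of the spin connection -/

/-- The frame components `ω^m_b φ^b_j` of a variation of the triad. -/
def frameV (E φ : TField ℂ) (x : Pt) (m j : Fin 3) : ℂ := ∑ b, invE E x m b * φ x b j

/-- The variation of `frameD E E` when `E` varies by a field with frame components `f` whose
derivative has the frame components `H`. -/
def frameVar (C : Fin 3 → Fin 3 → Fin 3 → ℂ) (f : Fin 3 → Fin 3 → ℂ)
    (H : Fin 3 → Fin 3 → Fin 3 → ℂ) (l m j : Fin 3) : ℂ :=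
  H l m j - ∑ n, f m n * C l n j + ∑ n, f n l * C n m j

/-- The linearisation at `E` of the spin connection, in the direction `φ`. -/
def linSpin (E φ : TField ℂ) : TField ℂ := fun x a k =>
  ∑ n, invE E x n a * (frameSpin (frameVar (frameD E E x) (frameV E φ x) (frameD E φ x)) n k
    - ∑ l, frameV E φ x l n * frameSpin (frameD E E x) l k)

theorem Triad.spinConnection_eq {U : Set Pt} {sE : Pt → ℝ} {E : TField ℂ} (h : Triad U sE E)
    {x : Pt} (hx : x ∈ U) (a k : Fin 3) :
    SelfdualGravity.spinConnection sE E x a k = ∑ l, SelfdualGravity.invE E x l a * frameSpin (frameD E E x) l k := by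
  simp only [← h.frame_spinConnection hx]
  exact eq_sum_invE (h.det_ne x hx) (fun a => SelfdualGravity.spinConnection sE E x a k) a

theorem sum_E_mul_frameV {E : TField ℂ} {x : Pt} (h : detE E x ≠ 0) (φ : TField ℂ) (b j : Fin 3) :
    ∑ m, E x b m * frameV E φ x m j = φ x b j :=
  (eq_sum_E h (fun b => φ x b j) b).symm

/-- The velocity at `r` of a family of fields. -/
def velocity (E : ℝ → TField ℂ) (r : ℝ) : TField ℂ := fun x a i => deriv (fun ρ => E ρ x a i) r

section Family

variable {O : Set (ℝ × Pt)} {sE : Pt → ℝ} {E : ℝ → TField ℂ} (h : TriadFamily O sE E)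
  {r : ℝ} {x : Pt} (hx : (r, x) ∈ O)
include h hx

theorem TriadFamily.hasDerivAt_E (b j : Fin 3) :
    HasDerivAt (fun ρ => E ρ x b j) (velocity E r x b j) r :=
  (h.smooth b j).hasDerivAt h.isOpen hx

theorem TriadFamily.hasDerivAt_pd_E (a b j : Fin 3) :
    HasDerivAt (fun ρ => pd a (fun y => E ρ y b j) x)
      (pd a (fun y => velocity E r y b j) x) r :=
  (h.smooth b j).hasDerivAt_pd h.isOpen hx a

/-- The variation of the coframe is `-ω Ė ω`. -/
theorem TriadFamily.hasDerivAt_invE (m b : Fin 3) :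
    HasDerivAt (fun ρ => SelfdualGravity.invE (E ρ) x m b)
      (-∑ n, frameV (E r) (velocity E r) x m n * SelfdualGravity.invE (E r) x n b) r := by
  have hd := h.det_ne r x hx
  have h1 : ∀ m b, HasDerivAt (fun ρ => SelfdualGravity.invE (E ρ) x m b) _ r :=
    fun m b => (h.invE m b).hasDerivAt h.isOpen hx
  set d : Fin 3 → Fin 3 → ℂ := fun m b => deriv (fun ρ => SelfdualGravity.invE (E ρ) x m b) r
  have h2 : ∀ j, ∑ b, d m b * E r x b j = -frameV (E r) (velocity E r) x m j := by
    intro j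
    have h3 : HasDerivAt (fun ρ => ∑ b, SelfdualGravity.invE (E ρ) x m b * E ρ x b j)
        (∑ b, (d m b * E r x b j + SelfdualGravity.invE (E r) x m b * velocity E r x b j)) r :=
      HasDerivAt.fun_sum fun b _ => (h1 m b).mul (h.hasDerivAt_E hx b j)
    have h4 : HasDerivAt (fun ρ => ∑ b, SelfdualGravity.invE (E ρ) x m b * E ρ x b j) 0 r := by
      refine (hasDerivAt_const r (if m = j then (1 : ℂ) else 0)).congr_of_eventuallyEq ?_
      have : ∀ᶠ ρ in nhds r, (ρ, x) ∈ O :=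
        (Continuous.prodMk_left x).continuousAt.eventually (h.isOpen.mem_nhds hx)
      filter_upwards [this] with ρ hρ using sum_invE_mul_E (h.det_ne ρ x hρ) m j
    have h5 := h3.unique h4
    rw [Finset.sum_add_distrib] at h5
    exact eq_neg_of_add_eq_zero_left h5
  have h6 : d m b = -∑ n, frameV (E r) (velocity E r) x m n * SelfdualGravity.invE (E r) x n b := by
    have e := eq_sum_invE hd (fun b => d m b) b
    rw [e, ← Finset.sum_neg_distrib]
    refine Finset.sum_congr rfl fun n _ => ?_
    have := h2 n
    simp only [mul_comm (d m _)] at this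
    rw [this]; ring
  rw [← h6]
  exact h1 m b

theorem TriadFamily.hasDerivAt_frameD (l m j : Fin 3) :
    HasDerivAt (fun ρ => frameD (E ρ) (E ρ) x l m j)
      (frameVar (frameD (E r) (E r) x) (frameV (E r) (velocity E r) x)
        (frameD (E r) (velocity E r) x) l m j) r := by
  have h1 := HasDerivAt.fun_sum (u := Finset.univ) fun a _ =>
    HasDerivAt.fun_sum (u := Finset.univ) fun b _ =>
      ((h.hasDerivAt_E hx a l).mul (h.hasDerivAt_invE hx m b)).mul (h.hasDerivAt_pd_E hx a b j)
  refine h1.congr_deriv ?_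
  have e : ∀ b, velocity E r x b l = ∑ m, E r x b m * frameV (E r) (velocity E r) x m l :=
    fun b => (sum_E_mul_frameV (h.det_ne r x hx) (velocity E r) b l).symm
  simp only [frameVar, frameD, e, Pi.mul_apply]
  generalize frameV (E r) (velocity E r) x = f
  generalize SelfdualGravity.invE (E r) x = W
  generalize E r x = M
  simp only [Fin.sum_univ_three]; ring

/-- The derivative of the spin connection along a family of triads. -/
theorem TriadFamily.hasDerivAt_spinConnection (a k : Fin 3) :
    HasDerivAt (fun ρ => SelfdualGravity.spinConnection sE (E ρ) x a k)
      (linSpin (E r) (velocity E r) x a k) r := by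
  have h0 : (fun ρ => SelfdualGravity.spinConnection sE (E ρ) x a k) =ᶠ[nhds r] fun ρ =>
      ∑ l, SelfdualGravity.invE (E ρ) x l a * frameSpin (frameD (E ρ) (E ρ) x) l k := by
    have : ∀ᶠ ρ in nhds r, (ρ, x) ∈ O :=
      (Continuous.prodMk_left x).continuousAt.eventually (h.isOpen.mem_nhds hx)
    filter_upwards [this] with ρ hρ using (h.triad ρ).spinConnection_eq hρ a k
  have h2 : ∀ l, HasDerivAt (fun ρ => frameSpin (frameD (E ρ) (E ρ) x) l k)
      (frameSpin (frameVar (frameD (E r) (E r) x) (frameV (E r) (velocity E r) x)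
        (frameD (E r) (velocity E r) x)) l k) r := by
    intro l
    have hC := h.hasDerivAt_frameD hx
    simp only [frameSpin]
    exact ((HasDerivAt.fun_sum fun j _ => HasDerivAt.fun_sum fun m _ =>
      (((hC l m j).add (hC m j l)).add (hC m l j)).const_mul _).const_mul _).add
      ((HasDerivAt.fun_sum fun j _ => HasDerivAt.fun_sum fun n _ =>
        (hC j n n).const_mul _).const_mul _)
  refine HasDerivAt.congr_of_eventuallyEq ?_ h0
  have h3 := HasDerivAt.fun_sum (u := Finset.univ) fun l _ =>
    (h.hasDerivAt_invE hx l a).mul (h2 l)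
  refine h3.congr_deriv ?_
  simp only [linSpin]
  generalize frameSpin (frameVar _ _ _) = G
  generalize frameSpin _ = G'
  simp only [Fin.sum_univ_three]; ring

end Family

/-! ### The linearised spin connection is symmetric -/

/-- The current whose divergence measures the asymmetry of the linearised spin connection. -/
def spinCurrent (E φ ψ : TField ℂ) (x : Pt) (a : Fin 3) : ℂ :=
  1 / 2 * ∑ k, ∑ j, ∑ m, eps ℂ k j m * (ψ x a k * frameV E φ x m j
    - E x a k * (∑ n, frameV E ψ x m n * frameV E φ x n j)
    - φ x a k * frameV E ψ x m j
    + E x a k * (∑ n, frameV E φ x m n * frameV E ψ x n j))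

set_option maxHeartbeats 1000000 in
/-- The pointwise identity behind `Triad.spin_symm`, in frame components: `f`, `g` are the two
variations, `H`, `H'` their derivatives, and `C` is the derivative of the triad. -/
theorem spin_symm_algebra (C H H' : Fin 3 → Fin 3 → Fin 3 → ℂ) (f g : Fin 3 → Fin 3 → ℂ) :
    ∑ n, ∑ k, g n k * (frameSpin (frameVar C f H) n k - ∑ l, f l n * frameSpin C l k)
      - ∑ n, ∑ k, f n k * (frameSpin (frameVar C g H') n k - ∑ l, g l n * frameSpin C l k)
    = 1 / 2 * ∑ k, ∑ j, ∑ m, eps ℂ k j m * (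
      (∑ n, H' n n k) * f m j + (∑ l, g l k * (H l m j - ∑ n, C l m n * f n j))
      - (∑ n, C n n k) * (∑ n, g m n * f n j)
      - (∑ n, ((H' k m n - ∑ p, C k m p * g p n) * f n j
          + g m n * (H k n j - ∑ p, C k n p * f p j)))
      - ((∑ n, H n n k) * g m j + (∑ l, f l k * (H' l m j - ∑ n, C l m n * g n j)))
      + (∑ n, C n n k) * (∑ n, f m n * g n j)
      + (∑ n, ((H k m n - ∑ p, C k m p * f p n) * g n j
          + f m n * (H' k n j - ∑ p, C k n p * g p j)))) := by
  simp only [frameSpin, frameVar, Fin.sum_univ_three, eps_table]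
  ring

theorem component_contDiffOn {U : Set Pt} {φ : TField ℂ} (hφ : ContDiffOn ℝ ∞ φ U) (a i : Fin 3) :
    ContDiffOn ℝ ∞ (fun x => φ x a i) U := contDiffOn_pi.1 (contDiffOn_pi.1 hφ a) i

namespace Triad

variable {U : Set Pt} {sE : Pt → ℝ} {E : TField ℂ} (h : Triad U sE E)
include h

theorem pd_invE_apply {x : Pt} (hx : x ∈ U) (a m b : Fin 3) :
    pd a (fun y => SelfdualGravity.invE E y m b) x
      = -∑ n, (∑ c, SelfdualGravity.invE E x m c * pd a (fun y => E y c n) x)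
        * SelfdualGravity.invE E x n b := by
  rw [eq_sum_invE (h.det_ne x hx) (fun b => pd a (fun y => SelfdualGravity.invE E y m b) x) b]
  simp only [h.pd_invE hx, mul_neg, Finset.sum_neg_distrib]
  refine congrArg _ (Finset.sum_congr rfl fun n _ => mul_comm _ _)

theorem contDiffOn_frameV {φ : TField ℂ} (hφ : ContDiffOn ℝ ∞ φ U) (m j : Fin 3) :
    ContDiffOn ℝ ∞ (fun x => frameV E φ x m j) U :=
  ContDiffOn.sum fun b _ => (h.invE m b).mul (component_contDiffOn hφ b j)

theorem contDiffOn_frameD {φ : TField ℂ} (hφ : ContDiffOn ℝ ∞ φ U) (l m j : Fin 3) :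
    ContDiffOn ℝ ∞ (fun x => frameD E φ x l m j) U :=
  ContDiffOn.sum fun a _ => ContDiffOn.sum fun b _ =>
    ((h.comp a l).mul (h.invE m b)).mul
      (contDiffOn_pd a h.isOpen (component_contDiffOn hφ b j))

omit h in
theorem contDiffOn_frameSpin {C : Pt → Fin 3 → Fin 3 → Fin 3 → ℂ}
    (hC : ∀ l m j, ContDiffOn ℝ ∞ (fun x => C x l m j) U) (l k : Fin 3) :
    ContDiffOn ℝ ∞ (fun x => frameSpin (C x) l k) U :=
  (contDiffOn_const.mul <| ContDiffOn.sum fun j _ => ContDiffOn.sum fun m _ =>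
    contDiffOn_const.mul (((hC l m j).add (hC m j l)).add (hC m l j))).add
  (contDiffOn_const.mul <| ContDiffOn.sum fun j _ => ContDiffOn.sum fun n _ =>
    contDiffOn_const.mul (hC j n n))

theorem contDiffOn_linSpin {φ : TField ℂ} (hφ : ContDiffOn ℝ ∞ φ U) (a k : Fin 3) :
    ContDiffOn ℝ ∞ (fun x => linSpin E φ x a k) U := by
  have h1 : ∀ l m j, ContDiffOn ℝ ∞ (fun x => frameVar (frameD E E x) (frameV E φ x)
      (frameD E φ x) l m j) U := fun l m j =>
    ((h.contDiffOn_frameD hφ l m j).sub (ContDiffOn.sum fun n _ =>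
      (h.contDiffOn_frameV hφ m n).mul (h.contDiffOn_frameD h.smooth l n j))).add
      (ContDiffOn.sum fun n _ =>
        (h.contDiffOn_frameV hφ n l).mul (h.contDiffOn_frameD h.smooth n m j))
  exact ContDiffOn.sum fun n _ => (h.invE n a).mul
    ((contDiffOn_frameSpin h1 n k).sub (ContDiffOn.sum fun l _ =>
      (h.contDiffOn_frameV hφ l n).mul
        (contDiffOn_frameSpin (fun l m j => h.contDiffOn_frameD h.smooth l m j) l k)))

theorem pd_frameV {φ : TField ℂ} (hφ : ContDiffOn ℝ ∞ φ U) {x : Pt} (hx : x ∈ U) (a m j : Fin 3) :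
    pd a (fun y => frameV E φ y m j) x
      = ∑ b, SelfdualGravity.invE E x m b * pd a (fun y => φ y b j) x
        - ∑ n, (∑ c, SelfdualGravity.invE E x m c * pd a (fun y => E y c n) x)
          * frameV E φ x n j := by
  have dφ : ∀ b j, DifferentiableAt ℝ (fun y => φ y b j) x :=
    fun b j => h.diffAt hx (component_contDiffOn hφ b j)
  have dw : ∀ m b, DifferentiableAt ℝ (fun y => SelfdualGravity.invE E y m b) x :=
    fun m b => h.diffAt hx (h.invE m b)
  simp only [frameV]
  simp (disch := fun_prop) only [pd_sum, pd_mul]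
  simp only [h.pd_invE_apply hx, Fin.sum_univ_three]
  ring

set_option maxHeartbeats 1000000 in
/-- The linearisation of the spin connection is symmetric up to a divergence: it is the second
variation of the functional `∫ Ẽ^a_i Γ^i_a`, whose gradient is `Γ`. -/
theorem spin_symm {φ ψ : TField ℂ} (hφ : ContDiffOn ℝ ∞ φ U) (hψ : ContDiffOn ℝ ∞ ψ U)
    {x : Pt} (hx : x ∈ U) :
    ∑ a, ∑ i, ψ x a i * linSpin E φ x a i - ∑ a, ∑ i, φ x a i * linSpin E ψ x a i
      = ∑ a, pd a (fun y => spinCurrent E φ ψ y a) x := by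
  have hd := h.det_ne x hx
  have dφ : ∀ b j, DifferentiableAt ℝ (fun y => φ y b j) x :=
    fun b j => h.diffAt hx (component_contDiffOn hφ b j)
  have dψ : ∀ b j, DifferentiableAt ℝ (fun y => ψ y b j) x :=
    fun b j => h.diffAt hx (component_contDiffOn hψ b j)
  have dE : ∀ b j, DifferentiableAt ℝ (fun y => E y b j) x :=
    fun b j => h.diffAt hx (h.comp b j)
  have df : ∀ b j, DifferentiableAt ℝ (fun y => frameV E φ y b j) x :=
    fun b j => h.diffAt hx (h.contDiffOn_frameV hφ b j)
  have dg : ∀ b j, DifferentiableAt ℝ (fun y => frameV E ψ y b j) x :=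
    fun b j => h.diffAt hx (h.contDiffOn_frameV hψ b j)
  -- contraction of a covector that is given in the coframe with a vector
  have lhs : ∀ (χ : TField ℂ) (S : Fin 3 → Fin 3 → ℂ),
      ∑ a, ∑ i, χ x a i * ∑ n, SelfdualGravity.invE E x n a * S n i
        = ∑ n, ∑ i, frameV E χ x n i * S n i := by
    intro χ S
    simp only [frameV, Fin.sum_univ_three]; ring
  have s1 : ∀ (χ : TField ℂ) k, ∑ a, pd a (fun y => χ y a k) x = ∑ n, frameD E χ x n n k := by
    intro χ k
    have e : ∑ n, frameD E χ x n n k = ∑ a, ∑ b, (∑ n, E x a n * SelfdualGravity.invE E x n b)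
        * pd a (fun y => χ y b k) x := by
      simp only [frameD, Fin.sum_univ_three]; ring
    rw [e]
    simp only [sum_E_mul_invE hd, ite_mul, one_mul, zero_mul, Finset.sum_ite_eq, Finset.mem_univ,
      if_true]
  have s3 : ∀ {χ : TField ℂ}, ContDiffOn ℝ ∞ χ U → ∀ k m j,
      ∑ a, E x a k * pd a (fun y => frameV E χ y m j) x
        = frameD E χ x k m j - ∑ n, frameD E E x k m n * frameV E χ x n j := by
    intro χ hχ k m j
    simp only [h.pd_frameV hχ hx, frameD]
    generalize frameV E χ x = v
    simp only [Fin.sum_univ_three]; ring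
  have s2 : ∀ {χ θ : TField ℂ}, ContDiffOn ℝ ∞ χ U → ∀ k m j,
      ∑ a, θ x a k * pd a (fun y => frameV E χ y m j) x
        = ∑ l, frameV E θ x l k *
          (frameD E χ x l m j - ∑ n, frameD E E x l m n * frameV E χ x n j) := by
    intro χ θ hχ k m j
    simp only [← s3 hχ, ← sum_E_mul_frameV hd θ]
    simp only [Fin.sum_univ_three]; ring
  have rhs : ∑ a, pd a (fun y => spinCurrent E φ ψ y a) x
      = 1 / 2 * ∑ k, ∑ j, ∑ m, eps ℂ k j m * (
      (∑ a, pd a (fun y => ψ y a k) x) * frameV E φ x m j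
        + (∑ a, ψ x a k * pd a (fun y => frameV E φ y m j) x)
      - (∑ a, pd a (fun y => E y a k) x) * (∑ n, frameV E ψ x m n * frameV E φ x n j)
      - (∑ n, ((∑ a, E x a k * pd a (fun y => frameV E ψ y m n) x) * frameV E φ x n j
          + frameV E ψ x m n * (∑ a, E x a k * pd a (fun y => frameV E φ y n j) x)))
      - ((∑ a, pd a (fun y => φ y a k) x) * frameV E ψ x m j
        + (∑ a, φ x a k * pd a (fun y => frameV E ψ y m j) x))
      + (∑ a, pd a (fun y => E y a k) x) * (∑ n, frameV E φ x m n * frameV E ψ x n j)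
      + (∑ n, ((∑ a, E x a k * pd a (fun y => frameV E φ y m n) x) * frameV E ψ x n j
          + frameV E φ x m n * (∑ a, E x a k * pd a (fun y => frameV E ψ y n j) x)))) := by
    simp only [spinCurrent]
    simp (disch := fun_prop) only [pd_sum, pd_mul, pd_add, pd_sub, pd_const, zero_mul, zero_add]
    have swap : ∀ (e : Fin 3 → Fin 3 → Fin 3 → ℂ) (X : Fin 3 → Fin 3 → Fin 3 → Fin 3 → ℂ),
        ∑ a, 1 / 2 * ∑ k, ∑ j, ∑ m, e k j m * X a k j m
        = 1 / 2 * ∑ k, ∑ j, ∑ m, e k j m * ∑ a, X a k j m := by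
      intro e X
      simp only [Fin.sum_univ_three]; ring
    refine (swap (eps ℂ) _).trans (congrArg _ ?_)
    refine Finset.sum_congr rfl fun k _ => Finset.sum_congr rfl fun j _ =>
      Finset.sum_congr rfl fun m _ => congrArg _ ?_
    simp only [Fin.sum_univ_three]
    ring
  rw [rhs]
  simp only [s1, s3 hφ, s3 hψ]
  simp only [s2 hφ, s2 hψ]
  rw [← spin_symm_algebra]
  simp only [linSpin, lhs]

end Triad

/-! ### Variations of a triad -/

theorem TestField.contDiffOn {𝕜 : Type} [RCLike 𝕜] {U : Set Pt} {φ : TField 𝕜}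
    (hφ : TestField U φ) : ContDiffOn ℝ ∞ φ U :=
  contDiffOn_pi.2 fun a => contDiffOn_pi.2 fun i => (hφ a i).1.contDiffOn

section Variation

variable {U : Set Pt} {sE : Pt → ℝ} {E : TField ℂ} (h : Triad U sE E) {φ : TField ℂ}
include h

variable {P : Type*} [NormedAddCommGroup P] [NormedSpace ℝ P] (c : P → ℂ)

/-- The parameters and points for which a variation of a triad is nondegenerate. -/
def variationDomain (U : Set Pt) (E φ : TField ℂ) (c : P → ℂ) : Set (P × Pt) :=
  {p | p.2 ∈ U ∧ detE (E + c p.1 • φ) p.2 ≠ 0}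

omit h in
theorem jointSmooth_variation {u : TField ℂ} (hu : ContDiffOn ℝ ∞ u U) (hφ : ContDiffOn ℝ ∞ φ U)
    (hc : ContDiff ℝ ∞ c) (a i : Fin 3) :
    JointSmooth (univ ×ˢ U) (fun (s : P) x => (u + c s • φ) x a i) := by
  have h1 : JointSmooth (univ ×ˢ U) (fun (s : P) x => u x a i) :=
    jointSmooth_const (component_contDiffOn hu a i) univ
  have h2 : JointSmooth (univ ×ˢ U) (fun (s : P) x => φ x a i) :=
    jointSmooth_const (component_contDiffOn hφ a i) univ
  have h3 : JointSmooth (univ ×ˢ U) (fun (s : P) (_ : Pt) => c s) :=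
    (hc.comp contDiff_fst).contDiffOn
  exact h1.add (h3.mul h2)

theorem Triad.variation (hφ : ContDiffOn ℝ ∞ φ U) (hc : ContDiff ℝ ∞ c) :
    TriadFamily (variationDomain U E φ c) sE (fun s => E + c s • φ) := by
  have h1 := jointSmooth_variation c h.smooth hφ hc
  have hsub : variationDomain U E φ c ⊆ univ ×ˢ U := fun p hp => ⟨trivial, hp.1⟩
  refine ⟨?_, fun a i => (h1 a i).mono hsub, fun s x hx => hx.2, fun s x hx => h.sign x hx.1⟩
  have hd : JointSmooth (univ ×ˢ U) (fun (s : P) x => SelfdualGravity.detE (E + c s • φ) x) := by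
    simp only [detE_eq]
    have h3 : ∀ a b d i j k : Fin 3, JointSmooth (univ ×ˢ U) (fun (s : P) x =>
        (E + c s • φ) x a i * (E + c s • φ) x b j * (E + c s • φ) x d k) :=
      fun a b d i j k => ((h1 a i).mul (h1 b j)).mul (h1 d k)
    exact (((((h3 _ _ _ _ _ _).sub (h3 _ _ _ _ _ _)).sub (h3 _ _ _ _ _ _)).add
      (h3 _ _ _ _ _ _)).add (h3 _ _ _ _ _ _)).sub (h3 _ _ _ _ _ _)
  have := hd.continuousOn.isOpen_inter_preimage (isOpen_univ.prod h.isOpen)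
    (isOpen_compl_singleton (x := (0 : ℂ)))
  have e : variationDomain U E φ c = univ ×ˢ U ∩
      (fun p : P × Pt => SelfdualGravity.detE (E + c p.1 • φ) p.2) ⁻¹' {0}ᶜ :=
    Set.ext fun p => ⟨fun hp => ⟨⟨trivial, hp.1⟩, hp.2⟩, fun hp => ⟨hp.1.2, hp.2⟩⟩
  rw [e]
  exact this

omit [NormedAddCommGroup P] [NormedSpace ℝ P] in
theorem mem_variationDomain {s : P} (hs : c s = 0) {x : Pt} (hx : x ∈ U) :
    (s, x) ∈ variationDomain U E φ c := by
  refine ⟨hx, ?_⟩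
  simpa [hs] using h.det_ne x hx

omit h in
theorem velocity_variation (u φ : TField ℂ) :
    velocity (fun r : ℝ => u + (r : ℂ) • φ) 0 = φ := by
  funext x a i
  have : HasDerivAt (fun r : ℝ => u x a i + (r : ℂ) * φ x a i) (φ x a i) 0 := by
    simpa using ((Complex.ofRealCLM.hasDerivAt (x := (0 : ℝ))).mul_const (φ x a i)).const_add (u x a i)
  exact this.deriv

theorem hasDerivAt_spinConnection_variation (hφ : ContDiffOn ℝ ∞ φ U) {x : Pt} (hx : x ∈ U)
    (a k : Fin 3) :
    HasDerivAt (fun r : ℝ => spinConnection sE (E + (r : ℂ) • φ) x a k)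
      (linSpin E φ x a k) 0 := by
  have hc : ContDiff ℝ ∞ (fun r : ℝ => (r : ℂ)) := Complex.ofRealCLM.contDiff
  have := (h.variation (fun r : ℝ => (r : ℂ)) hφ hc).hasDerivAt_spinConnection
    (mem_variationDomain h (fun r : ℝ => (r : ℂ)) (s := 0) Complex.ofReal_zero hx) a k
  rw [velocity_variation] at this
  simpa using this

/-! ### The symmetry of the linearised spin connection in integrated form -/

omit h in
theorem frameV_eq_zero {x : Pt} (hx : x ∉ fieldSupport φ) : frameV E φ x = 0 := by
  funext m j; simp [frameV, eq_zero_of_notMem_fieldSupport hx]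

omit h in
theorem frameD_eq_zero {x : Pt} (hx : x ∉ fieldSupport φ) : frameD E φ x = 0 := by
  funext l m j
  have : ∀ a b, pd a (fun y => φ y b j) x = 0 := fun a b =>
    pd_eq_zero_of_notMem_tsupport (notMem_fieldSupport.1 hx b j) a
  simp [frameD, this]

theorem testField_linSpin (hφ : TestField U φ) : TestField U (linSpin E φ) := fun a k =>
  isTest_of_smoothOn h.isOpen (TestField.isCompact hφ) (TestField.subset hφ)
    (h.contDiffOn_linSpin (TestField.contDiffOn hφ) a k) fun x hx => by
      simp [linSpin, frameV_eq_zero hx, frameD_eq_zero hx, frameSpin, frameVar]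

theorem isTest_spinCurrent (hφ : TestField U φ) {ψ : TField ℂ} (hψ : ContDiffOn ℝ ∞ ψ U)
    (a : Fin 3) : IsTest U (fun x => spinCurrent E φ ψ x a) := by
  have hφ' := TestField.contDiffOn hφ
  refine isTest_of_smoothOn h.isOpen (TestField.isCompact hφ) (TestField.subset hφ) ?_ ?_
  · have hE := h.comp
    have h1 := component_contDiffOn hφ'
    have h2 := component_contDiffOn hψ
    have h3 := h.contDiffOn_frameV hφ'
    have h4 := h.contDiffOn_frameV hψ
    clear hψ hφ'
    unfold spinCurrent
    refine contDiffOn_const.mul ?_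
    refine ContDiffOn.sum fun k _ => ContDiffOn.sum fun j _ => ContDiffOn.sum fun m _ =>
      contDiffOn_const.mul ((((h2 a k).mul (h3 m j)).sub ((hE a k).mul ?_)).sub
        ((h1 a k).mul (h4 m j)) |>.add ((hE a k).mul ?_))
    · exact ContDiffOn.sum fun n _ => (h4 m n).mul (h3 n j)
    · exact ContDiffOn.sum fun n _ => (h3 m n).mul (h4 n j)
  · intro x hx
    simp [spinCurrent, frameV_eq_zero hx, eq_zero_of_notMem_fieldSupport hx]

/-- The linearised spin connection is symmetric with respect to the pairing of fields: it is a
second functional derivative. -/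
theorem pairing_linSpin (hφ : TestField U φ) {ψ : TField ℂ} (hψ : ContDiffOn ℝ ∞ ψ U) :
    pairing U ψ (linSpin E φ) = pairing U (linSpin E ψ) φ := by
  have hψ' : ContDiffOn ℝ ∞ (linSpin E ψ) U :=
    contDiffOn_pi.2 fun a => contDiffOn_pi.2 fun i => h.contDiffOn_linSpin hψ a i
  rw [← sub_eq_zero, pairing, pairing, ← integral_sub
    (integrableOn_pairing h.isOpen hψ.continuousOn (testField_linSpin h hφ))
    (integrableOn_pairing h.isOpen hψ'.continuousOn hφ)]
  rw [← IsTest.integral_div h.isOpen (isTest_spinCurrent h hφ hψ)]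
  refine setIntegral_congr_fun h.isOpen.measurableSet fun x hx => ?_
  simp only [← h.spin_symm (TestField.contDiffOn hφ) hψ hx]
  simp only [mul_comm]

end Variation

/-! ### The Poisson bracket of `K` and `Ẽ` -/

theorem linSpin_smul {U : Set Pt} (hU : IsOpen U) (E : TField ℂ) {φ : TField ℂ}
    (hφ : ContDiffOn ℝ ∞ φ U) (c : ℂ) {x : Pt} (hx : x ∈ U) (a k : Fin 3) :
    linSpin E (c • φ) x a k = c * linSpin E φ x a k := by
  have h1 : ∀ m j, frameV E (c • φ) x m j = c * frameV E φ x m j := fun m j => by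
    simp only [frameV, Pi.smul_apply, smul_eq_mul, Finset.mul_sum]
    exact Finset.sum_congr rfl fun _ _ => by ring
  have h2 : ∀ l m j, frameD E (c • φ) x l m j = c * frameD E φ x l m j := fun l m j => by
    have : ∀ a b, pd a (fun y => (c • φ) y b j) x = c * pd a (fun y => φ y b j) x := fun a b =>
      pd_const_mul a c (differentiableAt_of_contDiffOn hU (component_contDiffOn hφ b j) hx)
    simp only [frameD, this, Finset.mul_sum]
    exact Finset.sum_congr rfl fun _ _ => Finset.sum_congr rfl fun _ _ => by ring
  simp only [linSpin, frameSpin, frameVar, h1, h2]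
  generalize frameV E φ x = f
  generalize frameD E φ x = H
  generalize frameD E E x = C
  simp only [Fin.sum_univ_three, eps_table]
  ring

/-- The field with the single component `f` in the position `(a, i)`. -/
def singleField (a i : Fin 3) (f : Pt → ℂ) : TField ℂ := fun x b j =>
  if b = a ∧ j = i then f x else 0

theorem testField_single {U : Set Pt} {f : Pt → ℂ} (hf : IsTest U f) (a i : Fin 3) :
    TestField U (singleField a i f) := by
  intro b j
  by_cases hb : b = a ∧ j = i
  · simpa only [singleField, hb, and_self, if_true] using hf
  · simpa only [singleField, hb, if_false] using isTest_zero

theorem pairing_single (U : Set Pt) (a i : Fin 3) (f : Pt → ℂ) (φ : TField ℂ) :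
    pairing U (singleField a i f) φ = ∫ x in U, f x * φ x a i := by
  rw [pairing]
  congr 1; ext x
  rw [Finset.sum_eq_single a, Finset.sum_eq_single i]
  · simp [singleField]
  · intro j _ hj; simp [singleField, hj]
  · simp
  · intro b _ hb; simp [singleField, hb]
  · simp

/-- The brackets of `K` and `Ẽ` are canonical. Only the derivatives `δK/δA = 1/i` and `δẼ/δẼ = 1`
contribute, as `Ẽ` does not depend on `A`; the derivative of `K` with respect to `Ẽ`, which exists
by the symmetry of the linearised spin connection, drops out. -/
theorem hasPoissonBracket_extrinsicK {U : Set Pt} {sE : Pt → ℝ} {A E : TField ℂ}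
    (h : Triad U sE E) (hA : ContDiffOn ℝ ∞ A U) (κ : ℝ) (lam : ℂ) (a i b j : Fin 3)
    {f g : Pt → ℂ} (hf : IsTest U f) (hg : IsTest U g) :
    HasPoissonBracket (Complex.I * κ / (2 * lam)) U
      (fun A' E' => ∫ x in U, f x * extrinsicK sE A' E' x a i)
      (fun _ E' => ∫ y in U, g y * E' y b j) A E
      (κ / (2 * lam) * kron i j * kron a b * ∫ x in U, f x * g x) := by
  have hU := h.isOpen
  have hf0 : ∀ x, x ∉ tsupport f → f x = 0 := fun x hx => image_eq_zero_of_notMem_tsupport hx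
  have hg0 : ∀ x, x ∉ tsupport g → g x = 0 := fun x hx => image_eq_zero_of_notMem_tsupport hx
  have hopen : IsOpen ((univ : Set ℂ) ×ˢ U) := isOpen_univ.prod hU
  have hfI : IsTest U (fun x => f x / Complex.I) := by
    simp only [div_eq_mul_inv]
    exact hf.mul_smoothOn hU contDiffOn_const
  have hFP : ContDiffOn ℝ ∞
      (fun x c k => -(linSpin E (singleField a i f) x c k / Complex.I)) U :=
    contDiffOn_pi.2 fun c => contDiffOn_pi.2 fun k => ContDiffOn.neg <| ContDiffOn.div_const
      (h.contDiffOn_linSpin (TestField.contDiffOn (testField_single hf a i)) c k) _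
  refine ⟨singleField a i (fun x => f x / Complex.I),
    fun x c k => -(linSpin E (singleField a i f) x c k / Complex.I), 0, singleField b j g,
    ?_, ?_, ?_, ?_, ?_⟩
  · refine hasFunctionalDeriv_of_compact hU (h := fun A' x => f x * extrinsicK sE A' E x a i)
      hf.2.1 hf.2.2 (fun φ hφ => ⟨univ ×ˢ U, hopen, fun x hx => ⟨trivial, hx⟩, ?_⟩)
      (fun u' x _ hx => by simp [hf0 x hx]) ?_ ?_
    · have h1 := jointSmooth_variation (fun s : ℂ => s) hA (TestField.contDiffOn hφ) contDiff_id a i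
      simp only [extrinsicK, div_eq_mul_inv]
      exact (jointSmooth_const hf.1.contDiffOn univ).mul
        ((h1.sub (jointSmooth_const (h.spinConnection a i) univ)).mul (jointSmooth_of_const _))
    · exact (TestField.contDiffOn (testField_single hfI a i)).continuousOn
    · intro φ hφ
      rw [pairing_single]
      refine setIntegral_congr_fun hU.measurableSet fun x _ => ?_
      have : HasDerivAt (fun r : ℝ => f x * extrinsicK sE (A + (r : ℂ) • φ) E x a i)
          (f x * (φ x a i / Complex.I)) 0 := by
        refine HasDerivAt.const_mul _ (HasDerivAt.div_const ?_ _)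
        refine HasDerivAt.sub_const _ ?_
        simpa using ((Complex.ofRealCLM.hasDerivAt (x := (0 : ℝ))).mul_const
          (φ x a i)).const_add (A x a i)
      refine this.deriv.trans ?_
      ring
  · refine hasFunctionalDeriv_of_compact hU (h := fun E' x => f x * extrinsicK sE A E' x a i)
      hf.2.1 hf.2.2 (fun φ hφ => ⟨variationDomain U E φ (fun s : ℂ => s),
        (h.variation (fun s : ℂ => s) (TestField.contDiffOn hφ) contDiff_id).isOpen,
        fun x hx => mem_variationDomain h (fun s : ℂ => s) rfl hx, ?_⟩)
      (fun u' x _ hx => by simp [hf0 x hx]) ?_ ?_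
    · have h1 := (h.variation (fun s : ℂ => s) (TestField.contDiffOn hφ)
        contDiff_id).spinConnection a i
      have hsub : variationDomain U E φ (fun s : ℂ => s) ⊆ univ ×ˢ U :=
        fun p hp => ⟨trivial, hp.1⟩
      simp only [extrinsicK, div_eq_mul_inv]
      exact ((jointSmooth_const hf.1.contDiffOn univ).mono hsub).mul
        ((((jointSmooth_const (component_contDiffOn hA a i) univ).mono hsub).sub h1).mul
          (jointSmooth_of_const _))
    · exact hFP.continuousOn
    · intro φ hφ
      have h2 : pairing U (fun x c k => -(linSpin E (singleField a i f) x c k / Complex.I)) φ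
          = pairing U (linSpin E (singleField a i f)) ((-1 / Complex.I) • φ) := by
        simp only [pairing]
        refine setIntegral_congr_fun hU.measurableSet fun x _ => ?_
        refine Finset.sum_congr rfl fun c _ => Finset.sum_congr rfl fun k _ => ?_
        simp only [Pi.smul_apply, smul_eq_mul]
        ring
      rw [h2, ← pairing_linSpin h (TestField.smul hφ _)
        (TestField.contDiffOn (testField_single hf a i)), pairing_single]
      refine setIntegral_congr_fun hU.measurableSet fun x hx => ?_
      have hφ' := TestField.contDiffOn hφ
      have h3 : linSpin E ((-1 / Complex.I) • φ) x a i = -1 / Complex.I * linSpin E φ x a i := by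
        rw [linSpin_smul h.isOpen E hφ' _ hx]
      have : HasDerivAt (fun r : ℝ => f x * extrinsicK sE A (E + (r : ℂ) • φ) x a i)
          (f x * (-(linSpin E φ x a i) / Complex.I)) 0 :=
        HasDerivAt.const_mul _ (HasDerivAt.div_const
          ((hasDerivAt_spinConnection_variation h hφ' hx a i).const_sub _) _)
      refine this.deriv.trans ?_
      simp only [h3]
      ring
  · refine hasFunctionalDeriv_of_compact hU (h := fun _ x => g x * E x b j)
      hg.2.1 hg.2.2 (fun φ hφ => ⟨univ ×ˢ U, hopen, fun x hx => ⟨trivial, hx⟩, ?_⟩)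
      (fun u' x _ hx => by simp [hg0 x hx]) continuousOn_const ?_
    · exact (jointSmooth_const hg.1.contDiffOn univ).mul (jointSmooth_const (h.comp b j) univ)
    · intro φ _
      simp [firstVar, pairing]
  · refine hasFunctionalDeriv_of_compact hU (h := fun E' x => g x * E' x b j)
      hg.2.1 hg.2.2 (fun φ hφ => ⟨univ ×ˢ U, hopen, fun x hx => ⟨trivial, hx⟩, ?_⟩)
      (fun u' x _ hx => by simp [hg0 x hx]) ?_ ?_
    · exact (jointSmooth_const hg.1.contDiffOn univ).mul
        (jointSmooth_variation (fun s : ℂ => s) h.smooth (TestField.contDiffOn hφ) contDiff_id b j)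
    · exact (TestField.contDiffOn (testField_single hg b j)).continuousOn
    · intro φ hφ
      rw [pairing_single]
      refine setIntegral_congr_fun hU.measurableSet fun x _ => ?_
      have : HasDerivAt (fun r : ℝ => g x * (E + (r : ℂ) • φ) x b j) (g x * φ x b j) 0 := by
        refine HasDerivAt.const_mul _ ?_
        simpa using ((Complex.ofRealCLM.hasDerivAt (x := (0 : ℝ))).mul_const
          (φ x b j)).const_add (E x b j)
      exact this.deriv
  · have h0 : ∀ W : TField ℂ, pairing U W 0 = 0 := fun W => by simp [pairing]
    rw [h0, sub_zero, pairing_single]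
    by_cases hab : a = b ∧ i = j
    · obtain ⟨rfl, rfl⟩ := hab
      simp only [singleField, kron, if_true, and_self, mul_one]
      rw [← integral_const_mul, ← integral_const_mul]
      refine setIntegral_congr_fun hU.measurableSet fun x _ => ?_
      field_simp
    · have e1 : kron i j * kron a b = 0 := by
        rw [kron, kron]
        rcases not_and_or.1 hab with h' | h' <;> simp [h']
      rw [mul_assoc (_ / _) (kron i j), e1]
      simp [singleField, hab]

/-! ### The complex square root -/

/-- The square root of `RCLike` is the principal branch, hence smooth off the nonpositive reals. -/
theorem sqrt_eq_exp_log {z : ℂ} (hz : z ≠ 0) :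
    RCLike.sqrt z = Complex.exp (Complex.log z / 2) := by
  rw [RCLike.sqrt_complex, _root_.sqrt_eq_exp hz]

theorem sqrt_ne_zero {z : ℂ} (hz : z ≠ 0) : RCLike.sqrt z ≠ 0 := by
  rw [sqrt_eq_exp_log hz]
  exact Complex.exp_ne_zero _

theorem sqrt_mul_self {z : ℂ} (hz : z ≠ 0) : RCLike.sqrt z * RCLike.sqrt z = z := by
  rw [sqrt_eq_exp_log hz, ← Complex.exp_add, add_halves, Complex.exp_log hz]

theorem contDiffAt_sqrt {z : ℂ} (hz : z ∈ Complex.slitPlane) :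
    ContDiffAt ℂ ∞ (RCLike.sqrt : ℂ → ℂ) z := by
  have h : ContDiffAt ℂ ∞ (fun z => Complex.exp (Complex.log z / 2)) z :=
    ((Complex.contDiffAt_log hz).div_const 2).cexp
  refine h.congr_of_eventuallyEq ?_
  filter_upwards [isOpen_compl_singleton.mem_nhds (Complex.slitPlane_ne_zero hz)] with w hw
  exact sqrt_eq_exp_log hw

theorem JointSmooth.sqrt {P : Type*} [NormedAddCommGroup P] [NormedSpace ℝ P] {O : Set (P × Pt)}
    {f : P → Pt → ℂ} (hf : JointSmooth O f) (h : ∀ s x, (s, x) ∈ O → f s x ∈ Complex.slitPlane) :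
    JointSmooth O (fun s x => RCLike.sqrt (f s x)) := fun p hp =>
  ContDiffAt.comp_contDiffWithinAt (g := (RCLike.sqrt : ℂ → ℂ)) (f := fun p : P × Pt => f p.1 p.2) p
    ((contDiffAt_sqrt (h p.1 p.2 hp)).restrict_scalars ℝ) (hf p hp)

/-! ### The selfdual Hamiltonian as a function of first jets -/

/-- Values of a field and of its first derivatives at a point. -/
abbrev Jet : Type := (Fin 3 → Fin 3 → ℂ) × (Fin 3 → Fin 3 → Fin 3 → ℂ)

/-- The first jet of a field at a point. -/
def jet (u : TField ℂ) (x : Pt) : Jet := (u x, fun a b k => pd a (fun y => u y b k) x)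

/-- The curvature as a function of the jet of the connection. -/
def jetCurvature (p : Jet) (a b k : Fin 3) : ℂ :=
  p.2 a b k - p.2 b a k + ∑ m, ∑ n, eps ℂ m n k * p.1 a m * p.1 b n

/-- The density of the selfdual Hamiltonian as a function of the jets of connection and triad;
the remaining arguments are the values of lapse, shift, multiplier and signs at the point. -/
def sdSymbol (κ : ℝ) (lam n : ℂ) (v l : Fin 3 → ℂ) (s s' : ℂ) (p : Jet × Jet) : ℂ :=
  n * (-(lam * s / (RCLike.sqrt (s' * (Matrix.of p.2.1).det) * κ * s')) *
    ∑ i, ∑ j, ∑ k, ∑ a, ∑ b, eps ℂ k i j * p.2.1 a i * p.2.1 b j * jetCurvature p.1 a b k)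
  + ∑ a, v a * (2 * lam / (Complex.I * κ) * ∑ b, ∑ i, p.2.1 b i * jetCurvature p.1 a b i)
  + ∑ i, l i * (2 * lam / (Complex.I * κ) * ∑ a, (p.2.2 a a i
    + ∑ j, ∑ k, eps ℂ i j k * p.1.1 a j * p.2.1 a k))

theorem selfdualTotal_eq_symbol (κ : ℝ) (lam : ℂ) (se sE : Pt → ℝ) (A E : TField ℂ) (N : Pt → ℂ)
    (Nv Λ : Pt → Fin 3 → ℂ) (x : Pt) : selfdualTotal κ lam se sE A E N Nv Λ x
      = sdSymbol κ lam (N x) (Nv x) (Λ x) (se x) (sE x) (jet A x, jet E x) := rfl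

theorem differentiableAt_sdSymbol (κ : ℝ) (lam n : ℂ) (v l : Fin 3 → ℂ) (s s' : ℂ) {p : Jet × Jet}
    (hp : s' * (Matrix.of p.2.1).det ∈ Complex.slitPlane) :
    DifferentiableAt ℂ (sdSymbol κ lam n v l s s') p := by
  have h0 : DifferentiableAt ℂ (fun p : Jet × Jet => (Matrix.of p.2.1).det) p := by
    simp only [Matrix.det_fin_three, Matrix.of_apply]
    fun_prop
  have h1 : DifferentiableAt ℂ
      (fun p : Jet × Jet => (RCLike.sqrt (s' * (Matrix.of p.2.1).det))⁻¹) p := by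
    refine DifferentiableAt.inv ?_ (sqrt_ne_zero (Complex.slitPlane_ne_zero hp))
    exact DifferentiableAt.comp (f := fun p : Jet × Jet => s' * (Matrix.of p.2.1).det) p
      ((contDiffAt_sqrt hp).differentiableAt (by simp)) (h0.const_mul s')
  have key : ∀ f : Jet × Jet → ℂ, DifferentiableAt ℂ f p → DifferentiableAt ℂ (fun p : Jet × Jet =>
      n * (-(lam * s * (f p * (κ : ℂ)⁻¹ * s'⁻¹)) *
        ∑ i, ∑ j, ∑ k, ∑ a, ∑ b, eps ℂ k i j * p.2.1 a i * p.2.1 b j * jetCurvature p.1 a b k)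
      + ∑ a, v a * (2 * lam * (Complex.I * κ)⁻¹ * ∑ b, ∑ i, p.2.1 b i * jetCurvature p.1 a b i)
      + ∑ i, l i * (2 * lam * (Complex.I * κ)⁻¹ * ∑ a, (p.2.2 a a i
        + ∑ j, ∑ k, eps ℂ i j k * p.1.1 a j * p.2.1 a k))) p := by
    intro f hf
    unfold jetCurvature
    fun_prop
  unfold sdSymbol
  simp only [div_eq_mul_inv, mul_inv] at key ⊢
  exact key _ h1

/-- The linearisation of the density of the selfdual Hamiltonian at `(A, E)`, in the direction
`(α, ε)`. -/
def sdLin (κ : ℝ) (lam : ℂ) (se sE : Pt → ℝ) (A E : TField ℂ) (N : Pt → ℂ)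
    (Nv Λ : Pt → Fin 3 → ℂ) (α ε : TField ℂ) (x : Pt) : ℂ :=
  fderiv ℂ (sdSymbol κ lam (N x) (Nv x) (Λ x) (se x) (sE x)) (jet A x, jet E x)
    (jet α x, jet ε x)

theorem hasDerivAt_jet {O : Set (ℝ × Pt)} (hO : IsOpen O) {u : ℝ → TField ℂ}
    (hu : ∀ a i, JointSmooth O (fun r x => u r x a i)) {r : ℝ} {x : Pt} (hx : (r, x) ∈ O) :
    HasDerivAt (fun ρ => jet (u ρ) x) (jet (velocity u r) x) r := by
  refine HasDerivAt.prodMk ?_ ?_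
  · exact hasDerivAt_pi.2 fun a => hasDerivAt_pi.2 fun i => (hu a i).hasDerivAt hO hx
  · exact hasDerivAt_pi.2 fun a => hasDerivAt_pi.2 fun b => hasDerivAt_pi.2 fun i =>
      (hu b i).hasDerivAt_pd hO hx a

/-- The chain rule for the density of the selfdual Hamiltonian. -/
theorem hasDerivAt_selfdualTotal (κ : ℝ) (lam : ℂ) (se sE : Pt → ℝ) {O : Set (ℝ × Pt)}
    (hO : IsOpen O) {A E : ℝ → TField ℂ} (hA : ∀ a i, JointSmooth O (fun r x => A r x a i))
    (hE : ∀ a i, JointSmooth O (fun r x => E r x a i)) {r : ℝ} {x : Pt} (hx : (r, x) ∈ O)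
    (hq : detq sE (E r) x ∈ Complex.slitPlane) (N : Pt → ℂ) (Nv Λ : Pt → Fin 3 → ℂ) :
    HasDerivAt (fun ρ => selfdualTotal κ lam se sE (A ρ) (E ρ) N Nv Λ x)
      (sdLin κ lam se sE (A r) (E r) N Nv Λ (velocity A r) (velocity E r) x) r := by
  have h1 := ((differentiableAt_sdSymbol κ lam (N x) (Nv x) (Λ x) (se x) (sE x)
    (p := (jet (A r) x, jet (E r) x)) hq).hasFDerivAt.restrictScalars ℝ)
  exact h1.comp_hasDerivAt (f := fun ρ => (jet (A ρ) x, jet (E ρ) x)) r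
    ((hasDerivAt_jet hO hA hx).prodMk (hasDerivAt_jet hO hE hx))

theorem jet_zero (x : Pt) : jet 0 x = 0 := by
  refine Prod.ext rfl ?_
  funext a b k
  exact pd_const a (0 : ℂ)

theorem jet_add_smul {U : Set Pt} (hU : IsOpen U) {u v : TField ℂ} (hu : ContDiffOn ℝ ∞ u U)
    (hv : ContDiffOn ℝ ∞ v U) (c : ℂ) {x : Pt} (hx : x ∈ U) :
    jet (u + c • v) x = jet u x + c • jet v x := by
  refine Prod.ext rfl ?_
  funext a b k
  have h1 := differentiableAt_of_contDiffOn hU (component_contDiffOn hu b k) hx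
  have h2 := differentiableAt_of_contDiffOn hU (component_contDiffOn hv b k) hx
  refine (pd_add a h1 (h2.const_mul c)).trans ?_
  rw [pd_const_mul a c h2]
  rfl

theorem jet_congr {u v : TField ℂ} {x : Pt} (h : u =ᶠ[nhds x] v) : jet u x = jet v x := by
  refine Prod.ext h.eq_of_nhds ?_
  funext a b k
  have : (fun y => u y b k) =ᶠ[nhds x] fun y => v y b k := by
    filter_upwards [h] with y hy using by rw [hy]
  simp only [jet, pd, this.fderiv_eq]

/-- Away from its support a variation does not change a field, to any order. -/
theorem eventuallyEq_of_notMem_fieldSupport {𝕜 : Type} [RCLike 𝕜] {U : Set Pt} {φ : TField 𝕜}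
    (hφ : TestField U φ) {x : Pt} (hx : x ∉ fieldSupport φ) : φ =ᶠ[nhds x] 0 := by
  filter_upwards [(TestField.isCompact hφ).isClosed.isOpen_compl.mem_nhds hx] with y hy
  funext a i
  exact eq_zero_of_notMem_fieldSupport hy a i

/-! ### Smoothness of the Hamiltonian densities along families -/

section SmoothDensities

variable {P : Type*} [NormedAddCommGroup P] [NormedSpace ℝ P] {O : Set (P × Pt)}
  {sE : Pt → ℝ} {E A : P → TField ℂ} (h : TriadFamily O sE E)
  (hA : ∀ a i, JointSmooth O (fun s x => A s x a i))
  (hq : ∀ s x, (s, x) ∈ O → detq sE (E s) x ∈ Complex.slitPlane)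
include h hA

theorem jointSmooth_curvature (a b k : Fin 3) :
    JointSmooth O (fun s x => curvature (A s) x a b k) :=
  (((hA b k).pd h.isOpen a).sub ((hA a k).pd h.isOpen b)).add <| JointSmooth.sum fun _ =>
    JointSmooth.sum fun _ => ((JointSmooth.const_mul _ (hA _ _)).mul (hA _ _))

theorem jointSmooth_gauss (κ : ℝ) (lam : ℂ) (i : Fin 3) :
    JointSmooth O (fun s x => gauss κ lam (A s) (E s) x i) :=
  JointSmooth.const_mul _ <| JointSmooth.sum fun a => ((h.smooth a i).pd h.isOpen a).add <|
    JointSmooth.sum fun _ => JointSmooth.sum fun _ =>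
      (JointSmooth.const_mul _ (hA _ _)).mul (h.smooth _ _)

theorem jointSmooth_diffeo (κ : ℝ) (lam : ℂ) (a : Fin 3) :
    JointSmooth O (fun s x => diffeo κ lam (A s) (E s) x a) :=
  JointSmooth.const_mul _ <| JointSmooth.sum fun _ => JointSmooth.sum fun _ =>
    (h.smooth _ _).mul (jointSmooth_curvature h hA _ _ _)

theorem jointSmooth_KE (b a : Fin 3) : JointSmooth O (fun s x => KE (A s) (E s) x b a) :=
  JointSmooth.sum fun _ => (hA _ _).mul (h.smooth _ _)

theorem jointSmooth_trKE : JointSmooth O (fun s x => trKE (A s) (E s) x) :=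
  JointSmooth.sum fun _ => jointSmooth_KE h hA _ _

theorem jointSmooth_admGauss (κ : ℝ) (i : Fin 3) :
    JointSmooth O (fun s x => admGauss κ (A s) (E s) x i) :=
  JointSmooth.const_mul _ <| JointSmooth.sum fun _ => JointSmooth.sum fun _ =>
    JointSmooth.const_mul _ <| JointSmooth.sum fun _ => (hA _ _).mul (h.smooth _ _)

theorem jointSmooth_admDiffeo (κ : ℝ) (a : Fin 3) :
    JointSmooth O (fun s x => admDiffeo κ sE (A s) (E s) x a) := by
  have hT : ∀ b a : Fin 3, JointSmooth O (fun s y =>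
      KE (A s) (E s) y b a - if b = a then trKE (A s) (E s) y else 0) := by
    intro b a
    refine (jointSmooth_KE h hA b a).sub ?_
    by_cases hab : b = a
    · simpa only [hab, if_true] using jointSmooth_trKE h hA
    · simpa only [hab, if_false] using jointSmooth_of_const 0
  exact JointSmooth.const_mul _ <| JointSmooth.sum fun b => ((hT _ _).pd h.isOpen _).add <|
    JointSmooth.sum fun _ => (((h.christoffel _ _ _).mul (hT _ _)).sub
      ((h.christoffel _ _ _).mul (hT _ _))).sub ((h.christoffel _ _ _).mul (hT _ _))

include hq

omit hA in
theorem jointSmooth_invSqrt :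
    JointSmooth O (fun s x => (RCLike.sqrt (detq sE (E s) x))⁻¹) :=
  (h.detq.sqrt hq).inv fun _ _ hx => sqrt_ne_zero (h.detq_ne hx)

theorem jointSmooth_hamilton (κ : ℝ) (lam : ℂ) {se : Pt → ℝ}
    (hse : JointSmooth O (fun _ x => ((se x : ℝ) : ℂ))) :
    JointSmooth O (fun s x => hamilton κ lam se sE (A s) (E s) x) := by
  simp only [hamilton, div_eq_mul_inv, mul_inv]
  refine JointSmooth.mul (JointSmooth.neg (((jointSmooth_of_const _).mul hse).mul
    (((jointSmooth_invSqrt h hq).mul (jointSmooth_of_const _)).mul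
      (h.smooth_sign.inv fun _ _ hx => ?_)))) ?_
  · exact_mod_cast h.sign_ne hx
  · exact JointSmooth.sum fun _ => JointSmooth.sum fun _ => JointSmooth.sum fun _ =>
      JointSmooth.sum fun _ => JointSmooth.sum fun _ =>
        ((JointSmooth.const_mul _ (h.smooth _ _)).mul (h.smooth _ _)).mul
          (jointSmooth_curvature h hA _ _ _)

theorem jointSmooth_admHamilton (κ : ℝ) :
    JointSmooth O (fun s x => admHamilton κ sE (A s) (E s) x) := by
  simp only [admHamilton, mul_inv]
  exact (JointSmooth.const_mul _ (jointSmooth_invSqrt h hq)).mul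
    (((h.detq.mul h.scalarCurvature).add ((jointSmooth_trKE h hA).mul (jointSmooth_trKE h hA))).sub
      (JointSmooth.sum fun _ => JointSmooth.sum fun _ =>
        (jointSmooth_KE h hA _ _).mul (jointSmooth_KE h hA _ _)))

theorem jointSmooth_admTotal (κ : ℝ) {N : Pt → ℂ} {Nv Ω : Pt → Fin 3 → ℂ}
    (hN : JointSmooth O (fun _ x => N x)) (hNv : ∀ a, JointSmooth O (fun _ x => Nv x a))
    (hΩ : ∀ i, JointSmooth O (fun _ x => Ω x i)) :
    JointSmooth O (fun s x => admTotal κ sE (A s) (E s) N Nv Ω x) :=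
  ((hN.mul (jointSmooth_admHamilton h hA hq κ)).add
    (JointSmooth.sum fun a => (hNv a).mul (jointSmooth_admDiffeo h hA κ a))).add
    (JointSmooth.sum fun i => (hΩ i).mul (jointSmooth_admGauss h hA κ i))

theorem jointSmooth_selfdualTotal (κ : ℝ) (lam : ℂ) {se : Pt → ℝ}
    (hse : JointSmooth O (fun _ x => ((se x : ℝ) : ℂ))) {N : Pt → ℂ} {Nv Λ : Pt → Fin 3 → ℂ}
    (hN : JointSmooth O (fun _ x => N x)) (hNv : ∀ a, JointSmooth O (fun _ x => Nv x a))
    (hΛ : ∀ i, JointSmooth O (fun _ x => Λ x i)) :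
    JointSmooth O (fun s x => selfdualTotal κ lam se sE (A s) (E s) N Nv Λ x) :=
  ((hN.mul (jointSmooth_hamilton h hA hq κ lam hse)).add
    (JointSmooth.sum fun a => (hNv a).mul (jointSmooth_diffeo h hA κ lam a))).add
    (JointSmooth.sum fun i => (hΛ i).mul (jointSmooth_gauss h hA κ lam i))

end SmoothDensities

/-! ### The ADM constraints depend on the metric and on `K^i_a Ẽ^b_i` only -/

section Congruence

variable {𝕜 : Type} [RCLike 𝕜] {V : Set Pt} (hV : IsOpen V) {sE : Pt → ℝ} {K E K' E' : TField 𝕜}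
  (hd : ∀ x ∈ V, detq sE E x = detq sE E' x)
  (hm : ∀ x ∈ V, ∀ a b, metric sE E x a b = metric sE E' x a b)
  (hi : ∀ x ∈ V, ∀ a b, invMetric sE E x a b = invMetric sE E' x a b)
  (hKE : ∀ x ∈ V, ∀ b a, KE K E x b a = KE K' E' x b a)
include hV hm hi

theorem christoffel_congr {x : Pt} (hx : x ∈ V) (c a b : Fin 3) :
    christoffel sE E x c a b = christoffel sE E' x c a b := by
  have e : ∀ a b c, pd a (fun y => metric sE E y b c) x = pd a (fun y => metric sE E' y b c) x :=
    fun a b c => pd_congr a hV (fun y hy => hm y hy b c) hx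
  simp only [christoffel, e, hi x hx]

theorem scalarCurvature_congr {x : Pt} (hx : x ∈ V) :
    scalarCurvature sE E x = scalarCurvature sE E' x := by
  have e0 := fun (x : Pt) (hx : x ∈ V) => christoffel_congr hV hm hi hx
  have e : ∀ d a b c, pd d (fun y => christoffel sE E y a b c) x
      = pd d (fun y => christoffel sE E' y a b c) x :=
    fun d a b c => pd_congr d hV (fun y hy => e0 y hy a b c) hx
  simp only [scalarCurvature, ricci, e, e0 x hx, hi x hx]

include hKE

theorem admDiffeo_congr (κ : ℝ) {x : Pt} (hx : x ∈ V) (a : Fin 3) :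
    admDiffeo κ sE K E x a = admDiffeo κ sE K' E' x a := by
  have e1 : ∀ y ∈ V, trKE K E y = trKE K' E' y := fun y hy => by simp only [trKE, hKE y hy]
  have e2 : ∀ b a c, pd c (fun y => KE K E y b a - if b = a then trKE K E y else 0) x
      = pd c (fun y => KE K' E' y b a - if b = a then trKE K' E' y else 0) x :=
    fun b a c => pd_congr c hV (fun y hy => by rw [hKE y hy, e1 y hy]) hx
  simp only [admDiffeo, covDerivDensity, e2, hKE x hx, e1 x hx, christoffel_congr hV hm hi hx]

include hd

theorem admHamilton_congr (κ : ℝ) {x : Pt} (hx : x ∈ V) :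
    admHamilton κ sE K E x = admHamilton κ sE K' E' x := by
  have e1 : trKE K E x = trKE K' E' x := by simp only [trKE, hKE x hx]
  simp only [admHamilton, hd x hx, hKE x hx, e1, scalarCurvature_congr hV hm hi hx]

end Congruence

/-- The density of the total ADM Hamiltonian is local. -/
theorem admTotal_congr {𝕜 : Type} [RCLike 𝕜] (κ : ℝ) {sE : Pt → ℝ} {K E K' E' : TField 𝕜} {x : Pt}
    (hK : K =ᶠ[nhds x] K') (hE : E =ᶠ[nhds x] E') (N : Pt → 𝕜) (Nv Ω : Pt → Fin 3 → 𝕜) :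
    admTotal κ sE K E N Nv Ω x = admTotal κ sE K' E' N Nv Ω x := by
  obtain ⟨V, hV, hVo, hxV⟩ := eventually_nhds_iff.1 (hK.and hE)
  have eK : ∀ y ∈ V, K y = K' y := fun y hy => (hV y hy).1
  have eE : ∀ y ∈ V, E y = E' y := fun y hy => (hV y hy).2
  have hd : ∀ y ∈ V, detq sE E y = detq sE E' y := fun y hy => by simp only [detq, detE, eE y hy]
  have hm : ∀ y ∈ V, ∀ a b, metric sE E y a b = metric sE E' y a b := fun y hy a b => by
    simp only [metric, hd y hy, invE, eE y hy]
  have hi : ∀ y ∈ V, ∀ a b, invMetric sE E y a b = invMetric sE E' y a b := fun y hy a b => by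
    simp only [invMetric, hd y hy, eE y hy]
  have hKE : ∀ y ∈ V, ∀ b a, KE K E y b a = KE K' E' y b a := fun y hy a b => by
    simp only [KE, eE y hy, eK y hy]
  simp only [admTotal, admHamilton_congr hVo hd hm hi hKE κ hxV,
    admDiffeo_congr hVo hm hi hKE κ hxV, admGauss, eK x hxV, eE x hxV]

/-! ### Variations of the selfdual and of the ADM Hamiltonian -/

theorem TriadFamily.mono {P : Type*} [NormedAddCommGroup P] [NormedSpace ℝ P] {O O' : Set (P × Pt)}
    {sE : Pt → ℝ} {E : P → TField ℂ} (h : TriadFamily O sE E) (hO : IsOpen O') (hs : O' ⊆ O) :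
    TriadFamily O' sE E :=
  ⟨hO, fun a i => (h.smooth a i).mono hs, fun s x hx => h.det_ne s x (hs hx),
    fun s x hx => h.sign s x (hs hx)⟩

/-- The parameters and points for which a variation of a triad is nondegenerate and the principal
square root of the determinant of its metric is smooth. -/
def slitDomain {P : Type*} (U : Set Pt) (sE : Pt → ℝ) (E φ : TField ℂ) (c : P → ℂ) : Set (P × Pt) :=
  variationDomain U E φ c ∩ (fun p => detq sE (E + c p.1 • φ) p.2) ⁻¹' Complex.slitPlane

section Slit

variable {U : Set Pt} {sE : Pt → ℝ} {E : TField ℂ} (h : Triad U sE E) {φ : TField ℂ}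

theorem slitDomain_subset {P : Type*} {c : P → ℂ} : slitDomain U sE E φ c ⊆ univ ×ˢ U :=
  fun _ hp => ⟨trivial, hp.1.1⟩

include h

theorem Triad.slitVariation {P : Type*} [NormedAddCommGroup P] [NormedSpace ℝ P] {c : P → ℂ}
    (hφ : ContDiffOn ℝ ∞ φ U) (hc : ContDiff ℝ ∞ c) :
    TriadFamily (slitDomain U sE E φ c) sE (fun s => E + c s • φ) := by
  have hv := h.variation c hφ hc
  exact hv.mono (hv.detq.continuousOn.isOpen_inter_preimage hv.isOpen Complex.isOpen_slitPlane)
    inter_subset_left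

theorem mem_slitDomain {P : Type*} {c : P → ℂ} {s : P} (hs : c s = 0) {x : Pt} (hx : x ∈ U)
    (hq : detq sE E x ∈ Complex.slitPlane) : (s, x) ∈ slitDomain U sE E φ c :=
  ⟨mem_variationDomain h c hs hx, by simpa [hs] using hq⟩

end Slit

theorem testField_zero {𝕜 : Type} [RCLike 𝕜] (U : Set Pt) : TestField U (0 : TField 𝕜) :=
  fun _ _ => isTest_zero

theorem add_smul_eventuallyEq {𝕜 : Type} [RCLike 𝕜] {U : Set Pt} {φ : TField 𝕜}
    (hφ : TestField U φ) (u : TField 𝕜) (s : 𝕜) {x : Pt} (hx : x ∉ fieldSupport φ) :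
    u + s • φ =ᶠ[nhds x] u := by
  filter_upwards [eventuallyEq_of_notMem_fieldSupport hφ hx] with y hy
  simp [hy]

theorem velocity_const (u : TField ℂ) (r : ℝ) : velocity (fun _ => u) r = 0 := by
  funext x a i
  simp [velocity]

theorem contDiffOn_zero_field (U : Set Pt) : ContDiffOn ℝ ∞ (0 : TField ℂ) U :=
  contDiffOn_const (c := (0 : Fin 3 → Fin 3 → ℂ))

section Densities

variable {U : Set Pt} {sE se : Pt → ℝ} {E : TField ℂ} (h : Triad U sE E)
  (hq : ∀ x ∈ U, detq sE E x ∈ Complex.slitPlane) (hse : LocSign U se)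
  {N : Pt → ℂ} {Nv Λ : Pt → Fin 3 → ℂ} (hN : ContDiffOn ℝ ∞ N U) (hNv : ContDiffOn ℝ ∞ Nv U)
  (hΛ : ContDiffOn ℝ ∞ Λ U) {A : TField ℂ} (hA : ContDiffOn ℝ ∞ A U) (κ : ℝ) (lam : ℂ)
include h hq hN hNv hΛ hA

section Joint

variable {P : Type*} [NormedAddCommGroup P] [NormedSpace ℝ P] {c : P → ℂ} (hc : ContDiff ℝ ∞ c)
  {φ ψ : TField ℂ} (hφ : ContDiffOn ℝ ∞ φ U) (hψ : ContDiffOn ℝ ∞ ψ U)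
include hc hφ hψ

omit hq in
include hse in
theorem jointSmooth_selfdualTotal_variation :
    JointSmooth (slitDomain U sE E ψ c)
      (fun s x => selfdualTotal κ lam se sE (A + c s • φ) (E + c s • ψ) N Nv Λ x) :=
  jointSmooth_selfdualTotal (h.slitVariation hψ hc)
    (fun a i => (jointSmooth_variation c hA hφ hc a i).mono slitDomain_subset)
    (fun _ _ hx => hx.2) κ lam ((jointSmooth_const hse.contDiffOn_complex univ).mono
      slitDomain_subset) ((jointSmooth_const hN univ).mono slitDomain_subset)
    (fun a => (jointSmooth_const (contDiffOn_pi.1 hNv a) univ).mono slitDomain_subset)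
    (fun a => (jointSmooth_const (contDiffOn_pi.1 hΛ a) univ).mono slitDomain_subset)

omit hq in
theorem jointSmooth_admTotal_variation :
    JointSmooth (slitDomain U sE E ψ c)
      (fun s x => admTotal κ sE (A + c s • φ) (E + c s • ψ) N Nv Λ x) :=
  jointSmooth_admTotal (h.slitVariation hψ hc)
    (fun a i => (jointSmooth_variation c hA hφ hc a i).mono slitDomain_subset)
    (fun _ _ hx => hx.2) κ ((jointSmooth_const hN univ).mono slitDomain_subset)
    (fun a => (jointSmooth_const (contDiffOn_pi.1 hNv a) univ).mono slitDomain_subset)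
    (fun a => (jointSmooth_const (contDiffOn_pi.1 hΛ a) univ).mono slitDomain_subset)

end Joint

include hse

theorem variable_selfdual_connection :
    Variable U (fun A' x => selfdualTotal κ lam se sE A' E N Nv Λ x) A where
  smooth φ hφ := ⟨slitDomain U sE E 0 (fun s : ℂ => s),
    (h.slitVariation (contDiffOn_zero_field U) contDiff_id).isOpen,
    fun x hx => mem_slitDomain h rfl hx (hq x hx), by
      have e := jointSmooth_selfdualTotal_variation h hse hN hNv hΛ hA κ lam
        (c := fun s : ℂ => s) contDiff_id (TestField.contDiffOn hφ) (contDiffOn_zero_field U)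
      simp only [smul_zero, add_zero] at e
      exact e⟩
  isLocal φ hφ s x _ hxK := by
    rw [selfdualTotal_eq_symbol, selfdualTotal_eq_symbol,
      jet_congr (add_smul_eventuallyEq hφ A s hxK)]

theorem variable_selfdual_triad :
    Variable U (fun E' x => selfdualTotal κ lam se sE A E' N Nv Λ x) E where
  smooth φ hφ := ⟨slitDomain U sE E φ (fun s : ℂ => s),
    (h.slitVariation (TestField.contDiffOn hφ) contDiff_id).isOpen,
    fun x hx => mem_slitDomain h rfl hx (hq x hx), by
      have e := jointSmooth_selfdualTotal_variation h hse hN hNv hΛ hA κ lam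
        (c := fun s : ℂ => s) contDiff_id (contDiffOn_zero_field U) (TestField.contDiffOn hφ)
      simp only [smul_zero, add_zero] at e
      exact e⟩
  isLocal φ hφ s x _ hxK := by
    rw [selfdualTotal_eq_symbol, selfdualTotal_eq_symbol,
      jet_congr (add_smul_eventuallyEq hφ E s hxK)]

omit hse hN hNv hΛ

theorem firstVar_selfdual_connection {φ : TField ℂ} (hφ : ContDiffOn ℝ ∞ φ U) {x : Pt}
    (hx : x ∈ U) :
    firstVar (fun A' x => selfdualTotal κ lam se sE A' E N Nv Λ x) A φ x
      = sdLin κ lam se sE A E N Nv Λ φ 0 x := by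
  have h1 := hasDerivAt_selfdualTotal κ lam se sE (isOpen_univ.prod h.isOpen)
    (A := fun r : ℝ => A + (r : ℂ) • φ) (E := fun _ => E)
    (fun a i => jointSmooth_variation _ hA hφ Complex.ofRealCLM.contDiff a i)
    (fun a i => jointSmooth_const (h.comp a i) univ) (r := 0) ⟨trivial, hx⟩ (hq x hx) N Nv Λ
  rw [velocity_variation, velocity_const] at h1
  simp only [Complex.ofReal_zero, zero_smul, add_zero] at h1
  exact h1.deriv

theorem firstVar_selfdual_triad {φ : TField ℂ} (hφ : ContDiffOn ℝ ∞ φ U) {x : Pt}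
    (hx : x ∈ U) :
    firstVar (fun E' x => selfdualTotal κ lam se sE A E' N Nv Λ x) E φ x
      = sdLin κ lam se sE A E N Nv Λ 0 φ x := by
  have h1 := hasDerivAt_selfdualTotal κ lam se sE (isOpen_univ.prod h.isOpen)
    (E := fun r : ℝ => E + (r : ℂ) • φ) (A := fun _ => A)
    (fun a i => jointSmooth_const (component_contDiffOn hA a i) univ)
    (fun a i => jointSmooth_variation _ h.smooth hφ Complex.ofRealCLM.contDiff a i)
    (r := 0) ⟨trivial, hx⟩ (by simpa using hq x hx) N Nv Λ
  rw [velocity_variation, velocity_const] at h1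
  simp only [Complex.ofReal_zero, zero_smul, add_zero] at h1
  exact h1.deriv

end Densities

section SdLin

variable (κ : ℝ) (lam : ℂ) (se sE : Pt → ℝ) (A E : TField ℂ) (N : Pt → ℂ)
  (Nv Λ : Pt → Fin 3 → ℂ)

theorem sdLin_split (α ε : TField ℂ) (x : Pt) :
    sdLin κ lam se sE A E N Nv Λ α ε x
      = sdLin κ lam se sE A E N Nv Λ α 0 x + sdLin κ lam se sE A E N Nv Λ 0 ε x := by
  simp only [sdLin, jet_zero]
  rw [← map_add, Prod.mk_add_mk, add_zero, zero_add]

theorem sdLin_add_smul_left {U : Set Pt} (hU : IsOpen U) {α β : TField ℂ} (hα : ContDiffOn ℝ ∞ α U)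
    (hβ : ContDiffOn ℝ ∞ β U) (c : ℂ) {x : Pt} (hx : x ∈ U) :
    sdLin κ lam se sE A E N Nv Λ (α + c • β) 0 x
      = sdLin κ lam se sE A E N Nv Λ α 0 x + c * sdLin κ lam se sE A E N Nv Λ β 0 x := by
  simp only [sdLin, jet_zero, jet_add_smul hU hα hβ c hx]
  have e : (jet α x + c • jet β x, (0 : Jet)) = (jet α x, 0) + c • (jet β x, 0) :=
    Prod.ext rfl (by simp)
  rw [e, map_add, map_smul, smul_eq_mul]

theorem sdLin_add_smul_right {U : Set Pt} (hU : IsOpen U) {α β : TField ℂ} (hα : ContDiffOn ℝ ∞ α U)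
    (hβ : ContDiffOn ℝ ∞ β U) (c : ℂ) {x : Pt} (hx : x ∈ U) :
    sdLin κ lam se sE A E N Nv Λ 0 (α + c • β) x
      = sdLin κ lam se sE A E N Nv Λ 0 α x + c * sdLin κ lam se sE A E N Nv Λ 0 β x := by
  simp only [sdLin, jet_zero, jet_add_smul hU hα hβ c hx]
  have e : ((0 : Jet), jet α x + c • jet β x) = (0, jet α x) + c • (0, jet β x) :=
    Prod.ext (by simp) rfl
  rw [e, map_add, map_smul, smul_eq_mul]

end SdLin

/-! ### The first variation of the ADM Hamiltonian -/

/-- The first variation of the density of the complexified ADM Hamiltonian in the direction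
`(φ, ψ)`. -/
def admVar (κ : ℝ) (sE : Pt → ℝ) (N : Pt → ℂ) (Nv Ω : Pt → Fin 3 → ℂ) (K E φ ψ : TField ℂ)
    (x : Pt) : ℂ :=
  deriv (fun r : ℝ => admTotal κ sE (K + (r : ℂ) • φ) (E + (r : ℂ) • ψ) N Nv Ω x) 0

/-- The variation of `gaussVec K E` in the direction `(φ, ψ)`. -/
def gaussVar (K E φ ψ : TField ℂ) (x : Pt) (i : Fin 3) : ℂ :=
  gaussVec φ E x i + gaussVec K ψ x i

theorem hasDerivAt_line (u φ : TField ℂ) (x : Pt) (a i : Fin 3) :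
    HasDerivAt (fun r : ℝ => (u + (r : ℂ) • φ) x a i) (φ x a i) 0 := by
  simpa using ((Complex.ofRealCLM.hasDerivAt (x := (0 : ℝ))).mul_const
    (φ x a i)).const_add (u x a i)

theorem hasDerivAt_gaussVec (K E φ ψ : TField ℂ) (x : Pt) (i : Fin 3) :
    HasDerivAt (fun r : ℝ => gaussVec (K + (r : ℂ) • φ) (E + (r : ℂ) • ψ) x i)
      (gaussVar K E φ ψ x i) 0 := by
  have h := HasDerivAt.fun_sum (u := Finset.univ) fun j _ =>
    HasDerivAt.fun_sum (u := Finset.univ) fun k _ => HasDerivAt.const_mul (eps ℂ i j k) <|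
      HasDerivAt.fun_sum (u := Finset.univ) fun a _ =>
        (hasDerivAt_line K φ x a j).mul (hasDerivAt_line E ψ x a k)
  refine h.congr_deriv ?_
  simp only [gaussVar, gaussVec, Complex.ofReal_zero, zero_smul, add_zero, mul_add,
    Finset.sum_add_distrib]

theorem admTotal_add_gauss (κ : ℝ) (sE : Pt → ℝ) (N : Pt → ℂ) (Nv Ω w : Pt → Fin 3 → ℂ)
    (K E : TField ℂ) (x : Pt) : admTotal κ sE K E N Nv (Ω + w) x
      = admTotal κ sE K E N Nv Ω x + ∑ i, w x i * (2 / κ * gaussVec K E x i) := by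
  simp only [admTotal, admGauss_eq, Pi.add_apply, add_mul, Finset.sum_add_distrib]
  ring

section

variable {U : Set Pt} {sE : Pt → ℝ} {E : TField ℂ} (h : Triad U sE E)
  (hq : ∀ x ∈ U, detq sE E x ∈ Complex.slitPlane)
  {N : Pt → ℂ} {Nv Ω : Pt → Fin 3 → ℂ} (hN : ContDiffOn ℝ ∞ N U) (hNv : ContDiffOn ℝ ∞ Nv U)
  (hΩ : ContDiffOn ℝ ∞ Ω U) {K : TField ℂ} (hK : ContDiffOn ℝ ∞ K U) (κ : ℝ)
  {φ ψ : TField ℂ}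
include h hq hN hNv hΩ hK

theorem hasDerivAt_admTotal (hφ : ContDiffOn ℝ ∞ φ U) (hψ : ContDiffOn ℝ ∞ ψ U) {x : Pt}
    (hx : x ∈ U) :
    HasDerivAt (fun r : ℝ => admTotal κ sE (K + (r : ℂ) • φ) (E + (r : ℂ) • ψ) N Nv Ω x)
      (admVar κ sE N Nv Ω K E φ ψ x) 0 :=
  (jointSmooth_admTotal_variation h hN hNv hΩ hK κ Complex.ofRealCLM.contDiff hφ hψ).hasDerivAt
    (h.slitVariation hψ Complex.ofRealCLM.contDiff).isOpen
    (mem_slitDomain h Complex.ofReal_zero hx (hq x hx))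

theorem admVar_add_gauss (hφ : ContDiffOn ℝ ∞ φ U) (hψ : ContDiffOn ℝ ∞ ψ U)
    (w : Pt → Fin 3 → ℂ) {x : Pt} (hx : x ∈ U) :
    admVar κ sE N Nv (Ω + w) K E φ ψ x = admVar κ sE N Nv Ω K E φ ψ x
      + ∑ i, w x i * (2 / κ * gaussVar K E φ ψ x i) := by
  have h1 := (hasDerivAt_admTotal h hq hN hNv hΩ hK κ hφ hψ hx).add
    (HasDerivAt.fun_sum (u := Finset.univ) fun i _ =>
      ((hasDerivAt_gaussVec K E φ ψ x i).const_mul (2 / (κ : ℂ))).const_mul (w x i))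
  rw [← h1.deriv, admVar]
  congr 1
  funext r
  exact admTotal_add_gauss κ sE N Nv Ω w _ _ x

theorem isTest_admVar (hφ : TestField U φ) (hψ : TestField U ψ) :
    IsTest U (admVar κ sE N Nv Ω K E φ ψ) := by
  have hc : ContDiff ℝ ∞ (fun r : ℝ => (r : ℂ)) := Complex.ofRealCLM.contDiff
  have hO := (h.slitVariation (TestField.contDiffOn hψ) hc).isOpen
  refine isTest_of_smoothOn h.isOpen ((TestField.isCompact hφ).union (TestField.isCompact hψ))
    (union_subset (TestField.subset hφ) (TestField.subset hψ)) ?_ ?_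
  · exact ((jointSmooth_admTotal_variation h hN hNv hΩ hK κ hc (TestField.contDiffOn hφ)
      (TestField.contDiffOn hψ)).deriv hO).slice
      fun x hx => mem_slitDomain h Complex.ofReal_zero hx (hq x hx)
  · intro x hx
    have e : ∀ r : ℝ, admTotal κ sE (K + (r : ℂ) • φ) (E + (r : ℂ) • ψ) N Nv Ω x
        = admTotal κ sE K E N Nv Ω x := fun r =>
      admTotal_congr κ (add_smul_eventuallyEq hφ K _ fun h => hx (Or.inl h))
        (add_smul_eventuallyEq hψ E _ fun h => hx (Or.inr h)) N Nv Ω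
    simp only [admVar, e, deriv_const]

end

/-! ### Comparison of the first variations -/

/-- The derivative of `1 / √q` is `-Γ^c_{ca} / √q`. -/
theorem Triad.pd_invSqrt {U : Set Pt} {sE : Pt → ℝ} {E : TField ℂ} (h : Triad U sE E)
    (hq : ∀ x ∈ U, SelfdualGravity.detq sE E x ∈ Complex.slitPlane) {x : Pt} (hx : x ∈ U)
    (a : Fin 3) :
    pd a (fun y => (RCLike.sqrt (SelfdualGravity.detq sE E y))⁻¹) x
      = -(∑ c, SelfdualGravity.christoffel sE E x c c a)
        * (RCLike.sqrt (SelfdualGravity.detq sE E x))⁻¹ := by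
  have hs : ContDiffOn ℝ ∞ (fun y => (RCLike.sqrt (SelfdualGravity.detq sE E y))⁻¹) U :=
    Triad.slice_const (jointSmooth_invSqrt h.family fun _ x hx => hq x hx.2)
  have hd := h.diffAt hx hs
  have e : pd a (fun y => (RCLike.sqrt (SelfdualGravity.detq sE E y))⁻¹
      * (RCLike.sqrt (SelfdualGravity.detq sE E y))⁻¹ * SelfdualGravity.detq sE E y) x
      = pd a (fun _ => (1 : ℂ)) x := pd_congr a h.isOpen (fun y hy => by
    have h0 := h.detq_ne hy
    have h1 := sqrt_ne_zero h0
    nth_rewrite 3 [← sqrt_mul_self h0]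
    field_simp) hx
  rw [pd_const, pd_mul a (hd.fun_mul hd) (h.diffAt hx h.detq), pd_mul a hd hd] at e
  have h0 := h.detq_ne hx
  have h1 := sqrt_ne_zero h0
  rw [h.christoffel_trace hx a]
  rw [h.pd_detq hx a] at e
  set T := ∑ b, ∑ j, SelfdualGravity.invE E x j b * pd a (fun y => E y b j) x
  set w := (RCLike.sqrt (SelfdualGravity.detq sE E x))⁻¹
  have hw : w * SelfdualGravity.detq sE E x ≠ 0 := mul_ne_zero (inv_ne_zero h1) h0
  refine mul_left_cancel₀ hw ?_
  linear_combination (1 / 2 : ℂ) * e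

/-- The multiplier of the Gauss constraint by which the selfdual and the ADM Hamiltonian differ. -/
def gaugeShift (se sE : Pt → ℝ) (N : Pt → ℂ) (Nv : Pt → Fin 3 → ℂ) (K E : TField ℂ) (x : Pt)
    (i : Fin 3) : ℂ :=
  Complex.I * (∑ a, Nv x a * K x a i - ((se x / sE x : ℝ) : ℂ) *
    ((RCLike.sqrt (detq sE E x))⁻¹ * ∑ a, pd a N x * E x a i))

/-- The current whose divergence is the difference of the variations of the selfdual and of the
ADM Hamiltonian on the Gauss surface. -/
def gaussCurrent (κ : ℝ) (se sE : Pt → ℝ) (N : Pt → ℂ) (K E φ ψ : TField ℂ) (x : Pt)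
    (a : Fin 3) : ℂ :=
  2 * Complex.I / κ * (((se x / sE x : ℝ) : ℂ) * N x *
    ((RCLike.sqrt (detq sE E x))⁻¹ * ∑ i, E x a i * gaussVar K E φ ψ x i))

section Comparison

variable {U : Set Pt} {sE se : Pt → ℝ} {E : TField ℂ} (h : Triad U sE E)
  (hq : ∀ x ∈ U, detq sE E x ∈ Complex.slitPlane) (hse : LocSign U se)
  {N : Pt → ℂ} {Nv Λ : Pt → Fin 3 → ℂ} (hN : ContDiffOn ℝ ∞ N U) (hNv : ContDiffOn ℝ ∞ Nv U)
  (hΛ : ContDiffOn ℝ ∞ Λ U) {K : TField ℂ} (hK : ContDiffOn ℝ ∞ K U) {κ : ℝ} (hκ : κ ≠ 0) (lam : ℂ)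
  {φ ψ : TField ℂ}

theorem contDiffOn_gaussVec {U : Set Pt} {K E : TField ℂ} (hK : ContDiffOn ℝ ∞ K U)
    (hE : ContDiffOn ℝ ∞ E U) (i : Fin 3) : ContDiffOn ℝ ∞ (fun x => gaussVec K E x i) U :=
  ContDiffOn.sum fun j _ => ContDiffOn.sum fun k _ => contDiffOn_const.mul <|
    ContDiffOn.sum fun a _ => (component_contDiffOn hK a j).mul (component_contDiffOn hE a k)

theorem contDiffOn_gaussVar {U : Set Pt} {K E φ ψ : TField ℂ} (hK : ContDiffOn ℝ ∞ K U)
    (hE : ContDiffOn ℝ ∞ E U) (hφ : ContDiffOn ℝ ∞ φ U) (hψ : ContDiffOn ℝ ∞ ψ U) (i : Fin 3) :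
    ContDiffOn ℝ ∞ (fun x => gaussVar K E φ ψ x i) U :=
  (contDiffOn_gaussVec hφ hE i).add (contDiffOn_gaussVec hK hψ i)

include h hq

theorem contDiffOn_invSqrt :
    ContDiffOn ℝ ∞ (fun y => (RCLike.sqrt (detq sE E y))⁻¹) U :=
  Triad.slice_const (jointSmooth_invSqrt h.family fun _ x hx => hq x hx.2)

include hse hN hK

theorem contDiffOn_gaugeShift (hNv : ContDiffOn ℝ ∞ Nv U) :
    ContDiffOn ℝ ∞ (gaugeShift se sE N Nv K E) U :=
  contDiffOn_pi.2 fun i => contDiffOn_const.mul <|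
    (ContDiffOn.sum fun a _ => (contDiffOn_pi.1 hNv a).mul (component_contDiffOn hK a i)).sub <|
    (hse.div h.sign).contDiffOn_complex.mul <| (contDiffOn_invSqrt h hq).mul <|
      ContDiffOn.sum fun a _ => (contDiffOn_pd a h.isOpen hN).mul (h.comp a i)

theorem isTest_gaussCurrent (hφ : TestField U φ) (hψ : TestField U ψ) (a : Fin 3) :
    IsTest U (fun x => gaussCurrent κ se sE N K E φ ψ x a) := by
  refine isTest_of_smoothOn h.isOpen ((TestField.isCompact hφ).union (TestField.isCompact hψ))
    (union_subset (TestField.subset hφ) (TestField.subset hψ)) ?_ ?_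
  · exact contDiffOn_const.mul <| ((hse.div h.sign).contDiffOn_complex.mul hN).mul <|
      (contDiffOn_invSqrt h hq).mul <| ContDiffOn.sum fun i _ => (h.comp a i).mul
        (contDiffOn_gaussVar hK h.smooth (TestField.contDiffOn hφ) (TestField.contDiffOn hψ) i)
  · intro x hx
    have h1 := eq_zero_of_notMem_fieldSupport (φ := φ) fun h => hx (Or.inl h)
    have h2 := eq_zero_of_notMem_fieldSupport (φ := ψ) fun h => hx (Or.inr h)
    simp [gaussCurrent, gaussVar, gaussVec, h1, h2]

omit hq hse hN in
include hκ in
/-- The selfdual Hamiltonian in terms of `K` and `Ẽ`. -/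
theorem selfdualTotal_eq {A : TField ℂ}
    (hA : ∀ x ∈ U, ∀ a i, A x a i = spinConnection sE E x a i + Complex.I * K x a i) {x : Pt}
    (hx : x ∈ U) :
    selfdualTotal κ lam se sE A E N Nv Λ x
      = lam * (admTotal κ sE K E (fun x => ((se x / sE x : ℝ) : ℂ) * N x) Nv Λ x
        + ∑ a, Nv x a * (2 * Complex.I / κ * ∑ m, K x a m * gaussVec K E x m)
        + ((se x / sE x : ℝ) : ℂ) * N x * (2 * Complex.I / κ *
          ((RCLike.sqrt (detq sE E x))⁻¹ * ∑ a, (pd a (fun y => ∑ i, E y a i * gaussVec K E y i) x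
            - (∑ c, christoffel sE E x c c a) * ∑ i, E x a i * gaussVec K E x i)))) := by
  have hK' := component_contDiffOn hK
  rw [selfdualTotal, h.hamilton_eq hx lam se hK' hA, admTotal]
  simp only [h.diffeo_eq hx hκ lam hK' hA, h.gauss_eq hx hκ lam hA]
  simp only [Fin.sum_univ_three]
  ring

end Comparison

section Comparison

variable {U : Set Pt} {sE se : Pt → ℝ} {E : TField ℂ} (h : Triad U sE E)
  (hq : ∀ x ∈ U, detq sE E x ∈ Complex.slitPlane) (hse : LocSign U se)
  {N : Pt → ℂ} {Nv Λ : Pt → Fin 3 → ℂ} (hN : ContDiffOn ℝ ∞ N U) (hNv : ContDiffOn ℝ ∞ Nv U)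
  (hΛ : ContDiffOn ℝ ∞ Λ U) {K : TField ℂ} (hK : ContDiffOn ℝ ∞ K U) {κ : ℝ} (hκ : κ ≠ 0) (lam : ℂ)
  {φ ψ : TField ℂ} (hφ : ContDiffOn ℝ ∞ φ U) (hψ : ContDiffOn ℝ ∞ ψ U)

/-- Leibniz' rule at a zero of the second factor, where only that factor is differentiated. -/
theorem hasDerivAt_mul_of_zero {f g : ℝ → ℂ} {f' g' : ℂ} (hf : HasDerivAt f f' 0)
    (hg : HasDerivAt g g' 0) (h0 : g 0 = 0) : HasDerivAt (fun r => f r * g r) (f 0 * g') 0 := by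
  exact (hf.mul hg).congr_deriv (by simp [h0])

theorem gaussVec_line_zero (K E φ ψ : TField ℂ) (x : Pt) (i : Fin 3) :
    gaussVec (K + ((0 : ℝ) : ℂ) • φ) (E + ((0 : ℝ) : ℂ) • ψ) x i = gaussVec K E x i := by
  simp

include h hφ hψ hK

/-- On the Gauss surface the derivative of the divergence term of the Hamilton constraint is a
divergence. -/
theorem hasDerivAt_gaussDiv (hg : ∀ x ∈ U, ∀ i, gaussVec K E x i = 0)
    (hq : ∀ x ∈ U, detq sE E x ∈ Complex.slitPlane) {x : Pt} (hx : x ∈ U) :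
    HasDerivAt (fun r : ℝ => (RCLike.sqrt (detq sE (E + (r : ℂ) • ψ) x))⁻¹ *
        ∑ a, (pd a (fun y => ∑ i, (E + (r : ℂ) • ψ) y a i *
          gaussVec (K + (r : ℂ) • φ) (E + (r : ℂ) • ψ) y i) x
        - (∑ c, christoffel sE (E + (r : ℂ) • ψ) x c c a) * ∑ i, (E + (r : ℂ) • ψ) x a i *
          gaussVec (K + (r : ℂ) • φ) (E + (r : ℂ) • ψ) x i))
      (∑ a, pd a (fun y => (RCLike.sqrt (detq sE E y))⁻¹ *
        ∑ i, E y a i * gaussVar K E φ ψ y i) x) 0 := by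
  have hc : ContDiff ℝ ∞ (fun r : ℝ => (r : ℂ)) := Complex.ofRealCLM.contDiff
  have hf := h.slitVariation (φ := ψ) hψ hc
  have hmem : ((0 : ℝ), x) ∈ slitDomain U sE E ψ (fun r : ℝ => (r : ℂ)) :=
    mem_slitDomain h Complex.ofReal_zero hx (hq x hx)
  have hKs : ∀ a i, JointSmooth (slitDomain U sE E ψ (fun r : ℝ => (r : ℂ)))
      (fun r x => (K + (r : ℂ) • φ) x a i) := fun a i =>
    (jointSmooth_variation (fun r : ℝ => (r : ℂ)) hK hφ hc a i).mono slitDomain_subset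
  have hgs : ∀ i, JointSmooth (slitDomain U sE E ψ (fun r : ℝ => (r : ℂ)))
      (fun r x => gaussVec (K + (r : ℂ) • φ) (E + (r : ℂ) • ψ) x i) := fun i =>
    JointSmooth.sum fun _ => JointSmooth.sum fun _ => JointSmooth.const_mul _ <|
      JointSmooth.sum fun _ => (hKs _ _).mul (hf.smooth _ _)
  have hVs : ∀ a, JointSmooth (slitDomain U sE E ψ (fun r : ℝ => (r : ℂ)))
      (fun r y => ∑ i, (E + (r : ℂ) • ψ) y a i *
          gaussVec (K + (r : ℂ) • φ) (E + (r : ℂ) • ψ) y i) := fun a =>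
    JointSmooth.sum fun i => (hf.smooth a i).mul (hgs i)
  have h0 : ∀ y ∈ U, ∀ i, gaussVec (K + ((0 : ℝ) : ℂ) • φ) (E + ((0 : ℝ) : ℂ) • ψ) y i = 0 :=
    fun y hy i => (gaussVec_line_zero K E φ ψ y i).trans (hg y hy i)
  -- the current vanishes at the base point, so that only its own derivative contributes
  have hV : ∀ a, ∀ y ∈ U, HasDerivAt (fun r : ℝ => ∑ i, (E + (r : ℂ) • ψ) y a i *
      gaussVec (K + (r : ℂ) • φ) (E + (r : ℂ) • ψ) y i)
      (∑ i, E y a i * gaussVar K E φ ψ y i) 0 := by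
    intro a y hy
    refine HasDerivAt.fun_sum fun i _ => ?_
    have := hasDerivAt_mul_of_zero (hasDerivAt_line E ψ y a i)
      (hasDerivAt_gaussVec K E φ ψ y i) (h0 y hy i)
    simpa using this
  have hV0 : ∀ a, ∀ y ∈ U, ∑ i, (E + ((0 : ℝ) : ℂ) • ψ) y a i *
      gaussVec (K + ((0 : ℝ) : ℂ) • φ) (E + ((0 : ℝ) : ℂ) • ψ) y i = 0 := fun a y hy => by
    simp only [h0 y hy, mul_zero, Finset.sum_const_zero]
  have hpd : ∀ a, HasDerivAt (fun r : ℝ => pd a (fun y => ∑ i, (E + (r : ℂ) • ψ) y a i *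
      gaussVec (K + (r : ℂ) • φ) (E + (r : ℂ) • ψ) y i) x)
      (pd a (fun y => ∑ i, E y a i * gaussVar K E φ ψ y i) x) 0 := by
    intro a
    refine ((hVs a).hasDerivAt_pd hf.isOpen hmem a).congr_deriv ?_
    exact pd_congr a h.isOpen (fun y hy => (hV a y hy).deriv) hx
  have hpd0 : ∀ a, pd a (fun y => ∑ i, (E + ((0 : ℝ) : ℂ) • ψ) y a i *
      gaussVec (K + ((0 : ℝ) : ℂ) • φ) (E + ((0 : ℝ) : ℂ) • ψ) y i) x = 0 := fun a =>
    (pd_congr a h.isOpen (g := fun _ => 0) (hV0 a) hx).trans (pd_const a 0)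
  have hΓ : ∀ a, HasDerivAt (fun r : ℝ => ∑ c, christoffel sE (E + (r : ℂ) • ψ) x c c a) _ 0 :=
    fun a => HasDerivAt.fun_sum fun c _ => (hf.christoffel c c a).hasDerivAt hf.isOpen hmem
  have hs := (jointSmooth_invSqrt hf fun _ _ hx => hx.2).hasDerivAt hf.isOpen hmem
  have key := hasDerivAt_mul_of_zero hs (HasDerivAt.fun_sum (u := Finset.univ) fun a _ =>
    (hpd a).sub (hasDerivAt_mul_of_zero (hΓ a) (hV a x hx) (hV0 a x hx)))
    (by simp only [Pi.sub_apply, hpd0, hV0 _ x hx, mul_zero, sub_zero, Finset.sum_const_zero])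
  refine key.congr_deriv ?_
  simp only [Complex.ofReal_zero, zero_smul, add_zero, Finset.mul_sum]
  refine Finset.sum_congr rfl fun a _ => ?_
  have d1 := h.diffAt hx (contDiffOn_invSqrt h hq)
  have d2 : DifferentiableAt ℝ (fun y => ∑ i, E y a i * gaussVar K E φ ψ y i) x :=
    h.diffAt hx (ContDiffOn.sum fun i _ =>
      (h.comp a i).mul (contDiffOn_gaussVar hK h.smooth hφ hψ i))
  have e := pd_mul a d1 d2
  rw [h.pd_invSqrt hq hx a] at e
  simp only [Finset.mul_sum] at e ⊢
  rw [e]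
  simp only [Fin.sum_univ_three]
  ring

include hse hN hNv hΛ hκ

/-- On the Gauss surface the first variations of the selfdual and of the ADM Hamiltonian agree up
to the factor `λ`, a shift of the multiplier of the Gauss constraint, and a divergence. -/
theorem sdLin_eq_admVar (hg : ∀ x ∈ U, ∀ i, gaussVec K E x i = 0)
    (hq : ∀ x ∈ U, detq sE E x ∈ Complex.slitPlane) {A : TField ℂ}
    (hA : ∀ x ∈ U, ∀ a i, A x a i = spinConnection sE E x a i + Complex.I * K x a i)
    {x : Pt} (hx : x ∈ U) :
    sdLin κ lam se sE A E N Nv Λ (linSpin E ψ + Complex.I • φ) ψ x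
      = lam * (admVar κ sE (fun x => ((se x / sE x : ℝ) : ℂ) * N x) Nv
          (Λ + gaugeShift se sE N Nv K E) K E φ ψ x
        + ∑ a, pd a (fun y => gaussCurrent κ se sE N K E φ ψ y a) x) := by
  have hκ' : (κ : ℂ) ≠ 0 := by exact_mod_cast hκ
  have hc : ContDiff ℝ ∞ (fun r : ℝ => (r : ℂ)) := Complex.ofRealCLM.contDiff
  have hf := h.slitVariation (φ := ψ) hψ hc
  have hmem : ∀ y ∈ U, ((0 : ℝ), y) ∈ slitDomain U sE E ψ (fun r : ℝ => (r : ℂ)) := fun y hy =>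
    mem_slitDomain h Complex.ofReal_zero hy (hq y hy)
  have hKs : ∀ a i, JointSmooth (slitDomain U sE E ψ (fun r : ℝ => (r : ℂ)))
      (fun r x => (K + (r : ℂ) • φ) x a i) := fun a i =>
    (jointSmooth_variation (fun r : ℝ => (r : ℂ)) hK hφ hc a i).mono slitDomain_subset
  have hNs : ContDiffOn ℝ ∞ (fun x => ((se x / sE x : ℝ) : ℂ) * N x) U :=
    (hse.div h.sign).contDiffOn_complex.mul hN
  set B : ℝ → TField ℂ := fun r x a i =>
    spinConnection sE (E + (r : ℂ) • ψ) x a i + Complex.I * (K + (r : ℂ) • φ) x a i with hB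
  have hBs : ∀ a i, JointSmooth (slitDomain U sE E ψ (fun r : ℝ => (r : ℂ)))
      (fun r x => B r x a i) := fun a i =>
    (hf.spinConnection a i).add (JointSmooth.const_mul _ (hKs a i))
  have hB0 : B 0 =ᶠ[nhds x] A := by
    filter_upwards [h.isOpen.mem_nhds hx] with y hy
    funext a i
    simp [hB, hA y hy]
  have hBv : velocity B 0 =ᶠ[nhds x] linSpin E ψ + Complex.I • φ := by
    filter_upwards [h.isOpen.mem_nhds hx] with y hy
    funext a i
    exact ((hasDerivAt_spinConnection_variation h hψ hy a i).add
      ((hasDerivAt_line K φ y a i).const_mul Complex.I)).deriv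
  have h1 := hasDerivAt_selfdualTotal κ lam se sE hf.isOpen hBs hf.smooth (hmem x hx)
    (by simpa using hq x hx) N Nv Λ
  have e1 : sdLin κ lam se sE (B 0) (E + ((0 : ℝ) : ℂ) • ψ) N Nv Λ (velocity B 0)
      (velocity (fun r : ℝ => E + (r : ℂ) • ψ) 0) x
      = sdLin κ lam se sE A E N Nv Λ (linSpin E ψ + Complex.I • φ) ψ x := by
    rw [velocity_variation]
    simp only [sdLin, jet_congr hB0, jet_congr hBv, Complex.ofReal_zero, zero_smul, add_zero]
  rw [e1] at h1
  have h2 := hasDerivAt_admTotal h hq hNs hNv hΛ hK κ hφ hψ hx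
  have hgx : ∀ m, gaussVec (K + ((0 : ℝ) : ℂ) • φ) (E + ((0 : ℝ) : ℂ) • ψ) x m = 0 := fun m =>
    (gaussVec_line_zero K E φ ψ x m).trans (hg x hx m)
  have h3 : HasDerivAt (fun r : ℝ => ∑ a, Nv x a * (2 * Complex.I / κ *
      ∑ m, (K + (r : ℂ) • φ) x a m * gaussVec (K + (r : ℂ) • φ) (E + (r : ℂ) • ψ) x m))
      (∑ a, Nv x a * (2 * Complex.I / κ * ∑ m, (K + ((0 : ℝ) : ℂ) • φ) x a m *
        gaussVar K E φ ψ x m)) 0 :=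
    HasDerivAt.fun_sum fun a _ => HasDerivAt.const_mul _ <| HasDerivAt.const_mul _ <|
      HasDerivAt.fun_sum fun m _ => hasDerivAt_mul_of_zero (hasDerivAt_line K φ x a m)
        (hasDerivAt_gaussVec K E φ ψ x m) (hgx m)
  have h4 := hasDerivAt_gaussDiv h hK hφ hψ hg hq hx
  have h5 := ((h2.add h3).add ((h4.const_mul (2 * Complex.I / κ)).const_mul
    (((se x / sE x : ℝ) : ℂ) * N x))).const_mul lam
  have h6 := h1.unique (h5.congr_of_eventuallyEq (by
    have : ∀ᶠ r in nhds (0 : ℝ), (r, x) ∈ slitDomain U sE E ψ (fun r : ℝ => (r : ℂ)) :=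
      (Continuous.prodMk_left x).continuousAt.eventually (hf.isOpen.mem_nhds (hmem x hx))
    filter_upwards [this] with r hr
    exact selfdualTotal_eq (hf.triad r)
      (contDiffOn_pi.2 fun a => contDiffOn_pi.2 fun i => (hKs a i).slice fun _ hx => hx)
      hκ lam (fun y _ a i => rfl) hr))
  rw [h6, admVar_add_gauss h hq hNs hNv hΛ hK κ hφ hψ _ hx]
  -- the divergence of the current, with the derivative of the lapse split off
  have e3 : ∀ a, pd a (fun y => gaussCurrent κ se sE N K E φ ψ y a) x
      = 2 * Complex.I / κ * ((((se x / sE x : ℝ) : ℂ) * pd a N x) *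
          ((RCLike.sqrt (detq sE E x))⁻¹ * ∑ i, E x a i * gaussVar K E φ ψ x i)
        + ((se x / sE x : ℝ) : ℂ) * N x * pd a (fun y => (RCLike.sqrt (detq sE E y))⁻¹ *
          ∑ i, E y a i * gaussVar K E φ ψ y i) x) := by
    intro a
    have d0 := h.diffAt hx hN
    have d1 := h.diffAt hx (contDiffOn_invSqrt h hq)
    have d2 : DifferentiableAt ℝ (fun y => ∑ i, E y a i * gaussVar K E φ ψ y i) x :=
      h.diffAt hx (ContDiffOn.sum fun i _ =>
        (h.comp a i).mul (contDiffOn_gaussVar hK h.smooth hφ hψ i))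
    have ds := h.diffAt hx hNs
    have e4 : pd a (fun x => ((se x / sE x : ℝ) : ℂ) * N x) x
        = ((se x / sE x : ℝ) : ℂ) * pd a N x := by
      have : (fun x => ((se x / sE x : ℝ) : ℂ) * N x) =ᶠ[nhds x]
          fun y => ((se x / sE x : ℝ) : ℂ) * N y := by
        filter_upwards [((hse.div h.sign) x hx).2] with y hy using by rw [hy]
      rw [pd, this.fderiv_eq]
      exact pd_const_mul a _ d0
    simp only [gaussCurrent]
    rw [pd_const_mul a _ (ds.fun_mul (d1.fun_mul d2)), pd_mul a ds (d1.fun_mul d2), e4]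
  simp only [e3, gaugeShift, Complex.ofReal_zero, zero_smul, add_zero]
  generalize admVar κ sE _ Nv Λ K E φ ψ x = X
  generalize ((se x / sE x : ℝ) : ℂ) = s
  simp only [Fin.sum_univ_three]
  ring

end Comparison

/-! ### Linearity of the pairing; real and imaginary parts of test fields -/

section Pairing

variable {𝕜 : Type} [RCLike 𝕜] {U : Set Pt}

theorem TestField.add {φ ψ : TField 𝕜} (hφ : TestField U φ) (hψ : TestField U ψ) :
    TestField U (φ + ψ) := fun a i => (hφ a i).add (hψ a i)

theorem pairing_add_right (hU : IsOpen U) {W φ ψ : TField 𝕜} (hW : ContinuousOn W U)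
    (hφ : TestField U φ) (hψ : TestField U ψ) :
    pairing U W (φ + ψ) = pairing U W φ + pairing U W ψ := by
  rw [pairing, pairing, pairing, ← integral_add (integrableOn_pairing hU hW hφ)
    (integrableOn_pairing hU hW hψ)]
  simp only [Pi.add_apply, mul_add, Finset.sum_add_distrib]

theorem pairing_add_left (hU : IsOpen U) {V W φ : TField 𝕜} (hV : ContinuousOn V U)
    (hW : ContinuousOn W U) (hφ : TestField U φ) :
    pairing U (V + W) φ = pairing U V φ + pairing U W φ := by
  rw [pairing, pairing, pairing, ← integral_add (integrableOn_pairing hU hV hφ)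
    (integrableOn_pairing hU hW hφ)]
  simp only [Pi.add_apply, add_mul, Finset.sum_add_distrib]

theorem pairing_smul_left (W φ : TField 𝕜) (c : 𝕜) :
    pairing U (c • W) φ = c * pairing U W φ := by
  rw [← pairing_smul_right]
  simp only [pairing, Pi.smul_apply, smul_eq_mul]
  congr 1
  funext x
  refine Finset.sum_congr rfl fun a _ => Finset.sum_congr rfl fun i _ => by ring

end Pairing

theorem IsTest.ofReal {U : Set Pt} {f : Pt → ℝ} (hf : IsTest U f) :
    IsTest U (fun x => (f x : ℂ)) := by
  have e : tsupport (fun x => (f x : ℂ)) ⊆ tsupport f := closure_mono fun x hx h0 => hx (by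
    simp only [h0, Complex.ofReal_zero])
  exact ⟨Complex.ofRealCLM.contDiff.comp hf.1, hf.2.1.comp_left Complex.ofReal_zero,
    e.trans hf.2.2⟩

theorem TestField.complexify {U : Set Pt} {φ : TField ℝ} (hφ : TestField U φ) :
    TestField U (complexify φ) := fun a i => (hφ a i).ofReal

/-- The real part of a complex field. -/
def reField (u : TField ℂ) : TField ℝ := fun x a i => (u x a i).re

/-- The imaginary part of a complex field. -/
def imField (u : TField ℂ) : TField ℝ := fun x a i => (u x a i).im

theorem IsTest.comp_clm {U : Set Pt} {f : Pt → ℂ} (hf : IsTest U f) (L : ℂ →L[ℝ] ℝ) :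
    IsTest U (fun x => L (f x)) := by
  have e : tsupport (fun x => L (f x)) ⊆ tsupport f := closure_mono fun x hx h0 => hx (by
    simp only [h0, map_zero])
  exact ⟨L.contDiff.comp hf.1, hf.2.1.comp_left (map_zero L), e.trans hf.2.2⟩

theorem TestField.re {U : Set Pt} {φ : TField ℂ} (hφ : TestField U φ) :
    TestField U (reField φ) := fun a i => (hφ a i).comp_clm Complex.reCLM

theorem TestField.im {U : Set Pt} {φ : TField ℂ} (hφ : TestField U φ) :
    TestField U (imField φ) := fun a i => (hφ a i).comp_clm Complex.imCLM

theorem re_add_I_smul_im (φ : TField ℂ) :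
    complexify (reField φ) + Complex.I • complexify (imField φ) = φ := by
  funext x a i
  simp only [Pi.add_apply, Pi.smul_apply, smul_eq_mul, complexify, reField, imField]
  rw [mul_comm]
  exact (mul_comm Complex.I _ ▸ Complex.re_add_im (φ x a i))

/-! ### Functional derivatives of the selfdual and of the ADM Hamiltonian -/

/-- `(V, W)` is the gradient at `(K, E)` of the complexified ADM Hamiltonian. -/
structure IsAdmGradient (κ : ℝ) (sE : Pt → ℝ) (U : Set Pt) (N : Pt → ℂ) (Nv Ω : Pt → Fin 3 → ℂ)
    (K E V W : TField ℂ) : Prop where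
  continuousOn_left : ContinuousOn V U
  continuousOn_right : ContinuousOn W U
  integral_eq : ∀ φ ψ, TestField U φ → TestField U ψ →
    ∫ x in U, admVar κ sE N Nv Ω K E φ ψ x = pairing U V φ + pairing U W ψ

section Gradient

variable {U : Set Pt} {sE se : Pt → ℝ} {E : TField ℂ} (h : Triad U sE E)
  (hq : ∀ x ∈ U, detq sE E x ∈ Complex.slitPlane) (hse : LocSign U se)
  {N : Pt → ℂ} {Nv Λ : Pt → Fin 3 → ℂ} (hN : ContDiffOn ℝ ∞ N U) (hNv : ContDiffOn ℝ ∞ Nv U)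
  (hΛ : ContDiffOn ℝ ∞ Λ U) {A : TField ℂ} (hA : ContDiffOn ℝ ∞ A U) {κ : ℝ} (lam : ℂ)
include h hq hse hN hNv hΛ hA

theorem integrableOn_sdLin_left {α : TField ℂ} (hα : TestField U α) :
    IntegrableOn (sdLin κ lam se sE A E N Nv Λ α 0) U :=
  ((variable_selfdual_connection h hq hse hN hNv hΛ hA κ lam).integrableOn h.isOpen hα).congr_fun
    (fun _ hx => firstVar_selfdual_connection h hq hA κ lam (TestField.contDiffOn hα) hx)
    h.isOpen.measurableSet

theorem integrableOn_sdLin_right {ε : TField ℂ} (hε : TestField U ε) :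
    IntegrableOn (sdLin κ lam se sE A E N Nv Λ 0 ε) U :=
  ((variable_selfdual_triad h hq hse hN hNv hΛ hA κ lam).integrableOn h.isOpen hε).congr_fun
    (fun _ hx => firstVar_selfdual_triad h hq hA κ lam (TestField.contDiffOn hε) hx)
    h.isOpen.measurableSet

theorem hasFunctionalDeriv_selfdual_connection_iff {W : TField ℂ} :
    HasFunctionalDeriv U (fun A' => ∫ x in U, (selfdualTotal κ lam se sE A' E N Nv Λ x
      - selfdualTotal κ lam se sE A E N Nv Λ x)) A W ↔ ContinuousOn W U ∧
      ∀ α, TestField U α → ∫ x in U, sdLin κ lam se sE A E N Nv Λ α 0 x = pairing U W α := by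
  rw [hasFunctionalDeriv_iff h.isOpen (variable_selfdual_connection h hq hse hN hNv hΛ hA κ lam)]
  refine and_congr_right fun _ => forall_congr' fun α => forall_congr' fun hα => ?_
  rw [setIntegral_congr_fun h.isOpen.measurableSet fun x hx =>
    firstVar_selfdual_connection h hq hA κ lam (TestField.contDiffOn hα) hx]

theorem hasFunctionalDeriv_selfdual_triad_iff {W : TField ℂ} :
    HasFunctionalDeriv U (fun E' => ∫ x in U, (selfdualTotal κ lam se sE A E' N Nv Λ x
      - selfdualTotal κ lam se sE A E N Nv Λ x)) E W ↔ ContinuousOn W U ∧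
      ∀ ε, TestField U ε → ∫ x in U, sdLin κ lam se sE A E N Nv Λ 0 ε x = pairing U W ε := by
  rw [hasFunctionalDeriv_iff h.isOpen (variable_selfdual_triad h hq hse hN hNv hΛ hA κ lam)]
  refine and_congr_right fun _ => forall_congr' fun α => forall_congr' fun hα => ?_
  rw [setIntegral_congr_fun h.isOpen.measurableSet fun x hx =>
    firstVar_selfdual_triad h hq hA κ lam (TestField.contDiffOn hα) hx]

theorem integral_sdLin_split {α ε : TField ℂ} (hα : TestField U α) (hε : TestField U ε) :
    ∫ x in U, sdLin κ lam se sE A E N Nv Λ α ε x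
      = (∫ x in U, sdLin κ lam se sE A E N Nv Λ α 0 x)
        + ∫ x in U, sdLin κ lam se sE A E N Nv Λ 0 ε x := by
  rw [← integral_add (integrableOn_sdLin_left h hq hse hN hNv hΛ hA lam hα)
    (integrableOn_sdLin_right h hq hse hN hNv hΛ hA lam hε)]
  exact integral_congr_ae (Filter.Eventually.of_forall fun x => sdLin_split κ lam se sE A E N Nv Λ α ε x)

theorem integral_sdLin_left_add_smul {α β : TField ℂ} (hα : TestField U α) (hβ : TestField U β)
    (c : ℂ) : ∫ x in U, sdLin κ lam se sE A E N Nv Λ (α + c • β) 0 x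
      = (∫ x in U, sdLin κ lam se sE A E N Nv Λ α 0 x)
        + c * ∫ x in U, sdLin κ lam se sE A E N Nv Λ β 0 x := by
  rw [← integral_const_mul, ← integral_add (integrableOn_sdLin_left h hq hse hN hNv hΛ hA lam hα)
    ((integrableOn_sdLin_left h hq hse hN hNv hΛ hA lam hβ).const_mul c)]
  exact setIntegral_congr_fun h.isOpen.measurableSet fun x hx =>
    sdLin_add_smul_left κ lam se sE A E N Nv Λ h.isOpen (TestField.contDiffOn hα)
      (TestField.contDiffOn hβ) c hx

theorem integral_sdLin_right_add_smul {α β : TField ℂ} (hα : TestField U α) (hβ : TestField U β)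
    (c : ℂ) : ∫ x in U, sdLin κ lam se sE A E N Nv Λ 0 (α + c • β) x
      = (∫ x in U, sdLin κ lam se sE A E N Nv Λ 0 α x)
        + c * ∫ x in U, sdLin κ lam se sE A E N Nv Λ 0 β x := by
  rw [← integral_const_mul, ← integral_add (integrableOn_sdLin_right h hq hse hN hNv hΛ hA lam hα)
    ((integrableOn_sdLin_right h hq hse hN hNv hΛ hA lam hβ).const_mul c)]
  exact setIntegral_congr_fun h.isOpen.measurableSet fun x hx =>
    sdLin_add_smul_right κ lam se sE A E N Nv Λ h.isOpen (TestField.contDiffOn hα)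
      (TestField.contDiffOn hβ) c hx

variable (hκ : κ ≠ 0) {K : TField ℂ} (hK : ContDiffOn ℝ ∞ K U)
  (hg : ∀ x ∈ U, ∀ i, gaussVec K E x i = 0)
  (hAK : ∀ x ∈ U, ∀ a i, A x a i = spinConnection sE E x a i + Complex.I * K x a i)
include hκ hK hg hAK

omit hA in
/-- The integrated form of `sdLin_eq_admVar`, in which the divergence has disappeared. -/
theorem integral_sdLin_eq {φ ψ : TField ℂ} (hφ : TestField U φ) (hψ : TestField U ψ) :
    ∫ x in U, sdLin κ lam se sE A E N Nv Λ (linSpin E ψ + Complex.I • φ) ψ x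
      = lam * ∫ x in U, admVar κ sE (fun x => ((se x / sE x : ℝ) : ℂ) * N x) Nv
          (Λ + gaugeShift se sE N Nv K E) K E φ ψ x := by
  have hNs : ContDiffOn ℝ ∞ (fun x => ((se x / sE x : ℝ) : ℂ) * N x) U :=
    (hse.div h.sign).contDiffOn_complex.mul hN
  have hΛs : ContDiffOn ℝ ∞ (Λ + gaugeShift se sE N Nv K E) U :=
    hΛ.add (contDiffOn_gaugeShift h hq hse hN hK hNv)
  have hy := fun a => isTest_gaussCurrent (κ := κ) h hq hse hN hK hφ hψ a
  have e0 := IsTest.integral_div h.isOpen hy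
  have e1 : IntegrableOn (fun x => ∑ a, pd a (fun y => gaussCurrent κ se sE N K E φ ψ y a) x) U :=
    (IsTest.sum fun a _ => (hy a).coordDeriv h.isOpen a).integrableOn
  rw [setIntegral_congr_fun h.isOpen.measurableSet fun x hx =>
    sdLin_eq_admVar h hse hN hNv hΛ hK hκ lam (TestField.contDiffOn hφ) (TestField.contDiffOn hψ)
      hg hq hAK hx]
  rw [integral_const_mul, integral_add (isTest_admVar h hq hNs hNv hΛs hK κ hφ hψ).integrableOn e1,
    e0, add_zero]

/-- A gradient of the selfdual Hamiltonian on the Gauss surface is a gradient of the complexified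
ADM Hamiltonian, after the canonical transformation from `A` to `K`. -/
theorem isAdmGradient_of_selfdual (hlam : lam ≠ 0) {WQ WP : TField ℂ} (hWQ : ContDiffOn ℝ ∞ WQ U)
    (h1 : HasFunctionalDeriv U (fun A' => ∫ x in U, (selfdualTotal κ lam se sE A' E N Nv Λ x
      - selfdualTotal κ lam se sE A E N Nv Λ x)) A WQ)
    (h2 : HasFunctionalDeriv U (fun E' => ∫ x in U, (selfdualTotal κ lam se sE A E' N Nv Λ x
      - selfdualTotal κ lam se sE A E N Nv Λ x)) E WP) :
    IsAdmGradient κ sE U (fun x => ((se x / sE x : ℝ) : ℂ) * N x) Nv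
      (Λ + gaugeShift se sE N Nv K E) K E ((Complex.I / lam) • WQ)
      ((1 / lam) • (WP + linSpin E WQ)) := by
  rw [hasFunctionalDeriv_selfdual_connection_iff h hq hse hN hNv hΛ hA lam] at h1
  rw [hasFunctionalDeriv_selfdual_triad_iff h hq hse hN hNv hΛ hA lam] at h2
  have hl : ContinuousOn (linSpin E WQ) U :=
    (contDiffOn_pi.2 fun a => contDiffOn_pi.2 fun i => h.contDiffOn_linSpin hWQ a i :
      ContDiffOn ℝ ∞ (linSpin E WQ) U).continuousOn
  refine ⟨h1.1.const_smul _, (h2.1.add hl).const_smul _, fun φ ψ hφ hψ => ?_⟩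
  have hα : TestField U (linSpin E ψ) := testField_linSpin h hψ
  have hφ' : TestField U (Complex.I • φ) := TestField.smul hφ _
  have e := integral_sdLin_eq h hq hse hN hNv hΛ lam hκ hK hg hAK hφ hψ
  rw [integral_sdLin_split h hq hse hN hNv hΛ hA lam (hα.add hφ') hψ, h1.2 _ (hα.add hφ'),
    h2.2 _ hψ, pairing_add_right h.isOpen h1.1 hα hφ', pairing_smul_right,
    pairing_linSpin h hψ hWQ] at e
  rw [pairing_smul_left, pairing_smul_left, pairing_add_left h.isOpen h2.1 hl hψ]
  refine mul_left_cancel₀ hlam ?_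
  rw [← e]
  field_simp
  ring

/-- A gradient of the ADM Hamiltonian on the Gauss surface, tested on real fields only, yields a
gradient of the selfdual Hamiltonian. -/
theorem hasFunctionalDeriv_selfdual_of_adm {V W : TField ℂ} (hV : ContDiffOn ℝ ∞ V U)
    (hW : ContinuousOn W U)
    (hV' : ∀ φ : TField ℝ, TestField U φ →
      ∫ x in U, admVar κ sE (fun x => ((se x / sE x : ℝ) : ℂ) * N x) Nv
        (Λ + gaugeShift se sE N Nv K E) K E (complexify φ) 0 x = pairing U V (complexify φ))
    (hW' : ∀ ψ : TField ℝ, TestField U ψ →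
      ∫ x in U, admVar κ sE (fun x => ((se x / sE x : ℝ) : ℂ) * N x) Nv
        (Λ + gaugeShift se sE N Nv K E) K E 0 (complexify ψ) x = pairing U W (complexify ψ)) :
    HasFunctionalDeriv U (fun A' => ∫ x in U, (selfdualTotal κ lam se sE A' E N Nv Λ x
      - selfdualTotal κ lam se sE A E N Nv Λ x)) A ((-Complex.I * lam) • V) ∧
    HasFunctionalDeriv U (fun E' => ∫ x in U, (selfdualTotal κ lam se sE A E' N Nv Λ x
      - selfdualTotal κ lam se sE A E N Nv Λ x)) E
      (lam • W + (-1 : ℂ) • linSpin E ((-Complex.I * lam) • V)) := by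
  set WQ : TField ℂ := (-Complex.I * lam) • V with hWQdef
  have hWQ : ContDiffOn ℝ ∞ WQ U := hV.const_smul (-Complex.I * lam)
  have hl : ContinuousOn (linSpin E WQ) U :=
    (contDiffOn_pi.2 fun a => contDiffOn_pi.2 fun i => h.contDiffOn_linSpin hWQ a i :
      ContDiffOn ℝ ∞ (linSpin E WQ) U).continuousOn
  have h0 : TestField U (0 : TField ℂ) := testField_zero U
  have hl0 : linSpin E 0 = 0 := by
    funext x a i
    have hp : ∀ a, pd a (fun _ : Pt => (0 : ℂ)) x = 0 := fun a => pd_const a 0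
    simp [linSpin, frameV, frameD, frameVar, frameSpin, hp]
  have key1 : ∀ α, TestField U α →
      ∫ x in U, sdLin κ lam se sE A E N Nv Λ α 0 x = pairing U WQ α := by
    have base : ∀ φ : TField ℝ, TestField U φ →
        ∫ x in U, sdLin κ lam se sE A E N Nv Λ (Complex.I • complexify φ) 0 x
          = pairing U WQ (Complex.I • complexify φ) := by
      intro φ hφ
      have e := integral_sdLin_eq h hq hse hN hNv hΛ lam hκ hK hg hAK
        (TestField.complexify hφ) h0
      rw [hV' φ hφ, hl0, zero_add] at e
      rw [e, pairing_smul_right, hWQdef, pairing_smul_left]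
      linear_combination (lam * pairing U V (complexify φ)) * Complex.I_mul_I
    intro α hα
    have t1 : TestField U (Complex.I • complexify (imField α)) :=
      TestField.smul (TestField.complexify (TestField.im hα)) _
    have t2 : TestField U (Complex.I • complexify (reField α)) :=
      TestField.smul (TestField.complexify (TestField.re hα)) _
    have e : Complex.I • complexify (imField α) + (-Complex.I) • (Complex.I • complexify (reField α))
        = α := by
      rw [smul_smul, neg_mul, Complex.I_mul_I, neg_neg, one_smul, add_comm, re_add_I_smul_im]
    rw [← e, integral_sdLin_left_add_smul h hq hse hN hNv hΛ hA lam t1 t2,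
      pairing_add_right h.isOpen hWQ.continuousOn t1 (TestField.smul t2 _),
      pairing_smul_right _ (Complex.I • complexify (reField α)),
      base _ (TestField.im hα), base _ (TestField.re hα)]
  have hWP : ContinuousOn (lam • W + (-1 : ℂ) • linSpin E WQ) U :=
    (hW.const_smul lam).add (hl.const_smul (-1 : ℂ))
  have key2 : ∀ ε, TestField U ε → ∫ x in U, sdLin κ lam se sE A E N Nv Λ 0 ε x
      = pairing U (lam • W + (-1 : ℂ) • linSpin E WQ) ε := by
    have base : ∀ ψ : TField ℝ, TestField U ψ →
        ∫ x in U, sdLin κ lam se sE A E N Nv Λ 0 (complexify ψ) x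
          = pairing U (lam • W + (-1 : ℂ) • linSpin E WQ) (complexify ψ) := by
      intro ψ hψ
      have tψ := TestField.complexify hψ
      have tl : TestField U (linSpin E (complexify ψ)) := testField_linSpin h tψ
      have e := integral_sdLin_eq h hq hse hN hNv hΛ lam hκ hK hg hAK
        h0 tψ
      rw [hW' ψ hψ, smul_zero, add_zero,
        integral_sdLin_split h hq hse hN hNv hΛ hA lam tl tψ, key1 _ tl,
        pairing_linSpin h tψ hWQ] at e
      rw [pairing_add_left h.isOpen (hW.const_smul lam) (hl.const_smul (-1 : ℂ)) tψ,
        pairing_smul_left, pairing_smul_left, ← e]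
      ring
    intro ε hε
    have t1 := TestField.complexify (TestField.re hε)
    have t2 := TestField.complexify (TestField.im hε)
    rw [← re_add_I_smul_im ε, integral_sdLin_right_add_smul h hq hse hN hNv hΛ hA lam t1 t2,
      pairing_add_right h.isOpen hWP t1 (TestField.smul t2 _), pairing_smul_right,
      base _ (TestField.re hε), base _ (TestField.im hε)]
  exact ⟨(hasFunctionalDeriv_selfdual_connection_iff h hq hse hN hNv hΛ hA lam).2
      ⟨hWQ.continuousOn, key1⟩,
    (hasFunctionalDeriv_selfdual_triad_iff h hq hse hN hNv hΛ hA lam).2 ⟨hWP, key2⟩⟩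

end Gradient

/-! ### The gradient of the ADM Hamiltonian with respect to `K` -/

/-- The covariant derivative `𝒟_b N^a` of the shift. -/
def shiftGrad (sE : Pt → ℝ) (E : TField ℂ) (Nv : Pt → Fin 3 → ℂ) (x : Pt) (a b : Fin 3) : ℂ :=
  pd b (fun y => Nv y a) x + ∑ c, christoffel sE E x a b c * Nv x c

/-- The functional derivative of the complexified ADM Hamiltonian with respect to `K`. -/
def admGradK (κ : ℝ) (sE : Pt → ℝ) (N : Pt → ℂ) (Nv Ω : Pt → Fin 3 → ℂ) (K E : TField ℂ) :
    TField ℂ := fun x a i =>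
  2 * N x * (κ * RCLike.sqrt (detq sE E x))⁻¹ *
      (trKE K E x * E x a i - ∑ b, KE K E x a b * E x b i)
    + 2 / κ * (∑ b, shiftGrad sE E Nv x a b * E x b i - (∑ b, shiftGrad sE E Nv x b b) * E x a i)
    + 2 / κ * ∑ l, ∑ k, eps ℂ l i k * Ω x l * E x a k

/-- The trace-reversed momentum `K^i_a Ẽ^b_i - δ^b_a K^i_c Ẽ^c_i`. -/
def momentum (K E : TField ℂ) (x : Pt) (b a : Fin 3) : ℂ :=
  KE K E x b a - if b = a then trKE K E x else 0

theorem KE_line (K E φ : TField ℂ) (r : ℂ) (x : Pt) (b a : Fin 3) :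
    KE (K + r • φ) E x b a = KE K E x b a + r * KE φ E x b a := by
  simp only [KE, Pi.add_apply, Pi.smul_apply, smul_eq_mul, Fin.sum_univ_three]
  ring

theorem trKE_line (K E φ : TField ℂ) (r : ℂ) (x : Pt) :
    trKE (K + r • φ) E x = trKE K E x + r * trKE φ E x := by
  simp only [trKE, KE_line, Fin.sum_univ_three]
  ring

theorem momentum_line (K E φ : TField ℂ) (r : ℂ) (x : Pt) (b a : Fin 3) :
    momentum (K + r • φ) E x b a = momentum K E x b a + r * momentum φ E x b a := by
  simp only [momentum, KE_line, trKE_line]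
  split_ifs <;> ring

theorem gaussVec_line (K E φ : TField ℂ) (r : ℂ) (x : Pt) (i : Fin 3) :
    gaussVec (K + r • φ) E x i = gaussVec K E x i + r * gaussVec φ E x i := by
  simp only [gaussVec, Pi.add_apply, Pi.smul_apply, smul_eq_mul, Fin.sum_univ_three]
  ring

section

variable {U : Set Pt} {sE : Pt → ℝ} {E : TField ℂ} (h : Triad U sE E)

theorem contDiffOn_KE {U : Set Pt} {K E : TField ℂ} (hK : ContDiffOn ℝ ∞ K U)
    (hE : ContDiffOn ℝ ∞ E U) (b a : Fin 3) : ContDiffOn ℝ ∞ (fun x => KE K E x b a) U :=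
  ContDiffOn.sum fun i _ => (component_contDiffOn hK a i).mul (component_contDiffOn hE b i)

theorem contDiffOn_trKE {U : Set Pt} {K E : TField ℂ} (hK : ContDiffOn ℝ ∞ K U)
    (hE : ContDiffOn ℝ ∞ E U) : ContDiffOn ℝ ∞ (fun x => trKE K E x) U :=
  ContDiffOn.sum fun a _ => contDiffOn_KE hK hE a a

theorem contDiffOn_momentum {U : Set Pt} {K E : TField ℂ} (hK : ContDiffOn ℝ ∞ K U)
    (hE : ContDiffOn ℝ ∞ E U) (b a : Fin 3) : ContDiffOn ℝ ∞ (fun x => momentum K E x b a) U := by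
  refine (contDiffOn_KE hK hE b a).sub ?_
  by_cases hab : b = a
  · simpa only [hab, if_true] using contDiffOn_trKE hK hE
  · simpa only [hab, if_false] using contDiffOn_const

/-- The diffeomorphism constraint as the divergence of a mixed tensor density of weight one, in which
the traces of the Christoffel symbols cancel. -/
theorem admDiffeo_eq (κ : ℝ) (sE : Pt → ℝ) (K E : TField ℂ) (x : Pt) (a : Fin 3) :
    admDiffeo κ sE K E x a = -(2 / κ) * ∑ b, (pd b (fun y => momentum K E y b a) x
      - ∑ d, christoffel sE E x d b a * momentum K E x b d) := by
  have e : ∑ b, ∑ d, christoffel sE E x b b d * momentum K E x d a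
      = ∑ b, ∑ d, christoffel sE E x d d b * momentum K E x b a := Finset.sum_comm
  have e' : admDiffeo κ sE K E x a = -((2 / κ : ℝ) : ℂ) * ∑ b,
    (pd b (fun y => momentum K E y b a) x + ∑ d, (christoffel sE E x b b d * momentum K E x d a
      - christoffel sE E x d b a * momentum K E x b d
      - christoffel sE E x d d b * momentum K E x b a)) := rfl
  rw [e', Complex.ofReal_div, Complex.ofReal_ofNat]
  congr 1
  simp only [Finset.sum_add_distrib, Finset.sum_sub_distrib, e]
  ring

include h

theorem admDiffeo_line (κ : ℝ) {K φ : TField ℂ} (hK : ContDiffOn ℝ ∞ K U)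
    (hφ : ContDiffOn ℝ ∞ φ U) (r : ℂ) {x : Pt} (hx : x ∈ U) (a : Fin 3) :
    admDiffeo κ sE (K + r • φ) E x a = admDiffeo κ sE K E x a + r * admDiffeo κ sE φ E x a := by
  have e : ∀ b, pd b (fun y => momentum (K + r • φ) E y b a) x
      = pd b (fun y => momentum K E y b a) x + r * pd b (fun y => momentum φ E y b a) x := by
    intro b
    have d1 := h.diffAt hx (contDiffOn_momentum hK h.smooth b a)
    have d2 := h.diffAt hx (contDiffOn_momentum hφ h.smooth b a)
    simp only [momentum_line]
    rw [pd_add b d1 (d2.const_mul r), pd_const_mul b r d2]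
  simp only [admDiffeo_eq, e]
  simp only [momentum_line, Fin.sum_univ_three]
  ring

/-- The variation of the ADM Hamiltonian with respect to `K`, after an integration by parts. -/
theorem admVar_left {κ : ℝ} {N : Pt → ℂ} {Nv Ω : Pt → Fin 3 → ℂ} (hNv : ContDiffOn ℝ ∞ Nv U)
    {K φ : TField ℂ} (hK : ContDiffOn ℝ ∞ K U) (hφ : ContDiffOn ℝ ∞ φ U) {x : Pt} (hx : x ∈ U) :
    admVar κ sE N Nv Ω K E φ 0 x = ∑ a, ∑ i, admGradK κ sE N Nv Ω K E x a i * φ x a i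
      + ∑ b, pd b (fun y => -(2 / κ) * ∑ a, Nv y a * momentum φ E y b a) x := by
  have hquad : ∀ c0 c1 c2 : ℂ, HasDerivAt (fun r : ℝ => c0 + r * c1 + r * r * c2) c1 0 := by
    intro c0 c1 c2
    have hr : HasDerivAt (fun r : ℝ => (r : ℂ)) 1 0 := Complex.ofRealCLM.hasDerivAt
    refine (((hr.mul_const c1).const_add c0).add ((hr.mul hr).mul_const c2)).congr_deriv ?_
    simp
  have e1 : ∀ r : ℝ, admTotal κ sE (K + (r : ℂ) • φ) (E + (r : ℂ) • 0) N Nv Ω x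
      = admTotal κ sE K E N Nv Ω x
        + r * (N x * ((κ * RCLike.sqrt (detq sE E x))⁻¹ * (2 * trKE K E x * trKE φ E x
            - ∑ a, ∑ b, (KE K E x b a * KE φ E x a b + KE φ E x b a * KE K E x a b)))
          + ∑ a, Nv x a * admDiffeo κ sE φ E x a + ∑ i, Ω x i * (2 / κ * gaussVec φ E x i))
        + r * r * (N x * ((κ * RCLike.sqrt (detq sE E x))⁻¹ * (trKE φ E x * trKE φ E x
            - ∑ a, ∑ b, KE φ E x b a * KE φ E x a b))) := by
    intro r
    rw [smul_zero, add_zero]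
    simp only [admTotal, admHamilton, admGauss_eq, KE_line, trKE_line, gaussVec_line,
      admDiffeo_line h κ hK hφ _ hx, Complex.coe_algebraMap]
    generalize scalarCurvature sE E x = R
    generalize admDiffeo κ sE φ E x = D
    generalize admDiffeo κ sE K E x = D'
    generalize KE φ E x = X
    generalize KE K E x = Y
    generalize gaussVec φ E x = G
    generalize gaussVec K E x = G'
    simp only [Fin.sum_univ_three]
    ring
  rw [admVar, funext e1, (hquad _ _ _).deriv]
  have e2 : ∀ b, pd b (fun y => -(2 / κ) * ∑ a, Nv y a * momentum φ E y b a) x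
      = -(2 / κ) * ∑ a, (pd b (fun y => Nv y a) x * momentum φ E x b a
        + Nv x a * pd b (fun y => momentum φ E y b a) x) := by
    intro b
    have d1 : ∀ a, DifferentiableAt ℝ (fun y => Nv y a) x := fun a =>
      h.diffAt hx (contDiffOn_pi.1 hNv a)
    have d2 : ∀ a, DifferentiableAt ℝ (fun y => momentum φ E y b a) x := fun a =>
      h.diffAt hx (contDiffOn_momentum hφ h.smooth b a)
    rw [pd_const_mul b _ (DifferentiableAt.fun_sum fun a _ => (d1 a).fun_mul (d2 a)),
      pd_sum b fun a _ => (d1 a).fun_mul (d2 a)]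
    simp only [pd_mul b (d1 _) (d2 _)]
  simp only [e2, admDiffeo_eq]
  generalize hD : (fun b a => pd b (fun y => momentum φ E y b a) x) = D
  have hD' : ∀ b a, pd b (fun y => momentum φ E y b a) x = D b a := fun b a =>
    congrFun (congrFun hD b) a
  simp only [hD', admGradK, shiftGrad]
  generalize (κ * RCLike.sqrt (detq sE E x))⁻¹ = w
  generalize christoffel sE E x = Γ
  generalize hP : (fun b a => pd b (fun y => Nv y a) x) = P
  have hP' : ∀ b a, pd b (fun y => Nv y a) x = P b a := fun b a =>
    congrFun (congrFun hP b) a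
  simp only [hP', momentum, gaussVec]
  generalize hY : KE K E x = Y
  simp only [trKE, KE]
  simp only [Fin.sum_univ_three, eps_table, Fin.reduceEq, if_true, if_false]
  ring

theorem contDiffOn_admGradK (hq : ∀ x ∈ U, detq sE E x ∈ Complex.slitPlane) {κ : ℝ} {N : Pt → ℂ}
    {Nv Ω : Pt → Fin 3 → ℂ} (hN : ContDiffOn ℝ ∞ N U) (hNv : ContDiffOn ℝ ∞ Nv U)
    (hΩ : ContDiffOn ℝ ∞ Ω U) {K : TField ℂ} (hK : ContDiffOn ℝ ∞ K U) :
    ContDiffOn ℝ ∞ (admGradK κ sE N Nv Ω K E) U := by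
  have hM : ∀ a b, ContDiffOn ℝ ∞ (fun x => shiftGrad sE E Nv x a b) U := fun a b =>
    (contDiffOn_pd b h.isOpen (contDiffOn_pi.1 hNv a)).add
      (ContDiffOn.sum fun c _ => (h.christoffel a b c).mul (contDiffOn_pi.1 hNv c))
  refine contDiffOn_pi.2 fun a => contDiffOn_pi.2 fun i => ?_
  simp only [admGradK, mul_inv]
  refine (ContDiffOn.add ?_ ?_).add ?_
  · exact ((contDiffOn_const.mul hN).mul (contDiffOn_const.mul (contDiffOn_invSqrt h hq))).mul
      (((contDiffOn_trKE hK h.smooth).mul (h.comp a i)).sub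
        (ContDiffOn.sum fun b _ => (contDiffOn_KE hK h.smooth a b).mul (h.comp b i)))
  · exact contDiffOn_const.mul ((ContDiffOn.sum fun b _ => (hM a b).mul (h.comp b i)).sub
      ((ContDiffOn.sum fun b _ => hM b b).mul (h.comp a i)))
  · exact contDiffOn_const.mul (ContDiffOn.sum fun l _ => ContDiffOn.sum fun k _ =>
      (contDiffOn_const.mul (contDiffOn_pi.1 hΩ l)).mul (h.comp a k))

/-- The gradient with respect to `K` is unique, by the fundamental lemma of the calculus of
variations, and hence given by the explicit formula. -/
theorem IsAdmGradient.left_eq (hq : ∀ x ∈ U, detq sE E x ∈ Complex.slitPlane) {κ : ℝ} {N : Pt → ℂ}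
    {Nv Ω : Pt → Fin 3 → ℂ} (hN : ContDiffOn ℝ ∞ N U) (hNv : ContDiffOn ℝ ∞ Nv U)
    (hΩ : ContDiffOn ℝ ∞ Ω U) {K V W : TField ℂ} (hK : ContDiffOn ℝ ∞ K U)
    (hVW : IsAdmGradient κ sE U N Nv Ω K E V W) :
    ∀ x ∈ U, ∀ a i, V x a i = admGradK κ sE N Nv Ω K E x a i := by
  have hG := contDiffOn_admGradK h hq (κ := κ) hN hNv hΩ hK
  refine eq_of_pairing_eq h.isOpen hVW.continuousOn_left hG.continuousOn fun φ hφ => ?_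
  have e := hVW.integral_eq φ 0 hφ (testField_zero U)
  have p0 : pairing U W 0 = 0 := by simp [pairing]
  have hz : ∀ b, IsTest U (fun y => -(2 / (κ : ℂ)) * ∑ a, Nv y a * momentum φ E y b a) := by
    intro b
    have hφ' := TestField.contDiffOn hφ
    refine isTest_of_smoothOn h.isOpen (TestField.isCompact hφ) (TestField.subset hφ) ?_ ?_
    · exact contDiffOn_const.mul (ContDiffOn.sum fun a _ =>
        (contDiffOn_pi.1 hNv a).mul (contDiffOn_momentum hφ' h.smooth b a))
    · intro x hx
      have h0 := eq_zero_of_notMem_fieldSupport hx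
      simp [momentum, trKE, KE, h0]
  rw [p0, add_zero, setIntegral_congr_fun h.isOpen.measurableSet fun x hx =>
    admVar_left h hNv hK (TestField.contDiffOn hφ) hx, integral_add
      (integrableOn_pairing h.isOpen hG.continuousOn hφ)
      (IsTest.sum fun b _ => (hz b).coordDeriv h.isOpen b).integrableOn,
    IsTest.integral_div h.isOpen hz, add_zero] at e
  exact e.symm

end

/-! ### Gauge rotations -/

/-- The rotation of the internal index of a field. -/
def rotate (u : TField ℂ) (R : Pt → Fin 3 → Fin 3 → ℂ) : TField ℂ := fun x a i =>
  ∑ j, u x a j * R x j i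

theorem rotate_line (u φ : TField ℂ) (R : Pt → Fin 3 → Fin 3 → ℂ) (r : ℂ) :
    rotate (u + r • φ) R = rotate u R + r • rotate φ R := by
  funext x a i
  simp only [rotate, Pi.add_apply, Pi.smul_apply, smul_eq_mul, Fin.sum_univ_three]
  ring

section Pointwise

variable {R : Pt → Fin 3 → Fin 3 → ℂ} {x : Pt}
  (hR : Matrix.of (R x) ∈ Matrix.specialOrthogonalGroup (Fin 3) ℂ)
include hR

theorem rotation_mul_transpose : Matrix.of (R x) * (Matrix.of (R x)).transpose = 1 :=
  (Matrix.mem_orthogonalGroup_iff _ _).1 (Matrix.mem_specialOrthogonalGroup_iff.1 hR).1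

theorem rotation_det : (Matrix.of (R x)).det = 1 := (Matrix.mem_specialOrthogonalGroup_iff.1 hR).2

theorem sum_rotation_mul (i j : Fin 3) : ∑ k, R x i k * R x j k = if i = j then 1 else 0 := by
  have := congrFun (congrFun (rotation_mul_transpose hR) i) j
  simpa [Matrix.mul_apply, Matrix.one_apply] using this

theorem rotation_adjugate : (Matrix.of (R x)).adjugate = (Matrix.of (R x)).transpose := by
  have e := Matrix.adjugate_mul (Matrix.of (R x))
  rw [rotation_det hR, one_smul] at e
  calc (Matrix.of (R x)).adjugate
      = (Matrix.of (R x)).adjugate * (Matrix.of (R x) * (Matrix.of (R x)).transpose) := by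
        rw [rotation_mul_transpose hR, mul_one]
    _ = _ := by rw [← mul_assoc, e, one_mul]

omit hR in
theorem of_rotate (u : TField ℂ) : Matrix.of (rotate u R x) = Matrix.of (u x) * Matrix.of (R x) := by
  ext a i
  simp [rotate, Matrix.mul_apply]

theorem detE_rotate (E : TField ℂ) : detE (rotate E R) x = detE E x := by
  rw [detE, of_rotate, Matrix.det_mul, rotation_det hR, mul_one, detE]

theorem invE_rotate (E : TField ℂ) (i a : Fin 3) :
    invE (rotate E R) x i a = ∑ j, R x j i * invE E x j a := by
  rw [invE, of_rotate, Matrix.mul_inv_rev, Matrix.inv_eq_right_inv (rotation_mul_transpose hR)]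
  simp [Matrix.mul_apply, invE]

theorem detq_rotate (sE : Pt → ℝ) (E : TField ℂ) : detq sE (rotate E R) x = detq sE E x := by
  rw [detq, detE_rotate hR, detq]

/-- A rotation preserves the inner product. -/
theorem rotation_inner (v w : Fin 3 → ℂ) :
    ∑ i, (∑ j, v j * R x j i) * (∑ j, w j * R x j i) = ∑ j, v j * w j := by
  have e := sum_rotation_mul hR
  have e' : ∑ i, (∑ j, v j * R x j i) * (∑ j, w j * R x j i)
      = ∑ j, ∑ k, v j * w k * ∑ i, R x j i * R x k i := by
    simp only [Fin.sum_univ_three]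
    ring
  rw [e']
  simp [e]

theorem metric_rotate (sE : Pt → ℝ) (E : TField ℂ) (a b : Fin 3) :
    metric sE (rotate E R) x a b = metric sE E x a b := by
  have e := rotation_inner hR (fun j => invE E x j a) (fun j => invE E x j b)
  simp only [mul_comm _ (R x _ _)] at e
  simp only [metric, detq_rotate hR, invE_rotate hR, e]

theorem invMetric_rotate (sE : Pt → ℝ) (E : TField ℂ) (a b : Fin 3) :
    invMetric sE (rotate E R) x a b = invMetric sE E x a b := by
  simp only [invMetric, detq_rotate hR]
  exact congrArg _ (rotation_inner hR (E x a) (E x b))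

theorem KE_rotate (K E : TField ℂ) (b a : Fin 3) :
    KE (rotate K R) (rotate E R) x b a = KE K E x b a := rotation_inner hR (K x a) (E x b)

/-- A proper rotation preserves the vector product. -/
theorem gaussVec_rotate (K E : TField ℂ) (i : Fin 3) :
    gaussVec (rotate K R) (rotate E R) x i = ∑ j, gaussVec K E x j * R x j i := by
  have e : ∀ j, R x j i = (Matrix.of (R x)).adjugate i j := fun j => by
    rw [rotation_adjugate hR]; rfl
  have e2 : ∑ j, gaussVec K E x j * R x j i
      = ∑ j, gaussVec K E x j * (Matrix.of (R x)).adjugate i j := by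
    simp only [← e]
  rw [e2]
  rcases fin3_cases i with rfl | rfl | rfl <;>
  · simp only [gaussVec, rotate, Fin.sum_univ_three, eps_table, Matrix.adjugate_fin_three]
    simp
    ring

end Pointwise

section Gauge

variable {U : Set Pt} (hU : IsOpen U) {R : Pt → Fin 3 → Fin 3 → ℂ}
  (hR : ∀ x ∈ U, Matrix.of (R x) ∈ Matrix.specialOrthogonalGroup (Fin 3) ℂ)
include hU hR

/-- The ADM constraints are gauge invariant. -/
theorem adm_rotate (κ : ℝ) (sE : Pt → ℝ) (K E : TField ℂ) {x : Pt} (hx : x ∈ U) :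
    admHamilton κ sE (rotate K R) (rotate E R) x = admHamilton κ sE K E x ∧
      ∀ a, admDiffeo κ sE (rotate K R) (rotate E R) x a = admDiffeo κ sE K E x a :=
  ⟨admHamilton_congr hU (fun y hy => detq_rotate (hR y hy) sE E)
      (fun y hy => metric_rotate (hR y hy) sE E) (fun y hy => invMetric_rotate (hR y hy) sE E)
      (fun y hy => KE_rotate (hR y hy) K E) κ hx,
    admDiffeo_congr hU
      (fun y hy => metric_rotate (hR y hy) sE E) (fun y hy => invMetric_rotate (hR y hy) sE E)
      (fun y hy => KE_rotate (hR y hy) K E) κ hx⟩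

theorem admTotal_rotate (κ : ℝ) (sE : Pt → ℝ) (N : Pt → ℂ) (Nv Ω : Pt → Fin 3 → ℂ)
    (K E : TField ℂ) {x : Pt} (hx : x ∈ U) :
    admTotal κ sE (rotate K R) (rotate E R) N Nv (fun x i => ∑ j, Ω x j * R x j i) x
      = admTotal κ sE K E N Nv Ω x := by
  have e := rotation_inner (hR x hx) (Ω x) (fun j => 2 / κ * gaussVec K E x j)
  obtain ⟨e1, e2⟩ := adm_rotate hU hR κ sE K E hx
  simp only [admTotal, e1, e2, admGauss_eq, gaussVec_rotate (hR x hx)]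
  rw [← e]
  simp only [Finset.mul_sum, mul_assoc]

/-- The gradient of the ADM Hamiltonian is gauge covariant. -/
theorem IsAdmGradient.rotate {κ : ℝ} {sE : Pt → ℝ} {N : Pt → ℂ} {Nv Ω : Pt → Fin 3 → ℂ}
    {K E V W : TField ℂ} (hRs : ContDiffOn ℝ ∞ R U)
    (hVW : IsAdmGradient κ sE U N Nv (fun x i => ∑ j, Ω x j * R x j i)
      (SelfdualGravity.rotate K R) (SelfdualGravity.rotate E R) V W) :
    IsAdmGradient κ sE U N Nv Ω K E (SelfdualGravity.rotate V fun x i j => R x j i)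
      (SelfdualGravity.rotate W fun x i j => R x j i) := by
  have hRc : ∀ i j, ContDiffOn ℝ ∞ (fun x => R x i j) U := fun i j =>
    component_contDiffOn hRs i j
  have hc : ∀ {V : TField ℂ}, ContinuousOn V U →
      ContinuousOn (SelfdualGravity.rotate V fun x i j => R x j i) U := fun hV =>
    continuousOn_pi.2 fun a => continuousOn_pi.2 fun i => continuousOn_finsetSum _ fun j _ =>
      (continuousOn_component hV a j).mul (hRc i j).continuousOn
  have ht : ∀ {φ : TField ℂ}, TestField U φ → TestField U (SelfdualGravity.rotate φ R) :=
    fun hφ a i => IsTest.sum fun j _ => (hφ a j).mul_smoothOn hU (hRc j i)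
  have hp : ∀ V φ : TField ℂ, pairing U V (SelfdualGravity.rotate φ R)
      = pairing U (SelfdualGravity.rotate V fun x i j => R x j i) φ := by
    intro V φ
    simp only [pairing]
    congr 1
    funext x
    refine Finset.sum_congr rfl fun a _ => ?_
    simp only [SelfdualGravity.rotate, Fin.sum_univ_three]
    ring
  refine ⟨hc hVW.continuousOn_left, hc hVW.continuousOn_right, fun φ ψ hφ hψ => ?_⟩
  rw [← hp, ← hp, ← hVW.integral_eq _ _ (ht hφ) (ht hψ)]
  refine setIntegral_congr_fun hU.measurableSet fun x hx => ?_
  simp only [admVar, ← rotate_line, admTotal_rotate hU hR κ sE N Nv Ω _ _ hx]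

end Gauge

/-- The gradient of the ADM Hamiltonian when the multiplier of the Gauss constraint is shifted. -/
theorem IsAdmGradient.add_gauss {U : Set Pt} {sE : Pt → ℝ} {E : TField ℂ} (h : Triad U sE E)
    (hq : ∀ x ∈ U, detq sE E x ∈ Complex.slitPlane)
    {N : Pt → ℂ} {Nv Ω w : Pt → Fin 3 → ℂ} (hN : ContDiffOn ℝ ∞ N U) (hNv : ContDiffOn ℝ ∞ Nv U)
    (hΩ : ContDiffOn ℝ ∞ Ω U) (hw : ContDiffOn ℝ ∞ w U) {K : TField ℂ} (hK : ContDiffOn ℝ ∞ K U)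
    {κ : ℝ} {V W : TField ℂ} (hVW : IsAdmGradient κ sE U N Nv Ω K E V W) :
    IsAdmGradient κ sE U N Nv (Ω + w) K E
      (V + fun x a j => 2 / κ * ∑ i, ∑ k, eps ℂ i j k * w x i * E x a k)
      (W + fun x a k => 2 / κ * ∑ i, ∑ j, eps ℂ i j k * w x i * K x a j) := by
  have hc : ∀ {X : TField ℂ}, ContDiffOn ℝ ∞ X U → ∀ {c : Fin 3 → Fin 3 → Fin 3 → ℂ},
      ContinuousOn (fun x a j => 2 / (κ : ℂ) * ∑ i, ∑ k, c i j k * w x i * X x a k) U := by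
    intro X hX c
    refine ContDiffOn.continuousOn (𝕜 := ℝ) (n := ∞) ?_
    exact contDiffOn_pi.2 fun a => contDiffOn_pi.2 fun j => contDiffOn_const.mul <|
      ContDiffOn.sum fun i _ => ContDiffOn.sum fun k _ =>
        (contDiffOn_const.mul (contDiffOn_pi.1 hw i)).mul (component_contDiffOn hX a k)
  have c1 := hc h.smooth (c := fun i j k => eps ℂ i j k)
  have c2 := hc hK (c := fun i k j => eps ℂ i j k)
  refine ⟨hVW.continuousOn_left.add c1, hVW.continuousOn_right.add c2, fun φ ψ hφ hψ => ?_⟩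
  rw [setIntegral_congr_fun h.isOpen.measurableSet fun x hx =>
    admVar_add_gauss h hq hN hNv hΩ hK κ (TestField.contDiffOn hφ) (TestField.contDiffOn hψ) w hx]
  set X : TField ℂ := fun x a j => 2 / κ * ∑ i, ∑ k, eps ℂ i j k * w x i * E x a k with hX
  set Y : TField ℂ := fun x a k => 2 / κ * ∑ i, ∑ j, eps ℂ i j k * w x i * K x a j with hY
  have i1 := integrableOn_pairing h.isOpen c1 hφ
  have i2 := integrableOn_pairing h.isOpen c2 hψ
  have i3 : IntegrableOn
      (fun x => ∑ a, ∑ j, X x a j * φ x a j + ∑ a, ∑ k, Y x a k * ψ x a k) U := i1.add i2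
  have e : ∀ x, ∑ i, w x i * (2 / κ * gaussVar K E φ ψ x i)
      = ∑ a, ∑ j, X x a j * φ x a j + ∑ a, ∑ k, Y x a k * ψ x a k := by
    intro x
    simp only [hX, hY, gaussVar, gaussVec, Fin.sum_univ_three, eps_table]
    ring
  simp only [e]
  rw [integral_add (isTest_admVar h hq hN hNv hΩ hK κ hφ hψ).integrableOn i3,
    integral_add i1 i2, hVW.integral_eq φ ψ hφ hψ,
    pairing_add_left h.isOpen hVW.continuousOn_left c1 hφ,
    pairing_add_left h.isOpen hVW.continuousOn_right c2 hψ]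
  simp only [pairing]
  ring

/-! ### Real fields as complex fields -/

section Complexify

variable (sE : Pt → ℝ) (K E : TField ℝ)

theorem eps_ofReal (i j k : Fin 3) : ((eps ℝ i j k : ℝ) : ℂ) = eps ℂ i j k := by
  simp [eps]

theorem detE_complexify (x : Pt) : detE (complexify E) x = ((detE E x : ℝ) : ℂ) := by
  simp [detE, Matrix.det_fin_three, complexify]

theorem of_complexify (x : Pt) :
    Matrix.of (complexify E x) = (Matrix.of (E x)).map Complex.ofRealHom := rfl

theorem invE_complexify (x : Pt) (i a : Fin 3) :
    invE (complexify E) x i a = ((invE E x i a : ℝ) : ℂ) := by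
  have e : (Matrix.of (complexify E x)).adjugate
      = ((Matrix.of (E x)).adjugate).map Complex.ofRealHom := by
    rw [of_complexify]
    exact (RingHom.map_adjugate Complex.ofRealHom (Matrix.of (E x))).symm
  have e2 := detE_complexify E x
  rw [detE, detE] at e2
  rw [invE, invE, Matrix.inv_def, Matrix.inv_def, e, e2]
  simp

theorem detq_complexify (x : Pt) : detq sE (complexify E) x = ((detq sE E x : ℝ) : ℂ) := by
  simp [detq, detE_complexify]

theorem metric_complexify (x : Pt) (a b : Fin 3) :
    metric sE (complexify E) x a b = ((metric sE E x a b : ℝ) : ℂ) := by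
  simp [metric, detq_complexify, invE_complexify]

theorem invMetric_complexify (x : Pt) (a b : Fin 3) :
    invMetric sE (complexify E) x a b = ((invMetric sE E x a b : ℝ) : ℂ) := by
  simp [invMetric, detq_complexify, complexify]

theorem christoffel_complexify (x : Pt) (c a b : Fin 3) :
    christoffel sE (complexify E) x c a b = ((christoffel sE E x c a b : ℝ) : ℂ) := by
  simp [christoffel, metric_complexify, invMetric_complexify, pd_ofReal]

theorem scalarCurvature_complexify (x : Pt) :
    scalarCurvature sE (complexify E) x = ((scalarCurvature sE E x : ℝ) : ℂ) := by
  simp [scalarCurvature, ricci, christoffel_complexify, invMetric_complexify, pd_ofReal]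

theorem KE_complexify (x : Pt) (b a : Fin 3) :
    KE (complexify K) (complexify E) x b a = ((KE K E x b a : ℝ) : ℂ) := by
  simp [KE, complexify]

theorem trKE_complexify (x : Pt) :
    trKE (complexify K) (complexify E) x = ((trKE K E x : ℝ) : ℂ) := by
  simp [trKE, KE_complexify]

theorem admGauss_complexify (κ : ℝ) (x : Pt) (i : Fin 3) :
    admGauss κ (complexify K) (complexify E) x i = ((admGauss κ K E x i : ℝ) : ℂ) := by
  simp [admGauss, complexify, eps_ofReal]

theorem admDiffeo_complexify (κ : ℝ) (x : Pt) (a : Fin 3) :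
    admDiffeo κ sE (complexify K) (complexify E) x a = ((admDiffeo κ sE K E x a : ℝ) : ℂ) := by
  have e : ∀ y (b' a' : Fin 3), (KE (complexify K) (complexify E) y b' a'
      - if b' = a' then trKE (complexify K) (complexify E) y else 0)
      = (((KE K E y b' a' - if b' = a' then trKE K E y else 0) : ℝ) : ℂ) := by
    intro y b' a'
    rw [KE_complexify, trKE_complexify]
    split_ifs <;> simp
  simp only [admDiffeo, covDerivDensity, e, pd_ofReal, christoffel_complexify]
  simp

open scoped ComplexOrder in
theorem sqrt_ofReal {d : ℝ} (hd : 0 ≤ d) :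
    RCLike.sqrt (d : ℂ) = ((RCLike.sqrt d : ℝ) : ℂ) := by
  rw [RCLike.sqrt_of_nonneg (by exact_mod_cast hd : (0 : ℂ) ≤ d), RCLike.sqrt_real]
  simp

theorem admHamilton_complexify (κ : ℝ) {x : Pt} (hx : 0 ≤ detq sE E x) :
    admHamilton κ sE (complexify K) (complexify E) x = ((admHamilton κ sE K E x : ℝ) : ℂ) := by
  rw [admHamilton, admHamilton, detq_complexify, sqrt_ofReal hx]
  simp [scalarCurvature_complexify, KE_complexify, trKE_complexify]

theorem admTotal_complexify (κ : ℝ) (N : Pt → ℝ) (Nv Ω : Pt → Fin 3 → ℝ) {x : Pt}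
    (hx : 0 ≤ detq sE E x) :
    admTotal κ sE (complexify K) (complexify E) (fun x => (N x : ℂ)) (fun x a => (Nv x a : ℂ))
      (fun x i => (Ω x i : ℂ)) x = ((admTotal κ sE K E N Nv Ω x : ℝ) : ℂ) := by
  simp [admTotal, admHamilton_complexify sE K E κ hx, admDiffeo_complexify, admGauss_complexify]

theorem complexify_line (u φ : TField ℝ) (r : ℝ) :
    complexify (u + r • φ) = complexify u + (r : ℂ) • complexify φ := by
  funext x a i
  simp [complexify]

theorem complexify_zero : complexify 0 = 0 := by
  funext x a i
  simp [complexify]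

theorem pairing_complexify (U : Set Pt) (W φ : TField ℝ) :
    pairing U (complexify W) (complexify φ) = ((pairing U W φ : ℝ) : ℂ) := by
  rw [pairing, pairing, ← integral_complex_ofReal]
  simp [complexify]

end Complexify

/-! ### Real and complex functional derivatives of the ADM Hamiltonian -/

section RealTransfer

variable {U : Set Pt} {sE : Pt → ℝ} {E : TField ℝ} (h : Triad U sE (complexify E))
  (hq : ∀ x ∈ U, 0 < detq sE E x) {N : Pt → ℝ} {Nv Ω : Pt → Fin 3 → ℝ}
  (hN : ContDiffOn ℝ ∞ N U) (hNv : ContDiffOn ℝ ∞ Nv U) (hΩ : ContDiffOn ℝ ∞ Ω U)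
  {K : TField ℝ} (hK : ContDiffOn ℝ ∞ K U) (κ : ℝ)

theorem ContDiffOn.complexify_field {u : TField ℝ} {U : Set Pt} (hu : ContDiffOn ℝ ∞ u U) :
    ContDiffOn ℝ ∞ (complexify u) U :=
  contDiffOn_pi.2 fun a => contDiffOn_pi.2 fun i =>
    Complex.ofRealCLM.contDiff.comp_contDiffOn (contDiffOn_pi.1 (contDiffOn_pi.1 hu a) i)

theorem ContDiffOn.complexify_vector {v : Pt → Fin 3 → ℝ} {U : Set Pt} (hv : ContDiffOn ℝ ∞ v U) :
    ContDiffOn ℝ ∞ (fun x a => (v x a : ℂ)) U :=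
  contDiffOn_pi.2 fun a => Complex.ofRealCLM.contDiff.comp_contDiffOn (contDiffOn_pi.1 hv a)

theorem ContDiffOn.complexify_scalar {f : Pt → ℝ} {U : Set Pt} (hf : ContDiffOn ℝ ∞ f U) :
    ContDiffOn ℝ ∞ (fun x => (f x : ℂ)) U := Complex.ofRealCLM.contDiff.comp_contDiffOn hf

/-- The parameters and points for which a variation of a real triad has a Riemannian metric. -/
def positiveDomain (U : Set Pt) (sE : Pt → ℝ) (E ψ : TField ℝ) : Set (ℝ × Pt) :=
  slitDomain U sE (complexify E) (complexify ψ) (fun r : ℝ => (r : ℂ)) ∩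
    (fun p => detq sE (complexify E + (p.1 : ℂ) • complexify ψ) p.2) ⁻¹' {z : ℂ | 0 < z.re}

include hq in
theorem ofReal_detq_mem_slitPlane : ∀ x ∈ U, detq sE (complexify E) x ∈ Complex.slitPlane :=
  fun x hx => by
    rw [detq_complexify]
    exact Complex.ofReal_mem_slitPlane.2 (hq x hx)

theorem positive_of_mem {ψ : TField ℝ} {r : ℝ} {x : Pt} (hx : (r, x) ∈ positiveDomain U sE E ψ) :
    0 < detq sE (E + r • ψ) x := by
  have : 0 < (detq sE (complexify E + (r : ℂ) • complexify ψ) x).re := hx.2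
  rwa [← complexify_line, detq_complexify, Complex.ofReal_re] at this

include h

theorem isOpen_positiveDomain {ψ : TField ℝ} (hψ : ContDiffOn ℝ ∞ ψ U) :
    IsOpen (positiveDomain U sE E ψ) := by
  have hf := h.slitVariation (ContDiffOn.complexify_field hψ) Complex.ofRealCLM.contDiff
  exact hf.detq.continuousOn.isOpen_inter_preimage hf.isOpen
    (isOpen_lt continuous_const Complex.continuous_re)

include hq

theorem mem_positiveDomain {ψ : TField ℝ} {x : Pt} (hx : x ∈ U) :
    ((0 : ℝ), x) ∈ positiveDomain U sE E ψ := by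
  refine ⟨mem_slitDomain h Complex.ofReal_zero hx (ofReal_detq_mem_slitPlane hq x hx), ?_⟩
  simp [detq_complexify, hq x hx]

include hN hNv hΩ hK

omit hq in
theorem jointSmooth_admTotal_real {φ ψ : TField ℝ} (hφ : ContDiffOn ℝ ∞ φ U)
    (hψ : ContDiffOn ℝ ∞ ψ U) : JointSmooth (positiveDomain U sE E ψ)
      (fun r x => admTotal κ sE (K + r • φ) (E + r • ψ) N Nv Ω x) := by
  have h1 := (jointSmooth_admTotal_variation h (ContDiffOn.complexify_scalar hN)
    (ContDiffOn.complexify_vector hNv) (ContDiffOn.complexify_vector hΩ)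
    (ContDiffOn.complexify_field hK) κ Complex.ofRealCLM.contDiff
    (ContDiffOn.complexify_field hφ) (ContDiffOn.complexify_field hψ)).mono
    (inter_subset_left (s := slitDomain U sE (complexify E) (complexify ψ) (fun r : ℝ => (r : ℂ)))
      (t := (fun p => detq sE (complexify E + (p.1 : ℂ) • complexify ψ) p.2) ⁻¹' {z : ℂ | 0 < z.re}))
  have h2 : JointSmooth (positiveDomain U sE E ψ) (fun r x => (admTotal κ sE
      (complexify K + (r : ℂ) • complexify φ) (complexify E + (r : ℂ) • complexify ψ)
      (fun x => (N x : ℂ)) (fun x a => (Nv x a : ℂ)) (fun x i => (Ω x i : ℂ)) x).re) :=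
    Complex.reCLM.contDiff.comp_contDiffOn h1
  refine h2.congr fun r x hx => ?_
  rw [← complexify_line, ← complexify_line,
    admTotal_complexify sE _ _ κ N Nv Ω (positive_of_mem hx).le, Complex.ofReal_re]

theorem variable_adm_left : Variable U (fun K' x => admTotal κ sE K' E N Nv Ω x) K where
  smooth φ hφ := ⟨positiveDomain U sE E 0,
    isOpen_positiveDomain h (contDiffOn_const (c := (0 : Fin 3 → Fin 3 → ℝ))),
    fun x hx => mem_positiveDomain h hq hx, by
      have e := jointSmooth_admTotal_real h hN hNv hΩ hK κ (TestField.contDiffOn hφ)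
        (ψ := 0) (contDiffOn_const (c := (0 : Fin 3 → Fin 3 → ℝ)))
      simp only [smul_zero, add_zero] at e
      exact e⟩
  isLocal φ hφ s x _ hxK :=
    admTotal_congr κ (add_smul_eventuallyEq hφ K s hxK) Filter.EventuallyEq.rfl N Nv Ω

theorem variable_adm_right : Variable U (fun E' x => admTotal κ sE K E' N Nv Ω x) E where
  smooth φ hφ := ⟨positiveDomain U sE E φ, isOpen_positiveDomain h (TestField.contDiffOn hφ),
    fun x hx => mem_positiveDomain h hq hx, by
      have e := jointSmooth_admTotal_real h hN hNv hΩ hK κ (φ := 0)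
        (contDiffOn_const (c := (0 : Fin 3 → Fin 3 → ℝ))) (TestField.contDiffOn hφ)
      simp only [smul_zero, add_zero] at e
      exact e⟩
  isLocal φ hφ s x _ hxK :=
    admTotal_congr κ Filter.EventuallyEq.rfl (add_smul_eventuallyEq hφ E s hxK) N Nv Ω

/-- For real fields and variations the complexified variation is the real one. -/
theorem admVar_complexify {φ ψ : TField ℝ} (hφ : ContDiffOn ℝ ∞ φ U) (hψ : ContDiffOn ℝ ∞ ψ U)
    {x : Pt} (hx : x ∈ U) :
    admVar κ sE (fun x => (N x : ℂ)) (fun x a => (Nv x a : ℂ)) (fun x i => (Ω x i : ℂ))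
      (complexify K) (complexify E) (complexify φ) (complexify ψ) x
      = ((deriv (fun r : ℝ => admTotal κ sE (K + r • φ) (E + r • ψ) N Nv Ω x) 0 : ℝ) : ℂ) := by
  have hO := isOpen_positiveDomain h hψ
  have h1 := (jointSmooth_admTotal_real h hN hNv hΩ hK κ hφ hψ).hasDerivAt hO
    (mem_positiveDomain h hq hx)
  refine ((h1.ofReal_comp).congr_of_eventuallyEq ?_).deriv
  have : ∀ᶠ r in nhds (0 : ℝ), (r, x) ∈ positiveDomain U sE E ψ :=
    (Continuous.prodMk_left x).continuousAt.eventually (hO.mem_nhds (mem_positiveDomain h hq hx))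
  filter_upwards [this] with r hr
  rw [← complexify_line, ← complexify_line,
    admTotal_complexify sE _ _ κ N Nv Ω (positive_of_mem hr).le]

/-- The real functional derivative with respect to `K` is the complex gradient tested on real
variations. -/
theorem hasFunctionalDeriv_adm_left_iff {W : TField ℝ} :
    HasFunctionalDeriv U (fun K' => ∫ x in U, (admTotal κ sE K' E N Nv Ω x
      - admTotal κ sE K E N Nv Ω x)) K W ↔ ContinuousOn W U ∧ ∀ φ : TField ℝ, TestField U φ →
      ∫ x in U, admVar κ sE (fun x => (N x : ℂ)) (fun x a => (Nv x a : ℂ)) (fun x i => (Ω x i : ℂ))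
        (complexify K) (complexify E) (complexify φ) 0 x
        = pairing U (complexify W) (complexify φ) := by
  rw [hasFunctionalDeriv_iff h.isOpen (variable_adm_left h hq hN hNv hΩ hK κ)]
  refine and_congr_right fun _ => forall_congr' fun φ => forall_congr' fun hφ => ?_
  have e : ∀ x ∈ U, admVar κ sE (fun x => (N x : ℂ)) (fun x a => (Nv x a : ℂ))
      (fun x i => (Ω x i : ℂ)) (complexify K) (complexify E) (complexify φ) 0 x
      = ((firstVar (fun K' x => admTotal κ sE K' E N Nv Ω x) K φ x : ℝ) : ℂ) := by
    intro x hx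
    have := admVar_complexify h hq hN hNv hΩ hK κ (TestField.contDiffOn hφ) (ψ := 0)
      (contDiffOn_const (c := (0 : Fin 3 → Fin 3 → ℝ))) hx
    simp only [smul_zero, add_zero, complexify_zero] at this
    exact this
  rw [setIntegral_congr_fun h.isOpen.measurableSet e, integral_complex_ofReal, pairing_complexify,
    Complex.ofReal_inj]

/-- The real functional derivative with respect to `E` is the complex gradient tested on real
variations. -/
theorem hasFunctionalDeriv_adm_right_iff {W : TField ℝ} :
    HasFunctionalDeriv U (fun E' => ∫ x in U, (admTotal κ sE K E' N Nv Ω x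
      - admTotal κ sE K E N Nv Ω x)) E W ↔ ContinuousOn W U ∧ ∀ ψ : TField ℝ, TestField U ψ →
      ∫ x in U, admVar κ sE (fun x => (N x : ℂ)) (fun x a => (Nv x a : ℂ)) (fun x i => (Ω x i : ℂ))
        (complexify K) (complexify E) 0 (complexify ψ) x
        = pairing U (complexify W) (complexify ψ) := by
  rw [hasFunctionalDeriv_iff h.isOpen (variable_adm_right h hq hN hNv hΩ hK κ)]
  refine and_congr_right fun _ => forall_congr' fun φ => forall_congr' fun hφ => ?_
  have e : ∀ x ∈ U, admVar κ sE (fun x => (N x : ℂ)) (fun x a => (Nv x a : ℂ))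
      (fun x i => (Ω x i : ℂ)) (complexify K) (complexify E) 0 (complexify φ) x
      = ((firstVar (fun E' x => admTotal κ sE K E' N Nv Ω x) E φ x : ℝ) : ℂ) := by
    intro x hx
    have := admVar_complexify h hq hN hNv hΩ hK κ (φ := 0)
      (contDiffOn_const (c := (0 : Fin 3 → Fin 3 → ℝ))) (TestField.contDiffOn hφ) hx
    simp only [smul_zero, add_zero, complexify_zero] at this
    exact this
  rw [setIntegral_congr_fun h.isOpen.measurableSet e, integral_complex_ofReal, pairing_complexify,
    Complex.ofReal_inj]

end RealTransfer

/-! ### Time dependent fields on a product of an interval and the patch -/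

section TimeFamilies

variable {U : Set Pt} {I : Set ℝ} {sE se : Pt → ℝ}

theorem JointSmooth.ofReal {O : Set (ℝ × Pt)} {f : ℝ → Pt → ℝ} (hf : JointSmooth O f) :
    JointSmooth O (fun t x => (f t x : ℂ)) := Complex.ofRealCLM.contDiff.comp_contDiffOn hf

theorem SmoothFamily.vector {V : Type} [NormedAddCommGroup V] [NormedSpace ℝ V]
    {f : ℝ → Pt → Fin 3 → V} (hf : SmoothFamily I U f) (a : Fin 3) :
    JointSmooth (I ×ˢ U) (fun t x => f t x a) := contDiffOn_pi.1 hf a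

theorem SmoothFamily.field {V : Type} [NormedAddCommGroup V] [NormedSpace ℝ V]
    {f : ℝ → Pt → Fin 3 → Fin 3 → V} (hf : SmoothFamily I U f) (a i : Fin 3) :
    JointSmooth (I ×ˢ U) (fun t x => f t x a i) := jointSmooth_pi.1 hf a i

theorem SmoothFamily.complexify {E : ℝ → TField ℝ} (hE : SmoothFamily I U E) :
    SmoothFamily I U (fun t => complexify (E t)) :=
  jointSmooth_pi.2 fun a i => (SmoothFamily.field hE a i).ofReal

theorem SmoothFamily.slice {V : Type} [NormedAddCommGroup V] [NormedSpace ℝ V] {f : ℝ → Pt → V}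
    (hf : SmoothFamily I U f) {t : ℝ} (ht : t ∈ I) : ContDiffOn ℝ ∞ (f t) U :=
  JointSmooth.slice hf fun _ hx => ⟨ht, hx⟩

theorem triadFamily_of_smoothFamily (hI : IsOpen I) (hU : IsOpen U) {E : ℝ → TField ℂ}
    (hE : SmoothFamily I U E) (hs : ∀ t ∈ I, IsOrientationSign U (detE (E t)) sE) :
    TriadFamily (I ×ˢ U) sE E where
  isOpen := hI.prod hU
  smooth := SmoothFamily.field hE
  det_ne t x hx := (hs t hx.1).2.1 x hx.2
  sign t x hx := (hs t hx.1).locSign hU x hx.2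

theorem TriadFamily.slice {E : ℝ → TField ℂ} (h : TriadFamily (I ×ˢ U) sE E) (hU : IsOpen U)
    {t : ℝ} (ht : t ∈ I) : Triad U sE (E t) where
  isOpen := hU
  smooth := contDiffOn_pi.2 fun a => contDiffOn_pi.2 fun i =>
    (h.smooth a i).slice fun _ hx => ⟨ht, hx⟩
  det_ne x hx := h.det_ne t x ⟨ht, hx⟩
  sign x hx := h.sign t x ⟨ht, hx⟩

theorem TriadFamily.contDiffOn_velocity {E : ℝ → TField ℂ} (h : TriadFamily (I ×ˢ U) sE E)
    {t : ℝ} (ht : t ∈ I) : ContDiffOn ℝ ∞ (velocity E t) U :=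
  contDiffOn_pi.2 fun a => contDiffOn_pi.2 fun i =>
    ((h.smooth a i).deriv h.isOpen).slice fun _ hx => ⟨ht, hx⟩

theorem linSpin_congr (hU : IsOpen U) (E : TField ℂ) {φ ψ : TField ℂ}
    (e : ∀ y ∈ U, ∀ a i, φ y a i = ψ y a i) {x : Pt} (hx : x ∈ U) :
    linSpin E φ x = linSpin E ψ x := by
  have e1 : frameV E φ x = frameV E ψ x := by
    funext m j
    simp only [frameV, e x hx]
  have e2 : frameD E φ x = frameD E ψ x := by
    funext l m j
    simp only [frameD]
    refine Finset.sum_congr rfl fun a _ => Finset.sum_congr rfl fun b _ => ?_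
    rw [pd_congr a hU (fun y hy => e y hy b j) hx]
  funext a k
  simp only [linSpin, e1, e2]

theorem jointSmooth_gaugeShift {E K : ℝ → TField ℂ} (h : TriadFamily (I ×ˢ U) sE E)
    (hq : ∀ t x, (t, x) ∈ I ×ˢ U → detq sE (E t) x ∈ Complex.slitPlane)
    (hse : ∀ t ∈ I, LocSign U se) {N : ℝ → Pt → ℂ} {Nv : ℝ → Pt → Fin 3 → ℂ}
    (hN : SmoothFamily I U N) (hNv : SmoothFamily I U Nv) (hK : SmoothFamily I U K) :
    SmoothFamily I U (fun t => gaugeShift se sE (N t) (Nv t) (K t) (E t)) := by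
  have hs : JointSmooth (I ×ˢ U) (fun (_ : ℝ) x => ((se x / sE x : ℝ) : ℂ)) := by
    intro p hp
    have hsE : LocSign U sE := fun x hx => h.sign p.1 x ⟨hp.1, hx⟩
    exact jointSmooth_const ((hse p.1 hp.1).div hsE).contDiffOn_complex I p hp
  refine contDiffOn_pi.2 fun i => ?_
  exact JointSmooth.const_mul _ <|
    (JointSmooth.sum fun a => (SmoothFamily.vector hNv a).mul (SmoothFamily.field hK a i)).sub <|
    hs.mul <| (jointSmooth_invSqrt h hq).mul <| JointSmooth.sum fun a =>
      (JointSmooth.pd h.isOpen hN a).mul (h.smooth a i)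

end TimeFamilies

/-! ### Real solutions of ADM gravity are solutions of selfdual gravity -/

/-- The metric of a real triad with `q > 0` is positive definite. -/
theorem metric_posDef {sE : Pt → ℝ} {E : TField ℝ} {x : Pt} (hq : 0 < detq sE E x) :
    (Matrix.of (metric sE E x)).PosDef := by
  have hd : IsUnit (Matrix.of (E x)).det := by
    refine isUnit_iff_ne_zero.2 fun h0 => hq.ne' ?_
    rw [detq, detE, h0, mul_zero]
  have hB : IsUnit (Matrix.of (E x))⁻¹ :=
    (Matrix.isUnit_nonsing_inv_iff).2 ((Matrix.isUnit_iff_isUnit_det _).2 hd)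
  have h1 := Matrix.PosDef.conjTranspose_mul_self (Matrix.of (E x))⁻¹
    (Matrix.mulVec_injective_of_isUnit hB)
  have h2 := h1.smul hq
  convert h2 using 1
  ext a b
  simp [metric, invE, Matrix.mul_apply]

section Converse

variable {U : Set Pt} (hU : IsOpen U) {κ : ℝ} (hκ : κ ≠ 0) {lam : ℂ} (hlam : lam ≠ 0)
  {se sE : Pt → ℝ} {I : Set ℝ} {K E : ℝ → TField ℝ} {N : ℝ → Pt → ℝ} {Nv Ω : ℝ → Pt → Fin 3 → ℝ}
include hU

omit hU in
theorem realityConditions_complexify (hq : ∀ t ∈ I, ∀ x ∈ U, 0 < detq sE (E t) x) :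
    RealityConditions U I sE (fun t => complexify (E t)) := by
  refine fun t ht x hx => ⟨⟨_, metric_posDef (hq t ht x hx), fun a b =>
    metric_complexify sE (E t) x a b⟩, fun a b => ?_⟩
  simp only [metric_complexify]
  by_cases hd : DifferentiableAt ℝ (fun τ => metric sE (E τ) x a b) t
  · rw [hd.hasDerivAt.ofReal_comp.deriv, Complex.ofReal_im]
  · rw [deriv_zero_of_not_differentiableAt, Complex.zero_im]
    exact fun h => hd (Complex.reCLM.differentiableAt.comp t h)

include hκ hlam

/-- Hamilton's equations at one instant: the derivatives of `A = Γ + iK` and of `E` follow from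
those of `K` and of `E`. -/
theorem selfdual_equations_of_adm {t : ℝ} (ht : t ∈ I)
    (hf : TriadFamily (I ×ˢ U) sE (fun t => complexify (E t)))
    (hse : LocSign U se) (hq : ∀ x ∈ U, 0 < detq sE (E t) x) {A : ℝ → TField ℂ}
    {N : Pt → ℝ} {Nv Ω : Pt → Fin 3 → ℝ} {Λ : Pt → Fin 3 → ℂ}
    (hN : ContDiffOn ℝ ∞ N U) (hNv : ContDiffOn ℝ ∞ Nv U) (hΩ : ContDiffOn ℝ ∞ Ω U)
    (hK : ContDiffOn ℝ ∞ (K t) U) (hA : ContDiffOn ℝ ∞ (A t) U) (hΛ : ContDiffOn ℝ ∞ Λ U)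
    (hAK : ∀ t x a i, A t x a i
      = spinConnection sE (complexify (E t)) x a i + Complex.I * complexify (K t) x a i)
    (hΛΩ : Λ + gaugeShift se sE (fun x => (N x : ℂ)) (fun x a => (Nv x a : ℂ)) (complexify (K t))
      (complexify (E t)) = fun x i => (Ω x i : ℂ))
    (hg : ∀ x ∈ U, ∀ i, gaussVec (complexify (K t)) (complexify (E t)) x i = 0)
    {WQ WP : TField ℝ}
    (h1 : HasFunctionalDeriv U (fun K' => ∫ x in U,
      (admTotal κ sE K' (E t) (fun x => se x / sE x * N x) Nv Ω x
        - admTotal κ sE (K t) (E t) (fun x => se x / sE x * N x) Nv Ω x)) (K t) WQ)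
    (h2 : HasFunctionalDeriv U (fun E' => ∫ x in U,
      (admTotal κ sE (K t) E' (fun x => se x / sE x * N x) Nv Ω x
        - admTotal κ sE (K t) (E t) (fun x => se x / sE x * N x) Nv Ω x)) (E t) WP)
    (hQ : ∀ x ∈ U, ∀ a i, HasDerivAt (fun τ => K τ x a i) (κ / 2 * WP x a i) t)
    (hP : ∀ x ∈ U, ∀ a i, HasDerivAt (fun τ => E τ x a i) (-(κ / 2) * WQ x a i) t) :
    ∃ VQ VP : TField ℂ,
      HasFunctionalDeriv U (fun A' => ∫ x in U,
        (selfdualTotal κ lam se sE A' (complexify (E t)) (fun x => (N x : ℂ))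
            (fun x a => (Nv x a : ℂ)) Λ x
          - selfdualTotal κ lam se sE (A t) (complexify (E t)) (fun x => (N x : ℂ))
            (fun x a => (Nv x a : ℂ)) Λ x)) (A t) VQ ∧
      HasFunctionalDeriv U (fun E' => ∫ x in U,
        (selfdualTotal κ lam se sE (A t) E' (fun x => (N x : ℂ)) (fun x a => (Nv x a : ℂ)) Λ x
          - selfdualTotal κ lam se sE (A t) (complexify (E t)) (fun x => (N x : ℂ))
            (fun x a => (Nv x a : ℂ)) Λ x)) (complexify (E t)) VP ∧
      ∀ x ∈ U, ∀ a i,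
        HasDerivAt (fun τ => A τ x a i) (Complex.I * κ / (2 * lam) * VP x a i) t ∧
        HasDerivAt (fun τ => complexify (E τ) x a i) (-(Complex.I * κ / (2 * lam)) * VQ x a i) t := by
  have h := hf.slice hU ht
  have hκ' : (κ : ℂ) ≠ 0 := by exact_mod_cast hκ
  have hqs := ofReal_detq_mem_slitPlane hq
  have hNs : ContDiffOn ℝ ∞ (fun x => se x / sE x * N x) U :=
    (hse.div h.sign).contDiffOn.mul hN
  rw [hasFunctionalDeriv_adm_left_iff h hq hNs hNv hΩ hK κ] at h1
  rw [hasFunctionalDeriv_adm_right_iff h hq hNs hNv hΩ hK κ] at h2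
  have hvel : ∀ x ∈ U, ∀ a i, velocity (fun t => complexify (E t)) t x a i
      = ((-(κ / 2) : ℂ) • complexify WQ) x a i := by
    intro x hx a i
    refine ((hP x hx a i).ofReal_comp.deriv).trans ?_
    simp [complexify]
  have hV : ContDiffOn ℝ ∞ (complexify WQ) U := by
    refine ((hf.contDiffOn_velocity ht).const_smul (-(2 / κ) : ℂ)).congr fun x hx => ?_
    funext a i
    simp only [Pi.smul_apply, hvel x hx a i, smul_eq_mul]
    field_simp
  have hW : ContinuousOn (complexify WP) U :=
    continuousOn_pi.2 fun a => continuousOn_pi.2 fun i =>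
      Complex.continuous_ofReal.comp_continuousOn (continuousOn_component h2.1 a i)
  have eN : (fun x => ((se x / sE x * N x : ℝ) : ℂ))
      = fun x => ((se x / sE x : ℝ) : ℂ) * (N x : ℂ) := by
    funext x
    push_cast
    rfl
  rw [eN] at h1 h2
  have key := hasFunctionalDeriv_selfdual_of_adm h hqs hse
    (ContDiffOn.complexify_scalar hN) (ContDiffOn.complexify_vector hNv) hΛ
    hA lam hκ (ContDiffOn.complexify_field hK) hg (fun x _ => hAK t x) hV hW
    (by rw [hΛΩ]; exact h1.2) (by rw [hΛΩ]; exact h2.2)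
  refine ⟨_, _, key.1, key.2, fun x hx a i => ⟨?_, ?_⟩⟩
  · have d := (hf.hasDerivAt_spinConnection ⟨ht, hx⟩ a i).add
      ((hQ x hx a i).ofReal_comp.const_mul Complex.I)
    have e : (fun τ => A τ x a i) = (fun τ => spinConnection sE (complexify (E τ)) x a i)
        + fun τ => Complex.I * ((K τ x a i : ℝ) : ℂ) := funext fun τ => hAK τ x a i
    rw [e]
    refine d.congr_deriv ?_
    rw [linSpin_congr hU _ hvel hx, linSpin_smul hU _ hV _ hx]
    simp only [Pi.add_apply, Pi.smul_apply, smul_eq_mul]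
    rw [linSpin_smul hU _ hV _ hx]
    push_cast
    simp only [complexify]
    generalize linSpin (complexify (E t)) (complexify WQ) x a i = l
    field_simp
    linear_combination (-l) * Complex.I_sq
  · refine (hP x hx a i).ofReal_comp.congr_deriv ?_
    simp only [Pi.smul_apply, smul_eq_mul, complexify]
    push_cast
    field_simp
    linear_combination (-(WQ x a i : ℂ)) * Complex.I_sq

/-- Real solutions of the ADM equations are solutions of the selfdual equations. -/
theorem selfdual_of_adm (hI : IsOpen I) (hK : SmoothFamily I U K) (hE : SmoothFamily I U E)
    (hN : SmoothFamily I U N) (hNv : SmoothFamily I U Nv) (hΩ : SmoothFamily I U Ω)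
    (hse : ∀ t ∈ I, LocSign U se) (hsE : ∀ t ∈ I, LocSign U sE)
    (hq : ∀ t ∈ I, ∀ x ∈ U, 0 < detq sE (E t) x)
    (hsol : SolvesHamiltonEqs (κ / 2) U I
      (fun t K' E' => admTotal κ sE K' E' (fun x => se x / sE x * N t x) (Nv t) (Ω t)) K E)
    (hG : ∀ t ∈ I, ∀ x ∈ U, ∀ i, admGauss κ (K t) (E t) x i = 0) :
    ∃ (A : ℝ → TField ℂ) (Λ : ℝ → Pt → Fin 3 → ℂ),
      SmoothFamily I U A ∧ SmoothFamily I U Λ ∧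
      (∀ t ∈ I, ∀ x ∈ U, ∀ a i,
        A t x a i = spinConnection sE (complexify (E t)) x a i + Complex.I * (K t x a i : ℂ)) ∧
      (∀ t ∈ I, ∀ x ∈ U, ∀ i, gauss κ lam (A t) (complexify (E t)) x i = 0) ∧
      SolvesHamiltonEqs (Complex.I * κ / (2 * lam)) U I
        (fun t A' E' => selfdualTotal κ lam se sE A' E' (fun x => (N t x : ℂ))
          (fun x a => (Nv t x a : ℂ)) (Λ t)) A (fun t => complexify (E t)) := by
  have hf : TriadFamily (I ×ˢ U) sE (fun t => complexify (E t)) :=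
    { isOpen := hI.prod hU
      smooth := SmoothFamily.field (SmoothFamily.complexify hE)
      det_ne := fun t x hx h0 => (hq t hx.1 x hx.2).ne' (by
        rw [detE_complexify, Complex.ofReal_eq_zero] at h0
        rw [detq, h0, mul_zero])
      sign := fun t x hx => hsE t hx.1 x hx.2 }
  have hNc : SmoothFamily I U (fun t x => (N t x : ℂ)) := JointSmooth.ofReal hN
  have hNvc : SmoothFamily I U (fun t x a => (Nv t x a : ℂ)) :=
    contDiffOn_pi.2 fun a => (SmoothFamily.vector hNv a).ofReal
  have hΩc : SmoothFamily I U (fun t x a => (Ω t x a : ℂ)) :=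
    contDiffOn_pi.2 fun a => (SmoothFamily.vector hΩ a).ofReal
  have hKc := SmoothFamily.complexify hK
  obtain ⟨A, hA⟩ : ∃ A : ℝ → TField ℂ, ∀ t x a i, A t x a i =
      spinConnection sE (complexify (E t)) x a i + Complex.I * complexify (K t) x a i :=
    ⟨fun t x a i => _, fun _ _ _ _ => rfl⟩
  obtain ⟨Θ, hΘ⟩ : ∃ Θ : ℝ → Pt → Fin 3 → ℂ, ∀ t, Θ t =
      gaugeShift se sE (fun x => (N t x : ℂ)) (fun x a => (Nv t x a : ℂ)) (complexify (K t))
        (complexify (E t)) := ⟨fun t => _, fun _ => rfl⟩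
  have hΘs : SmoothFamily I U Θ := by
    rw [funext hΘ]
    exact jointSmooth_gaugeShift hf (fun t x hx => ofReal_detq_mem_slitPlane (hq t hx.1) x hx.2)
      hse hNc hNvc hKc
  have hAs : SmoothFamily I U A := jointSmooth_pi.2 fun a i => by
    simp only [hA]
    exact (hf.spinConnection a i).add (JointSmooth.const_mul _ (SmoothFamily.field hKc a i))
  have hΛ : SmoothFamily I U (fun t => (fun x i => (Ω t x i : ℂ)) - Θ t) := hΩc.sub hΘs
  have hg : ∀ t ∈ I, ∀ x ∈ U, ∀ i, gaussVec (complexify (K t)) (complexify (E t)) x i = 0 := by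
    intro t ht x hx i
    have hκ' : (κ : ℂ) ≠ 0 := by exact_mod_cast hκ
    have e := admGauss_eq κ (complexify (K t)) (complexify (E t)) x i
    rw [admGauss_complexify, hG t ht x hx i, Complex.ofReal_zero] at e
    simpa [hκ'] using e.symm
  refine ⟨A, _, hAs, hΛ, fun t _ x _ => hA t x, fun t ht x hx i => ?_, fun t ht => ?_⟩
  · rw [(hf.slice hU ht).gauss_eq hx hκ lam (fun x _ => hA t x), admGauss_eq, hg t ht x hx,
      mul_zero, mul_zero]
  · obtain ⟨WQ, WP, h1, h2, h3⟩ := hsol t ht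
    exact selfdual_equations_of_adm hU hκ hlam ht hf (hse t ht) (hq t ht)
      (SmoothFamily.slice hN ht) (SmoothFamily.slice hNv ht) (SmoothFamily.slice hΩ ht)
      (SmoothFamily.slice hK ht) (SmoothFamily.slice hAs ht) (SmoothFamily.slice hΛ ht) hA
      (by rw [hΘ t, sub_add_cancel]) (hg t ht) h1 h2 (fun x hx a i => (h3 x hx a i).1)
      (fun x hx a i => (h3 x hx a i).2)

end Converse

/-! ### A real triad for a real metric -/

/-- The Gram matrix `E Eᵀ` of a complex triad with real positive metric is real and positive, since
it is the adjugate of the metric. -/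
theorem gram_posDef {sE : Pt → ℝ} {E : TField ℂ} {x : Pt} (hd : detE E x ≠ 0)
    (hs : sE x = 1 ∨ sE x = -1) {m : Matrix (Fin 3) (Fin 3) ℝ} (hm : m.PosDef)
    (h : ∀ a b, metric sE E x a b = (m a b : ℂ)) :
    ∃ (Q : Matrix (Fin 3) (Fin 3) ℝ) (q : ℝ), Q.PosDef ∧ 0 < q ∧ Q.det = q ^ 2 ∧
      detq sE E x = (q : ℂ) ∧ ∀ a b, ∑ i, E x a i * E x b i = (Q a b : ℂ) := by
  set B : Matrix (Fin 3) (Fin 3) ℂ := Matrix.of (E x) with hB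
  set M : Matrix (Fin 3) (Fin 3) ℂ := m.map Complex.ofRealHom with hMdef
  have hBu : IsUnit B.det := isUnit_iff_ne_zero.2 hd
  have hdet : M.det = ((m.det : ℝ) : ℂ) := (RingHom.map_det Complex.ofRealHom m).symm
  have hM : M = detq sE E x • (B⁻¹.transpose * B⁻¹) := by
    ext a b
    have := (h a b).symm
    simpa [hMdef, metric, invE, Matrix.mul_apply] using this
  have hqq : detq sE E x = ((sE x : ℝ) : ℂ) * B.det := rfl
  have hs2 : ((sE x : ℝ) : ℂ) * ((sE x : ℝ) : ℂ) = 1 := by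
    rcases hs with h | h <;> simp [h]
  have hq : detq sE E x = ((m.det : ℝ) : ℂ) := by
    rw [← hdet, hM, Matrix.det_smul, Matrix.det_mul, Matrix.det_transpose, Matrix.det_nonsing_inv,
      Ring.inverse_eq_inv', Fintype.card_fin, hqq]
    have hB0 : B.det ≠ 0 := hd
    field_simp
    linear_combination (-((sE x : ℝ) : ℂ)) * hs2
  have hm0 := hm.det_pos
  have hm0' : ((m.det : ℝ) : ℂ) ≠ 0 := by exact_mod_cast hm0.ne'
  refine ⟨m.det • m⁻¹, m.det, hm.inv.smul hm0, hm0, ?_, hq, fun a b => ?_⟩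
  · rw [Matrix.det_smul, Matrix.det_nonsing_inv, Ring.inverse_eq_inv', Fintype.card_fin]
    field_simp
  · have h1 : M * (B * B.transpose) = ((m.det : ℝ) : ℂ) • 1 := by
      rw [hM, hq, Matrix.smul_mul, Matrix.mul_assoc, ← Matrix.mul_assoc B⁻¹,
        Matrix.nonsing_inv_mul _ hBu, Matrix.one_mul, ← Matrix.transpose_mul,
        Matrix.mul_nonsing_inv _ hBu, Matrix.transpose_one]
    have h2 : m⁻¹.map Complex.ofRealHom * M = 1 := by
      rw [hMdef, ← Matrix.map_mul, Matrix.nonsing_inv_mul _ (isUnit_iff_ne_zero.2 hm0.ne')]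
      simp
    have h3 : B * B.transpose = ((m.det : ℝ) : ℂ) • m⁻¹.map Complex.ofRealHom := by
      have := congrArg (m⁻¹.map Complex.ofRealHom * ·) h1
      simpa [← Matrix.mul_assoc, h2] using this
    have := congrFun (congrFun h3 a) b
    simpa [Matrix.mul_apply, hB] using this

/-- The lower triangular Cholesky factor of a positive matrix `Q` with `det Q = q²`. Its last entry
is written with `q`, so that it is a smooth function of `Q` and `q`. -/
def cholesky (Q : Matrix (Fin 3) (Fin 3) ℝ) (q : ℝ) : Fin 3 → Fin 3 → ℝ :=
  ![![√(Q 0 0), 0, 0],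
    ![Q 0 1 / √(Q 0 0), √(Q 0 0 * Q 1 1 - Q 0 1 ^ 2) / √(Q 0 0), 0],
    ![Q 0 2 / √(Q 0 0), (Q 1 2 * Q 0 0 - Q 0 1 * Q 0 2) /
        (√(Q 0 0) * √(Q 0 0 * Q 1 1 - Q 0 1 ^ 2)), q / √(Q 0 0 * Q 1 1 - Q 0 1 ^ 2)]]

theorem minor_pos {Q : Matrix (Fin 3) (Fin 3) ℝ} (hQ : Q.PosDef) :
    0 < Q 0 0 * Q 1 1 - Q 0 1 ^ 2 := by
  have hinj : Function.Injective ![(0 : Fin 3), 1] := by decide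
  have h := (hQ.submatrix hinj).det_pos
  have hs : Q 1 0 = Q 0 1 := by simpa using hQ.1.apply 0 1
  rw [Matrix.det_fin_two] at h
  simpa [hs, sq] using h

/-- The lower triangular factor `L` of `Q = L Lᵀ` has determinant `q`. -/
theorem cholesky_spec {Q : Matrix (Fin 3) (Fin 3) ℝ} (hQ : Q.PosDef) {q : ℝ} (hq : Q.det = q ^ 2) :
    (∀ a b, ∑ i, cholesky Q q a i * cholesky Q q b i = Q a b) ∧
      (Matrix.of (cholesky Q q)).det = q := by
  have h0 := hQ.diag_pos (i := 0)
  have h1 := minor_pos hQ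
  have hs : ∀ a b, Q a b = Q b a := fun a b => by simpa using hQ.1.apply b a
  have e0 := Real.sq_sqrt h0.le
  have e1 := Real.sq_sqrt h1.le
  have n0 := (Real.sqrt_pos.2 h0).ne'
  have n1 := (Real.sqrt_pos.2 h1).ne'
  rw [Matrix.det_fin_three, hs 1 0, hs 2 0, hs 2 1] at hq
  constructor
  · intro a b
    fin_cases a <;> fin_cases b <;> simp [cholesky, Fin.sum_univ_three]
    · nlinarith
    · field_simp
    · field_simp
    · rw [hs 1 0]; field_simp
    · field_simp
      rw [e0, e1]; ring
    · field_simp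
      rw [e0]; ring
    · rw [hs 2 0]; field_simp
    · rw [hs 2 1]; field_simp
      rw [e0]; ring
    · field_simp
      rw [e0, e1, ← hq]; ring
  · rw [Matrix.det_fin_three]
    simp [cholesky]
    field_simp

section RealTriad

variable {U : Set Pt} {I : Set ℝ} {sE : Pt → ℝ} {E : ℝ → TField ℂ}

theorem smooth_cholesky {O : Set (ℝ × Pt)} {Q : ℝ → Pt → Matrix (Fin 3) (Fin 3) ℝ}
    {q : ℝ → Pt → ℝ} (hQ : ∀ a b, JointSmooth O (fun t x => Q t x a b)) (hq : JointSmooth O q)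
    (hpos : ∀ t x, (t, x) ∈ O → (Q t x).PosDef) :
    ∀ a i, JointSmooth O (fun t x => cholesky (Q t x) (q t x) a i) := by
  have s0 : JointSmooth O (fun t x => √(Q t x 0 0)) :=
    ContDiffOn.sqrt (hQ 0 0) fun p hp => (hpos p.1 p.2 hp).diag_pos.ne'
  have s1 : JointSmooth O (fun t x => √(Q t x 0 0 * Q t x 1 1 - Q t x 0 1 ^ 2)) :=
    ContDiffOn.sqrt (ContDiffOn.sub (ContDiffOn.mul (hQ 0 0) (hQ 1 1)) (ContDiffOn.pow (hQ 0 1) 2))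
      fun p hp => (minor_pos (hpos p.1 p.2 hp)).ne'
  have n0 : ∀ p ∈ O, √(Q p.1 p.2 0 0) ≠ 0 := fun p hp =>
    (Real.sqrt_pos.2 (hpos p.1 p.2 hp).diag_pos).ne'
  have n1 : ∀ p ∈ O, √(Q p.1 p.2 0 0 * Q p.1 p.2 1 1 - Q p.1 p.2 0 1 ^ 2) ≠ 0 := fun p hp =>
    (Real.sqrt_pos.2 (minor_pos (hpos p.1 p.2 hp))).ne'
  intro a i
  have hz : JointSmooth O (fun _ _ => (0 : ℝ)) := contDiffOn_const
  fin_cases a <;> fin_cases i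
  · exact s0
  · exact hz
  · exact hz
  · exact ContDiffOn.div (hQ 0 1) s0 n0
  · exact ContDiffOn.div s1 s0 n0
  · exact hz
  · exact ContDiffOn.div (hQ 0 2) s0 n0
  · exact ContDiffOn.div (ContDiffOn.sub (ContDiffOn.mul (hQ 1 2) (hQ 0 0))
      (ContDiffOn.mul (hQ 0 1) (hQ 0 2))) (ContDiffOn.mul s0 s1) fun p hp => mul_ne_zero (n0 p hp) (n1 p hp)
  · exact ContDiffOn.div hq s1 n1

theorem JointSmooth.re {O : Set (ℝ × Pt)} {f : ℝ → Pt → ℂ} (hf : JointSmooth O f) :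
    JointSmooth O (fun t x => (f t x).re) := Complex.reCLM.contDiff.comp_contDiffOn hf

/-- Under the reality conditions a complex triad is the gauge rotation of a real one. -/
theorem exists_real_triad (h : TriadFamily (I ×ˢ U) sE E) (hr : RealityConditions U I sE E) :
    ∃ (E' : ℝ → TField ℝ) (R : ℝ → Pt → Fin 3 → Fin 3 → ℂ),
      SmoothFamily I U E' ∧ SmoothFamily I U R ∧ ∀ t ∈ I, ∀ x ∈ U,
        Matrix.of (R t x) ∈ Matrix.specialOrthogonalGroup (Fin 3) ℂ ∧
        0 < detq sE (E' t) x ∧ ∀ a i, E t x a i = rotate (complexify (E' t)) (R t) x a i := by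
  have hg : ∀ t x, (t, x) ∈ I ×ˢ U → ∃ (Q : Matrix (Fin 3) (Fin 3) ℝ) (q : ℝ), Q.PosDef ∧ 0 < q ∧
      Q.det = q ^ 2 ∧ detq sE (E t) x = (q : ℂ) ∧ ∀ a b, ∑ i, E t x a i * E t x b i = (Q a b : ℂ) :=
    fun t x hx => by
      obtain ⟨m, hm, hm'⟩ := (hr t hx.1 x hx.2).1
      exact gram_posDef (h.det_ne t x hx) (h.sign t x hx).1 hm hm'
  choose! Q q hQ hq hQq hqE hQE using hg
  have hQs : ∀ a b, JointSmooth (I ×ˢ U) (fun t x => Q t x a b) := fun a b =>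
    (JointSmooth.re (JointSmooth.sum (s := Finset.univ) fun i =>
      (h.smooth a i).mul (h.smooth b i))).congr fun t x hx => by
        rw [hQE t x hx, Complex.ofReal_re]
  have hqs : JointSmooth (I ×ˢ U) q := (JointSmooth.re h.detq).congr fun t x hx => by
    rw [hqE t x hx, Complex.ofReal_re]
  have hs1 : ∀ t x, (t, x) ∈ I ×ˢ U → sE x * sE x = 1 := fun t x hx => by
    rcases (h.sign t x hx).1 with h | h <;> simp [h]
  obtain ⟨E', hE'⟩ : ∃ E' : ℝ → TField ℝ, ∀ t x a i,
      E' t x a i = sE x * cholesky (Q t x) (q t x) a i := ⟨_, fun _ _ _ _ => rfl⟩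
  have hE's : SmoothFamily I U E' := jointSmooth_pi.2 fun a i => by
    simp only [hE']
    have hs : JointSmooth (I ×ˢ U) (fun (_ : ℝ) x => sE x) := by
      simpa only [Complex.ofReal_re] using JointSmooth.re h.smooth_sign
    exact ContDiffOn.mul hs (smooth_cholesky hQs hqs hQ a i)
  have hdet : ∀ t x, (t, x) ∈ I ×ˢ U → detE (E' t) x = sE x * q t x := by
    intro t x hx
    have e := (cholesky_spec (hQ t x hx) (hQq t x hx)).2
    have e2 : Matrix.of (E' t x) = sE x • Matrix.of (cholesky (Q t x) (q t x)) := by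
      ext a i
      simp [hE']
    rw [detE, e2, Matrix.det_smul, e, Fintype.card_fin]
    linear_combination (sE x * q t x) * hs1 t x hx
  have hf : TriadFamily (I ×ˢ U) sE (fun t => complexify (E' t)) :=
    { isOpen := h.isOpen
      smooth := SmoothFamily.field (SmoothFamily.complexify hE's)
      det_ne := fun t x hx => by
        rw [detE_complexify, hdet t x hx]
        exact_mod_cast mul_ne_zero (h.sign_ne hx) (hq t x hx).ne'
      sign := h.sign }
  obtain ⟨R, hR⟩ : ∃ R : ℝ → Pt → Fin 3 → Fin 3 → ℂ, ∀ t x j i,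
      R t x j i = ∑ a, invE (complexify (E' t)) x j a * E t x a i := ⟨_, fun _ _ _ _ => rfl⟩
  have hRs : SmoothFamily I U R := jointSmooth_pi.2 fun j i => by
    simp only [hR]
    exact JointSmooth.sum fun a => (hf.invE j a).mul (h.smooth a i)
  refine ⟨E', R, hE's, hRs, fun t ht x hx => ?_⟩
  have hx' : (t, x) ∈ I ×ˢ U := ⟨ht, hx⟩
  set B := Matrix.of (complexify (E' t) x) with hB
  set C := Matrix.of (E t x) with hC
  have hRm : Matrix.of (R t x) = B⁻¹ * C := by
    ext j i
    simp [hR, Matrix.mul_apply, invE, hB, hC]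
  have hBu : IsUnit B.det := isUnit_iff_ne_zero.2 (hf.det_ne t x hx')
  have hgram : C * C.transpose = B * B.transpose := by
    ext a b
    have e := (cholesky_spec (hQ t x hx') (hQq t x hx')).1 a b
    simp only [Matrix.mul_apply, Matrix.transpose_apply, hB, hC, Matrix.of_apply, complexify,
      hE', hQE t x hx', ← e]
    push_cast
    refine Finset.sum_congr rfl fun i _ => ?_
    have := congrArg (fun r : ℝ => (r : ℂ)) (hs1 t x hx')
    push_cast at this
    linear_combination (-(cholesky (Q t x) (q t x) a i : ℂ) * (cholesky (Q t x) (q t x) b i : ℂ))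
      * this
  refine ⟨?_, ?_, fun a i => ?_⟩
  · rw [Matrix.mem_specialOrthogonalGroup_iff, Matrix.mem_orthogonalGroup_iff, hRm]
    constructor
    · change B⁻¹ * C * (B⁻¹ * C).transpose = 1
      rw [Matrix.transpose_mul, Matrix.mul_assoc, ← Matrix.mul_assoc C, hgram,
        Matrix.mul_assoc B, ← Matrix.mul_assoc, Matrix.nonsing_inv_mul _ hBu, Matrix.one_mul,
        ← Matrix.transpose_mul, Matrix.nonsing_inv_mul _ hBu, Matrix.transpose_one]
    · have e1 : B.det = ((sE x * q t x : ℝ) : ℂ) := by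
        rw [← hdet t x hx', ← detE_complexify]; rfl
      have e2 : ((sE x : ℝ) : ℂ) * C.det = (q t x : ℂ) := hqE t x hx'
      have e3 := congrArg (fun r : ℝ => (r : ℂ)) (hs1 t x hx')
      push_cast at e1 e3
      rw [Matrix.det_mul, Matrix.det_nonsing_inv, Ring.inverse_eq_inv']
      have e4 : C.det = B.det := by
        rw [e1]
        linear_combination (-C.det) * e3 + ((sE x : ℝ) : ℂ) * e2
      rw [e4, inv_mul_cancel₀ hBu.ne_zero]
  · have e : detq sE (E' t) x = q t x := by
      rw [detq, hdet t x hx', RCLike.ofReal_real_eq_id, id, ← mul_assoc, hs1 t x hx', one_mul]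
    rw [e]
    exact hq t x hx'
  · have e := of_rotate (R := R t) (x := x) (complexify (E' t))
    rw [hRm, ← hB, ← Matrix.mul_assoc, Matrix.mul_nonsing_inv _ hBu, Matrix.one_mul] at e
    exact (congrFun (congrFun e a) i).symm

end RealTriad

/-! ### Reality of the extrinsic curvature -/

theorem eps_table_real : (eps ℝ 0 1 2 = 1 ∧ eps ℝ 1 2 0 = 1 ∧ eps ℝ 2 0 1 = 1 ∧
    eps ℝ 0 2 1 = -1 ∧ eps ℝ 2 1 0 = -1 ∧ eps ℝ 1 0 2 = -1) ∧
    (∀ i k, eps ℝ i i k = 0) ∧ (∀ i k, eps ℝ i k i = 0) ∧ ∀ i k, eps ℝ k i i = 0 := by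
  refine ⟨⟨?_, ?_, ?_, ?_, ?_, ?_⟩, ?_, ?_, ?_⟩ <;> first | (simp [eps]; done) | (simp [eps]; norm_num)

/-- The velocity of the triad determines the extrinsic curvature and the multiplier of the Gauss
constraint: the map `k ↦ (tr k) δ - k` is injective on symmetric matrices, and the multiplier is
seen in the antisymmetric part. -/
theorem eq_zero_of_velocity {E k : Fin 3 → Fin 3 → ℝ} {o : Fin 3 → ℝ} (hE : (Matrix.of E).det ≠ 0)
    {n c : ℝ} (hn : n ≠ 0) (hc : c ≠ 0)
    (hg : ∀ i, ∑ j, ∑ m, eps ℝ i j m * ∑ a, k a j * E a m = 0)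
    (h : ∀ a i, n * ((∑ b, ∑ m, k b m * E b m) * E a i - ∑ b, (∑ m, k b m * E a m) * E b i)
      + c * ∑ l, ∑ m, eps ℝ l i m * o l * E a m = 0) :
    (∀ a i, k a i = 0) ∧ ∀ i, o i = 0 := by
  obtain ⟨S, hS⟩ : ∃ S : Fin 3 → Fin 3 → ℝ, ∀ i j, S i j = ∑ b, k b i * E b j :=
    ⟨_, fun _ _ => rfl⟩
  have h1 : ∀ i m, n * ((S 0 0 + S 1 1 + S 2 2) * (if m = i then 1 else 0) - S m i)
      + c * ∑ l, eps ℝ l i m * o l = 0 := by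
    intro i
    refine congrFun (Matrix.eq_zero_of_mulVec_eq_zero (M := Matrix.of E)
      (v := fun m => n * ((S 0 0 + S 1 1 + S 2 2) * (if m = i then 1 else 0) - S m i)
      + c * ∑ l, eps ℝ l i m * o l) hE (funext fun a => ?_))
    have e1 : ∑ b, (∑ m, k b m * E a m) * E b i = ∑ m, E a m * S m i := by
      simp only [hS, Fin.sum_univ_three]
      ring
    have e2 : ∑ b, ∑ m, k b m * E b m = S 0 0 + S 1 1 + S 2 2 := by
      simp only [hS, Fin.sum_univ_three]
      ring
    refine Eq.trans ?_ (h a i)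
    rw [e1, e2]
    simp only [Matrix.mulVec, dotProduct, Matrix.of_apply]
    rcases fin3_cases i with rfl | rfl | rfl <;>
    · simp only [Fin.sum_univ_three, eps_table_real, Fin.reduceEq, if_true, if_false]
      ring
  have hg' : S 1 2 = S 2 1 ∧ S 2 0 = S 0 2 ∧ S 0 1 = S 1 0 := by
    have g0 := hg 0
    have g1 := hg 1
    have g2 := hg 2
    simp only [Fin.sum_univ_three, eps_table_real] at g0 g1 g2
    simp only [hS, Fin.sum_univ_three]
    refine ⟨by linarith, by linarith, by linarith⟩
  obtain ⟨s1, s2, s3⟩ := hg'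
  have z00 := h1 0 0
  have z11 := h1 1 1
  have z22 := h1 2 2
  have z01 := h1 0 1
  have z10 := h1 1 0
  have z02 := h1 0 2
  have z20 := h1 2 0
  have z12 := h1 1 2
  have z21 := h1 2 1
  simp only [Fin.sum_univ_three, eps_table_real, Fin.reduceEq, if_true, if_false] at z00 z11 z22 z01 z10 z02 z20 z12 z21
  have o2 : o 2 = 0 := by
    have : c * o 2 = 0 := by rw [s3] at z10; linarith
    simpa [hc] using this
  have o1 : o 1 = 0 := by
    have : c * o 1 = 0 := by rw [s2] at z02; linarith
    simpa [hc] using this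
  have o0 : o 0 = 0 := by
    have : c * o 0 = 0 := by rw [s1] at z21; linarith
    simpa [hc] using this
  have hS0 : ∀ i j, S i j = 0 := by
    rw [o0] at z12 z21
    rw [o1] at z02 z20
    rw [o2] at z01 z10
    have d0 : S 1 1 + S 2 2 = 0 := by
      have : n * (S 1 1 + S 2 2) = 0 := by linarith
      simpa [hn] using this
    have d1 : S 0 0 + S 2 2 = 0 := by
      have : n * (S 0 0 + S 2 2) = 0 := by linarith
      simpa [hn] using this
    have d2 : S 0 0 + S 1 1 = 0 := by
      have : n * (S 0 0 + S 1 1) = 0 := by linarith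
      simpa [hn] using this
    have t : ∀ s : ℝ, n * s = 0 → s = 0 := fun s hs => by simpa [hn] using hs
    have f01 := t (S 0 1) (by linarith)
    have f10 := t (S 1 0) (by linarith)
    have f02 := t (S 0 2) (by linarith)
    have f20 := t (S 2 0) (by linarith)
    have f12 := t (S 1 2) (by linarith)
    have f21 := t (S 2 1) (by linarith)
    intro i j
    rcases fin3_cases i with rfl | rfl | rfl <;> rcases fin3_cases j with rfl | rfl | rfl <;>
      first | assumption | linarith
  refine ⟨fun a i => ?_, fun i => by rcases fin3_cases i with rfl | rfl | rfl <;> assumption⟩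
  refine congrFun (Matrix.eq_zero_of_mulVec_eq_zero (M := (Matrix.of E).transpose)
    (v := fun a => k a i) (by rwa [Matrix.det_transpose]) (funext fun j => ?_)) a
  rw [Pi.zero_apply, ← hS0 i j]
  simp only [Matrix.mulVec, dotProduct, Matrix.transpose_apply, Matrix.of_apply, hS, mul_comm]

section Reality

variable {sE : Pt → ℝ} {E : TField ℝ} {x : Pt}

theorem shiftGrad_complexify (sE : Pt → ℝ) (E : TField ℝ) (Nv : Pt → Fin 3 → ℝ) (x : Pt)
    (a b : Fin 3) : shiftGrad sE (complexify E) (fun x a => (Nv x a : ℂ)) x a b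
      = ((pd b (fun y => Nv y a) x + ∑ c, christoffel sE E x a b c * Nv x c : ℝ) : ℂ) := by
  simp [shiftGrad, pd_ofReal, christoffel_complexify]

/-- A real velocity of a real triad forces `K` and the multiplier of the Gauss constraint to be
real, if the lapse has no zero. -/
theorem im_eq_zero_of_admGradK (hq : 0 < detq sE E x) {κ : ℝ} (hκ : κ ≠ 0) {N : Pt → ℝ}
    (hN : N x ≠ 0) (Nv : Pt → Fin 3 → ℝ) {Ω : Pt → Fin 3 → ℂ} {K : TField ℂ}
    (hg : ∀ i, gaussVec K (complexify E) x i = 0)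
    (hV : ∀ a i, (admGradK κ sE (fun x => (N x : ℂ)) (fun x a => (Nv x a : ℂ)) Ω K
      (complexify E) x a i).im = 0) :
    (∀ a i, (K x a i).im = 0) ∧ ∀ i, (Ω x i).im = 0 := by
  have hE : (Matrix.of (E x)).det ≠ 0 := fun h0 => hq.ne' (by rw [detq, detE, h0, mul_zero])
  have hs : RCLike.sqrt (detq sE E x) ≠ 0 := by
    rw [RCLike.sqrt_real]
    exact (Real.sqrt_pos.2 hq).ne'
  have hn : 2 * N x * (κ * RCLike.sqrt (detq sE E x))⁻¹ ≠ 0 := by positivity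
  have hc : 2 / κ ≠ 0 := by positivity
  refine eq_zero_of_velocity (k := fun a i => (K x a i).im) (o := fun i => (Ω x i).im) hE hn hc
    (fun i => ?_) (fun a i => ?_)
  · have e := congrArg Complex.im (hg i)
    simp only [gaussVec, complexify, ← eps_ofReal] at e
    simpa only [Complex.im_sum, Complex.im_ofReal_mul, Complex.im_mul_ofReal, Complex.zero_im]
      using e
  · have e := hV a i
    have e1 : 2 * (N x : ℂ) * ((κ : ℂ) * RCLike.sqrt (detq sE (complexify E) x))⁻¹
        = ((2 * N x * (κ * RCLike.sqrt (detq sE E x))⁻¹ : ℝ) : ℂ) := by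
      rw [detq_complexify, sqrt_ofReal hq.le]
      push_cast
      rfl
    have e2 : (2 / (κ : ℂ)) = ((2 / κ : ℝ) : ℂ) := by push_cast; rfl
    have e3 : ∀ r s : ℝ, ((r : ℂ) * (s : ℂ)).im = 0 := fun r s => by
      rw [← Complex.ofReal_mul, Complex.ofReal_im]
    simp only [admGradK, shiftGrad_complexify, e1, e2, trKE, KE, complexify, ← eps_ofReal] at e
    simp only [Complex.add_im, Complex.sub_im, Complex.im_sum, Complex.im_ofReal_mul,
      Complex.im_mul_ofReal, Complex.ofReal_im, mul_zero, zero_mul, sub_zero, Finset.sum_const_zero,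
      add_zero] at e
    exact e

end Reality

/-! ### Solutions in a rotating frame -/

theorem IsAdmGradient.congr {κ : ℝ} {sE : Pt → ℝ} {U : Set Pt} (hU : IsOpen U) {N : Pt → ℂ}
    {Nv Ω Ω' : Pt → Fin 3 → ℂ} {K E K' E' V W : TField ℂ}
    (hVW : IsAdmGradient κ sE U N Nv Ω K E V W) (hΩ : ∀ x ∈ U, Ω x = Ω' x)
    (hK : ∀ x ∈ U, K x = K' x) (hE : ∀ x ∈ U, E x = E' x) :
    IsAdmGradient κ sE U N Nv Ω' K' E' V W := by
  refine ⟨hVW.continuousOn_left, hVW.continuousOn_right, fun φ ψ hφ hψ => ?_⟩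
  rw [← hVW.integral_eq φ ψ hφ hψ]
  refine setIntegral_congr_fun hU.measurableSet fun x hx => ?_
  have e : ∀ {u u' v : TField ℂ} {r : ℝ}, (∀ x ∈ U, u x = u' x) →
      u' + (r : ℂ) • v =ᶠ[nhds x] u + (r : ℂ) • v := fun {u u' v r} h => by
    filter_upwards [hU.mem_nhds hx] with y hy
    simp only [Pi.add_apply, Pi.smul_apply, h y hy]
  simp only [admVar]
  congr 1
  funext r
  rw [admTotal_congr κ (e hK) (e hE) N Nv Ω']
  simp only [admTotal, hΩ x hx]

/-- The angular velocity of a curve of rotations: the axial vector of `R Ṙᵀ`. -/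
def angularVelocity (R : ℝ → TField ℂ) (t : ℝ) (x : Pt) (i : Fin 3) : ℂ :=
  -(1 / 2) * ∑ j, ∑ k, eps ℂ i j k * ∑ l, R t x k l * velocity R t x j l

section RotatingFrame

variable {U : Set Pt} {I : Set ℝ} {R : ℝ → TField ℂ} (hI : IsOpen I) (hU : IsOpen U)
  (hRs : SmoothFamily I U R)
  (hR : ∀ t ∈ I, ∀ x ∈ U, Matrix.of (R t x) ∈ Matrix.specialOrthogonalGroup (Fin 3) ℂ)
  {t : ℝ} (ht : t ∈ I) {x : Pt} (hx : x ∈ U)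
include hI hU hRs

theorem hasDerivAt_rotation {t : ℝ} (ht : t ∈ I) {x : Pt} (hx : x ∈ U) (j i : Fin 3) :
    HasDerivAt (fun τ => R τ x j i) (velocity R t x j i) t :=
  (SmoothFamily.field hRs j i).hasDerivAt (hI.prod hU) ⟨ht, hx⟩

theorem smooth_angularVelocity : SmoothFamily I U (angularVelocity R) :=
  contDiffOn_pi.2 fun _ => JointSmooth.const_mul _ <| JointSmooth.sum fun j => JointSmooth.sum
    fun k => JointSmooth.const_mul _ <| JointSmooth.sum fun l => (SmoothFamily.field hRs k l).mul
      ((SmoothFamily.field hRs j l).deriv (hI.prod hU))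

include hR ht hx

/-- The matrix `R Ṙᵀ` is antisymmetric, and so is given by its axial vector. -/
theorem rotation_mul_velocity (j k : Fin 3) : ∑ l, R t x k l * velocity R t x j l
    = -∑ i, eps ℂ i j k * angularVelocity R t x i := by
  have anti : ∀ j k, ∑ l, R t x k l * velocity R t x j l
      = -∑ l, R t x j l * velocity R t x k l := by
    intro j k
    have d := HasDerivAt.fun_sum (u := Finset.univ) fun l _ =>
      (hasDerivAt_rotation hI hU hRs ht hx k l).mul (hasDerivAt_rotation hI hU hRs ht hx j l)
    have d0 : HasDerivAt (fun τ => ∑ l, R τ x k l * R τ x j l) 0 t := by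
      refine (hasDerivAt_const t (if k = j then (1 : ℂ) else 0)).congr_of_eventuallyEq ?_
      filter_upwards [hI.mem_nhds ht] with τ hτ using sum_rotation_mul (hR τ hτ x hx) k j
    have e := d.unique d0
    simp only [Fin.sum_univ_three] at e ⊢
    linear_combination e
  have h00 := anti 0 0
  have h11 := anti 1 1
  have h22 := anti 2 2
  have h01 := anti 0 1
  have h02 := anti 0 2
  have h12 := anti 1 2
  simp only [angularVelocity]
  generalize hB : (fun k j => ∑ l, R t x k l * velocity R t x j l) = B at *
  have hB' : ∀ k j, ∑ l, R t x k l * velocity R t x j l = B k j := fun k j => by rw [← hB]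
  simp only [hB'] at *
  rcases fin3_cases j with rfl | rfl | rfl <;> rcases fin3_cases k with rfl | rfl | rfl <;>
    simp only [Fin.sum_univ_three, eps_table] <;>
    first
    | linear_combination (1 / 2) * h00
    | linear_combination (1 / 2) * h11
    | linear_combination (1 / 2) * h22
    | linear_combination (1 / 2) * h01
    | linear_combination -(1 / 2) * h01
    | linear_combination (1 / 2) * h02
    | linear_combination -(1 / 2) * h02
    | linear_combination (1 / 2) * h12

/-- The velocity of a field in the rotating frame. -/
theorem hasDerivAt_rotate_transpose {u : ℝ → TField ℂ} {v : TField ℂ} {a : Fin 3}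
    (hu : ∀ i, HasDerivAt (fun τ => u τ x a i) (v x a i) t) {u' : TField ℂ}
    (hu' : ∀ i, u t x a i = rotate u' (R t) x a i) (j : Fin 3) :
    HasDerivAt (fun τ => rotate (u τ) (fun x i j => R τ x j i) x a j)
      (rotate v (fun x i j => R t x j i) x a j
        - ∑ i, ∑ k, eps ℂ i j k * angularVelocity R t x i * u' x a k) t := by
  have d := HasDerivAt.fun_sum (u := Finset.univ) fun l _ =>
    (hu l).mul (hasDerivAt_rotation hI hU hRs ht hx j l)
  refine d.congr_deriv ?_
  have e : ∑ i, ∑ k, eps ℂ i j k * angularVelocity R t x i * u' x a k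
      = -∑ k, u' x a k * ∑ l, R t x k l * velocity R t x j l := by
    simp only [rotation_mul_velocity hI hU hRs hR ht hx]
    simp only [Fin.sum_univ_three]
    ring
  rw [e]
  simp only [hu', rotate, Fin.sum_univ_three]
  ring

end RotatingFrame

/-! ### Selfdual solutions are complexified ADM solutions -/

section ComplexSolution

variable {U : Set Pt} (hU : IsOpen U) {κ : ℝ} (hκ : κ ≠ 0) {lam : ℂ} (hlam : lam ≠ 0)
  {se sE : Pt → ℝ} {I : Set ℝ} {A E : ℝ → TField ℂ}

theorem smooth_extrinsicK (hf : TriadFamily (I ×ˢ U) sE E) (hA : SmoothFamily I U A) :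
    SmoothFamily I U (fun t => extrinsicK sE (A t) (E t)) := by
  have e : ∀ a i, JointSmooth (I ×ˢ U) (fun t x => extrinsicK sE (A t) (E t) x a i) := fun a i => by
    simp only [extrinsicK, div_eq_mul_inv]
    exact ((SmoothFamily.field hA a i).sub (hf.spinConnection a i)).mul (jointSmooth_of_const _)
  exact jointSmooth_pi.2 e

include hU hκ hlam

/-- At each instant, the selfdual equations of motion are those of complexified ADM gravity. -/
theorem adm_equations_of_selfdual {t : ℝ} (ht : t ∈ I) (hf : TriadFamily (I ×ˢ U) sE E)
    (hA : SmoothFamily I U A) (hse : LocSign U se)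
    (hq : ∀ x ∈ U, detq sE (E t) x ∈ Complex.slitPlane) {N : Pt → ℂ} {Nv Λ : Pt → Fin 3 → ℂ}
    (hN : ContDiffOn ℝ ∞ N U) (hNv : ContDiffOn ℝ ∞ Nv U) (hΛ : ContDiffOn ℝ ∞ Λ U)
    (hg : ∀ x ∈ U, ∀ i, gaussVec (extrinsicK sE (A t) (E t)) (E t) x i = 0) {WQ WP : TField ℂ}
    (h1 : HasFunctionalDeriv U (fun A' => ∫ x in U, (selfdualTotal κ lam se sE A' (E t) N Nv Λ x
      - selfdualTotal κ lam se sE (A t) (E t) N Nv Λ x)) (A t) WQ)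
    (h2 : HasFunctionalDeriv U (fun E' => ∫ x in U, (selfdualTotal κ lam se sE (A t) E' N Nv Λ x
      - selfdualTotal κ lam se sE (A t) (E t) N Nv Λ x)) (E t) WP)
    (hQ : ∀ x ∈ U, ∀ a i, HasDerivAt (fun τ => A τ x a i)
      (Complex.I * κ / (2 * lam) * WP x a i) t)
    (hP : ∀ x ∈ U, ∀ a i, HasDerivAt (fun τ => E τ x a i)
      (-(Complex.I * κ / (2 * lam)) * WQ x a i) t) :
    ∃ V W : TField ℂ, IsAdmGradient κ sE U (fun x => ((se x / sE x : ℝ) : ℂ) * N x) Nv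
        (Λ + gaugeShift se sE N Nv (extrinsicK sE (A t) (E t)) (E t))
        (extrinsicK sE (A t) (E t)) (E t) V W ∧
      (∀ x ∈ U, ∀ a i, HasDerivAt (fun τ => E τ x a i) (-(κ / 2 : ℂ) * V x a i) t) ∧
      ∀ x ∈ U, ∀ a i, HasDerivAt (fun τ => extrinsicK sE (A τ) (E τ) x a i)
        ((κ / 2 : ℂ) * W x a i) t := by
  have h := hf.slice hU ht
  have hκ' : (κ : ℂ) ≠ 0 := by exact_mod_cast hκ
  set c : ℂ := Complex.I * κ / (2 * lam) with hc
  have hc0 : c ≠ 0 := by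
    rw [hc]
    exact div_ne_zero (mul_ne_zero Complex.I_ne_zero hκ') (mul_ne_zero two_ne_zero hlam)
  have hvel : ∀ x ∈ U, ∀ a i, velocity E t x a i = ((-c) • WQ) x a i := fun x hx a i =>
    (hP x hx a i).deriv
  have hWQ : ContDiffOn ℝ ∞ WQ U := by
    refine ((hf.contDiffOn_velocity ht).const_smul (-c)⁻¹).congr fun x hx => ?_
    funext a i
    simp only [Pi.smul_apply, hvel x hx a i, smul_eq_mul]
    field_simp
  refine ⟨_, _, isAdmGradient_of_selfdual h hq hse hN hNv hΛ (SmoothFamily.slice hA ht) lam hκ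
    (SmoothFamily.slice (smooth_extrinsicK hf hA) ht) hg
    (fun x _ a i => extrinsicK_spec sE (A t) (E t) x a i) hlam hWQ h1 h2,
    fun x hx a i => ?_, fun x hx a i => ?_⟩
  · refine (hP x hx a i).congr_deriv ?_
    simp only [Pi.smul_apply, smul_eq_mul, hc]
    field_simp
  · have d := ((hQ x hx a i).sub (hf.hasDerivAt_spinConnection ⟨ht, hx⟩ a i)).div_const Complex.I
    refine HasDerivAt.congr_deriv (f := fun τ => extrinsicK sE (A τ) (E τ) x a i) d ?_
    rw [linSpin_congr hU _ hvel hx, linSpin_smul hU _ hWQ _ hx]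
    simp only [Pi.smul_apply, Pi.add_apply, smul_eq_mul, hc]
    field_simp
    ring

omit hκ hlam in
/-- Complexified ADM equations in a rotating frame: the rotation is absorbed by adding its angular
velocity to the multiplier of the Gauss constraint. -/
theorem adm_equations_rotate (hI : IsOpen I) {t : ℝ} (ht : t ∈ I) {K E' : ℝ → TField ℂ}
    (hf : TriadFamily (I ×ˢ U) sE E') {R : ℝ → TField ℂ} (hRs : SmoothFamily I U R)
    (hR : ∀ t ∈ I, ∀ x ∈ U, Matrix.of (R t x) ∈ Matrix.specialOrthogonalGroup (Fin 3) ℂ)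
    (hER : ∀ t ∈ I, ∀ x ∈ U, ∀ a i, E t x a i = rotate (E' t) (R t) x a i)
    (hκ : κ ≠ 0)
    (hq : ∀ x ∈ U, detq sE (E' t) x ∈ Complex.slitPlane) {N : Pt → ℂ} {Nv Ω : Pt → Fin 3 → ℂ}
    (hN : ContDiffOn ℝ ∞ N U) (hNv : ContDiffOn ℝ ∞ Nv U) (hΩ : ContDiffOn ℝ ∞ Ω U)
    (hK : ContDiffOn ℝ ∞ (K t) U) {V W : TField ℂ}
    (hVW : IsAdmGradient κ sE U N Nv Ω (K t) (E t) V W)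
    (hE : ∀ x ∈ U, ∀ a i, HasDerivAt (fun τ => E τ x a i) (-(κ / 2 : ℂ) * V x a i) t)
    (hK' : ∀ x ∈ U, ∀ a i, HasDerivAt (fun τ => K τ x a i) ((κ / 2 : ℂ) * W x a i) t) :
    ∃ V' W' : TField ℂ, IsAdmGradient κ sE U N Nv
        ((fun x j => ∑ i, Ω x i * R t x j i) + angularVelocity R t)
        (rotate (K t) fun x i j => R t x j i) (E' t) V' W' ∧
      (∀ x ∈ U, ∀ a i, HasDerivAt (fun τ => E' τ x a i) (-(κ / 2 : ℂ) * V' x a i) t) ∧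
      ∀ x ∈ U, ∀ a i, HasDerivAt (fun τ => rotate (K τ) (fun x i j => R τ x j i) x a i)
        ((κ / 2 : ℂ) * W' x a i) t := by
  have hκ' : (κ : ℂ) ≠ 0 := by exact_mod_cast hκ
  have h := hf.slice hU ht
  have hRt := SmoothFamily.slice hRs ht
  have hcol : ∀ τ ∈ I, ∀ x ∈ U, ∀ i j, ∑ k, R τ x k i * R τ x k j = if i = j then 1 else 0 := by
    intro τ hτ x hx i j
    have e := mul_eq_one_comm.1 (rotation_mul_transpose (hR τ hτ x hx))
    have := congrFun (congrFun e i) j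
    simpa [Matrix.mul_apply, Matrix.one_apply] using this
  -- rotating forth and back
  have back : ∀ (v : Fin 3 → ℂ), ∀ τ ∈ I, ∀ x ∈ U, ∀ i,
      v i = ∑ j, (∑ l, v l * R τ x j l) * R τ x j i := by
    intro v τ hτ x hx i
    have e : ∑ j, (∑ l, v l * R τ x j l) * R τ x j i
        = ∑ l, v l * ∑ j, R τ x j l * R τ x j i := by
      simp only [Fin.sum_univ_three]
      ring
    simp [e, hcol τ hτ x hx]
  have forth : ∀ (v : Fin 3 → ℂ), ∀ τ ∈ I, ∀ x ∈ U, ∀ i,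
      ∑ j, (∑ l, v l * R τ x l j) * R τ x i j = v i := by
    intro v τ hτ x hx i
    have e : ∑ j, (∑ l, v l * R τ x l j) * R τ x i j
        = ∑ l, v l * ∑ j, R τ x l j * R τ x i j := by
      simp only [Fin.sum_univ_three]
      ring
    simp [e, sum_rotation_mul (hR τ hτ x hx)]
  have hKs : ContDiffOn ℝ ∞ (rotate (K t) fun x i j => R t x j i) U :=
    contDiffOn_pi.2 fun a => contDiffOn_pi.2 fun i => ContDiffOn.sum fun j _ =>
      (component_contDiffOn hK a j).mul (component_contDiffOn hRt i j)
  have hΩ' : ContDiffOn ℝ ∞ (fun x j => ∑ i, Ω x i * R t x j i) U :=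
    contDiffOn_pi.2 fun j => ContDiffOn.sum fun i _ =>
      (contDiffOn_pi.1 hΩ i).mul (component_contDiffOn hRt j i)
  have g1 := hVW.congr hU (Ω' := fun x i => ∑ j, (∑ l, Ω x l * R t x j l) * R t x j i)
    (K' := rotate (rotate (K t) fun x i j => R t x j i) (R t)) (E' := rotate (E' t) (R t))
    (fun x hx => funext fun i => back (Ω x) t ht x hx i)
    (fun x hx => funext fun a => funext fun i => back (K t x a) t ht x hx i)
    (fun x hx => funext fun a => funext fun i => hER t ht x hx a i)
  have g2 := IsAdmGradient.rotate (Ω := fun x j => ∑ l, Ω x l * R t x j l) hU (hR t ht) hRt g1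
  have hw : ContDiffOn ℝ ∞ (angularVelocity R t) U :=
    SmoothFamily.slice (smooth_angularVelocity hI hU hRs) ht
  refine ⟨_, _, g2.add_gauss h hq hN hNv hΩ' hw hKs, fun x hx a j => ?_, fun x hx a j => ?_⟩
  · have d := hasDerivAt_rotate_transpose hI hU hRs hR ht hx (u := E)
      (v := (-(κ / 2 : ℂ)) • V) (hE x hx a) (fun i => hER t ht x hx a i) j
    have e : (fun τ => E' τ x a j) =ᶠ[nhds t]
        fun τ => rotate (E τ) (fun x i j => R τ x j i) x a j := by
      filter_upwards [hI.mem_nhds ht] with τ hτ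
      simp only [rotate, hER τ hτ x hx]
      exact (forth (E' τ x a) τ hτ x hx j).symm
    refine (d.congr_of_eventuallyEq e).congr_deriv ?_
    simp only [rotate, Pi.smul_apply, Pi.add_apply, smul_eq_mul, Fin.sum_univ_three]
    field_simp
    ring
  · have d := hasDerivAt_rotate_transpose hI hU hRs hR ht hx (u := K)
      (v := ((κ / 2 : ℂ)) • W) (hK' x hx a) (u' := rotate (K t) fun x i j => R t x j i)
      (fun i => back (K t x a) t ht x hx i) j
    refine d.congr_deriv ?_
    simp only [rotate, Pi.smul_apply, Pi.add_apply, smul_eq_mul]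
    rcases fin3_cases j with rfl | rfl | rfl <;>
    · simp only [Fin.sum_univ_three, eps_table]
      field_simp
      ring

end ComplexSolution

/-! ### Selfdual solutions that satisfy the reality conditions are real ADM solutions -/

theorem pairing_complexify_reField {U : Set Pt} (hU : IsOpen U) {V : TField ℂ}
    (hV : ∀ x ∈ U, ∀ a i, (V x a i).im = 0) (φ : TField ℂ) :
    pairing U (complexify (reField V)) φ = pairing U V φ := by
  refine setIntegral_congr_fun hU.measurableSet fun x hx => ?_
  refine Finset.sum_congr rfl fun a _ => Finset.sum_congr rfl fun i _ => ?_
  congr 1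
  exact Complex.ext (by simp [complexify, reField]) (by simp [complexify, hV x hx a i])

theorem pairing_zero_right (U : Set Pt) (V : TField ℂ) : pairing U V 0 = 0 := by simp [pairing]

/-- A real gradient of the complexified ADM Hamiltonian at a real point is a gradient of the real
ADM Hamiltonian. -/
theorem IsAdmGradient.hasFunctionalDeriv {U : Set Pt} {sE : Pt → ℝ} {K E : TField ℝ}
    (h : Triad U sE (complexify E)) (hq : ∀ x ∈ U, 0 < detq sE E x) {N : Pt → ℝ}
    {Nv Ω : Pt → Fin 3 → ℝ} (hN : ContDiffOn ℝ ∞ N U) (hNv : ContDiffOn ℝ ∞ Nv U)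
    (hΩ : ContDiffOn ℝ ∞ Ω U) (hK : ContDiffOn ℝ ∞ K U) {κ : ℝ} {V W : TField ℂ}
    (hVW : IsAdmGradient κ sE U (fun x => (N x : ℂ)) (fun x a => (Nv x a : ℂ))
      (fun x i => (Ω x i : ℂ)) (complexify K) (complexify E) V W)
    (hV : ∀ x ∈ U, ∀ a i, (V x a i).im = 0) (hW : ∀ x ∈ U, ∀ a i, (W x a i).im = 0) :
    HasFunctionalDeriv U (fun K' => ∫ x in U, (admTotal κ sE K' E N Nv Ω x
      - admTotal κ sE K E N Nv Ω x)) K (reField V) ∧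
    HasFunctionalDeriv U (fun E' => ∫ x in U, (admTotal κ sE K E' N Nv Ω x
      - admTotal κ sE K E N Nv Ω x)) E (reField W) := by
  have hc : ∀ {V : TField ℂ}, ContinuousOn V U → ContinuousOn (reField V) U := fun hV =>
    continuousOn_pi.2 fun a => continuousOn_pi.2 fun i =>
      Complex.continuous_re.comp_continuousOn (continuousOn_component hV a i)
  rw [hasFunctionalDeriv_adm_left_iff h hq hN hNv hΩ hK κ,
    hasFunctionalDeriv_adm_right_iff h hq hN hNv hΩ hK κ]
  refine ⟨⟨hc hVW.continuousOn_left, fun φ hφ => ?_⟩, hc hVW.continuousOn_right, fun ψ hψ => ?_⟩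
  · rw [hVW.integral_eq _ _ (TestField.complexify hφ) (testField_zero U), pairing_zero_right,
      add_zero, pairing_complexify_reField h.isOpen hV]
  · rw [hVW.integral_eq _ _ (testField_zero U) (TestField.complexify hψ), pairing_zero_right,
      zero_add, pairing_complexify_reField h.isOpen hW]

/-- If a nonzero real multiple of `v` is the velocity of a function that is real near `t`, then `v`
is real. -/
theorem im_eq_zero_of_hasDerivAt {f : ℝ → ℂ} {c : ℝ} (hc : c ≠ 0) {v : ℂ} {t : ℝ}
    (h : HasDerivAt f ((c : ℂ) * v) t) (hf : ∀ᶠ τ in nhds t, (f τ).im = 0) : v.im = 0 := by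
  have d : HasDerivAt (fun τ => (f τ).im) ((c : ℂ) * v).im t :=
    Complex.imCLM.hasFDerivAt.comp_hasDerivAt t h
  have e := d.unique ((hasDerivAt_const t (0 : ℝ)).congr_of_eventuallyEq hf)
  rw [Complex.im_ofReal_mul] at e
  exact (mul_eq_zero.1 e).resolve_left hc

theorem HasDerivAt.re {f : ℝ → ℂ} {v : ℂ} {t : ℝ} (h : HasDerivAt f v t) :
    HasDerivAt (fun τ => (f τ).re) v.re t := Complex.reCLM.hasFDerivAt.comp_hasDerivAt t h

section RealSolution

variable {U : Set Pt} (hU : IsOpen U) {κ : ℝ} (hκ : κ ≠ 0) {sE : Pt → ℝ} {I : Set ℝ}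
  (hI : IsOpen I) {E : ℝ → TField ℝ} {K : ℝ → TField ℂ} {N : ℝ → Pt → ℝ}
  {Nv : ℝ → Pt → Fin 3 → ℝ} {Ω : ℝ → Pt → Fin 3 → ℂ}
  (hf : TriadFamily (I ×ˢ U) sE (fun t => complexify (E t)))
  (hq : ∀ t ∈ I, ∀ x ∈ U, 0 < detq sE (E t) x)
  (hN : SmoothFamily I U N) (hNv : SmoothFamily I U Nv) (hΩ : SmoothFamily I U Ω)
  (hK : SmoothFamily I U K) (hN0 : ∀ t ∈ I, ∀ x ∈ U, N t x ≠ 0)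
  (hg : ∀ t ∈ I, ∀ x ∈ U, ∀ i, gaussVec (K t) (complexify (E t)) x i = 0)
  (hsol : ∀ t ∈ I, ∃ V W : TField ℂ, IsAdmGradient κ sE U (fun x => (N t x : ℂ))
      (fun x a => (Nv t x a : ℂ)) (Ω t) (K t) (complexify (E t)) V W ∧
    (∀ x ∈ U, ∀ a i, HasDerivAt (fun τ => complexify (E τ) x a i)
      (-(κ / 2 : ℂ) * V x a i) t) ∧
    ∀ x ∈ U, ∀ a i, HasDerivAt (fun τ => K τ x a i) ((κ / 2 : ℂ) * W x a i) t)
include hU hκ hf hq hN hNv hΩ hK hN0 hg hsol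

/-- Along a solution of complexified ADM gravity with real triad, lapse and shift, the extrinsic
curvature and the multiplier of the Gauss constraint are real. -/
theorem im_eq_zero_of_solution {t : ℝ} (ht : t ∈ I) {x : Pt} (hx : x ∈ U) :
    (∀ a i, (K t x a i).im = 0) ∧ ∀ i, (Ω t x i).im = 0 := by
  obtain ⟨V, W, hVW, hE, -⟩ := hsol t ht
  refine im_eq_zero_of_admGradK (hq t ht x hx) hκ (hN0 t ht x hx) (Nv t) (hg t ht x hx)
    fun a i => ?_
  rw [← IsAdmGradient.left_eq (hf.slice hU ht) (ofReal_detq_mem_slitPlane (hq t ht))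
    (ContDiffOn.complexify_scalar (SmoothFamily.slice hN ht))
    (ContDiffOn.complexify_vector (SmoothFamily.slice hNv ht)) (SmoothFamily.slice hΩ ht)
    (SmoothFamily.slice hK ht) hVW x hx a i]
  have d := hE x hx a i
  have e : (-(κ / 2 : ℂ)) = ((-(κ / 2) : ℝ) : ℂ) := by push_cast; rfl
  rw [e] at d
  exact im_eq_zero_of_hasDerivAt (neg_ne_zero.2 (div_ne_zero hκ two_ne_zero)) d
    (Filter.Eventually.of_forall fun τ => Complex.ofReal_im _)

include hI in
/-- Such a solution is a solution of real ADM gravity. -/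
theorem solvesHamiltonEqs_re : SolvesHamiltonEqs (κ / 2) U I
    (fun t K' E' => admTotal κ sE K' E' (N t) (Nv t) (fun x i => (Ω t x i).re))
    (fun t => reField (K t)) E := by
  have him := fun (t : ℝ) (ht : t ∈ I) (x : Pt) (hx : x ∈ U) =>
    im_eq_zero_of_solution hU hκ hf hq hN hNv hΩ hK hN0 hg hsol ht hx
  intro t ht
  obtain ⟨V, W, hVW, hE, hK'⟩ := hsol t ht
  have hκ2 : κ / 2 ≠ 0 := div_ne_zero hκ two_ne_zero
  have e : (κ / 2 : ℂ) = ((κ / 2 : ℝ) : ℂ) := by push_cast; rfl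
  have e' : (-(κ / 2 : ℂ)) = ((-(κ / 2) : ℝ) : ℂ) := by push_cast; rfl
  have hV : ∀ x ∈ U, ∀ a i, (V x a i).im = 0 := fun x hx a i => by
    have d := hE x hx a i
    rw [e'] at d
    exact im_eq_zero_of_hasDerivAt (neg_ne_zero.2 hκ2) d
      (Filter.Eventually.of_forall fun τ => Complex.ofReal_im _)
  have hW : ∀ x ∈ U, ∀ a i, (W x a i).im = 0 := fun x hx a i => by
    have d := hK' x hx a i
    rw [e] at d
    refine im_eq_zero_of_hasDerivAt hκ2 d ?_
    filter_upwards [hI.mem_nhds ht] with τ hτ using (him τ hτ x hx).1 a i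
  have hKs : ContDiffOn ℝ ∞ (reField (K t)) U := contDiffOn_pi.2 fun a => contDiffOn_pi.2 fun i =>
    Complex.reCLM.contDiff.comp_contDiffOn (component_contDiffOn (SmoothFamily.slice hK ht) a i)
  have hΩs : ContDiffOn ℝ ∞ (fun x i => (Ω t x i).re) U := contDiffOn_pi.2 fun i =>
    Complex.reCLM.contDiff.comp_contDiffOn (contDiffOn_pi.1 (SmoothFamily.slice hΩ ht) i)
  have g := hVW.congr hU (Ω' := fun x i => (((Ω t x i).re : ℝ) : ℂ))
    (K' := complexify (reField (K t))) (E' := complexify (E t))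
    (fun x hx => funext fun i => Complex.ext (by simp) (by simp [(him t ht x hx).2 i]))
    (fun x hx => funext fun a => funext fun i => Complex.ext (by simp [complexify, reField])
      (by simp [complexify, (him t ht x hx).1 a i])) (fun _ _ => rfl)
  obtain ⟨k1, k2⟩ := g.hasFunctionalDeriv (hf.slice hU ht) (hq t ht) (SmoothFamily.slice hN ht)
    (SmoothFamily.slice hNv ht) hΩs hKs hV hW
  refine ⟨_, _, k1, k2, fun x hx a i => ⟨?_, ?_⟩⟩
  · refine (HasDerivAt.re (hK' x hx a i)).congr_deriv ?_
    rw [e, Complex.re_ofReal_mul]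
    rfl
  · refine (HasDerivAt.re (hE x hx a i)).congr_deriv ?_
    rw [e', Complex.re_ofReal_mul]
    rfl

end RealSolution

theorem eq_zero_of_rotation {R : TField ℂ} {x : Pt}
    (hR : Matrix.of (R x) ∈ Matrix.specialOrthogonalGroup (Fin 3) ℂ) {v : Fin 3 → ℂ}
    (h : ∀ j, ∑ k, v k * R x k j = 0) (i : Fin 3) : v i = 0 := by
  have e : ∑ j, (∑ k, v k * R x k j) * R x i j = ∑ k, v k * ∑ j, R x k j * R x i j := by
    simp only [Fin.sum_univ_three]
    ring
  simpa [h, sum_rotation_mul hR] using e.symm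

section Direct

variable {U : Set Pt} (hU : IsOpen U) {κ : ℝ} (hκ : κ ≠ 0) {lam : ℂ} (hlam : lam ≠ 0)
  {se sE : Pt → ℝ} {I : Set ℝ} {A E : ℝ → TField ℂ} {N : ℝ → Pt → ℝ} {Nv : ℝ → Pt → Fin 3 → ℝ}
  {Λ : ℝ → Pt → Fin 3 → ℂ}
include hU hκ hlam

/-- The constraints in terms of real fields that are related to `(K, E)` by a rotation. -/
theorem constraints_real {A E : TField ℂ} (h : Triad U sE E) (hA : ContDiffOn ℝ ∞ A U)
    (hG : ∀ x ∈ U, ∀ i, gauss κ lam A E x i = 0) {R : TField ℂ}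
    (hR : ∀ x ∈ U, Matrix.of (R x) ∈ Matrix.specialOrthogonalGroup (Fin 3) ℂ) {K' E' : TField ℝ}
    (hq : ∀ x ∈ U, 0 < detq sE E' x)
    (hE : ∀ x ∈ U, ∀ a i, E x a i = rotate (complexify E') R x a i)
    (hK : ∀ x ∈ U, ∀ a i, extrinsicK sE A E x a i = rotate (complexify K') R x a i)
    {x : Pt} (hx : x ∈ U) :
    (∀ i, admGauss κ K' E' x i = 0) ∧
      (∀ a, diffeo κ lam A E x a = lam * ((admDiffeo κ sE K' E' x a : ℝ) : ℂ)) ∧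
      hamilton κ lam se sE A E x =
        lam * ((se x / sE x : ℝ) : ℂ) * ((admHamilton κ sE K' E' x : ℝ) : ℂ) := by
  obtain ⟨hg, hc⟩ := constraints_of_gauss h hκ hlam se hA hG
  obtain ⟨hc1, hc2⟩ := hc x hx
  have eE : E =ᶠ[nhds x] rotate (complexify E') R := by
    filter_upwards [hU.mem_nhds hx] with y hy
    exact funext fun a => funext fun i => hE y hy a i
  have eK : extrinsicK sE A E =ᶠ[nhds x] rotate (complexify K') R := by
    filter_upwards [hU.mem_nhds hx] with y hy
    exact funext fun a => funext fun i => hK y hy a i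
  obtain ⟨r1, r2⟩ := adm_rotate hU hR κ sE (complexify K') (complexify E') hx
  have hd := admTotal_congr κ (sE := sE) eK eE
  refine ⟨fun i => ?_, fun a => ?_, ?_⟩
  · have hgr : ∀ j, ∑ k, gaussVec (complexify K') (complexify E') x k * R x k j = 0 := fun j => by
      rw [← gaussVec_rotate (hR x hx), ← hg x hx j]
      simp only [gaussVec, hE x hx, hK x hx]
    have := admGauss_complexify K' E' κ x i
    rw [admGauss_eq, eq_zero_of_rotation (hR x hx) hgr i] at this
    simpa using this.symm
  · have e := hd 0 (fun _ b => if b = a then 1 else 0) 0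
    simp only [admTotal, Pi.zero_apply, zero_mul, Finset.sum_const_zero, zero_add, add_zero,
      ite_mul, one_mul, Finset.sum_ite_eq', Finset.mem_univ, if_true] at e
    rw [hc1, e, r2, admDiffeo_complexify]
  · have e := hd (fun _ => 1) 0 0
    simp only [admTotal, Pi.zero_apply, zero_mul, Finset.sum_const_zero, one_mul, add_zero] at e
    rw [hc2, e, r1, admHamilton_complexify sE K' E' κ (hq x hx).le]

/-- A selfdual solution whose triad is the gauge rotation of a real one is, in the rotated frame, a
solution of complexified ADM gravity. -/
theorem exists_rotated_solution (hI : IsOpen I) (hA : SmoothFamily I U A)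
    (hN : SmoothFamily I U N) (hNv : SmoothFamily I U Nv) (hΛ : SmoothFamily I U Λ)
    (hf : TriadFamily (I ×ˢ U) sE E) (hse : ∀ t ∈ I, LocSign U se)
    (hsol : SolvesHamiltonEqs (Complex.I * κ / (2 * lam)) U I
      (fun t A' E' => selfdualTotal κ lam se sE A' E' (fun x => (N t x : ℂ))
        (fun x a => (Nv t x a : ℂ)) (Λ t)) A E)
    (hG : ∀ t ∈ I, ∀ x ∈ U, ∀ i, gauss κ lam (A t) (E t) x i = 0)
    {E' R : ℝ → TField ℂ} (hRs : SmoothFamily I U R)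
    (hR : ∀ t ∈ I, ∀ x ∈ U, Matrix.of (R t x) ∈ Matrix.specialOrthogonalGroup (Fin 3) ℂ)
    (hEE : ∀ t ∈ I, ∀ x ∈ U, ∀ a i, E t x a i = rotate (E' t) (R t) x a i)
    (hf' : TriadFamily (I ×ˢ U) sE E')
    (hqs : ∀ t ∈ I, ∀ x ∈ U, detq sE (E' t) x ∈ Complex.slitPlane) :
    ∃ (K' : ℝ → TField ℂ) (Ω : ℝ → Pt → Fin 3 → ℂ), SmoothFamily I U K' ∧ SmoothFamily I U Ω ∧
      (∀ t ∈ I, ∀ x ∈ U, ∀ a i, extrinsicK sE (A t) (E t) x a i = rotate (K' t) (R t) x a i) ∧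
      (∀ t ∈ I, ∀ x ∈ U, ∀ i, gaussVec (K' t) (E' t) x i = 0) ∧
      ∀ t ∈ I, ∃ V W : TField ℂ,
        IsAdmGradient κ sE U (fun x => ((se x / sE x : ℝ) : ℂ) * (N t x : ℂ))
          (fun x a => (Nv t x a : ℂ)) (Ω t) (K' t) (E' t) V W ∧
        (∀ x ∈ U, ∀ a i, HasDerivAt (fun τ => E' τ x a i) (-(κ / 2 : ℂ) * V x a i) t) ∧
        ∀ x ∈ U, ∀ a i, HasDerivAt (fun τ => K' τ x a i) ((κ / 2 : ℂ) * W x a i) t := by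
  have hNc : SmoothFamily I U (fun t x => (N t x : ℂ)) := JointSmooth.ofReal hN
  have hNvc : SmoothFamily I U (fun t x a => (Nv t x a : ℂ)) :=
    contDiffOn_pi.2 fun a => (SmoothFamily.vector hNv a).ofReal
  have hqE : ∀ t ∈ I, ∀ x ∈ U, detq sE (E t) x ∈ Complex.slitPlane := fun t ht x hx => by
    have e' : detq sE (E t) x = detq sE (rotate (E' t) (R t)) x := by
      simp only [detq, detE, funext fun a => funext fun i => hEE t ht x hx a i]
    rw [e', detq_rotate (hR t ht x hx)]
    exact hqs t ht x hx
  have hKs := smooth_extrinsicK hf hA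
  have hg : ∀ t ∈ I, ∀ x ∈ U, ∀ i, gaussVec (extrinsicK sE (A t) (E t)) (E t) x i = 0 :=
    fun t ht => (constraints_of_gauss (hf.slice hU ht) hκ hlam se (SmoothFamily.slice hA ht)
      (hG t ht)).1
  have hΘ := jointSmooth_gaugeShift hf (fun t x hx => hqE t hx.1 x hx.2) hse hNc hNvc hKs
  have hΛΘ : SmoothFamily I U (fun t => Λ t + gaugeShift se sE (fun x => (N t x : ℂ))
      (fun x a => (Nv t x a : ℂ)) (extrinsicK sE (A t) (E t)) (E t)) := hΛ.add hΘ
  have hNs : ∀ t ∈ I, ContDiffOn ℝ ∞ (fun x => ((se x / sE x : ℝ) : ℂ) * (N t x : ℂ)) U :=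
    fun t ht => ((hse t ht).div (hf.slice hU ht).sign).contDiffOn_complex.mul
      (SmoothFamily.slice hNc ht)
  have key : ∀ t ∈ I, ∃ V W : TField ℂ,
      IsAdmGradient κ sE U (fun x => ((se x / sE x : ℝ) : ℂ) * (N t x : ℂ))
        (fun x a => (Nv t x a : ℂ)) (Λ t + gaugeShift se sE (fun x => (N t x : ℂ))
          (fun x a => (Nv t x a : ℂ)) (extrinsicK sE (A t) (E t)) (E t))
        (extrinsicK sE (A t) (E t)) (E t) V W ∧
      (∀ x ∈ U, ∀ a i, HasDerivAt (fun τ => E τ x a i) (-(κ / 2 : ℂ) * V x a i) t) ∧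
      ∀ x ∈ U, ∀ a i, HasDerivAt (fun τ => extrinsicK sE (A τ) (E τ) x a i)
        ((κ / 2 : ℂ) * W x a i) t := by
    intro t ht
    obtain ⟨WQ, WP, h1, h2, h3⟩ := hsol t ht
    exact adm_equations_of_selfdual hU hκ hlam ht hf hA (hse t ht)
      (hqE t ht) (SmoothFamily.slice hNc ht) (SmoothFamily.slice hNvc ht) (SmoothFamily.slice hΛ ht)
      (hg t ht) h1 h2 (fun x hx a i => (h3 x hx a i).1) (fun x hx a i => (h3 x hx a i).2)
  clear hsol hΘ hG
  -- only the smoothness of the extrinsic curvature and of the shifted multiplier is used below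
  generalize hKdef : (fun t => extrinsicK sE (A t) (E t)) = K at hKs
  have hKt : ∀ t, extrinsicK sE (A t) (E t) = K t := fun t => by rw [← hKdef]
  generalize hΩdef : (fun t => Λ t + gaugeShift se sE (fun x => (N t x : ℂ))
      (fun x a => (Nv t x a : ℂ)) (extrinsicK sE (A t) (E t)) (E t)) = Ω at hΛΘ
  have hΩt : ∀ t, Λ t + gaugeShift se sE (fun x => (N t x : ℂ))
      (fun x a => (Nv t x a : ℂ)) (extrinsicK sE (A t) (E t)) (E t) = Ω t := fun t => by
    rw [← hΩdef]
  simp only [hΩt] at key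
  simp only [hKt] at key hg ⊢
  have hKR : ∀ t ∈ I, ∀ x ∈ U, ∀ a i,
      K t x a i = rotate (rotate (K t) fun x i j => R t x j i) (R t) x a i := by
    intro t ht x hx a i
    have e := mul_eq_one_comm.1 (rotation_mul_transpose (hR t ht x hx))
    have hcol : ∀ l, ∑ j, R t x j l * R t x j i = if l = i then 1 else 0 := fun l => by
      have := congrFun (congrFun e l) i
      simpa [Matrix.mul_apply, Matrix.one_apply] using this
    have e' : rotate (rotate (K t) fun x i j => R t x j i) (R t) x a i
        = ∑ l, K t x a l * ∑ j, R t x j l * R t x j i := by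
      simp only [rotate, Fin.sum_univ_three]
      ring
    rw [e']
    simp [hcol]
  refine ⟨fun t => rotate (K t) fun x i j => R t x j i,
    fun t => (fun x j => ∑ i, Ω t x i * R t x j i) + angularVelocity R t, ?_, ?_, hKR, ?_, ?_⟩
  · exact jointSmooth_pi.2 fun a i => JointSmooth.sum fun j =>
      (SmoothFamily.field hKs a j).mul (SmoothFamily.field hRs i j)
  · refine ContDiffOn.add ?_ (smooth_angularVelocity hI hU hRs)
    exact contDiffOn_pi.2 fun j => JointSmooth.sum fun i =>
      (SmoothFamily.vector hΛΘ i).mul (SmoothFamily.field hRs j i)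
  · intro t ht x hx i
    have hgr : ∀ j, ∑ k, gaussVec (rotate (K t) fun x i j => R t x j i) (E' t) x k * R t x k j
        = 0 := fun j => by
      rw [← gaussVec_rotate (hR t ht x hx), ← hg t ht x hx j]
      simp only [gaussVec, hEE t ht x hx, hKR t ht x hx]
    exact eq_zero_of_rotation (hR t ht x hx) hgr i
  · intro t ht
    obtain ⟨V, W, hVW, hE, hK⟩ := key t ht
    exact adm_equations_rotate hU hI ht hf' hRs hR hEE hκ (hqs t ht) (hNs t ht)
      (SmoothFamily.slice hNvc ht) (SmoothFamily.slice hΛΘ ht) (SmoothFamily.slice hKs ht)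
      hVW hE hK

/-- Selfdual solutions that satisfy the reality conditions are, up to a gauge rotation, real
solutions of ADM gravity. -/
theorem adm_of_selfdual (hI : IsOpen I) (hA : SmoothFamily I U A)
    (hN : SmoothFamily I U N) (hNv : SmoothFamily I U Nv) (hΛ : SmoothFamily I U Λ)
    (hf : TriadFamily (I ×ˢ U) sE E)
    (hse : ∀ t ∈ I, LocSign U se) (hN0 : ∀ t ∈ I, ∀ x ∈ U, N t x ≠ 0)
    (hsol : SolvesHamiltonEqs (Complex.I * κ / (2 * lam)) U I
      (fun t A' E' => selfdualTotal κ lam se sE A' E' (fun x => (N t x : ℂ))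
        (fun x a => (Nv t x a : ℂ)) (Λ t)) A E)
    (hG : ∀ t ∈ I, ∀ x ∈ U, ∀ i, gauss κ lam (A t) (E t) x i = 0)
    (hr : RealityConditions U I sE E) :
    ∃ (K' E' : ℝ → TField ℝ) (R : ℝ → Pt → Fin 3 → Fin 3 → ℂ) (Ω : ℝ → Pt → Fin 3 → ℝ),
      SmoothFamily I U K' ∧ SmoothFamily I U E' ∧ SmoothFamily I U R ∧ SmoothFamily I U Ω ∧
      (∀ t ∈ I, ∀ x ∈ U,
        Matrix.of (R t x) ∈ Matrix.specialOrthogonalGroup (Fin 3) ℂ ∧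
        IsRotatedBy (E t) (E' t) (R t) x ∧
        IsRotatedBy (extrinsicK sE (A t) (E t)) (K' t) (R t) x ∧
        0 < detq sE (E' t) x ∧
        (∀ i, admGauss κ (K' t) (E' t) x i = 0) ∧
        (∀ a, diffeo κ lam (A t) (E t) x a =
          lam * ((admDiffeo κ sE (K' t) (E' t) x a : ℝ) : ℂ)) ∧
        hamilton κ lam se sE (A t) (E t) x =
          lam * ((se x / sE x : ℝ) : ℂ) * ((admHamilton κ sE (K' t) (E' t) x : ℝ) : ℂ)) ∧
      SolvesHamiltonEqs (κ / 2) U I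
        (fun t K'' E'' => admTotal κ sE K'' E'' (fun x => se x / sE x * N t x) (Nv t) (Ω t))
        K' E' := by
  obtain ⟨E', R, hE's, hRs, hER⟩ := exists_real_triad hf hr
  have hR := fun t ht x hx => (hER t ht x hx).1
  have hq := fun t ht x hx => (hER t ht x hx).2.1
  have hEE := fun t ht x hx => (hER t ht x hx).2.2
  have hf' : TriadFamily (I ×ˢ U) sE (fun t => complexify (E' t)) :=
    { isOpen := hI.prod hU
      smooth := SmoothFamily.field (SmoothFamily.complexify hE's)
      det_ne := fun t x hx h0 => (hq t hx.1 x hx.2).ne' (by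
        rw [detE_complexify, Complex.ofReal_eq_zero] at h0
        rw [detq, h0, mul_zero])
      sign := hf.sign }
  obtain ⟨K', Ω, hK's, hΩs, hKR, hg', hsol'⟩ := exists_rotated_solution hU hκ hlam hI hA hN hNv hΛ
    hf hse hsol hG hRs hR hEE hf' (fun t ht => ofReal_detq_mem_slitPlane (hq t ht))
  have hNs : SmoothFamily I U (fun t x => se x / sE x * N t x) := by
    have hs : JointSmooth (I ×ˢ U) (fun (_ : ℝ) x => se x / sE x) := fun p hp =>
      jointSmooth_const ((hse p.1 hp.1).div (hf.slice hU hp.1).sign).contDiffOn I p hp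
    exact ContDiffOn.mul hs hN
  simp only [← Complex.ofReal_mul] at hsol'
  have hN0' : ∀ t ∈ I, ∀ x ∈ U, se x / sE x * N t x ≠ 0 := fun t ht x hx =>
    mul_ne_zero (div_ne_zero ((hse t ht).ne_zero hx) ((hf.slice hU ht).sign.ne_zero hx))
      (hN0 t ht x hx)
  have him := fun (t : ℝ) (ht : t ∈ I) (x : Pt) (hx : x ∈ U) =>
    im_eq_zero_of_solution hU hκ hf' hq hNs hNv hΩs hK's hN0' hg' hsol' ht hx
  have hK're : ∀ t ∈ I, ∀ x ∈ U, ∀ a i, extrinsicK sE (A t) (E t) x a i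
      = rotate (complexify (reField (K' t))) (R t) x a i := by
    intro t ht x hx a i
    rw [hKR t ht x hx]
    refine Finset.sum_congr rfl fun j _ => ?_
    congr 1
    exact Complex.ext (by simp [complexify, reField]) (by simp [complexify, (him t ht x hx).1 a j])
  refine ⟨fun t => reField (K' t), E', R, fun t x i => (Ω t x i).re,
    jointSmooth_pi.2 fun a i => JointSmooth.re (SmoothFamily.field hK's a i), hE's, hRs,
    contDiffOn_pi.2 fun i => JointSmooth.re (SmoothFamily.vector hΩs i), fun t ht x hx => ?_,
    solvesHamiltonEqs_re hU hκ hI hf' hq hNs hNv hΩs hK's hN0' hg' hsol'⟩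
  obtain ⟨c1, c2, c3⟩ := constraints_real (se := se) hU hκ hlam (hf.slice hU ht)
    (SmoothFamily.slice hA ht) (hG t ht) (hR t ht) (hq t ht) (hEE t ht) (hK're t ht) hx
  exact ⟨hR t ht x hx, hEE t ht x hx, hK're t ht x hx, hq t ht x hx, c1, c2, c3⟩

end Direct

end SelfdualGravity

end

theorem mainTheorem3 (U : Set Pt) (hU : IsOpen U) (κ : ℝ) (hκ : κ ≠ 0) (lam : ℂ) (hlam : lam ≠ 0)
    (se sE : Pt → ℝ) :
    -- Poisson relation and constraints at a point of the complex phase space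
    (∀ (A E : TField ℂ) (e : Pt → Fin 4 → Fin 4 → ℂ),
      ContDiffOn ℝ ∞ A U → ContDiffOn ℝ ∞ E U →
      IsOrientationSign U (detTetrad e) se → IsOrientationSign U (detE E) sE →
      (∀ (a i b j : Fin 3) (f g : Pt → ℂ), IsTest U f → IsTest U g →
        HasPoissonBracket (Complex.I * κ / (2 * lam)) U
          (fun A' E' => ∫ x in U, f x * extrinsicK sE A' E' x a i)
          (fun _ E' => ∫ y in U, g y * E' y b j) A E
          (κ / (2 * lam) * kron i j * kron a b * ∫ x in U, f x * g x)) ∧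
      ((∀ x ∈ U, ∀ i, gauss κ lam A E x i = 0) →
        ∀ x ∈ U,
          (∀ a, diffeo κ lam A E x a = lam * admDiffeo κ sE (extrinsicK sE A E) E x a) ∧
          hamilton κ lam se sE A E x =
            lam * ((se x / sE x : ℝ) : ℂ) * admHamilton κ sE (extrinsicK sE A E) E x)) ∧
    -- under the reality conditions, selfdual solutions are real ADM solutions up to gauge rotation
    (∀ (I : Set ℝ) (A E : ℝ → TField ℂ) (e : ℝ → Pt → Fin 4 → Fin 4 → ℂ) (N : ℝ → Pt → ℝ)
      (Nv : ℝ → Pt → Fin 3 → ℝ) (Λ : ℝ → Pt → Fin 3 → ℂ),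
      IsOpen I → SmoothFamily I U A → SmoothFamily I U E → SmoothFamily I U N →
      SmoothFamily I U Nv → SmoothFamily I U Λ →
      (∀ t ∈ I, IsOrientationSign U (detTetrad (e t)) se ∧ IsOrientationSign U (detE (E t)) sE) →
      (∀ t ∈ I, ∀ x ∈ U, N t x ≠ 0) →
      SolvesHamiltonEqs (Complex.I * κ / (2 * lam)) U I
        (fun t A' E' => selfdualTotal κ lam se sE A' E' (fun x => (N t x : ℂ))
          (fun x a => (Nv t x a : ℂ)) (Λ t)) A E →
      (∀ t ∈ I, ∀ x ∈ U, ∀ i, gauss κ lam (A t) (E t) x i = 0) →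
      RealityConditions U I sE E →
      ∃ (K' E' : ℝ → TField ℝ) (R : ℝ → Pt → Fin 3 → Fin 3 → ℂ) (Ω : ℝ → Pt → Fin 3 → ℝ),
        SmoothFamily I U K' ∧ SmoothFamily I U E' ∧ SmoothFamily I U R ∧ SmoothFamily I U Ω ∧
        (∀ t ∈ I, ∀ x ∈ U,
          Matrix.of (R t x) ∈ Matrix.specialOrthogonalGroup (Fin 3) ℂ ∧
          IsRotatedBy (E t) (E' t) (R t) x ∧
          IsRotatedBy (extrinsicK sE (A t) (E t)) (K' t) (R t) x ∧
          0 < detq sE (E' t) x ∧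
          (∀ i, admGauss κ (K' t) (E' t) x i = 0) ∧
          (∀ a, diffeo κ lam (A t) (E t) x a =
            lam * ((admDiffeo κ sE (K' t) (E' t) x a : ℝ) : ℂ)) ∧
          hamilton κ lam se sE (A t) (E t) x =
            lam * ((se x / sE x : ℝ) : ℂ) * ((admHamilton κ sE (K' t) (E' t) x : ℝ) : ℂ)) ∧
        SolvesHamiltonEqs (κ / 2) U I
          (fun t K'' E'' => admTotal κ sE K'' E'' (fun x => se x / sE x * N t x) (Nv t) (Ω t))
          K' E') ∧
    -- conversely, every real ADM solution is a selfdual solution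
    (∀ (I : Set ℝ) (K E : ℝ → TField ℝ) (e : ℝ → Pt → Fin 4 → Fin 4 → ℂ) (N : ℝ → Pt → ℝ)
      (Nv Ω : ℝ → Pt → Fin 3 → ℝ),
      IsOpen I → SmoothFamily I U K → SmoothFamily I U E → SmoothFamily I U N →
      SmoothFamily I U Nv → SmoothFamily I U Ω →
      (∀ t ∈ I, IsOrientationSign U (detTetrad (e t)) se ∧ IsOrientationSign U (detE (E t)) sE) →
      (∀ t ∈ I, ∀ x ∈ U, 0 < detq sE (E t) x) →
      SolvesHamiltonEqs (κ / 2) U I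
        (fun t K' E' => admTotal κ sE K' E' (fun x => se x / sE x * N t x) (Nv t) (Ω t)) K E →
      (∀ t ∈ I, ∀ x ∈ U, ∀ i, admGauss κ (K t) (E t) x i = 0) →
      ∃ (A : ℝ → TField ℂ) (Λ : ℝ → Pt → Fin 3 → ℂ),
        SmoothFamily I U A ∧ SmoothFamily I U Λ ∧
        (∀ t ∈ I, ∀ x ∈ U, ∀ a i,
          A t x a i = spinConnection sE (complexify (E t)) x a i + Complex.I * (K t x a i : ℂ)) ∧
        (∀ t ∈ I, ∀ x ∈ U, ∀ i, gauss κ lam (A t) (complexify (E t)) x i = 0) ∧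
        RealityConditions U I sE (fun t => complexify (E t)) ∧
        SolvesHamiltonEqs (Complex.I * κ / (2 * lam)) U I
          (fun t A' E' => selfdualTotal κ lam se sE A' E' (fun x => (N t x : ℂ))
            (fun x a => (Nv t x a : ℂ)) (Λ t)) A (fun t => complexify (E t))) := by
  refine ⟨fun A E e hA hE hse hsE => ?_, ?_, ?_⟩
  · have h : Triad U sE E := ⟨hU, hE, hsE.2.1, hsE.locSign hU⟩
    exact ⟨fun a i b j f g hf hg => hasPoissonBracket_extrinsicK h hA κ lam a i b j hf hg,
      fun hG => (constraints_of_gauss h hκ hlam se hA hG).2⟩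
  · intro I A E e N Nv Λ hI hA hE hN hNv hΛ hs hN0 hsol hG hr
    exact adm_of_selfdual hU hκ hlam hI hA hN hNv hΛ
      (triadFamily_of_smoothFamily hI hU hE fun t ht => (hs t ht).2)
      (fun t ht => (hs t ht).1.locSign hU) hN0 hsol hG hr
  · intro I K E e N Nv Ω hI hK hE hN hNv hΩ hs hq hsol hG
    obtain ⟨A, Λ, hA, hΛ, hAK, hG', hsol'⟩ := selfdual_of_adm hU hκ hlam hI hK hE hN hNv hΩ
      (fun t ht => (hs t ht).1.locSign hU) (fun t ht => (hs t ht).2.locSign hU) hq hsol hG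
    exact ⟨A, Λ, hA, hΛ, hAK, hG', realityConditions_complexify hq, hsol'⟩
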